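/- **Setting.** Let $\nu,N,n\in\mathbb N$ and let $e_1,\dots,e_N\in\mathbb N^\nu\setminus\{0\}$. For $\delta\in[0,\infty)^\nu$, $d\in\mathbb N^\nu$ put $\delta^d=\prod_\mu\delta_\mu^{d_\mu}$ (with $0^0=1$), and for $t\in\mathbb R^N$ put $\delta t=(\delta^{e_1}t_1,\dots,\delta^{e_N}t_N)$. For a multi-index $\alpha\in\mathbb N^N$ let $\deg(\alpha)=\sum_j\alpha_je_j\in\mathbb N^\nu$. A multi-index $\alpha\neq0$ is a *pure power* if $\deg(\alpha)$ is nonzero in precisely one component, and a *non-pure power* otherwise. Vector fields are germs at $0\in\mathbb R^n$ of $C^\infty$ vector fields, paired with formal degrees in $\mathbb N^\nu\setminus\{0\}$. **Balls.** Let $(X,d)=(X_1,d_1),\dots,(X_q,d_q)$ be a finite list, with the $X_j$ smooth on an open $\Omega\ni0$. Write $\delta X=(\delta^{d_1}X_1,\dots,\delta^{d_q}X_q)$. The ball $B_{(X,d)}(x_0,\delta)$ is the set of endpoints $c(1)$ of absolutely continuous curves $c:[0,1]\to\Omega$ with $c(0)=x_0$ and $c'=\sum_ja_j\,\delta^{d_j}X_j(c)$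 a.e., where the $a_j$ are measurable and $\big\|(\sum_j|a_j|^2)^{1/2}\big\|_{L^\infty([0,1])}<1$. **Control.** The list $(X,d)$ *controls* $(X_0,d_0)$ if there are an open $U$ with $0\in U\subseteq\Omega$ (for some $\Omega$ as above) and $\tau_1>0$ such that for all $x_0\in U$, $\delta\in[0,1]^\nu$ there are functions $c_j^{x_0,\delta}$ on $B=B_{(X,d)}(x_0,\tau_1\delta)$ with $\delta^{d_0}X_0=\sum_jc_j^{x_0,\delta}\,\delta^{d_j}X_j$ on $B$ and such that, for every $m$, the derivatives $(\delta X)^\alpha c_j^{x_0,\delta}$, $|\alpha|\le m$ (along the integral curves of the fields $\delta^{d_k}X_k$), exist, are continuous on $B$, and are bounded there uniformly in $x_0\in U$, $\delta\in[0,1]^\nu$. It *controls* a family $W(t,x)$ of vector fields if there are $U,\tau_1$ as before and $\rho_1>0$ such that for all $x_0\in U$, $\delta\in[0,1]^\nu$ there are functions $c_l^{x_0,\delta}(t,x)$ on $B^N(\rho_1)\times B$, where $B^N(\rho_1)=\{t\in\mathbb R^N:|t|<\rho_1\}$, with $W(\delta t,x)=\sum_lc_l^{x_0,\delta}(t,x)\,\delta^{d_l}X_l(x)$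 there and such that, for every $m$, the derivatives $(\delta X)^\alpha\partial_t^\beta c_l^{x_0,\delta}$, $|\alpha|+|\beta|\le m$, exist, are continuous, and are bounded on $B^N(\rho_1)\times B$ uniformly in $x_0,\delta$. An arbitrary set controls something if some finite subset of it does. **Generation.** For a set $S$ of vector fields with formal degrees, $\mathcal L(S)$ is the smallest set that contains $S$ and is closed under $((X_1,d_1),(X_2,d_2))\mapsto([X_1,X_2],d_1+d_2)$; $\mathcal L_0(S)$ is the smallest set that contains $S$ and contains $([X_1,X_2],d_1+d_2)$ whenever $(X_1,d_1)\in S$ and $(X_2,d_2)\in\mathcal L_0(S)$. A finite list $\mathcal F=(X_1,d_1),\dots,(X_r,d_r)$ *generates* the finite list $(X_1,d_1),\dots,(X_q,d_q)$, $q\ge r$, if $(X_{r+1},d_{r+1}),\dots,(X_q,d_q)\in\mathcal L_0(\mathcal F)$ and the list $(X_1,d_1),\dots,(X_q,d_q)$ controls $([X_j,X_k],d_j+d_k)$ for all $1\le j,k\le q$. **Data.** Let $\gamma_t(x)=\gamma(t,x)$ be a $C^\infty$ map from a neighborhood of $(0,0)\in\mathbb R^N\times\mathbb R^n$ to $\mathbb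 R^n$ with $\gamma_0(x)\equiv x$. For $(t,x)$ near $(0,0)$ let $$W(t,x)=\frac{d}{d\epsilon}\Big|_{\epsilon=1}\gamma_{\epsilon t}\circ\gamma_t^{-1}(x),\qquad \widehat X_\alpha(x)=\frac1{\alpha!}\,\partial_t^\alpha W(t,x)\Big|_{t=0}.$$ An *exponential expansion* of $\gamma$ is a family $(X_\alpha)_{\alpha\ne0}$ of germs of $C^\infty$ vector fields with $\gamma_t(x)\sim\exp\big(\sum_{|\alpha|>0}t^\alpha X_\alpha\big)x$, that is, for every $M$, $\gamma_t(x)=\exp\big(\sum_{0<|\alpha|<M}t^\alpha X_\alpha\big)x+O(|t|^M)$ uniformly for $x$ near $0$, where $\exp(V)x$ is the time-one flow of $V$ from $x$. **Theorem 8.7.** The map $\gamma$ has an exponential expansion, and for every exponential expansion $(X_\alpha)$ of $\gamma$ the following three conditions are equivalent. (I) There is a finite $\mathcal F\subseteq\{(\widehat X_\alpha,\deg(\alpha)):\alpha\text{ a pure power}\}$ that generates a finite list which controls $W$. (II) Both of the following hold. (F) There is a finite $\mathcal F\subseteq\{(\widehat X_\alpha,\deg(\alpha)):\alpha\ne0\}$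 that generates a finite list which controls $W$. (A) For every non-pure power $\alpha$, $(\widehat X_\alpha,\deg(\alpha))$ is controlled by $\mathcal L\big(\{(\widehat X_\beta,\deg(\beta)):\beta\text{ a pure power}\}\big)$. (III) Both of the following hold. (F) There is a finite $\mathcal F\subseteq\{(X_\alpha,\deg(\alpha)):\alpha\ne0\}$ that generates a finite list which controls $W$. (A) For every non-pure power $\alpha$, $(X_\alpha,\deg(\alpha))$ is controlled by $\mathcal L\big(\{(X_\beta,\deg(\beta)):\beta\text{ a pure power}\}\big)$. -/

import Mathlib

open Set Filter Topology MeasureTheory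
open scoped ContDiff

namespace RadonControl

/-- The space `ℝ^n` with its Euclidean norm. -/
abbrev Euc (n : ℕ) : Type := EuclideanSpace ℝ (Fin n)

/-- A vector field on (an open subset of) `ℝ^n` paired with a `ν`-parameter formal degree.
A germ at `0` is represented by a function that is arbitrary away from a neighbourhood of `0`;
none of the notions below depends on the representative. -/
abbrev FormalVF (n ν : ℕ) : Type := (Euc n → Euc n) × (Fin ν → ℕ)

/-- `δ^d = ∏_μ δ_μ ^ d_μ`, with `0 ^ 0 = 1`. -/
def mpow {ν : ℕ} (δ : Fin ν → ℝ) (d : Fin ν → ℕ) : ℝ := ∏ μ, δ μ ^ d μ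

/-- The dilation `δ t = (δ^{e_1} t_1, …, δ^{e_N} t_N)`. -/
noncomputable def dilate {ν N : ℕ} (e : Fin N → Fin ν → ℕ) (δ : Fin ν → ℝ) (t : Euc N) : Euc N :=
  WithLp.toLp 2 (fun j => mpow δ (e j) * t j)

/-- `deg α = ∑_j α_j e_j`. -/
def degree {ν N : ℕ} (e : Fin N → Fin ν → ℕ) (α : Fin N → ℕ) : Fin ν → ℕ :=
  ∑ j, α j • e j

/-- `α` is a pure power if `deg α` is nonzero in precisely one component. -/
def IsPurePower {ν N : ℕ} (e : Fin N → Fin ν → ℕ) (α : Fin N → ℕ) : Prop :=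
  ∃! μ, degree e α μ ≠ 0

/-- The list of vector fields `δX = (δ^{d_1} X_1, …, δ^{d_q} X_q)`. -/
def scaled {n ν q : ℕ} (X : Fin q → FormalVF n ν) (δ : Fin ν → ℝ) (j : Fin q) : Euc n → Euc n :=
  fun x => mpow δ (X j).2 • (X j).1 x

/-- The Carnot-Carathéodory ball of unit radius in `Ω`, centred at `x₀`, with respect to the
list `Z`: the endpoints of the absolutely continuous curves in `Ω` that start at `x₀` and satisfy
`γ' = ∑ a_j Z_j(γ)` almost everywhere (written as an integral equation), where the controls
satisfy `‖(∑ |a_j|²)^{1/2}‖_{L^∞([0,1])} < 1`. -/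
def unitBall {n q : ℕ} (Ω : Set (Euc n)) (Z : Fin q → Euc n → Euc n) (x₀ : Euc n) :
    Set (Euc n) :=
  {y | ∃ (c : ℝ → Euc n) (a : ℝ → Euc q),
    ContinuousOn c (Icc 0 1) ∧ (∀ s ∈ Icc (0 : ℝ) 1, c s ∈ Ω) ∧ c 0 = x₀ ∧ c 1 = y ∧
    AEStronglyMeasurable a (volume.restrict (Icc (0 : ℝ) 1)) ∧
    eLpNorm a ⊤ (volume.restrict (Icc (0 : ℝ) 1)) < 1 ∧
    ∀ s ∈ Icc (0 : ℝ) 1, c s = x₀ + ∫ r in (0 : ℝ)..s, ∑ j, a r j • Z j (c r)}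

/-- The multi-parameter ball `B_{(X,d)}(x₀, δ) = B_{δX}(x₀)`. -/
def ccBall {n ν q : ℕ} (Ω : Set (Euc n)) (X : Fin q → FormalVF n ν) (x₀ : Euc n)
    (δ : Fin ν → ℝ) : Set (Euc n) :=
  unitBall Ω (scaled X δ) x₀

/-- `g = Z f` on `B`: at every point `y` of `B`, the derivative of `f` along the integral curve of
`Z` through `y` exists and equals `g y`. It is used for sets `B` that contain a short piece of
each of these integral curves, although `B` need not be open in `ℝ^n`. -/
def IsDerivAlong {n : ℕ} (Z : Euc n → Euc n) (B : Set (Euc n)) (f g : Euc n → ℝ) : Prop :=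
  ∀ y ∈ B, ∀ φ : ℝ → Euc n, φ 0 = y → (∀ᶠ s in 𝓝 (0 : ℝ), HasDerivAt φ (Z (φ s)) s) →
    HasDerivAt (fun s => f (φ s)) (g y) 0

/-- `f` is continuous on `A` and `|f| ≤ C` there. -/
def BoundedCont {Y : Type*} [TopologicalSpace Y] (A : Set Y) (C : ℝ) (f : Y → ℝ) : Prop :=
  ContinuousOn f A ∧ ∀ y ∈ A, |f y| ≤ C

/-- For every word `α` of length at most `m`, the derivative `(Z_{α_1} ⋯ Z_{α_k}) c` exists on `A`,
is continuous there and is bounded by `C`; `D j f g` stands for `g = Z_j f` on `A`. -/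
def WordBound {Y ι : Type*} [TopologicalSpace Y] (D : ι → (Y → ℝ) → (Y → ℝ) → Prop) (A : Set Y)
    (C : ℝ) : ℕ → (Y → ℝ) → Prop
  | 0, c => BoundedCont A C c
  | m + 1, c => BoundedCont A C c ∧ ∀ j, ∃ g, D j c g ∧ WordBound D A C m g

/-- `g = Z f` on `A × B`, where `Z` acts in the second variable. -/
def IsDerivAlongSnd {N n : ℕ} (Z : Euc n → Euc n) (A : Set (Euc N)) (B : Set (Euc n))
    (f g : Euc N × Euc n → ℝ) : Prop :=
  ∀ t ∈ A, IsDerivAlong Z B (fun x => f (t, x)) (fun x => g (t, x))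

/-- `g = ∂f/∂t_i` on `A × B`. -/
def IsPartialFst {N n : ℕ} (i : Fin N) (A : Set (Euc N)) (B : Set (Euc n))
    (f g : Euc N × Euc n → ℝ) : Prop :=
  ∀ t ∈ A, ∀ x ∈ B,
    HasDerivAt (fun s : ℝ => f (t + s • EuclideanSpace.single i (1 : ℝ), x)) (g (t, x)) 0

/-- All derivatives `Z^α ∂_t^β c` with `|α| + |β| ≤ m` (first the `t`-derivatives, then those along
the `Z_j`) exist on `A × B`, are continuous there and are bounded by `C`. -/
def MixedBound {N n q : ℕ} (Z : Fin q → Euc n → Euc n) (A : Set (Euc N)) (B : Set (Euc n))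
    (C : ℝ) : ℕ → (Euc N × Euc n → ℝ) → Prop
  | 0, c => BoundedCont (A ×ˢ B) C c
  | m + 1, c => BoundedCont (A ×ˢ B) C c ∧
      (∀ i, ∃ g, IsPartialFst i A B c g ∧ MixedBound Z A B C m g) ∧
      (∀ j, ∃ g, IsDerivAlongSnd (Z j) A B c g ∧
        WordBound (fun k => IsDerivAlongSnd (Z k) A B) (A ×ˢ B) C m g)

/-- The finite list `(X,d)` controls `(X₀,d₀)` on a neighbourhood of `0`. -/
def Controls {n ν q : ℕ} (X : Fin q → FormalVF n ν) (X₀ : FormalVF n ν) : Prop :=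
  ∃ Ω : Set (Euc n), IsOpen Ω ∧ (∀ j, ContDiffOn ℝ ∞ (X j).1 Ω) ∧
  ∃ U : Set (Euc n), IsOpen U ∧ 0 ∈ U ∧ U ⊆ Ω ∧
  ∃ τ : ℝ, 0 < τ ∧
  ∃ c : Euc n → (Fin ν → ℝ) → Fin q → Euc n → ℝ,
    (∀ x₀ ∈ U, ∀ δ ∈ Icc (0 : Fin ν → ℝ) 1, ∀ x ∈ ccBall Ω X x₀ (τ • δ),
      mpow δ X₀.2 • X₀.1 x = ∑ j, c x₀ δ j x • mpow δ (X j).2 • (X j).1 x) ∧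
    ∀ m : ℕ, ∃ C : ℝ, ∀ x₀ ∈ U, ∀ δ ∈ Icc (0 : Fin ν → ℝ) 1, ∀ j,
      WordBound (fun k => IsDerivAlong (scaled X δ k) (ccBall Ω X x₀ (τ • δ)))
        (ccBall Ω X x₀ (τ • δ)) C m (c x₀ δ j)

/-- The finite list `(X,d)` controls the `t`-dependent vector field `W(t,x)` on a neighbourhood
of `0`. -/
def ControlsFamily {n ν N q : ℕ} (e : Fin N → Fin ν → ℕ) (X : Fin q → FormalVF n ν)
    (W : Euc N × Euc n → Euc n) : Prop :=
  ∃ Ω : Set (Euc n), IsOpen Ω ∧ (∀ j, ContDiffOn ℝ ∞ (X j).1 Ω) ∧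
  ∃ U : Set (Euc n), IsOpen U ∧ 0 ∈ U ∧ U ⊆ Ω ∧
  ∃ τ : ℝ, 0 < τ ∧ ∃ ρ : ℝ, 0 < ρ ∧
  ∃ c : Euc n → (Fin ν → ℝ) → Fin q → Euc N × Euc n → ℝ,
    (∀ x₀ ∈ U, ∀ δ ∈ Icc (0 : Fin ν → ℝ) 1,
      ∀ t ∈ Metric.ball (0 : Euc N) ρ, ∀ x ∈ ccBall Ω X x₀ (τ • δ),
        W (dilate e δ t, x) = ∑ l, c x₀ δ l (t, x) • mpow δ (X l).2 • (X l).1 x) ∧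
    ∀ m : ℕ, ∃ C : ℝ, ∀ x₀ ∈ U, ∀ δ ∈ Icc (0 : Fin ν → ℝ) 1, ∀ l,
      MixedBound (scaled X δ) (Metric.ball (0 : Euc N) ρ) (ccBall Ω X x₀ (τ • δ)) C m (c x₀ δ l)

/-- A possibly infinite set controls `(X₀,d₀)` if some finite subset does. -/
def SetControls {n ν : ℕ} (S : Set (FormalVF n ν)) (X₀ : FormalVF n ν) : Prop :=
  ∃ (q : ℕ) (X : Fin q → FormalVF n ν), (∀ j, X j ∈ S) ∧ Controls X X₀

/-- `([X₁,X₂], d₁ + d₂)`. -/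
noncomputable def bracket {n ν : ℕ} (X Y : FormalVF n ν) : FormalVF n ν :=
  (VectorField.lieBracket ℝ X.1 Y.1, X.2 + Y.2)

/-- `ℒ(S)`: the smallest set that contains `S` and is closed under brackets. -/
inductive LieGen {n ν : ℕ} (S : Set (FormalVF n ν)) : FormalVF n ν → Prop
  | of (X : FormalVF n ν) : X ∈ S → LieGen S X
  | bracket (X Y : FormalVF n ν) : LieGen S X → LieGen S Y → LieGen S (bracket X Y)

/-- `ℒ₀(S)`: the smallest set that contains `S` and is closed under brackets with elements of `S`
on the left. -/
inductive LieGen₀ {n ν : ℕ} (S : Set (FormalVF n ν)) : FormalVF n ν → Prop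
  | of (X : FormalVF n ν) : X ∈ S → LieGen₀ S X
  | bracket (X Y : FormalVF n ν) : X ∈ S → LieGen₀ S Y → LieGen₀ S (bracket X Y)

/-- The list `F` generates the finite list `F, G` (the concatenation): the entries of `G` lie in
`ℒ₀(F)`, and the whole list controls the bracket of any two of its entries. -/
def Generates {n ν r p : ℕ} (F : Fin r → FormalVF n ν) (G : Fin p → FormalVF n ν) : Prop :=
  (∀ k, LieGen₀ (range F) (G k)) ∧
  ∀ j k, Controls (Fin.append F G) (bracket (Fin.append F G j) (Fin.append F G k))

/-- `g(t,x) = γ_t⁻¹(x)` for `(t,x)` near `(0,0)`. This determines the germ of `g`. -/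
def IsLocalInverse {N n : ℕ} (γ g : Euc N × Euc n → Euc n) : Prop :=
  ContinuousAt g 0 ∧ g 0 = 0 ∧
  (∀ᶠ p in 𝓝 (0 : Euc N × Euc n), γ (p.1, g p) = p.2) ∧
  (∀ᶠ p in 𝓝 (0 : Euc N × Euc n), g (p.1, γ p) = p.2)

/-- The local inverse exists for every germ of a smooth `γ` with `γ_0(x) = x`. -/
theorem exists_isLocalInverse {N n : ℕ} (γ : Euc N × Euc n → Euc n)
    (hγ : ∀ᶠ p in 𝓝 (0 : Euc N × Euc n), ContDiffAt ℝ ∞ γ p)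
    (hγ0 : ∀ᶠ x in 𝓝 (0 : Euc n), γ (0, x) = x) : ∃ g, IsLocalInverse γ g := by
  have h00 : γ 0 = 0 := hγ0.self_of_nhds
  have hs : HasStrictFDerivAt γ (fderiv ℝ γ 0) 0 :=
    hγ.self_of_nhds.hasStrictFDerivAt (by simp)
  set D := fderiv ℝ γ 0 with hD
  have hDx : ∀ x, D (0, x) = x := by
    intro x
    have h1 : HasFDerivAt (fun y : Euc n => γ (0, y))
        (D.comp (ContinuousLinearMap.inr ℝ (Euc N) (Euc n))) 0 := by
      have h2 : HasFDerivAt γ D ((ContinuousLinearMap.inr ℝ (Euc N) (Euc n)) 0) := by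
        rw [map_zero]
        exact hs.hasFDerivAt
      exact h2.comp (0 : Euc n) (ContinuousLinearMap.inr ℝ (Euc N) (Euc n)).hasFDerivAt
    have h3 : HasFDerivAt (fun y : Euc n => γ (0, y)) (ContinuousLinearMap.id ℝ (Euc n)) 0 :=
      (hasFDerivAt_id (0 : Euc n)).congr_of_eventuallyEq hγ0
    have h4 := h1.unique h3
    simpa using congrArg (fun L => L x) h4
  have hDp : ∀ t x, D (t, x) = D (t, 0) + x := by
    intro t x
    have : ((t, x) : Euc N × Euc n) = (t, 0) + (0, x) := by simp
    rw [this, map_add, hDx]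
  let A : Euc N →L[ℝ] Euc n := D.comp (ContinuousLinearMap.inl ℝ (Euc N) (Euc n))
  let f₁ : Euc N × Euc n →L[ℝ] Euc N × Euc n := (ContinuousLinearMap.fst ℝ _ _).prod D
  let f₂ : Euc N × Euc n →L[ℝ] Euc N × Euc n := (ContinuousLinearMap.fst ℝ _ _).prod
    (ContinuousLinearMap.snd ℝ _ _ - A.comp (ContinuousLinearMap.fst ℝ _ _))
  let L : (Euc N × Euc n) ≃L[ℝ] (Euc N × Euc n) := ContinuousLinearEquiv.equivOfInverse f₁ f₂
    (by rintro ⟨t, x⟩; simp [f₁, f₂, A, hDp t x])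
    (by rintro ⟨t, x⟩; simp [f₁, f₂, A, hDp t (x - D (t, 0))])
  let Φ : Euc N × Euc n → Euc N × Euc n := fun p => (p.1, γ p)
  have hΦ : HasStrictFDerivAt Φ (L : (Euc N × Euc n) →L[ℝ] (Euc N × Euc n)) 0 :=
    hasStrictFDerivAt_fst.prodMk hs
  have hΦ0 : Φ 0 = 0 := by simp [Φ, h00]
  have hr := hΦ.eventually_right_inverse
  have hl := hΦ.eventually_left_inverse
  have hc := hΦ.localInverse_continuousAt
  have h0 := hΦ.localInverse_apply_image
  rw [hΦ0] at hr hc h0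
  set Ψ := hΦ.localInverse Φ L 0 with hΨ
  refine ⟨fun p => (Ψ p).2, hc.snd, by simp [h0], ?_, ?_⟩
  · filter_upwards [hr] with p hp
    obtain ⟨h1, h2⟩ := Prod.ext_iff.1 (show Φ (Ψ p) = p from hp)
    change (Ψ p).1 = p.1 at h1
    rw [← h1]
    exact h2
  · filter_upwards [hl] with p hp
    have h1 : Ψ (Φ p) = p := hp
    exact congrArg Prod.snd h1

/-- `(t,x) ↦ γ_t⁻¹(x)`. -/
noncomputable def gammaInv {N n : ℕ} (γ : Euc N × Euc n → Euc n) : Euc N × Euc n → Euc n :=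
  Classical.epsilon (IsLocalInverse γ)

/-- `W(t,x) = d/dε|_{ε=1} γ_{εt}(γ_t⁻¹(x))`. -/
noncomputable def fieldW {N n : ℕ} (γ : Euc N × Euc n → Euc n) : Euc N × Euc n → Euc n :=
  fun p => deriv (fun ε : ℝ => γ (ε • p.1, gammaInv γ p)) 1

/-- `∂f/∂t_i`. -/
noncomputable def partialDeriv {N n : ℕ} (i : Fin N) (f : Euc N → Euc n) : Euc N → Euc n :=
  fun t => lineDeriv ℝ f t (EuclideanSpace.single i (1 : ℝ))

/-- `∂_t^α f = ∂_{t_1}^{α_1} ⋯ ∂_{t_N}^{α_N} f`. -/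
noncomputable def iterPartial {N n : ℕ} (α : Fin N → ℕ) (f : Euc N → Euc n) : Euc N → Euc n :=
  (List.finRange N).foldr (fun i g => (partialDeriv i)^[α i] g) f

/-- The Taylor coefficient `X̂_α(x) = (1/α!) ∂_t^α W(0,x)`. -/
noncomputable def taylorField {N n : ℕ} (W : Euc N × Euc n → Euc n) (α : Fin N → ℕ) :
    Euc n → Euc n :=
  fun x => (∏ i, ((α i).factorial : ℝ))⁻¹ • iterPartial α (fun t => W (t, x)) 0

/-- `∑_{0 < |α| < M} t^α X_α`. -/
noncomputable def truncField {N n : ℕ} (X : (Fin N → ℕ) → Euc n → Euc n) (M : ℕ) (t : Euc N) :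
    Euc n → Euc n :=
  fun x => ∑ α ∈ (Fintype.piFinset fun _ : Fin N => Finset.range M).filter
    (fun α => 0 < ∑ i, α i ∧ ∑ i, α i < M), (∏ i, t i ^ α i) • X α x

/-- `y = exp(V) x`: the integral curve of `V` that starts at `x` stays in `Ω` during the times
`[0,1]` and is at `y` at time `1`. -/
def IsExp {n : ℕ} (Ω : Set (Euc n)) (V : Euc n → Euc n) (x y : Euc n) : Prop :=
  ∃ c : ℝ → Euc n, c 0 = x ∧ c 1 = y ∧
    ∀ s ∈ Icc (0 : ℝ) 1, c s ∈ Ω ∧ HasDerivWithinAt c (V (c s)) (Icc 0 1) s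

/-- `γ_t(x) ∼ exp(∑_{|α| > 0} t^α X_α) x` with germs of `C^∞` vector fields `X_α`: for every `M`,
`γ_t(x) = exp(∑_{0 < |α| < M} t^α X_α) x + O(|t|^M)` uniformly for `x` near `0`. -/
def IsExpExpansion {N n : ℕ} (γ : Euc N × Euc n → Euc n) (X : (Fin N → ℕ) → Euc n → Euc n) :
    Prop :=
  ∀ M : ℕ, ∃ Ω : Set (Euc n), IsOpen Ω ∧ 0 ∈ Ω ∧
    (∀ α, 0 < ∑ i, α i → ∑ i, α i < M → ContDiffOn ℝ ∞ (X α) Ω) ∧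
    ∃ C : ℝ, ∀ᶠ p in 𝓝 (0 : Euc N × Euc n),
      ∃ y, IsExp Ω (truncField X M p.1) p.2 y ∧ ‖γ p - y‖ ≤ C * ‖p.1‖ ^ M

/-- `{(X_α, deg α) : α ≠ 0}`. -/
def allPowers {ν N n : ℕ} (e : Fin N → Fin ν → ℕ) (X : (Fin N → ℕ) → Euc n → Euc n) :
    Set (FormalVF n ν) :=
  {Y | ∃ α, α ≠ 0 ∧ Y = (X α, degree e α)}

/-- `{(X_α, deg α) : α is a pure power}`. -/
def purePowers {ν N n : ℕ} (e : Fin N → Fin ν → ℕ) (X : (Fin N → ℕ) → Euc n → Euc n) :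
    Set (FormalVF n ν) :=
  {Y | ∃ α, IsPurePower e α ∧ Y = (X α, degree e α)}

/-- Some finite subset of `S` generates a finite list that controls `W`. -/
def GeneratesControl {ν N n : ℕ} (e : Fin N → Fin ν → ℕ) (S : Set (FormalVF n ν))
    (W : Euc N × Euc n → Euc n) : Prop :=
  ∃ (r p : ℕ) (F : Fin r → FormalVF n ν) (G : Fin p → FormalVF n ν),
    (∀ i, F i ∈ S) ∧ Generates F G ∧ ControlsFamily e (Fin.append F G) W

/-- The algebraic condition: for every non-pure power `α`, `(X_α, deg α)` is controlled by
`ℒ({(X_β, deg β) : β is a pure power})`. -/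
def AlgebraicCondition {ν N n : ℕ} (e : Fin N → Fin ν → ℕ)
    (X : (Fin N → ℕ) → Euc n → Euc n) : Prop :=
  ∀ α : Fin N → ℕ, α ≠ 0 → ¬ IsPurePower e α →
    SetControls {Y | LieGen (purePowers e X) Y} (X α, degree e α)

/-- The pure powers of the Taylor coefficients of `W` generate a finite list that controls `W`. -/
def ConditionI {ν N n : ℕ} (e : Fin N → Fin ν → ℕ) (γ : Euc N × Euc n → Euc n) : Prop :=
  GeneratesControl e (purePowers e (taylorField (fieldW γ))) (fieldW γ)

/-- The finite type condition and the algebraic condition for the Taylor coefficients of `W`. -/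
def ConditionII {ν N n : ℕ} (e : Fin N → Fin ν → ℕ) (γ : Euc N × Euc n → Euc n) : Prop :=
  GeneratesControl e (allPowers e (taylorField (fieldW γ))) (fieldW γ) ∧
  AlgebraicCondition e (taylorField (fieldW γ))

/-- The finite type condition and the algebraic condition for the fields `X_α` (those of the
exponential expansion of `γ`); the finite list still has to control `W`. -/
def ConditionIII {ν N n : ℕ} (e : Fin N → Fin ν → ℕ) (γ : Euc N × Euc n → Euc n)
    (X : (Fin N → ℕ) → Euc n → Euc n) : Prop :=
  GeneratesControl e (allPowers e X) (fieldW γ) ∧ AlgebraicCondition e X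

end RadonControl

open RadonControl

/-!
# Pure powers and exponential expansions

A list `X` controls a field if the field is a combination of the `X_j` with smooth coefficients,
uniformly on the multi-parameter balls of `X` and in the scale `δ`. Such coefficients are not unique
and depend on the center of the ball, so control is first weakened to its pointwise, dual form: the
list *dominates* `Z` (`Dominates`) if `|ξ (δ^d Z)| ≤ C max_j |ξ (δ^{d_j} X_j)|` for all covectors
`ξ` at points near `0`, uniformly in `δ`. Domination is transitive and is inherited by sums, and
its constants do not involve derivatives.

**From domination to control.** If a list `Y` dominates its brackets, a Gronwall argument along
subunit curves, for covectors that are transported along them, shows that a frame of maximal volume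
among the `δ^{d_l} Y_l`, chosen at the center, remains a frame on the ball of scale `τ δ` for some
fixed `τ` (`IsFrameList.exists_frame`). The coordinates with respect to this frame of a family which
`Y` dominates together with its iterated brackets have bounded derivatives of all orders, because
the derivative of a coordinate is again an expression in such coordinates. Hence domination implies
control (`IsFrameClass.controls`, `IsFrameClass.controlsFamily`).

**Lists that control `W`.** A generated list that controls `W` is closed under brackets up to
control (`IsControlList`). It controls all Taylor coefficients `X̂_α` of `W`: differentiating
`W(δt, x) = ∑ c_l δ^{d_l} X_l` in `t` at `t = 0` yields the factor `δ^{deg α}` on the left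
(`IsControlList.taylorField_mem`). Hence it controls the graded Lie algebra that the `X̂_α` generate
(`LieSpan.mem_ctlClass`). Conversely, if finitely many brackets of fields of this Lie algebra
dominate one such list, they are, together with the fields needed to form them, another such list
(`IsControlList.generatesControl`). By the Jacobi identity it does not matter whether brackets are
nested on one side only, up to linear combinations (`LieSpan.lieGen₀Span`).

**The algebraic condition.** Let `E_α` be a family that generates the same Lie algebra, graded by
multi-indices, as the `X̂_α`. If `α` is a pure power, then so are all the multi-indices of sum `α`
that occur in a bracket, so the pure powers of both families generate the same Lie algebra as well.
If the `X̂_α` with pure powers `α` generate a list that controls `W`, finiteness and the algebraic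
condition for `E` follow at once. For the converse, let `X` be a list generated by the `E_α`; by the
algebraic condition the generators are dominated by finitely many brackets of pure powers, and one
has to pass to the iterated brackets of the generators. That is `IsDominatedClass.exists_dominates`,
the analytic core of the proof: suppose that `ξ` is normalized on `X` and small on many brackets of
the fields `Y` that dominate the generators. If `ξ` were large on `[Y, Z]`, transport along the flow
of `Y` would make it large on `Z` at a nearby point while it stays small on the brackets of the `Y`.
This gives Hölder estimates, with exponents that deteriorate with each bracket, on the finitely many
entries of `X`; as `ξ` is of size one on some entry of `X`, the exponents do not matter in the end.
The equivalence for `E` is `generatesControl_purePowers_iff`. Condition (II) is the case `E = X̂`.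

**Exponential expansions.** For condition (III) the family is `E_α = X_α`. Composition with `γ_t`
acts on functions asymptotically as `e^V` with `V = ∑ t^α X_α`. Applying the Euler operator of `t`
gives `E(e^V) = e^V W` with `W = ∑ t^α X̂_α`, whence `W = ((1 - e^{-ad V}) / ad V) (E V)` as formal
series of differential operators (`vanishBelow_euler_truncExp`, `exists_lieDer_eq_truncDexp`).
Therefore `X̂_α` is `|α| X_α` plus iterated commutators of `X_β` with `|β| < |α|`, and the two
families generate the same graded Lie algebra (`lieSpan_taylorField`, `lieSpan_of_isExpExpansion`).
An expansion exists since `γ` determines the `X_α` recursively through its Taylor coefficients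
(`logFields`, `exists_isExpExpansion`).
-/

open RadonControl

/-! ### Linear transport along subunit curves -/

/-- A linear integral equation with a small bounded measurable coefficient has a solution with
prescribed value at an arbitrary time. -/
theorem exists_linear_integral_equation {E : Type*} [NormedAddCommGroup E] [NormedSpace ℝ E]
    [CompleteSpace E] (B : ℝ → E →L[ℝ] E)
    (hB : AEStronglyMeasurable B (volume.restrict (Icc (0 : ℝ) 1))) {K : ℝ} (hK : K < 1)
    (hBK : ∀ s, ‖B s‖ ≤ K) {σ : ℝ} (hσ : σ ∈ Icc (0 : ℝ) 1) (η : E) :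
    ∃ ξ : ℝ → E, Continuous ξ ∧ ξ σ = η ∧
      ∀ s ∈ Icc (0 : ℝ) 1, ξ s = η + ∫ r in σ..s, B r (ξ r) := by
  have hK0 : 0 ≤ K := (norm_nonneg _).trans (hBK 0)
  have h01 : (0 : ℝ) ≤ 1 := zero_le_one
  have hint : ∀ f : C(Icc (0 : ℝ) 1, E), IntegrableOn (fun r => B r (IccExtend h01 f r))
      (Icc 0 1) := by
    intro f
    have hm : AEStronglyMeasurable (fun r => B r (IccExtend h01 f r))
        (volume.restrict (Icc (0 : ℝ) 1)) := by
      have h1 : AEStronglyMeasurable (IccExtend h01 f) (volume.restrict (Icc (0 : ℝ) 1)) :=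
        (f.continuous.Icc_extend').aestronglyMeasurable
      exact (isBoundedBilinearMap_apply (𝕜 := ℝ) (E := E)
        (F := E)).continuous.comp_aestronglyMeasurable
        (hB.prodMk h1)
    refine Integrable.of_bound hm (K * ‖f‖) (Eventually.of_forall fun r => ?_)
    refine ((B r).le_opNorm _).trans ?_
    exact mul_le_mul (hBK r) (f.norm_coe_le_norm _) (norm_nonneg _) hK0
  have hint' : ∀ (f : C(Icc (0 : ℝ) 1, E)), ∀ a ∈ Icc (0 : ℝ) 1, ∀ b ∈ Icc (0 : ℝ) 1,
      IntervalIntegrable (fun r => B r (IccExtend h01 f r)) volume a b := by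
    intro f a ha b hb
    exact ((hint f).mono_set (uIcc_subset_Icc ha hb)).intervalIntegrable
  let T : C(Icc (0 : ℝ) 1, E) → C(Icc (0 : ℝ) 1, E) := fun f =>
    ⟨fun s => η + ∫ r in σ..s, B r (IccExtend h01 f r), by
      refine continuous_const.add ?_
      have h1 : ContinuousOn (fun x => ∫ r in σ..x, B r (IccExtend h01 f r)) (Icc 0 1) := by
        have h2 := intervalIntegral.continuousOn_primitive_interval' (μ := volume)
          (f := fun r => B r (IccExtend h01 f r)) (a := σ) (b₁ := 0) (b₂ := 1)
          (hint' f 0 (by simp) 1 (by simp)) (by rwa [uIcc_of_le h01])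
        rwa [uIcc_of_le h01] at h2
      exact h1.domRestrict⟩
  have hT : ContractingWith (Real.toNNReal K) T := by
    refine ⟨by simpa using hK, LipschitzWith.of_dist_le_mul fun f g => ?_⟩
    rw [Real.coe_toNNReal _ hK0]
    refine (ContinuousMap.dist_le (by positivity)).2 fun s => ?_
    have : T f s - T g s = ∫ r in σ..s, B r (IccExtend h01 f r - IccExtend h01 g r) := by
      change (η + ∫ r in σ..s, B r (IccExtend h01 f r)) -
        (η + ∫ r in σ..s, B r (IccExtend h01 g r)) = _
      rw [add_sub_add_left_eq_sub, ← intervalIntegral.integral_sub (hint' f _ hσ _ s.2)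
        (hint' g _ hσ _ s.2)]
      simp
    rw [dist_eq_norm, this]
    refine (intervalIntegral.norm_integral_le_of_norm_le_const (C := K * dist f g) ?_).trans ?_
    · intro r _
      refine ((B r).le_opNorm _).trans ?_
      refine mul_le_mul (hBK r) ?_ (norm_nonneg _) hK0
      rw [← dist_eq_norm]
      exact ContinuousMap.dist_apply_le_dist _
    · have : |(s : ℝ) - σ| ≤ 1 := by
        rw [abs_le]; constructor <;> linarith [s.2.1, s.2.2, hσ.1, hσ.2]
      exact mul_le_of_le_one_right (by positivity) this
  obtain ⟨f, hf⟩ : ∃ f, T f = f := ⟨_, hT.fixedPoint_isFixedPt⟩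
  have hfs : ∀ s ∈ Icc (0 : ℝ) 1,
      IccExtend h01 f s = η + ∫ r in σ..s, B r (IccExtend h01 f r) := by
    intro s hs
    rw [IccExtend_of_mem _ _ hs]
    exact (DFunLike.congr_fun hf ⟨s, hs⟩).symm
  exact ⟨IccExtend h01 f, f.continuous.Icc_extend', by simpa using hfs σ hσ, hfs⟩

/-- The solutions of a linear integral equation are Lipschitz and almost everywhere
differentiable. -/
theorem exists_linear_ode {E : Type*} [NormedAddCommGroup E] [NormedSpace ℝ E]
    [CompleteSpace E] (B : ℝ → E →L[ℝ] E)
    (hB : AEStronglyMeasurable B (volume.restrict (Icc (0 : ℝ) 1))) {K : ℝ} (hK : K < 1)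
    (hBK : ∀ s, ‖B s‖ ≤ K) {σ : ℝ} (hσ : σ ∈ Icc (0 : ℝ) 1) (η : E) :
    ∃ ξ : ℝ → E, Continuous ξ ∧ ξ σ = η ∧ (∃ L : NNReal, LipschitzOnWith L ξ (Icc 0 1)) ∧
      ∀ᵐ s, s ∈ Icc (0 : ℝ) 1 → HasDerivAt ξ (B s (ξ s)) s := by
  have hK0 : 0 ≤ K := (norm_nonneg _).trans (hBK 0)
  obtain ⟨ξ, hξc, hξσ, hξ⟩ := exists_linear_integral_equation B hB hK hBK hσ η
  obtain ⟨M, hM⟩ := isCompact_Icc.exists_bound_of_continuousOn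
      (hξc.continuousOn (s := Icc (0 : ℝ) 1))
  have hM0 : 0 ≤ M := (norm_nonneg _).trans (hM 0 (by simp))
  have hBξ : IntervalIntegrable (fun r => B r (ξ r)) volume 0 1 := by
    have : IntegrableOn (fun r => B r (ξ r)) (uIcc 0 1) := by
      rw [uIcc_of_le zero_le_one]
      refine Integrable.of_bound ?_ (K * M) ?_
      · exact (isBoundedBilinearMap_apply (𝕜 := ℝ) (E := E)
          (F := E)).continuous.comp_aestronglyMeasurable (hB.prodMk hξc.aestronglyMeasurable)
      · refine (ae_restrict_iff' measurableSet_Icc).2 (Eventually.of_forall fun r hr => ?_)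
        exact ((B r).le_opNorm _).trans (mul_le_mul (hBK r) (hM r hr) (norm_nonneg _) hK0)
    exact this.intervalIntegrable
  refine ⟨ξ, hξc, hξσ, ⟨Real.toNNReal (K * M), LipschitzOnWith.of_dist_le_mul fun t ht s hs => ?_⟩,
    ?_⟩
  · have hi : ∀ t ∈ Icc (0 : ℝ) 1, IntervalIntegrable (fun r => B r (ξ r)) volume σ t := by
      intro t ht
      refine hBξ.mono_set ?_
      rw [uIcc_of_le zero_le_one]
      exact uIcc_subset_Icc hσ ht
    rw [Real.coe_toNNReal _ (by positivity), dist_eq_norm, hξ t ht, hξ s hs,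
      add_sub_add_left_eq_sub, intervalIntegral.integral_interval_sub_left (hi t ht) (hi s hs),
      Real.dist_eq]
    refine intervalIntegral.norm_integral_le_of_norm_le_const fun r hr => ?_
    have hr' := uIcc_subset_Icc hs ht (uIoc_subset_uIcc hr)
    exact ((B r).le_opNorm _).trans (mul_le_mul (hBK r) (hM r hr') (norm_nonneg _) hK0)
  · have h2 : ∀ᵐ s : ℝ, s ≠ 0 := by simp [ae_iff]
    have h3 : ∀ᵐ s : ℝ, s ≠ 1 := by simp [ae_iff]
    filter_upwards [hBξ.ae_hasDerivAt_integral, h2, h3] with s hs hs0 hs1 hmem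
    have h4 := hs (by rwa [uIcc_of_le zero_le_one]) σ (by rwa [uIcc_of_le zero_le_one])
    have h5 : Icc (0 : ℝ) 1 ∈ 𝓝 s :=
      Icc_mem_nhds (lt_of_le_of_ne hmem.1 hs0.symm) (lt_of_le_of_ne hmem.2 hs1)
    refine (h4.const_add η).congr_of_eventuallyEq ?_
    filter_upwards [h5] with r hr using hξ r hr

/-- A Lipschitz function on `[0,1]` whose derivative is almost everywhere bounded by `K`. -/
theorem abs_sub_le_of_ae_deriv_le {f f' : ℝ → ℝ} {L : NNReal} (hf : LipschitzOnWith L f (Icc 0 1))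
    (hd : ∀ᵐ s, s ∈ Icc (0 : ℝ) 1 → HasDerivAt f (f' s) s) {K : ℝ} {a b : ℝ}
    (ha : a ∈ Icc (0 : ℝ) 1) (hb : b ∈ Icc (0 : ℝ) 1)
    (hK : ∀ s ∈ Icc (0 : ℝ) 1, |f' s| ≤ K) : |f b - f a| ≤ K * |b - a| := by
  have hsub : uIcc a b ⊆ Icc 0 1 := uIcc_subset_Icc ha hb
  have hac : AbsolutelyContinuousOnInterval f a b :=
    (hf.mono hsub).absolutelyContinuousOnInterval
  rw [← hac.integral_deriv_eq_sub, ← Real.norm_eq_abs]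
  refine intervalIntegral.norm_integral_le_of_norm_le_const_ae ?_
  filter_upwards [hd] with s hs hmem
  have hs1 := hsub (uIoc_subset_uIcc hmem)
  rw [(hs hs1).deriv]
  exact hK s hs1

/-- A curve in `Ω` that satisfies `c' = ∑ a_j Z_j(c)` with a measurable control of norm at most
one. -/
structure IsSubunit {n q : ℕ} (Ω : Set (Euc n)) (Z : Fin q → Euc n → Euc n) (c : ℝ → Euc n)
    (a : ℝ → Euc q) : Prop where
  cont : ContinuousOn c (Icc 0 1)
  mem : ∀ s ∈ Icc (0 : ℝ) 1, c s ∈ Ω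
  meas : Measurable a
  bound : ∀ s, ‖a s‖ ≤ 1
  eq : ∀ s ∈ Icc (0 : ℝ) 1, c s = c 0 + ∫ r in (0 : ℝ)..s, ∑ j, a r j • Z j (c r)

namespace IsSubunit

variable {n q : ℕ} {Ω : Set (Euc n)} {Z : Fin q → Euc n → Euc n} {c : ℝ → Euc n} {a : ℝ → Euc q}

theorem abs_le (h : IsSubunit Ω Z c a) (s : ℝ) (j : Fin q) : |a s j| ≤ 1 :=
  (PiLp.norm_apply_le (a s) j).trans (h.bound s)

theorem norm_sum_le {E : Type*} [NormedAddCommGroup E] [NormedSpace ℝ E]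
    (h : IsSubunit Ω Z c a) (s : ℝ) (v : Fin q → E) {K : ℝ} (hv : ∀ j, ‖v j‖ ≤ K) :
    ‖∑ j, a s j • v j‖ ≤ q * K := by
  calc ‖∑ j, a s j • v j‖ ≤ ∑ j : Fin q, K := by
        refine norm_sum_le_of_le _ fun j _ => ?_
        rw [norm_smul]
        calc ‖a s j‖ * ‖v j‖ ≤ 1 * ‖v j‖ := by gcongr; exact h.abs_le s j
          _ ≤ K := by rw [one_mul]; exact hv j
    _ = q * K := by simp

theorem aestronglyMeasurable_sum {E : Type*} [NormedAddCommGroup E] [NormedSpace ℝ E]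
    [SecondCountableTopology E]
    (h : IsSubunit Ω Z c a) {v : Fin q → Euc n → E} (hv : ∀ j, ContinuousOn (v j) Ω) :
    AEStronglyMeasurable (fun r => ∑ j, a r j • v j (c r)) (volume.restrict (Icc (0 : ℝ) 1)) := by
  refine Finset.aestronglyMeasurable_fun_sum _ fun j _ => ?_
  have h1 : Measurable fun r => a r j := by
    have := h.meas
    exact (EuclideanSpace.proj (𝕜 := ℝ) j).continuous.measurable.comp this
  refine h1.aestronglyMeasurable.smul ?_
  exact ((hv j).comp h.cont h.mem).aestronglyMeasurable measurableSet_Icc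

theorem intervalIntegrable (h : IsSubunit Ω Z c a) (hZ : ∀ j, ContinuousOn (Z j) Ω) {K : ℝ}
    (hK : ∀ j, ∀ x ∈ Ω, ‖Z j x‖ ≤ K) :
    IntervalIntegrable (fun r => ∑ j, a r j • Z j (c r)) volume 0 1 := by
  have : IntegrableOn (fun r => ∑ j, a r j • Z j (c r)) (Icc 0 1) := by
    refine Integrable.of_bound (h.aestronglyMeasurable_sum hZ) (q * K) ?_
    refine (ae_restrict_iff' measurableSet_Icc).2 (Eventually.of_forall fun r hr => ?_)
    exact h.norm_sum_le r _ fun j => hK j _ (h.mem r hr)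
  have h2 : IntegrableOn (fun r => ∑ j, a r j • Z j (c r)) (uIcc 0 1) := by
    rwa [uIcc_of_le zero_le_one]
  exact h2.intervalIntegrable

theorem sub_eq_integral (h : IsSubunit Ω Z c a) (hZ : ∀ j, ContinuousOn (Z j) Ω) {K : ℝ}
    (hK : ∀ j, ∀ x ∈ Ω, ‖Z j x‖ ≤ K) {s t : ℝ} (hs : s ∈ Icc (0 : ℝ) 1) (ht : t ∈ Icc (0 : ℝ) 1) :
    c t - c s = ∫ r in s..t, ∑ j, a r j • Z j (c r) := by
  have hi := h.intervalIntegrable hZ hK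
  have h0 : ∀ t ∈ Icc (0 : ℝ) 1, IntervalIntegrable
      (fun r => ∑ j, a r j • Z j (c r)) volume 0 t := by
    intro t ht
    refine hi.mono_set ?_
    rw [uIcc_of_le zero_le_one]
    exact uIcc_subset_Icc (by simp) ht
  rw [h.eq t ht, h.eq s hs, add_sub_add_left_eq_sub,
    intervalIntegral.integral_interval_sub_left (h0 t ht) (h0 s hs)]

theorem lipschitzOnWith (h : IsSubunit Ω Z c a) (hZ : ∀ j, ContinuousOn (Z j) Ω) {K : ℝ}
    (hK0 : 0 ≤ K) (hK : ∀ j, ∀ x ∈ Ω, ‖Z j x‖ ≤ K) :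
    LipschitzOnWith (Real.toNNReal (q * K)) c (Icc 0 1) := by
  refine LipschitzOnWith.of_dist_le_mul fun t ht s hs => ?_
  rw [Real.coe_toNNReal _ (by positivity), dist_eq_norm, h.sub_eq_integral hZ hK hs ht,
    Real.dist_eq]
  refine intervalIntegral.norm_integral_le_of_norm_le_const fun r hr => ?_
  exact h.norm_sum_le r _ fun j => hK j _ (h.mem r (uIcc_subset_Icc hs ht (uIoc_subset_uIcc hr)))

theorem ae_hasDerivAt (h : IsSubunit Ω Z c a) (hZ : ∀ j, ContinuousOn (Z j) Ω) {K : ℝ}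
    (hK : ∀ j, ∀ x ∈ Ω, ‖Z j x‖ ≤ K) :
    ∀ᵐ s, s ∈ Icc (0 : ℝ) 1 → HasDerivAt c (∑ j, a s j • Z j (c s)) s := by
  have h1 := (h.intervalIntegrable hZ hK).ae_hasDerivAt_integral
  have h2 : ∀ᵐ s : ℝ, s ≠ 0 := by simp [ae_iff]
  have h3 : ∀ᵐ s : ℝ, s ≠ 1 := by simp [ae_iff]
  filter_upwards [h1, h2, h3] with s hs hs0 hs1 hmem
  have h4 := hs (by rwa [uIcc_of_le zero_le_one]) 0 (by simp)
  have h5 : Icc (0 : ℝ) 1 ∈ 𝓝 s :=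
    Icc_mem_nhds (lt_of_le_of_ne hmem.1 hs0.symm) (lt_of_le_of_ne hmem.2 hs1)
  refine (h4.const_add (c 0)).congr_of_eventuallyEq ?_
  filter_upwards [h5] with r hr using h.eq r hr

/-- Covectors can be transported along a subunit curve of smooth fields: the pairing of a
transported covector with a vector field `Y` has the derivative of the pairing with
`∑ a_j [Z_j, Y]`. -/
theorem exists_transport (h : IsSubunit Ω Z c a) (hΩ : IsOpen Ω) (hZ : ∀ j, ContDiffOn ℝ ∞ (Z j) Ω)
    {K : ℝ} (hK0 : 0 ≤ K) (hK1 : q * K < 1) (hK : ∀ j, ∀ x ∈ Ω, ‖Z j x‖ ≤ K)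
    (hK' : ∀ j, ∀ x ∈ Ω, ‖fderiv ℝ (Z j) x‖ ≤ K) {σ : ℝ} (hσ : σ ∈ Icc (0 : ℝ) 1)
    (η : Euc n →L[ℝ] ℝ) :
    ∃ ξ : ℝ → Euc n →L[ℝ] ℝ, Continuous ξ ∧ ξ σ = η ∧ ∀ Y : Euc n → Euc n, ContDiffOn ℝ ∞ Y Ω →
      (∃ L : NNReal, LipschitzOnWith L (fun s => ξ s (Y (c s))) (Icc 0 1)) ∧
      ∀ᵐ s, s ∈ Icc (0 : ℝ) 1 → HasDerivAt (fun s => ξ s (Y (c s)))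
        (∑ j, a s j * ξ s (VectorField.lieBracket ℝ (Z j) Y (c s))) s := by
  have hcont : ∀ j, ContinuousOn (Z j) Ω := fun j => (hZ j).continuousOn
  let A : ℝ → Euc n →L[ℝ] Euc n :=
    (Icc (0 : ℝ) 1).indicator fun s => ∑ j, a s j • fderiv ℝ (Z j) (c s)
  have hAK : ∀ s, ‖A s‖ ≤ q * K := by
    intro s
    by_cases hs : s ∈ Icc (0 : ℝ) 1
    · simp only [A, indicator_of_mem hs]
      exact h.norm_sum_le s _ fun j => hK' j _ (h.mem s hs)
    · simp only [A, indicator_of_notMem hs, norm_zero]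
      positivity
  have hAm : AEStronglyMeasurable A (volume.restrict (Icc (0 : ℝ) 1)) := by
    have := h.aestronglyMeasurable_sum (v := fun j => fderiv ℝ (Z j))
      fun j => ((hZ j).continuousOn_fderiv_of_isOpen hΩ (by simp))
    exact this.indicator measurableSet_Icc
  let Cmp : (Euc n →L[ℝ] Euc n) →L[ℝ] (Euc n →L[ℝ] ℝ) →L[ℝ] (Euc n →L[ℝ] ℝ) :=
    (ContinuousLinearMap.compL ℝ (Euc n) (Euc n) ℝ).flip
  let B : ℝ → (Euc n →L[ℝ] ℝ) →L[ℝ] (Euc n →L[ℝ] ℝ) := fun s => Cmp (-(A s))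
  have hBapp : ∀ s ξ v, B s ξ v = -(ξ (A s v)) := fun s ξ v => map_neg ξ _
  have hBK : ∀ s, ‖B s‖ ≤ q * K := by
    intro s
    refine ContinuousLinearMap.opNorm_le_bound _ (by positivity) fun ξ => ?_
    have : B s ξ = ξ.comp (-(A s)) := rfl
    rw [this, mul_comm]
    exact (ξ.opNorm_comp_le _).trans (by rw [norm_neg]; gcongr; exact hAK s)
  have hBm : AEStronglyMeasurable B (volume.restrict (Icc (0 : ℝ) 1)) :=
    Cmp.continuous.comp_aestronglyMeasurable hAm.neg
  obtain ⟨ξ, hξc, hξσ, hξL, hξd⟩ := exists_linear_ode B hBm hK1 hBK hσ η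
  refine ⟨ξ, hξc, hξσ, fun Y hY => ⟨?_, ?_⟩⟩
  · obtain ⟨L, hL⟩ := hξL
    have hcL := h.lipschitzOnWith hcont hK0 hK
    -- `Y ∘ c` is Lipschitz: `Y` is locally Lipschitz and the image of `c` is compact.
    have hYc : ∃ L' : NNReal, LipschitzOnWith L' Y (c '' Icc 0 1) := by
      refine LocallyLipschitzOn.exists_lipschitzOnWith_of_compact
        (isCompact_Icc.image_of_continuousOn h.cont) ?_
      rintro x ⟨s, hs, rfl⟩
      have hx := h.mem s hs
      obtain ⟨L', t, ht, hl⟩ := ((hY.contDiffAt (hΩ.mem_nhds hx)).of_le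
        (by simp : (1 : WithTop ℕ∞) ≤ ∞)).exists_lipschitzOnWith
      exact ⟨L', t, mem_nhdsWithin_of_mem_nhds ht, hl⟩
    obtain ⟨L', hL'⟩ := hYc
    have hYL : LipschitzOnWith (L' * Real.toNNReal (q * K)) (fun s => Y (c s)) (Icc 0 1) :=
      hL'.comp hcL (mapsTo_image _ _)
    obtain ⟨M, hM⟩ := isCompact_Icc.exists_bound_of_continuousOn
        (hξc.continuousOn (s := Icc (0 : ℝ) 1))
    obtain ⟨M', hM'⟩ := isCompact_Icc.exists_bound_of_continuousOn hYL.continuousOn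
    have hM0 : 0 ≤ M := (norm_nonneg _).trans (hM 0 (by simp))
    have hM0' : 0 ≤ M' := (norm_nonneg _).trans (hM' 0 (by simp))
    refine ⟨Real.toNNReal (L * M' + M * ↑(L' * Real.toNNReal (q * K))),
      LipschitzOnWith.of_dist_le_mul fun t ht s hs => ?_⟩
    rw [Real.coe_toNNReal _ (by positivity), dist_eq_norm]
    have : ξ t (Y (c t)) - ξ s (Y (c s)) = (ξ t - ξ s) (Y (c t)) + ξ s (Y (c t) - Y (c s)) := by
      simp
    rw [this]
    have h1 : ‖(ξ t - ξ s) (Y (c t))‖ ≤ L * dist t s * M' := by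
      refine ((ξ t - ξ s).le_opNorm _).trans ?_
      refine mul_le_mul ?_ (hM' t ht) (norm_nonneg _) (by positivity)
      rw [← dist_eq_norm]; exact hL.dist_le_mul t ht s hs
    have h2 : ‖ξ s (Y (c t) - Y (c s))‖ ≤ M * (↑(L' * Real.toNNReal (q * K)) * dist t s) := by
      refine ((ξ s).le_opNorm _).trans ?_
      refine mul_le_mul (hM s hs) ?_ (norm_nonneg _) hM0
      rw [← dist_eq_norm]; exact hYL.dist_le_mul t ht s hs
    refine (norm_add_le _ _).trans ((add_le_add h1 h2).trans (le_of_eq ?_))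
    ring
  · filter_upwards [hξd, h.ae_hasDerivAt hcont hK] with s h1 h2 hs
    have hx := h.mem s hs
    have hYd : HasFDerivAt Y (fderiv ℝ Y (c s)) (c s) :=
      ((hY.contDiffAt (hΩ.mem_nhds hx)).differentiableAt (by simp)).hasFDerivAt
    have h3 := (h1 hs).clm_apply (hYd.comp_hasDerivAt s (h2 hs))
    refine h3.congr_deriv ?_
    rw [hBapp]
    simp only [A, indicator_of_mem hs, VectorField.lieBracket, map_sum, map_smul, map_sub,
      _root_.sum_apply, _root_.smul_apply, smul_eq_mul, mul_sub,
      Finset.sum_sub_distrib, Function.comp_apply]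
    ring

end IsSubunit

/-! ### Unit balls -/

section UnitBall

variable {n q : ℕ} {Ω : Set (Euc n)} {Z : Fin q → Euc n → Euc n} {x₀ y : Euc n}

/-- The controls in the definition of the unit ball can be taken Borel measurable and bounded
everywhere by a constant smaller than one. -/
theorem mem_unitBall_iff : y ∈ unitBall Ω Z x₀ ↔
    ∃ (c : ℝ → Euc n) (a : ℝ → Euc q) (M : ℝ), M < 1 ∧ IsSubunit Ω Z c a ∧ c 0 = x₀ ∧ c 1 = y ∧
      ∀ s, ‖a s‖ ≤ M := by
  constructor
  · rintro ⟨c, a, hc, hΩ, h0, h1, ham, hae, heq⟩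
    set μ := volume.restrict (Icc (0 : ℝ) 1)
    set M := (eLpNorm a ⊤ μ).toReal with hM
    have hM1 : M < 1 := by
      have := (ENNReal.toReal_lt_toReal (ne_top_of_lt hae) ENNReal.one_ne_top).2 hae
      rwa [ENNReal.toReal_one] at this
    have hM0 : 0 ≤ M := ENNReal.toReal_nonneg
    have hle : ∀ᵐ s ∂μ, ‖a s‖ ≤ M := by
      have := ae_le_eLpNormEssSup (f := a) (μ := μ)
      filter_upwards [this] with s hs
      rw [← eLpNorm_exponent_top] at hs
      have h2 := ENNReal.toReal_mono (ne_top_of_lt hae) hs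
      rwa [toReal_enorm] at h2
    let b : ℝ → Euc q := fun s => if ‖ham.mk a s‖ ≤ M then ham.mk a s else 0
    have hbm : Measurable b := by
      have hm : Measurable (ham.mk a) := ham.stronglyMeasurable_mk.measurable
      exact Measurable.ite (measurableSet_le hm.norm measurable_const) hm measurable_const
    have hbM : ∀ s, ‖b s‖ ≤ M := by
      intro s
      by_cases h : ‖ham.mk a s‖ ≤ M
      · simp [b, h]
      · simpa [b, h] using hM0
    have hab : ∀ᵐ s ∂μ, a s = b s := by
      filter_upwards [ham.ae_eq_mk, hle] with s hs hs'
      rw [hs] at hs'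
      simp [b, hs', hs]
    refine ⟨c, b, M, hM1, ⟨hc, hΩ, hbm, fun s => (hbM s).trans hM1.le, fun s hs => ?_⟩, h0, h1, hbM⟩
    rw [heq s hs, h0]
    congr 1
    refine intervalIntegral.integral_congr_ae ?_
    filter_upwards [(ae_restrict_iff' measurableSet_Icc).1 hab] with r hr hrs
    have hr' : r ∈ Icc (0 : ℝ) 1 := uIcc_subset_Icc (by simp) hs (uIoc_subset_uIcc hrs)
    rw [hr hr']
  · rintro ⟨c, a, M, hM, h, h0, h1, haM⟩
    refine ⟨c, a, h.cont, h.mem, h0, h1, h.meas.aestronglyMeasurable, ?_, fun s hs =>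
      h0 ▸ h.eq s hs⟩
    have hM0 : 0 ≤ M := (norm_nonneg _).trans (haM 0)
    refine lt_of_le_of_lt (eLpNorm_le_of_ae_bound (C := M) (Eventually.of_forall haM)) ?_
    simpa using hM

theorem self_mem_unitBall (hx : x₀ ∈ Ω) : x₀ ∈ unitBall Ω Z x₀ :=
  mem_unitBall_iff.2 ⟨fun _ => x₀, fun _ => 0, 0, by simp,
    ⟨continuousOn_const, fun _ _ => hx, measurable_const, by simp, by simp⟩, rfl, rfl, by simp⟩

theorem unitBall_subset : unitBall Ω Z x₀ ⊆ Ω := by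
  rintro y ⟨c, a, -, hΩ, -, h1, -⟩
  exact h1 ▸ hΩ 1 (by simp)

/-- Subunit balls contain a short piece of each integral curve of (a multiple of) each of the
fields: run through the given curve in a shorter time and use the time that is left. -/
theorem eventually_mem_unitBall (hΩ : IsOpen Ω) (hZ : ∀ j, ContinuousOn (Z j) Ω)
    (hy : y ∈ unitBall Ω Z x₀) (k : Fin q) (κ : ℝ) {φ : ℝ → Euc n} (hφ0 : φ 0 = y)
    (hφ : ∀ᶠ s in 𝓝 (0 : ℝ), HasDerivAt φ (κ • Z k (φ s)) s) :
    ∀ᶠ s in 𝓝 (0 : ℝ), φ s ∈ unitBall Ω Z x₀ := by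
  obtain ⟨c, a, M, hM, h, h0, h1, haM⟩ := mem_unitBall_iff.1 hy
  have hM0 : 0 ≤ M := (norm_nonneg _).trans (haM 0)
  set b : ℝ := (1 + M) / 2 with hb
  have hb0 : 0 < b := by positivity
  have hb1 : b < 1 := by linarith
  set M' : ℝ := M / b with hM'
  have hM'1 : M' < 1 := by rw [hM', div_lt_one hb0]; linarith
  have hφΩ : ∀ᶠ s in 𝓝 (0 : ℝ), φ s ∈ Ω := by
    have : ContinuousAt φ 0 := hφ.self_of_nhds.continuousAt
    exact this.eventually (by rw [hφ0]; exact hΩ.mem_nhds (unitBall_subset hy))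
  obtain ⟨ε, hε, hball⟩ := Metric.eventually_nhds_iff_ball.1 (hφ.and hφΩ)
  have hsmall : ∀ᶠ s in 𝓝 (0 : ℝ), |s| < ε ∧ |κ * s / (1 - b)| < (1 + M') / 2 := by
    have h1 : ContinuousAt (fun s : ℝ => |s|) 0 := by fun_prop
    have h2 : ContinuousAt (fun s : ℝ => |κ * s / (1 - b)|) 0 := by fun_prop
    have hM'0 : 0 ≤ M' := by positivity
    exact (h1.eventually_lt_const (by simpa using hε)).and
      (h2.eventually_lt_const (by simp; positivity))
  filter_upwards [hsmall] with s ⟨hs1, hs2⟩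
  let c' : ℝ → Euc n := fun r => if r ≤ b then c (r / b) else φ ((r - b) * (s / (1 - b)))
  let a' : ℝ → Euc q := fun r =>
    if r ≤ b then b⁻¹ • a (r / b) else EuclideanSpace.single k (κ * (s / (1 - b)))
  have hb1' : 0 < 1 - b := by linarith
  have hleft : ∀ r ≤ b, c' r = c (r / b) := fun r hr => by simp [c', hr]
  have hright : ∀ r, b ≤ r → c' r = φ ((r - b) * (s / (1 - b))) := by
    intro r hr
    rcases hr.eq_or_lt with rfl | hr
    · simp [c', div_self hb0.ne', h1, hφ0]
    · simp [c', not_le.2 hr]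
  have harg : ∀ r ∈ Icc b 1, (r - b) * (s / (1 - b)) ∈ Metric.ball (0 : ℝ) ε := by
    intro r hr
    rw [mem_ball_zero_iff, Real.norm_eq_abs, abs_mul, abs_div, abs_of_nonneg (by linarith [hr.1]),
      abs_of_pos hb1']
    refine lt_of_le_of_lt ?_ hs1
    rw [mul_div_assoc', div_le_iff₀ hb1', mul_comm]
    gcongr
    exact hr.2
  have hdl : ∀ r ∈ Icc (0 : ℝ) b, r / b ∈ Icc (0 : ℝ) 1 := fun r hr =>
    ⟨div_nonneg hr.1 hb0.le, (div_le_one hb0).2 hr.2⟩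
  have hcl : ContinuousOn c' (Icc 0 b) := by
    refine (h.cont.comp (f := fun r => r / b) (by fun_prop) hdl).congr fun r hr => hleft r hr.2
  have hder : ∀ r ∈ Icc b 1, HasDerivAt (fun r => φ ((r - b) * (s / (1 - b))))
      ((s / (1 - b)) • κ • Z k (c' r)) r := by
    intro r hr
    have e1 := (hball _ (harg r hr)).1
    have e2 : HasDerivAt (fun r : ℝ => (r - b) * (s / (1 - b))) (1 * (s / (1 - b))) r :=
      ((hasDerivAt_id r).sub_const b).mul_const _
    have := e1.scomp r e2
    rw [one_mul] at this
    rw [hright r hr.1]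
    exact this
  have hcr : ContinuousOn c' (Icc b 1) := by
    have : ContinuousOn (fun r => φ ((r - b) * (s / (1 - b)))) (Icc b 1) :=
      fun r hr => (hder r hr).continuousAt.continuousWithinAt
    exact this.congr fun r hr => hright r hr.1
  have hc' : ContinuousOn c' (Icc 0 1) := by
    rw [← Icc_union_Icc_eq_Icc hb0.le hb1.le]
    exact hcl.union_of_isClosed hcr isClosed_Icc isClosed_Icc
  have hmem : ∀ r ∈ Icc (0 : ℝ) 1, c' r ∈ Ω := by
    intro r hr
    rcases le_total r b with hrb | hrb
    · rw [hleft r hrb]; exact h.mem _ (hdl r ⟨hr.1, hrb⟩)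
    · rw [hright r hrb]; exact (hball _ (harg r ⟨hrb, hr.2⟩)).2
  have ha'm : Measurable a' :=
    Measurable.ite measurableSet_Iic
      ((h.meas.comp (measurable_id.div_const b)).const_smul b⁻¹ : Measurable fun r =>
        b⁻¹ • a (r / b))
      measurable_const
  have hM'0 : 0 ≤ M' := by positivity
  have ha'b : ∀ r, ‖a' r‖ ≤ (1 + M') / 2 := by
    intro r
    by_cases hr : r ≤ b
    · simp only [a', hr, if_true, norm_smul, norm_inv, Real.norm_eq_abs, abs_of_pos hb0]
      calc b⁻¹ * ‖a (r / b)‖ ≤ b⁻¹ * M := by gcongr; exact haM _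
        _ = M' := by rw [hM']; field_simp
        _ ≤ _ := by linarith
    · simp only [a', hr, if_false, PiLp.norm_single, Real.norm_eq_abs]
      rw [mul_div_assoc'] ; exact hs2.le
  have hl : ∀ r ∈ Icc (0 : ℝ) b, c' r = c' 0 + ∫ ρ in (0 : ℝ)..r, ∑ j, a' ρ j • Z j (c' ρ) := by
    intro r hr
    have e1 : ∫ ρ in (0 : ℝ)..r, ∑ j, a' ρ j • Z j (c' ρ) =
        ∫ ρ in (0 : ℝ)..r, b⁻¹ • (∑ j, a (ρ / b) j • Z j (c (ρ / b))) := by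
      refine intervalIntegral.integral_congr fun ρ hρ => ?_
      rw [uIcc_of_le hr.1] at hρ
      have : ρ ≤ b := hρ.2.trans hr.2
      simp [hleft ρ this, a', this, Finset.smul_sum, smul_smul]
    rw [e1, intervalIntegral.integral_smul,
      intervalIntegral.inv_smul_integral_comp_div (fun ρ => ∑ j, a ρ j • Z j (c ρ)) b, zero_div,
      hleft r hr.2, hleft 0 hb0.le, zero_div]
    exact h.eq _ (hdl r hr)
  have hv : IntervalIntegrable (fun ρ => ∑ j, a' ρ j • Z j (c' ρ)) volume 0 1 := by
    obtain ⟨C, hC⟩ : ∃ C, ∀ j, ∀ r ∈ Icc (0 : ℝ) 1, ‖Z j (c' r)‖ ≤ C := by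
      have : ∀ j, ∃ C, ∀ r ∈ Icc (0 : ℝ) 1, ‖Z j (c' r)‖ ≤ C := fun j =>
        isCompact_Icc.exists_bound_of_continuousOn ((hZ j).comp hc' hmem)
      choose C hC using this
      refine ⟨∑ j, |C j|, fun j r hr => (hC j r hr).trans ((le_abs_self _).trans ?_)⟩
      exact Finset.single_le_sum (f := fun j => |C j|) (fun _ _ => abs_nonneg _) (Finset.mem_univ j)
    have hm : AEStronglyMeasurable (fun ρ => ∑ j, a' ρ j • Z j (c' ρ))
        (volume.restrict (Icc (0 : ℝ) 1)) := by
      refine Finset.aestronglyMeasurable_fun_sum _ fun j _ => ?_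
      have e1 : Measurable fun r => a' r j :=
        (EuclideanSpace.proj (𝕜 := ℝ) j).continuous.measurable.comp ha'm
      exact e1.aestronglyMeasurable.smul
        (((hZ j).comp hc' hmem).aestronglyMeasurable measurableSet_Icc)
    have : IntegrableOn (fun ρ => ∑ j, a' ρ j • Z j (c' ρ)) (uIcc 0 1) := by
      rw [uIcc_of_le zero_le_one]
      refine Integrable.of_bound hm (∑ j : Fin q, 1 * C) ?_
      refine (ae_restrict_iff' measurableSet_Icc).2 (Eventually.of_forall fun r hr => ?_)
      refine norm_sum_le_of_le _ fun j _ => ?_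
      rw [norm_smul]
      refine mul_le_mul ?_ (hC j r hr) (norm_nonneg _) zero_le_one
      exact (PiLp.norm_apply_le (a' r) j).trans ((ha'b r).trans (by linarith))
    exact this.intervalIntegrable
  have hsub : ∀ p ∈ Icc (0 : ℝ) 1, ∀ r ∈ Icc (0 : ℝ) 1,
      IntervalIntegrable (fun ρ => ∑ j, a' ρ j • Z j (c' ρ)) volume p r := fun p hp r hr =>
    hv.mono_set (by rw [uIcc_of_le zero_le_one]; exact uIcc_subset_Icc hp hr)
  have hbm : b ∈ Icc (0 : ℝ) 1 := ⟨hb0.le, hb1.le⟩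
  have hr' : ∀ r ∈ Icc b 1, c' r = c' b + ∫ ρ in b..r, ∑ j, a' ρ j • Z j (c' ρ) := by
    intro r hr
    have hr01 : r ∈ Icc (0 : ℝ) 1 := ⟨hb0.le.trans hr.1, hr.2⟩
    have e1 := intervalIntegral.integral_eq_sub_of_hasDerivAt
      (f := fun r => φ ((r - b) * (s / (1 - b)))) (f' := fun r => (s / (1 - b)) • κ • Z k (c' r))
      (a := b) (b := r)
      (fun ρ hρ => hder ρ (by rw [uIcc_of_le hr.1] at hρ; exact ⟨hρ.1, hρ.2.trans hr.2⟩))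
      ((hsub b hbm r hr01).congr_ae (by
        rw [uIoc_of_le hr.1]
        refine (ae_restrict_iff' measurableSet_Ioc).2 (Eventually.of_forall fun ρ hρ => ?_)
        simp [a', not_le.2 hρ.1, smul_smul, mul_comm]))
    have e2 : ∫ ρ in b..r, ∑ j, a' ρ j • Z j (c' ρ) =
        ∫ ρ in b..r, (s / (1 - b)) • κ • Z k (c' ρ) := by
      refine intervalIntegral.integral_congr_ae (Eventually.of_forall fun ρ hρ => ?_)
      rw [uIoc_of_le hr.1] at hρ
      simp [a', not_le.2 hρ.1, smul_smul, mul_comm]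
    rw [e2, e1, hright r hr.1, hright b le_rfl]
    simp
  refine mem_unitBall_iff.2 ⟨c', a', (1 + M') / 2, by linarith, ⟨hc', hmem, ha'm,
    fun r => (ha'b r).trans (by linarith), fun r hr => ?_⟩, ?_, ?_, ha'b⟩
  · rcases le_total r b with hrb | hrb
    · exact hl r ⟨hr.1, hrb⟩
    · rw [hr' r ⟨hrb, hr.2⟩, hl b ⟨hb0.le, le_rfl⟩, add_assoc,
        intervalIntegral.integral_add_adjacent_intervals (hsub 0 (by simp) b hbm) (hsub b hbm r hr)]
  · rw [hleft 0 hb0.le, zero_div, h0]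
  · rw [hright 1 hb1.le, mul_div_cancel₀ _ hb1'.ne']

end UnitBall

/-! ### Bounds for iterated derivatives -/

/-- The relations `g = D_j f` behave like derivations: they respect sums, products and
constants. -/
structure IsDerivationRel {Y ι : Type*} (D : ι → (Y → ℝ) → (Y → ℝ) → Prop) : Prop where
  add : ∀ j f g f' g', D j f g → D j f' g' → D j (fun y => f y + f' y) (fun y => g y + g' y)
  mul : ∀ j f g f' g', D j f g → D j f' g' →
    D j (fun y => f y * f' y) (fun y => g y * f' y + f y * g' y)
  const : ∀ j (k : ℝ), D j (fun _ => k) (fun _ => 0)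

theorem isDerivationRel_isDerivAlong {n : ℕ} {ι : Type*} (Z : ι → Euc n → Euc n)
    (B : Set (Euc n)) : IsDerivationRel fun k => IsDerivAlong (Z k) B where
  add _ _ _ _ _ h h' y hy φ h0 hφ := (h y hy φ h0 hφ).add (h' y hy φ h0 hφ)
  mul _ _ _ _ _ h h' y hy φ h0 hφ := by
    have := (h y hy φ h0 hφ).mul (h' y hy φ h0 hφ)
    rwa [h0] at this
  const _ _ _ _ _ _ _ := hasDerivAt_const _ _

theorem isDerivationRel_isDerivAlongSnd {N n : ℕ} {ι : Type*} (Z : ι → Euc n → Euc n)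
    (A : Set (Euc N)) (B : Set (Euc n)) : IsDerivationRel fun k => IsDerivAlongSnd (Z k) A B where
  add j _ _ _ _ h h' t ht :=
    (isDerivationRel_isDerivAlong Z B).add j _ _ _ _ (h t ht) (h' t ht)
  mul j _ _ _ _ h h' t ht :=
    (isDerivationRel_isDerivAlong Z B).mul j _ _ _ _ (h t ht) (h' t ht)
  const j k _ _ := (isDerivationRel_isDerivAlong Z B).const j k

section WordBound

variable {Y ι : Type*} [TopologicalSpace Y] {D D' : ι → (Y → ℝ) → (Y → ℝ) → Prop} {A A' : Set Y}
  {C C' : ℝ} {m : ℕ} {f g : Y → ℝ}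

theorem RadonControl.WordBound.mono (hD : ∀ j f g, D j f g → D' j f g) (hA : A' ⊆ A) (hC : C ≤ C')
    (h : WordBound D A C m f) : WordBound D' A' C' m f := by
  induction m generalizing f with
  | zero => exact ⟨h.1.mono hA, fun y hy => (h.2 y (hA hy)).trans hC⟩
  | succ m ih =>
    refine ⟨⟨h.1.1.mono hA, fun y hy => (h.1.2 y (hA hy)).trans hC⟩, fun j => ?_⟩
    obtain ⟨g, hg, hw⟩ := h.2 j
    exact ⟨g, hD j f g hg, ih hw⟩

theorem RadonControl.WordBound.mono_const (hC : C ≤ C') (h : WordBound D A C m f) :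
    WordBound D A C' m f :=
  h.mono (fun _ _ _ => id) subset_rfl hC

theorem RadonControl.WordBound.of_succ (h : WordBound D A C (m + 1) f) : WordBound D A C m f := by
  induction m generalizing f with
  | zero => exact h.1
  | succ m ih =>
    refine ⟨h.1, fun j => ?_⟩
    obtain ⟨g, hg, hw⟩ := h.2 j
    exact ⟨g, hg, ih hw⟩

theorem RadonControl.WordBound.const (hD : IsDerivationRel D) {k : ℝ} (hk : |k| ≤ C) :
    WordBound D A C m fun _ => k := by
  induction m generalizing k with
  | zero => exact ⟨continuousOn_const, fun _ _ => hk⟩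
  | succ m ih =>
    refine ⟨⟨continuousOn_const, fun _ _ => hk⟩, fun j => ⟨_, hD.const j k, ih ?_⟩⟩
    simpa using (abs_nonneg k).trans hk

theorem RadonControl.WordBound.add (hD : IsDerivationRel D) (hf : WordBound D A C m f)
    (hg : WordBound D A C' m g) : WordBound D A (C + C') m fun y => f y + g y := by
  have hb : ∀ {f g : Y → ℝ}, BoundedCont A C f → BoundedCont A C' g →
      BoundedCont A (C + C') fun y => f y + g y := fun hf hg =>
    ⟨hf.1.add hg.1, fun y hy => (abs_add_le _ _).trans (add_le_add (hf.2 y hy) (hg.2 y hy))⟩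
  induction m generalizing f g with
  | zero => exact hb hf hg
  | succ m ih =>
    refine ⟨hb hf.1 hg.1, fun j => ?_⟩
    obtain ⟨f', hf', hwf⟩ := hf.2 j
    obtain ⟨g', hg', hwg⟩ := hg.2 j
    exact ⟨_, hD.add j _ _ _ _ hf' hg', ih hwf hwg⟩

theorem RadonControl.WordBound.mul (hD : IsDerivationRel D) (hC : 0 ≤ C) (hC' : 0 ≤ C')
    (hf : WordBound D A C m f) (hg : WordBound D A C' m g) :
    WordBound D A (2 ^ m * (C * C')) m fun y => f y * g y := by
  have hb : ∀ {f g : Y → ℝ} (k : ℕ), BoundedCont A C f → BoundedCont A C' g →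
      BoundedCont A (2 ^ k * (C * C')) fun y => f y * g y := fun k hf hg =>
    ⟨hf.1.mul hg.1, fun y hy => by
      rw [abs_mul]
      refine (mul_le_mul (hf.2 y hy) (hg.2 y hy) (abs_nonneg _) hC).trans ?_
      exact le_mul_of_one_le_left (by positivity) (one_le_pow₀ one_le_two)⟩
  induction m generalizing f g with
  | zero => exact hb 0 hf hg
  | succ m ih =>
    refine ⟨hb _ hf.1 hg.1, fun j => ?_⟩
    obtain ⟨f', hf', hwf⟩ := hf.2 j
    obtain ⟨g', hg', hwg⟩ := hg.2 j
    refine ⟨_, hD.mul j _ _ _ _ hf' hg', ?_⟩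
    have := (ih hwf hg.of_succ).add hD (ih hf.of_succ hwg)
    convert this using 1
    ring

theorem RadonControl.WordBound.sum (hD : IsDerivationRel D) {κ : Type*} (s : Finset κ)
    {F : κ → Y → ℝ}
    (hF : ∀ i ∈ s, WordBound D A C m (F i)) :
    WordBound D A (s.card * C) m fun y => ∑ i ∈ s, F i y := by
  classical
  induction s using Finset.induction_on with
  | empty => simpa using WordBound.const (C := 0) (k := 0) hD (by simp)
  | insert a s ha ih =>
    have := (hF a (by simp)).add hD (ih fun i hi => hF i (by simp [hi]))
    simp only [Finset.sum_insert ha, Finset.card_insert_of_notMem ha]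
    refine this.mono_const (le_of_eq ?_)
    push_cast; ring

end WordBound

/-! ### Multi-parameter balls -/

section CCBall

variable {n ν q : ℕ}

theorem mpow_smul (τ : ℝ) (δ : Fin ν → ℝ) (d : Fin ν → ℕ) :
    mpow (τ • δ) d = τ ^ (∑ μ, d μ) * mpow δ d := by
  simp [mpow, mul_pow, Finset.prod_mul_distrib, Finset.prod_pow_eq_pow_sum]

theorem mpow_add (δ : Fin ν → ℝ) (d d' : Fin ν → ℕ) : mpow δ (d + d') = mpow δ d * mpow δ d' := by
  simp [mpow, pow_add, Finset.prod_mul_distrib]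

theorem mpow_nonneg {δ : Fin ν → ℝ} (hδ : δ ∈ Icc (0 : Fin ν → ℝ) 1) (d : Fin ν → ℕ) :
    0 ≤ mpow δ d :=
  Finset.prod_nonneg fun μ _ => pow_nonneg (hδ.1 μ) _

theorem mpow_le_one {δ : Fin ν → ℝ} (hδ : δ ∈ Icc (0 : Fin ν → ℝ) 1) (d : Fin ν → ℕ) :
    mpow δ d ≤ 1 :=
  Finset.prod_le_one (fun μ _ => pow_nonneg (hδ.1 μ) _) fun μ _ => pow_le_one₀ (hδ.1 μ) (hδ.2 μ)

theorem scaled_smul (X : Fin q → FormalVF n ν) (τ : ℝ) (δ : Fin ν → ℝ) (j : Fin q) (x : Euc n) :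
    scaled X (τ • δ) j x = τ ^ (∑ μ, (X j).2 μ) • scaled X δ j x := by
  simp [scaled, mpow_smul, smul_smul]

theorem continuousOn_scaled {X : Fin q → FormalVF n ν} {Ω : Set (Euc n)}
    (hX : ∀ j, ContDiffOn ℝ ∞ (X j).1 Ω) (δ : Fin ν → ℝ) (j : Fin q) :
    ContinuousOn (scaled X δ j) Ω :=
  (hX j).continuousOn.const_smul (mpow δ (X j).2)

theorem contDiffOn_scaled {X : Fin q → FormalVF n ν} {Ω : Set (Euc n)}
    (hX : ∀ j, ContDiffOn ℝ ∞ (X j).1 Ω) (δ : Fin ν → ℝ) (j : Fin q) :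
    ContDiffOn ℝ ∞ (scaled X δ j) Ω :=
  (hX j).const_smul _

theorem ccBall_mono {X : Fin q → FormalVF n ν} {Ω Ω' : Set (Euc n)} (hΩ : Ω' ⊆ Ω) {τ τ' : ℝ}
    (hτ' : 0 < τ') (hτ : τ' ≤ τ) (x₀ : Euc n) (δ : Fin ν → ℝ) :
    ccBall Ω' X x₀ (τ' • δ) ⊆ ccBall Ω X x₀ (τ • δ) := by
  intro y hy
  obtain ⟨c, a, M, hM, h, h0, h1, haM⟩ := mem_unitBall_iff.1 hy
  have hτ0 : 0 < τ := hτ'.trans_le hτ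
  let a' : ℝ → Euc q := fun s => WithLp.toLp 2 fun j => (τ' / τ) ^ (∑ μ, (X j).2 μ) * a s j
  have hle : ∀ s, ‖a' s‖ ≤ ‖a s‖ := by
    intro s
    rw [EuclideanSpace.norm_eq, EuclideanSpace.norm_eq]
    refine Real.sqrt_le_sqrt (Finset.sum_le_sum fun j _ => ?_)
    have : ‖a' s j‖ ≤ ‖a s j‖ := by
      simp only [a', norm_mul, Real.norm_eq_abs]
      refine mul_le_of_le_one_left (abs_nonneg _) ?_
      rw [abs_of_nonneg (by positivity)]
      exact pow_le_one₀ (by positivity) ((div_le_one hτ0).2 hτ)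
    gcongr
  have ha'm : Measurable a' := by
    refine (WithLp.measurable_toLp 2 _).comp (measurable_pi_lambda _ fun j => ?_)
    exact ((EuclideanSpace.proj (𝕜 := ℝ) j).continuous.measurable.comp h.meas).const_mul _
  refine mem_unitBall_iff.2 ⟨c, a', M, hM, ⟨h.cont, fun s hs => hΩ (h.mem s hs), ha'm,
    fun s => (hle s).trans (h.bound s), fun s hs => ?_⟩, h0, h1, fun s => (hle s).trans (haM s)⟩
  rw [h.eq s hs]
  congr 1
  refine intervalIntegral.integral_congr fun r _ => ?_
  refine Finset.sum_congr rfl fun j _ => ?_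
  simp only [a', scaled_smul, smul_smul]
  congr 1
  rw [div_pow]
  field_simp

theorem ccBall_subset {X : Fin q → FormalVF n ν} {Ω : Set (Euc n)} {x₀ : Euc n} {δ : Fin ν → ℝ} :
    ccBall Ω X x₀ δ ⊆ Ω := unitBall_subset

theorem self_mem_ccBall {X : Fin q → FormalVF n ν} {Ω : Set (Euc n)} {x₀ : Euc n} (hx : x₀ ∈ Ω)
    {δ : Fin ν → ℝ} : x₀ ∈ ccBall Ω X x₀ δ := self_mem_unitBall hx

theorem eventually_mem_ccBall {X : Fin q → FormalVF n ν} {Ω : Set (Euc n)} (hΩ : IsOpen Ω)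
    (hX : ∀ j, ContDiffOn ℝ ∞ (X j).1 Ω) {τ : ℝ} (hτ : 0 < τ) {δ : Fin ν → ℝ} {x₀ y : Euc n}
    (hy : y ∈ ccBall Ω X x₀ (τ • δ)) (k : Fin q) {φ : ℝ → Euc n} (hφ0 : φ 0 = y)
    (hφ : ∀ᶠ s in 𝓝 (0 : ℝ), HasDerivAt φ (scaled X δ k (φ s)) s) :
    ∀ᶠ s in 𝓝 (0 : ℝ), φ s ∈ ccBall Ω X x₀ (τ • δ) := by
  refine eventually_mem_unitBall hΩ (fun j => continuousOn_scaled hX _ j) hy k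
    (τ ^ (∑ μ, (X k).2 μ))⁻¹ hφ0 ?_
  filter_upwards [hφ] with s hs
  rw [scaled_smul, smul_smul, inv_mul_cancel₀ (by positivity), one_smul]
  exact hs

/-- The derivative along integral curves, at points of a subunit ball, of a vector field that is a
combination of given smooth fields on that ball. -/
theorem fderiv_apply_eq_of_isDerivAlong {X : Fin q → FormalVF n ν} {Ω : Set (Euc n)}
    (hΩ : IsOpen Ω) (hX : ∀ j, ContDiffOn ℝ ∞ (X j).1 Ω) {τ : ℝ} (hτ : 0 < τ) {δ : Fin ν → ℝ}
    {x₀ : Euc n} (k : Fin q) {ι : Type*} [Fintype ι] {V : ι → Euc n → Euc n}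
    (hV : ∀ i, ContDiffOn ℝ ∞ (V i) Ω) {Q : Euc n → Euc n} (hQ : ContDiffOn ℝ ∞ Q Ω)
    {c g : ι → Euc n → ℝ} (hc : ∀ x ∈ ccBall Ω X x₀ (τ • δ), Q x = ∑ i, c i x • V i x)
    (hg : ∀ i, IsDerivAlong (scaled X δ k) (ccBall Ω X x₀ (τ • δ)) (c i) (g i))
    {x : Euc n} (hx : x ∈ ccBall Ω X x₀ (τ • δ)) :
    fderiv ℝ Q x (scaled X δ k x) =
      ∑ i, (g i x • V i x + c i x • fderiv ℝ (V i) x (scaled X δ k x)) := by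
  have hxΩ : x ∈ Ω := ccBall_subset hx
  have hsm : ContDiffAt ℝ 1 (scaled X δ k) x :=
    ((contDiffOn_scaled hX δ k).contDiffAt (hΩ.mem_nhds hxΩ)).of_le (by simp)
  obtain ⟨φ, h0, ε, hε, hφ⟩ :=
    hsm.exists_forall_mem_closedBall_exists_eq_forall_mem_Ioo_hasDerivAt₀ 0
  have hφ' : ∀ᶠ s in 𝓝 (0 : ℝ), HasDerivAt φ (scaled X δ k (φ s)) s := by
    filter_upwards [Ioo_mem_nhds (by linarith : 0 - ε < 0) (by linarith : (0 : ℝ) < 0 + ε)] with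
      s hs
    exact hφ s hs
  have hmem := eventually_mem_ccBall hΩ hX hτ hx k h0 hφ'
  have hd0 : HasDerivAt φ (scaled X δ k x) 0 := by
    have := hφ'.self_of_nhds
    rwa [h0] at this
  have comp : ∀ {F : Euc n → Euc n}, ContDiffOn ℝ ∞ F Ω →
      HasDerivAt (fun s => F (φ s)) (fderiv ℝ F x (scaled X δ k x)) 0 := by
    intro F hF
    have h1 : HasFDerivAt F (fderiv ℝ F x) (φ 0) := by
      rw [h0]
      exact ((hF.contDiffAt (hΩ.mem_nhds hxΩ)).differentiableAt (by simp)).hasFDerivAt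
    exact h1.comp_hasDerivAt 0 hd0
  have h1 := comp hQ
  have h2 : HasDerivAt (fun s => ∑ i, c i (φ s) • V i (φ s))
      (∑ i, (g i x • V i x + c i x • fderiv ℝ (V i) x (scaled X δ k x))) 0 := by
    refine HasDerivAt.fun_sum fun i _ => ?_
    have := (hg i x hx φ h0 hφ').smul (comp (hV i))
    rw [h0] at this
    rw [add_comm]
    exact this
  refine h1.unique (h2.congr_of_eventuallyEq ?_)
  filter_upwards [hmem] with s hs using hc _ hs

end CCBall

/-! ### Families of vector fields that are uniformly controlled by a list -/

/-- A vector field that depends on the scale `δ` and on a parameter `t ∈ ℝ^N`. -/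
abbrev Family (ν N n : ℕ) : Type := (Fin ν → ℝ) → Euc N × Euc n → Euc n

/-- The family `δ^d X`, which does not depend on `t`. -/
def fam {ν n : ℕ} (N : ℕ) (Z : FormalVF n ν) : Family ν N n := fun δ p => mpow δ Z.2 • Z.1 p.2

/-- The Lie bracket in the space variable. -/
noncomputable def Family.bracket {ν N n : ℕ} (Q Q' : Family ν N n) : Family ν N n := fun δ p =>
  VectorField.lieBracket ℝ (fun x => Q δ (p.1, x)) (fun x => Q' δ (p.1, x)) p.2

/-- The derivative in the direction of `t_i`. -/
noncomputable def Family.partialFst {ν N n : ℕ} (i : Fin N) (Q : Family ν N n) : Family ν N n :=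
  fun δ p => fderiv ℝ (Q δ) p (EuclideanSpace.single i (1 : ℝ), 0)

/-- The product of the balls of radius `r` in the spaces of the parameter and of the variable. -/
def cyl (N n : ℕ) (r : ℝ) : Set (Euc N × Euc n) :=
  Metric.ball (0 : Euc N) r ×ˢ Metric.ball (0 : Euc n) r

theorem isOpen_cyl {N n : ℕ} {r : ℝ} : IsOpen (cyl N n r) :=
  Metric.isOpen_ball.prod Metric.isOpen_ball

/-- The family is smooth, uniformly in the scale, on the balls of radius `r`. -/
def SmoothFam {ν N n : ℕ} (r : ℝ) (Q : Family ν N n) : Prop :=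
  ∀ δ ∈ Icc (0 : Fin ν → ℝ) 1, ContDiffOn ℝ ∞ (Q δ) (cyl N n r)

section Smooth

variable {ν N n : ℕ} {r : ℝ} {Q Q' : Family ν N n}

theorem SmoothFam.slice (hQ : SmoothFam r Q) {δ : Fin ν → ℝ} (hδ : δ ∈ Icc (0 : Fin ν → ℝ) 1)
    {t : Euc N} (ht : t ∈ Metric.ball (0 : Euc N) r) :
    ContDiffOn ℝ ∞ (fun x => Q δ (t, x)) (Metric.ball 0 r) :=
  (hQ δ hδ).comp (contDiff_prodMk_right t).contDiffOn fun _ hx => ⟨ht, hx⟩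

theorem SmoothFam.fderiv_slice (hQ : SmoothFam r Q) {δ : Fin ν → ℝ}
    (hδ : δ ∈ Icc (0 : Fin ν → ℝ) 1) {p : Euc N × Euc n} (hp : p ∈ cyl N n r) :
    fderiv ℝ (fun x => Q δ (p.1, x)) p.2 =
      (fderiv ℝ (Q δ) p).comp (ContinuousLinearMap.inr ℝ (Euc N) (Euc n)) := by
  have h1 : HasFDerivAt (Q δ) (fderiv ℝ (Q δ) p) (p.1, p.2) :=
    (((hQ δ hδ).contDiffAt (isOpen_cyl.mem_nhds hp)).differentiableAt (by simp)).hasFDerivAt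
  exact (h1.comp p.2 (hasFDerivAt_prodMk_right p.1 p.2)).fderiv

theorem SmoothFam.bracket (hQ : SmoothFam r Q) (hQ' : SmoothFam r Q') :
    SmoothFam r (Q.bracket Q') := by
  intro δ hδ
  have key : ∀ {P : Family ν N n}, SmoothFam r P → ContDiffOn ℝ ∞
      (fun p => (fderiv ℝ (P δ) p).comp (ContinuousLinearMap.inr ℝ (Euc N) (Euc n))) (cyl N n r) :=
    fun hP => ((hP δ hδ).fderiv_of_isOpen isOpen_cyl (by simp)).clm_comp contDiffOn_const
  refine (((key hQ').clm_apply (hQ δ hδ)).sub ((key hQ).clm_apply (hQ' δ hδ))).congr fun p hp => ?_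
  simp only [Family.bracket, VectorField.lieBracket, hQ.fderiv_slice hδ hp, hQ'.fderiv_slice hδ hp]

theorem SmoothFam.partialFst (hQ : SmoothFam r Q) (i : Fin N) : SmoothFam r (Q.partialFst i) :=
  fun δ hδ => ((hQ δ hδ).fderiv_of_isOpen isOpen_cyl (by simp)).clm_apply contDiffOn_const

theorem smoothFam_fam {Z : FormalVF n ν} (hZ : ContDiffOn ℝ ∞ Z.1 (Metric.ball 0 r)) :
    SmoothFam r (fam N Z) := fun δ _ =>
  (hZ.comp contDiff_snd.contDiffOn fun _ hp => hp.2).const_smul (mpow δ Z.2)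

theorem fam_bracket {Z Z' : FormalVF n ν} (hZ : ContDiffOn ℝ ∞ Z.1 (Metric.ball 0 r))
    (hZ' : ContDiffOn ℝ ∞ Z'.1 (Metric.ball 0 r)) (δ : Fin ν → ℝ) {p : Euc N × Euc n}
    (hp : p ∈ cyl N n r) :
    fam N (RadonControl.bracket Z Z') δ p = (fam N Z).bracket (fam N Z') δ p := by
  have h1 : ∀ {V : Euc n → Euc n}, ContDiffOn ℝ ∞ V (Metric.ball 0 r) → DifferentiableAt ℝ V p.2 :=
    fun hV => (hV.contDiffAt (Metric.isOpen_ball.mem_nhds hp.2)).differentiableAt (by simp)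
  have e1 := VectorField.lieBracket_const_smul_left (𝕜 := ℝ) (V := Z.1)
    (W := fun x => mpow δ Z'.2 • Z'.1 x) (c := mpow δ Z.2) (h1 hZ)
  have e2 := VectorField.lieBracket_const_smul_right (𝕜 := ℝ) (V := Z.1)
    (W := Z'.1) (c := mpow δ Z'.2) (h1 hZ')
  change _ = VectorField.lieBracket ℝ (mpow δ Z.2 • Z.1) (fun x => mpow δ Z'.2 • Z'.1 x) p.2
  rw [e1]
  change _ = mpow δ Z.2 • VectorField.lieBracket ℝ Z.1 (mpow δ Z'.2 • Z'.1) p.2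
  rw [e2, smul_smul, ← mpow_add]
  rfl

end Smooth

/-- The family `Q` is controlled by the list `X`: on the ball of radius `r` and at all scales it is
a combination of the scaled fields, with coefficients that have bounded derivatives along these.
In contrast to `Controls`, the coefficients may depend on the order of the derivatives. -/
structure Ctl {ν N n q : ℕ} (X : Fin q → FormalVF n ν) (r : ℝ) (Q : Family ν N n) : Prop where
  smooth : SmoothFam r Q
  coeff : ∀ m : ℕ, ∃ C : ℝ, 0 ≤ C ∧ ∀ δ ∈ Icc (0 : Fin ν → ℝ) 1,
    ∀ x₀ ∈ Metric.ball (0 : Euc n) r, ∀ t ∈ Metric.ball (0 : Euc N) r, ∃ c : Fin q → Euc n → ℝ,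
      (∀ x ∈ ccBall (Metric.ball 0 r) X x₀ (r • δ), Q δ (t, x) = ∑ j, c j x • scaled X δ j x) ∧
      ∀ j, WordBound (fun k => IsDerivAlong (scaled X δ k) (ccBall (Metric.ball 0 r) X x₀ (r • δ)))
        (ccBall (Metric.ball 0 r) X x₀ (r • δ)) C m (c j)

/-- The list `X` is smooth on the ball of radius `r` and controls there the brackets of its
entries. -/
structure IsClosedList {ν n q : ℕ} (N : ℕ) (X : Fin q → FormalVF n ν) (r : ℝ) : Prop where
  pos : 0 < r
  smooth : ∀ j, ContDiffOn ℝ ∞ (X j).1 (Metric.ball 0 r)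
  bracket : ∀ j k, Ctl X r (fam N (RadonControl.bracket (X j) (X k)))

namespace Ctl

variable {ν N n q : ℕ} {X : Fin q → FormalVF n ν} {r : ℝ} {Q Q' : Family ν N n}

theorem congr (hQ : Ctl X r Q) (h : ∀ δ ∈ Icc (0 : Fin ν → ℝ) 1, ∀ p ∈ cyl N n r, Q' δ p = Q δ p) :
    Ctl X r Q' where
  smooth δ hδ := (hQ.smooth δ hδ).congr (h δ hδ)
  coeff m := by
    obtain ⟨C, hC, H⟩ := hQ.coeff m
    refine ⟨C, hC, fun δ hδ x₀ hx₀ t ht => ?_⟩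
    obtain ⟨c, hc, hw⟩ := H δ hδ x₀ hx₀ t ht
    exact ⟨c, fun x hx => (h δ hδ (t, x) ⟨ht, ccBall_subset hx⟩).trans (hc x hx), hw⟩

theorem add (hQ : Ctl X r Q) (hQ' : Ctl X r Q') : Ctl X r (fun δ p => Q δ p + Q' δ p) where
  smooth δ hδ := (hQ.smooth δ hδ).add (hQ'.smooth δ hδ)
  coeff m := by
    obtain ⟨C, hC, H⟩ := hQ.coeff m
    obtain ⟨C', hC', H'⟩ := hQ'.coeff m
    refine ⟨C + C', by positivity, fun δ hδ x₀ hx₀ t ht => ?_⟩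
    obtain ⟨c, hc, hw⟩ := H δ hδ x₀ hx₀ t ht
    obtain ⟨c', hc', hw'⟩ := H' δ hδ x₀ hx₀ t ht
    refine ⟨fun j x => c j x + c' j x, fun x hx => ?_, fun j =>
      (hw j).add (isDerivationRel_isDerivAlong _ _) (hw' j)⟩
    rw [hc x hx, hc' x hx, ← Finset.sum_add_distrib]
    exact Finset.sum_congr rfl fun j _ => (add_smul _ _ _).symm

theorem smul (k : ℝ) (hQ : Ctl X r Q) : Ctl X r (fun δ p => k • Q δ p) where
  smooth δ hδ := (hQ.smooth δ hδ).const_smul k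
  coeff m := by
    obtain ⟨C, hC, H⟩ := hQ.coeff m
    refine ⟨2 ^ m * (|k| * C), by positivity, fun δ hδ x₀ hx₀ t ht => ?_⟩
    obtain ⟨c, hc, hw⟩ := H δ hδ x₀ hx₀ t ht
    have hD := isDerivationRel_isDerivAlong (scaled X δ) (ccBall (Metric.ball 0 r) X x₀ (r • δ))
    refine ⟨fun j x => k * c j x, fun x hx => ?_, fun j =>
      (WordBound.const hD le_rfl).mul hD (abs_nonneg k) hC (hw j)⟩
    rw [hc x hx, Finset.smul_sum]
    exact Finset.sum_congr rfl fun j _ => smul_smul _ _ _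

theorem zero : Ctl X r (fun _ _ => 0 : Family ν N n) where
  smooth _ _ := contDiffOn_const
  coeff m := ⟨0, le_rfl, fun δ _ x₀ _ _ _ => ⟨fun _ _ => 0, by simp, fun _ =>
    WordBound.const (isDerivationRel_isDerivAlong _ _) (by simp)⟩⟩

/-- Freezing the parameter at `t = 0`. -/
theorem freeze (hr : 0 < r) (hQ : Ctl X r Q) :
    Ctl X r (fun δ p => Q δ (0, p.2) : Family ν N n) where
  smooth δ hδ := (hQ.smooth.slice hδ (Metric.mem_ball_self hr)).comp contDiff_snd.contDiffOn
    fun _ hp => hp.2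
  coeff m := by
    obtain ⟨C, hC, H⟩ := hQ.coeff m
    exact ⟨C, hC, fun δ hδ x₀ hx₀ t _ => H δ hδ x₀ hx₀ 0 (Metric.mem_ball_self hr)⟩

/-- The fields that are controlled by a list are closed under brackets, provided that the list
controls the brackets of its entries. -/
theorem bracket (hX : IsClosedList N X r) (hQ : Ctl X r Q) (hQ' : Ctl X r Q') :
    Ctl X r (Q.bracket Q') where
  smooth := hQ.smooth.bracket hQ'.smooth
  coeff m := by
    obtain ⟨C, hC, H⟩ := hQ.coeff (m + 1)
    obtain ⟨C', hC', H'⟩ := hQ'.coeff (m + 1)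
    have hb := fun j k => (hX.bracket j k).coeff m
    choose K hK0 hK using hb
    obtain ⟨K', hK'⟩ : ∃ K', ∀ j k, K j k ≤ K' := by
      refine ⟨∑ j, ∑ k, K j k, fun j k => ?_⟩
      exact (Finset.single_le_sum (f := fun k => K j k) (fun k _ => hK0 j k)
        (Finset.mem_univ k)).trans
        (Finset.single_le_sum (f := fun j => ∑ k, K j k)
          (fun j _ => Finset.sum_nonneg fun k _ => hK0 j k) (Finset.mem_univ j))
    set L := max K' 0
    have hL : 0 ≤ L := le_max_right _ _
    refine ⟨q * (2 ^ m * (C * C') + 2 ^ m * (1 * (2 ^ m * (C' * C)))) +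
      q * (q * (2 ^ m * ((2 ^ m * (C * C')) * L))), by positivity, fun δ hδ x₀ hx₀ t ht => ?_⟩
    obtain ⟨c, hc, hw⟩ := H δ hδ x₀ hx₀ t ht
    obtain ⟨c', hc', hw'⟩ := H' δ hδ x₀ hx₀ t ht
    have hb := fun j k => hK j k δ hδ x₀ hx₀ t ht
    choose b hb hwb using hb
    set B := ccBall (Metric.ball 0 r) X x₀ (r • δ) with hB
    have hD := isDerivationRel_isDerivAlong (scaled X δ) B
    have hg : ∀ l k, ∃ g, IsDerivAlong (scaled X δ k) B (c l) g ∧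
      WordBound (fun k => IsDerivAlong (scaled X δ k) B) B C m g := fun l k => (hw l).2 k
    have hg' : ∀ l k, ∃ g, IsDerivAlong (scaled X δ k) B (c' l) g ∧
      WordBound (fun k => IsDerivAlong (scaled X δ k) B) B C' m g := fun l k => (hw' l).2 k
    choose g hg hwg using hg
    choose g' hg' hwg' using hg'
    refine ⟨fun i x => ∑ j, (c j x * g' i j x + (-1) * (c' j x * g i j x)) +
      ∑ j, ∑ l, (c j x * c' l x) * b j l i x, fun x hx => ?_, fun i => ?_⟩
    · have hxr : x ∈ Metric.ball 0 r := ccBall_subset hx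
      have hsc := contDiffOn_scaled hX.smooth δ
      have f1 : ∀ k, fderiv ℝ (fun x => Q δ (t, x)) x (scaled X δ k x) =
          ∑ i, (g i k x • scaled X δ i x + c i x • fderiv ℝ (scaled X δ i) x (scaled X δ k x)) :=
        fun k => fderiv_apply_eq_of_isDerivAlong Metric.isOpen_ball hX.smooth hX.pos k hsc
          (hQ.smooth.slice hδ ht) hc (fun i => hg i k) hx
      have f2 : ∀ k, fderiv ℝ (fun x => Q' δ (t, x)) x (scaled X δ k x) =
          ∑ i, (g' i k x • scaled X δ i x + c' i x • fderiv ℝ (scaled X δ i) x (scaled X δ k x)) :=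
        fun k => fderiv_apply_eq_of_isDerivAlong Metric.isOpen_ball hX.smooth hX.pos k hsc
          (hQ'.smooth.slice hδ ht) hc' (fun i => hg' i k) hx
      have f3 : ∀ j l, fderiv ℝ (scaled X δ l) x (scaled X δ j x) -
          fderiv ℝ (scaled X δ j) x (scaled X δ l x) = ∑ i, b j l i x • scaled X δ i x := by
        intro j l
        rw [← hb j l x hx, fam_bracket (hX.smooth j) (hX.smooth l) δ (p := (t, x)) ⟨ht, hxr⟩]
        rfl
      have f4 : Q.bracket Q' δ (t, x) =
          ∑ j, c j x • fderiv ℝ (fun x => Q' δ (t, x)) x (scaled X δ j x) -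
          ∑ j, c' j x • fderiv ℝ (fun x => Q δ (t, x)) x (scaled X δ j x) := by
        change fderiv ℝ (fun x => Q' δ (t, x)) x (Q δ (t, x)) -
          fderiv ℝ (fun x => Q δ (t, x)) x (Q' δ (t, x)) = _
        rw [hc x hx, hc' x hx]
        simp only [map_sum, map_smul]
      have f5 : ∑ j, c' j x • ∑ i, c i x • fderiv ℝ (scaled X δ i) x (scaled X δ j x) =
          ∑ j, c j x • ∑ l, c' l x • fderiv ℝ (scaled X δ j) x (scaled X δ l x) := by
        simp only [Finset.smul_sum]
        rw [Finset.sum_comm]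
        refine Finset.sum_congr rfl fun j _ => Finset.sum_congr rfl fun l _ => smul_comm _ _ _
      have f6 : ∑ j, c j x • ∑ l, c' l x • fderiv ℝ (scaled X δ l) x (scaled X δ j x) -
          ∑ j, c j x • ∑ l, c' l x • fderiv ℝ (scaled X δ j) x (scaled X δ l x) =
          ∑ i, (∑ j, ∑ l, (c j x * c' l x) * b j l i x) • scaled X δ i x := by
        rw [← Finset.sum_sub_distrib]
        simp only [← smul_sub, ← Finset.sum_sub_distrib, f3, Finset.sum_smul]
        simp only [Finset.smul_sum, smul_smul]
        refine Eq.trans ?_ Finset.sum_comm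
        refine Finset.sum_congr rfl fun j _ => Eq.trans ?_ Finset.sum_comm
        exact Finset.sum_congr rfl fun l _ => Finset.sum_congr rfl fun i _ => by rw [mul_assoc]
      rw [f4]
      simp only [f1, f2, Finset.sum_add_distrib, smul_add]
      rw [f5]
      rw [add_sub_add_comm, f6]
      simp only [add_smul, Finset.sum_add_distrib, Finset.sum_smul]
      congr 1
      simp only [Finset.smul_sum, smul_smul, neg_mul, one_mul, neg_smul, Finset.sum_neg_distrib]
      rw [← sub_eq_add_neg, Finset.sum_comm, Finset.sum_comm (f := fun j i => (c' j x * _) • _)]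
    · refine WordBound.add hD ?_ ?_
      · have := WordBound.sum hD Finset.univ fun j _ =>
          ((hw j).of_succ.mul hD hC hC' (hwg' i j)).add hD
          ((WordBound.const (C := 1) (k := -1) hD (by simp)).mul hD zero_le_one (by positivity)
            ((hw' j).of_succ.mul hD hC' hC (hwg i j)))
        simpa only [Finset.card_univ, Fintype.card_fin] using this
      · have := WordBound.sum hD Finset.univ fun j _ => WordBound.sum hD Finset.univ fun l _ =>
          ((hw j).of_succ.mul hD hC hC' (hw' l).of_succ).mul hD (by positivity) hL
            ((hwb j l i).mono_const ((hK' j l).trans (le_max_left _ _)))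
        simpa only [Finset.card_univ, Fintype.card_fin] using this

theorem dom (hQ : Ctl X r Q) : ∃ C : ℝ, 0 ≤ C ∧ ∀ δ ∈ Icc (0 : Fin ν → ℝ) 1,
    ∀ p ∈ cyl N n r, ∀ (ξ : Euc n →L[ℝ] ℝ) (M : ℝ), (∀ j, |ξ (scaled X δ j p.2)| ≤ M) →
      |ξ (Q δ p)| ≤ C * M := by
  obtain ⟨C, hC, H⟩ := hQ.coeff 0
  refine ⟨q * C, by positivity, fun δ hδ p hp ξ M hM => ?_⟩
  obtain ⟨c, hc, hw⟩ := H δ hδ p.2 hp.2 p.1 hp.1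
  have hmem := self_mem_ccBall (X := X) (δ := r • δ) hp.2
  have := hc p.2 hmem
  rw [show Q δ p = Q δ (p.1, p.2) from rfl, this, map_sum]
  calc |∑ j, ξ (c j p.2 • scaled X δ j p.2)| ≤ ∑ j : Fin q, C * M := by
        refine (Finset.abs_sum_le_sum_abs _ _).trans (Finset.sum_le_sum fun j _ => ?_)
        rw [map_smul, smul_eq_mul, abs_mul]
        exact mul_le_mul ((hw j).2 _ hmem) (hM j) (abs_nonneg _) hC
    _ = q * C * M := by simp [mul_assoc]

end Ctl

/-! ### Uniform control of the Taylor coefficients -/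

theorem eventually_ball {E : Type*} [NormedAddCommGroup E] {p : E → Prop}
    (h : ∀ᶠ x in 𝓝 (0 : E), p x) : ∀ᶠ r in 𝓝[>] (0 : ℝ), ∀ x ∈ Metric.ball (0 : E) r, p x := by
  obtain ⟨ε, hε, H⟩ := Metric.eventually_nhds_iff_ball.1 h
  filter_upwards [Ioc_mem_nhdsGT hε] with r hr x hx
  exact H x (Metric.ball_subset_ball hr.2 hx)

theorem eventually_cyl {N n : ℕ} {p : Euc N × Euc n → Prop}
    (h : ∀ᶠ x in 𝓝 (0 : Euc N × Euc n), p x) : ∀ᶠ r in 𝓝[>] (0 : ℝ), ∀ x ∈ cyl N n r, p x := by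
  filter_upwards [eventually_ball h] with r hr x hx
  refine hr x ?_
  rw [cyl, ball_prod_same] at hx
  exact hx

section Extract

variable {ν N n q : ℕ} {X : Fin q → FormalVF n ν}

/-- A control in the sense of `Controls` is a uniform control on all small balls. -/
theorem RadonControl.Controls.eventually_ctl {Z : FormalVF n ν} (h : Controls X Z)
    (hZ : ∀ᶠ x in 𝓝 (0 : Euc n), ContDiffAt ℝ ∞ Z.1 x) :
    ∀ᶠ r in 𝓝[>] (0 : ℝ), Ctl X r (fam N Z) := by
  obtain ⟨Ω, hΩ, hX, U, hU, h0U, hUΩ, τ, hτ, c, hc, hw⟩ := h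
  filter_upwards [eventually_ball (hU.eventually_mem h0U), eventually_ball hZ, Ioc_mem_nhdsGT hτ]
    with r hrU hrZ hr
  have hsub : ∀ x₀ δ, ccBall (Metric.ball 0 r) X x₀ (r • δ) ⊆ ccBall Ω X x₀ (τ • δ) :=
    fun x₀ δ => ccBall_mono (fun x hx => hUΩ (hrU x hx)) hr.1 hr.2 x₀ δ
  refine ⟨smoothFam_fam fun x hx => (hrZ x hx).contDiffWithinAt, fun m => ?_⟩
  obtain ⟨C, hC⟩ := hw m
  refine ⟨max C 0, le_max_right _ _, fun δ hδ x₀ hx₀ t _ => ⟨c x₀ δ, fun x hx => ?_, fun j => ?_⟩⟩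
  · exact hc x₀ (hrU x₀ hx₀) δ hδ x (hsub x₀ δ hx)
  · exact (hC x₀ (hrU x₀ hx₀) δ hδ j).mono (fun k f g hfg y hy => hfg y (hsub x₀ δ hy))
      (hsub x₀ δ) (le_max_left _ _)

theorem RadonControl.MixedBound.mono {Z : Fin q → Euc n → Euc n} {A A' : Set (Euc N)}
    {B B' : Set (Euc n)} {C C' : ℝ} (hA : A' ⊆ A) (hB : B' ⊆ B) (hC : C ≤ C') {m : ℕ}
    {c : Euc N × Euc n → ℝ} (h : MixedBound Z A B C m c) : MixedBound Z A' B' C' m c := by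
  induction m generalizing c with
  | zero => exact ⟨h.1.mono (prod_mono hA hB), fun y hy => (h.2 y (prod_mono hA hB hy)).trans hC⟩
  | succ m ih =>
    refine ⟨⟨h.1.1.mono (prod_mono hA hB), fun y hy => (h.1.2 y (prod_mono hA hB hy)).trans hC⟩,
      fun i => ?_, fun j => ?_⟩
    · obtain ⟨g, hg, hm⟩ := h.2.1 i
      exact ⟨g, fun t ht x hx => hg t (hA ht) x (hB hx), ih hm⟩
    · obtain ⟨g, hg, hw⟩ := h.2.2 j
      exact ⟨g, fun t ht y hy => hg t (hA ht) y (hB hy),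
        hw.mono (fun k f g hfg t ht y hy => hfg t (hA ht) y (hB hy)) (prod_mono hA hB) hC⟩

theorem RadonControl.MixedBound.wordBound {Z : Fin q → Euc n → Euc n} {A : Set (Euc N)}
    {B : Set (Euc n)} {C : ℝ} {m : ℕ} {c : Euc N × Euc n → ℝ} (h : MixedBound Z A B C m c) :
    WordBound (fun k => IsDerivAlongSnd (Z k) A B) (A ×ˢ B) C m c := by
  cases m with
  | zero => exact h
  | succ m => exact ⟨h.1, h.2.2⟩

theorem RadonControl.WordBound.slice {Z : Fin q → Euc n → Euc n} {A : Set (Euc N)}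
    {B : Set (Euc n)} {C : ℝ} {m : ℕ} {c : Euc N × Euc n → ℝ}
    (h : WordBound (fun k => IsDerivAlongSnd (Z k) A B) (A ×ˢ B) C m c) {t : Euc N} (ht : t ∈ A) :
    WordBound (fun k => IsDerivAlong (Z k) B) B C m (fun x => c (t, x)) := by
  have hb : ∀ {c : Euc N × Euc n → ℝ}, BoundedCont (A ×ˢ B) C c →
      BoundedCont B C fun x => c (t, x) := fun h =>
    ⟨h.1.comp (by fun_prop) fun x hx => ⟨ht, hx⟩, fun x hx => h.2 (t, x) ⟨ht, hx⟩⟩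
  induction m generalizing c with
  | zero => exact hb h
  | succ m ih =>
    refine ⟨hb h.1, fun j => ?_⟩
    obtain ⟨g, hg, hw⟩ := h.2 j
    exact ⟨_, hg t ht, ih hw⟩

/-- The analogue of `Ctl` with derivatives in the parameter as well. -/
structure MCtl (X : Fin q → FormalVF n ν) (r : ℝ) (Q : Family ν N n) : Prop where
  smooth : SmoothFam r Q
  coeff : ∀ m : ℕ, ∃ C : ℝ, 0 ≤ C ∧ ∀ δ ∈ Icc (0 : Fin ν → ℝ) 1,
    ∀ x₀ ∈ Metric.ball (0 : Euc n) r, ∃ c : Fin q → Euc N × Euc n → ℝ,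
      (∀ t ∈ Metric.ball (0 : Euc N) r, ∀ x ∈ ccBall (Metric.ball 0 r) X x₀ (r • δ),
        Q δ (t, x) = ∑ j, c j (t, x) • scaled X δ j x) ∧
      ∀ j, MixedBound (scaled X δ) (Metric.ball 0 r)
        (ccBall (Metric.ball 0 r) X x₀ (r • δ)) C m (c j)

theorem MCtl.ctl {r : ℝ} {Q : Family ν N n} (h : MCtl X r Q) : Ctl X r Q := by
  refine ⟨h.smooth, fun m => ?_⟩
  obtain ⟨C, hC, H⟩ := h.coeff m
  refine ⟨C, hC, fun δ hδ x₀ hx₀ t ht => ?_⟩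
  obtain ⟨c, hc, hw⟩ := H δ hδ x₀ hx₀
  exact ⟨fun j x => c j (t, x), hc t ht, fun j => (hw j).wordBound.slice ht⟩

theorem hasDerivAt_partial {Q : Euc N × Euc n → Euc n} {r : ℝ} (hQ : ContDiffOn ℝ ∞ Q (cyl N n r))
    (i : Fin N) {p : Euc N × Euc n} (hp : p ∈ cyl N n r) :
    HasDerivAt (fun s : ℝ => Q (p.1 + s • EuclideanSpace.single i (1 : ℝ), p.2))
      (fderiv ℝ Q p (EuclideanSpace.single i (1 : ℝ), 0)) 0 := by
  have h1 : HasFDerivAt Q (fderiv ℝ Q p)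
      (p.1 + (0 : ℝ) • EuclideanSpace.single i (1 : ℝ), p.2) := by
    rw [zero_smul, add_zero]
    exact ((hQ.contDiffAt (isOpen_cyl.mem_nhds hp)).differentiableAt (by simp)).hasFDerivAt
  have h2 : HasDerivAt (fun s : ℝ => (p.1 + s • EuclideanSpace.single i (1 : ℝ), p.2))
      (EuclideanSpace.single i (1 : ℝ), (0 : Euc n)) 0 := by
    have : HasDerivAt (fun s : ℝ => p.1 + s • EuclideanSpace.single i (1 : ℝ))
        ((1 : ℝ) • EuclideanSpace.single i (1 : ℝ)) 0 :=
      ((hasDerivAt_id (0 : ℝ)).smul_const _).const_add p.1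
    rw [one_smul] at this
    exact this.prodMk (hasDerivAt_const _ _)
  exact h1.comp_hasDerivAt (0 : ℝ) h2

theorem MCtl.partialFst {r : ℝ} {Q : Family ν N n} (h : MCtl X r Q) (i : Fin N) :
    MCtl X r (Q.partialFst i) := by
  refine ⟨h.smooth.partialFst i, fun m => ?_⟩
  obtain ⟨C, hC, H⟩ := h.coeff (m + 1)
  refine ⟨C, hC, fun δ hδ x₀ hx₀ => ?_⟩
  obtain ⟨c, hc, hw⟩ := H δ hδ x₀ hx₀
  choose g hg hm using fun j => (hw j).2.1 i
  refine ⟨g, fun t ht x hx => ?_, hm⟩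
  have h1 := hasDerivAt_partial (h.smooth δ hδ) i (p := (t, x)) ⟨ht, ccBall_subset hx⟩
  have h2 : HasDerivAt (fun s : ℝ => ∑ j, c j (t + s • EuclideanSpace.single i (1 : ℝ), x) •
      scaled X δ j x) (∑ j, g j (t, x) • scaled X δ j x) 0 :=
    HasDerivAt.fun_sum fun j _ => (hg j t ht x hx).smul_const _
  refine h1.unique (h2.congr_of_eventuallyEq ?_)
  have hcont : ContinuousAt (fun s : ℝ => t + s • EuclideanSpace.single i (1 : ℝ)) 0 := by fun_prop
  have : ∀ᶠ s in 𝓝 (0 : ℝ), t + s • EuclideanSpace.single i (1 : ℝ) ∈ Metric.ball (0 : Euc N) r :=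
    hcont.eventually (Metric.isOpen_ball.mem_nhds (by simpa using ht))
  filter_upwards [this] with s hs using hc _ hs x hx

/-! The dilated family `W(δt, x)`. -/

theorem norm_dilate_le (e : Fin N → Fin ν → ℕ) {δ : Fin ν → ℝ} (hδ : δ ∈ Icc (0 : Fin ν → ℝ) 1)
    (t : Euc N) : ‖dilate e δ t‖ ≤ ‖t‖ := by
  rw [EuclideanSpace.norm_eq, EuclideanSpace.norm_eq]
  refine Real.sqrt_le_sqrt (Finset.sum_le_sum fun j _ => ?_)
  have : ‖dilate e δ t j‖ ≤ ‖t j‖ := by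
    simp only [dilate, norm_mul, Real.norm_eq_abs]
    refine mul_le_of_le_one_left (abs_nonneg _) ?_
    rw [abs_of_nonneg (mpow_nonneg hδ _)]
    exact mpow_le_one hδ _
  gcongr

/-- The dilation as a continuous linear map. -/
noncomputable def dilateL (e : Fin N → Fin ν → ℕ) (δ : Fin ν → ℝ) : Euc N →L[ℝ] Euc N :=
  LinearMap.toContinuousLinearMap
    { toFun := dilate e δ
      map_add' := fun s t => by ext j; simp [dilate, mul_add]
      map_smul' := fun k t => by ext j; simp [dilate]; ring }

theorem dilateL_apply (e : Fin N → Fin ν → ℕ) (δ : Fin ν → ℝ) (t : Euc N) :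
    dilateL e δ t = dilate e δ t := rfl

theorem dilate_single (e : Fin N → Fin ν → ℕ) (δ : Fin ν → ℝ) (i : Fin N) :
    dilate e δ (EuclideanSpace.single i (1 : ℝ)) =
      mpow δ (e i) • EuclideanSpace.single i (1 : ℝ) := by
  ext j
  by_cases h : j = i
  · subst h; simp [dilate]
  · simp [dilate, h]

theorem dilate_mem_cyl (e : Fin N → Fin ν → ℕ) {δ : Fin ν → ℝ} (hδ : δ ∈ Icc (0 : Fin ν → ℝ) 1)
    {r : ℝ} {p : Euc N × Euc n} (hp : p ∈ cyl N n r) : (dilate e δ p.1, p.2) ∈ cyl N n r := by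
  refine ⟨?_, hp.2⟩
  have := hp.1
  rw [mem_ball_zero_iff] at this ⊢
  exact (norm_dilate_le e hδ _).trans_lt this

/-- The family `W(δt, x)`. -/
noncomputable def dilFam (e : Fin N → Fin ν → ℕ) (W : Euc N × Euc n → Euc n) : Family ν N n :=
  fun δ p => W (dilate e δ p.1, p.2)

theorem smoothFam_dilFam (e : Fin N → Fin ν → ℕ) {W : Euc N × Euc n → Euc n} {r : ℝ}
    (hW : ContDiffOn ℝ ∞ W (cyl N n r)) : SmoothFam r (dilFam e W) := by
  intro δ hδ
  have h1 : ContDiff ℝ ∞ fun p : Euc N × Euc n => (dilateL e δ p.1, p.2) :=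
    ((dilateL e δ).contDiff.comp contDiff_fst).prodMk contDiff_snd
  exact hW.comp h1.contDiffOn fun p hp => dilate_mem_cyl e hδ hp

theorem RadonControl.ControlsFamily.eventually_mctl {e : Fin N → Fin ν → ℕ}
    {W : Euc N × Euc n → Euc n} (h : ControlsFamily e X W)
    (hW : ∀ᶠ p in 𝓝 (0 : Euc N × Euc n), ContDiffAt ℝ ∞ W p) :
    ∀ᶠ r in 𝓝[>] (0 : ℝ), MCtl X r (dilFam e W) := by
  obtain ⟨Ω, hΩ, hX, U, hU, h0U, hUΩ, τ, hτ, ρ, hρ, c, hc, hw⟩ := h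
  filter_upwards [eventually_ball (hU.eventually_mem h0U), eventually_cyl hW, Ioc_mem_nhdsGT hτ,
    Ioc_mem_nhdsGT hρ] with r hrU hrW hr hr'
  have hsub : ∀ x₀ δ, ccBall (Metric.ball 0 r) X x₀ (r • δ) ⊆ ccBall Ω X x₀ (τ • δ) :=
    fun x₀ δ => ccBall_mono (fun x hx => hUΩ (hrU x hx)) hr.1 hr.2 x₀ δ
  have hsub' : Metric.ball (0 : Euc N) r ⊆ Metric.ball 0 ρ := Metric.ball_subset_ball hr'.2
  refine ⟨smoothFam_dilFam e fun p hp => (hrW p hp).contDiffWithinAt, fun m => ?_⟩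
  obtain ⟨C, hC⟩ := hw m
  refine ⟨max C 0, le_max_right _ _, fun δ hδ x₀ hx₀ => ⟨c x₀ δ, fun t ht x hx => ?_, fun j => ?_⟩⟩
  · exact hc x₀ (hrU x₀ hx₀) δ hδ t (hsub' ht) x (hsub x₀ δ hx)
  · exact (hC x₀ (hrU x₀ hx₀) δ hδ j).mono hsub' (hsub x₀ δ) (le_max_left _ _)

/-- The iterated derivative of `W` in the parameter directions of the list `L`. -/
noncomputable def listPartial (L : List (Fin N)) (W : Euc N × Euc n → Euc n) :
    Euc N × Euc n → Euc n :=
  L.foldr (fun i w p => fderiv ℝ w p (EuclideanSpace.single i (1 : ℝ), 0)) W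

theorem contDiffOn_listPartial {W : Euc N × Euc n → Euc n} {r : ℝ}
    (hW : ContDiffOn ℝ ∞ W (cyl N n r)) (L : List (Fin N)) :
    ContDiffOn ℝ ∞ (listPartial L W) (cyl N n r) := by
  induction L with
  | nil => exact hW
  | cons i L ih => exact (ih.fderiv_of_isOpen isOpen_cyl (by simp)).clm_apply contDiffOn_const

/-- The iterated derivative of a family in the parameter directions of the list `L`. -/
noncomputable def Family.listPartial (L : List (Fin N)) (Q : Family ν N n) : Family ν N n :=
  L.foldr (fun i Q => Q.partialFst i) Q

theorem MCtl.listPartial {r : ℝ} {Q : Family ν N n} (h : MCtl X r Q) (L : List (Fin N)) :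
    MCtl X r (Q.listPartial L) := by
  induction L with
  | nil => exact h
  | cons i L ih => exact ih.partialFst i

theorem listPartial_dilFam (e : Fin N → Fin ν → ℕ) {W : Euc N × Euc n → Euc n} {r : ℝ}
    (hW : ContDiffOn ℝ ∞ W (cyl N n r)) (L : List (Fin N)) {δ : Fin ν → ℝ}
    (hδ : δ ∈ Icc (0 : Fin ν → ℝ) 1) {p : Euc N × Euc n} (hp : p ∈ cyl N n r) :
    (dilFam e W).listPartial L δ p =
      mpow δ (L.map e).sum • _root_.listPartial L W (dilate e δ p.1, p.2) := by
  induction L generalizing p with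
  | nil => simp [Family.listPartial, _root_.listPartial, dilFam, mpow]
  | cons i L ih =>
    change fderiv ℝ ((dilFam e W).listPartial L δ) p (EuclideanSpace.single i (1 : ℝ), 0) = _
    have heq : (dilFam e W).listPartial L δ =ᶠ[𝓝 p] fun p =>
        mpow δ (L.map e).sum • _root_.listPartial L W (dilateL e δ p.1, p.2) := by
      filter_upwards [isOpen_cyl.mem_nhds hp] with p' hp' using ih hp'
    have hd : HasFDerivAt (_root_.listPartial L W) (fderiv ℝ (_root_.listPartial L W)
        (dilate e δ p.1, p.2)) (dilateL e δ p.1, p.2) :=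
      (((contDiffOn_listPartial hW L).contDiffAt
        (isOpen_cyl.mem_nhds (dilate_mem_cyl e hδ hp))).differentiableAt (by simp)).hasFDerivAt
    have h1 : HasFDerivAt (fun p : Euc N × Euc n => (dilateL e δ p.1, p.2))
        (((dilateL e δ).comp (ContinuousLinearMap.fst ℝ (Euc N) (Euc n))).prod
          (ContinuousLinearMap.snd ℝ (Euc N) (Euc n))) p :=
      (((dilateL e δ).comp (ContinuousLinearMap.fst ℝ (Euc N) (Euc n))).prod
          (ContinuousLinearMap.snd ℝ (Euc N) (Euc n))).hasFDerivAt
    have h2 := (hd.comp p h1).const_smul (mpow δ (L.map e).sum)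
    rw [heq.fderiv_eq]
    have h3 : fderiv ℝ (fun p : Euc N × Euc n =>
        mpow δ (L.map e).sum • _root_.listPartial L W (dilateL e δ p.1, p.2)) p = _ := h2.fderiv
    rw [h3]
    simp only [_root_.smul_apply, ContinuousLinearMap.comp_apply, ContinuousLinearMap.prod_apply,
      ContinuousLinearMap.coe_fst', ContinuousLinearMap.coe_snd', dilateL_apply, dilate_single]
    have h4 : ((mpow δ (e i) • EuclideanSpace.single i (1 : ℝ), (0 : Euc n)) : Euc N × Euc n) =
        mpow δ (e i) • (EuclideanSpace.single i (1 : ℝ), (0 : Euc n)) := by simp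
    rw [h4, map_smul, smul_smul, List.map_cons, List.sum_cons, mpow_add, mul_comm]
    rfl

/-- The list in which every index `i` occurs `α i` times. -/
def indexList (α : Fin N → ℕ) : List (Fin N) :=
  (List.finRange N).flatMap fun i => List.replicate (α i) i

theorem sum_map_indexList {M : Type*} [AddCommMonoid M] (e : Fin N → M) (α : Fin N → ℕ) :
    ((indexList α).map e).sum = ∑ i, α i • e i := by
  have h : ∀ l : List (Fin N), ((l.flatMap fun i => List.replicate (α i) i).map e).sum =
      (l.map fun i => α i • e i).sum := by
    intro l
    induction l with
    | nil => rfl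
    | cons i l ih => simp [ih]
  rw [indexList, h, ← List.ofFn_eq_map, List.sum_ofFn]

theorem iterPartial_eq_foldr (α : Fin N → ℕ) (f : Euc N → Euc n) :
    iterPartial α f = (indexList α).foldr partialDeriv f := by
  have h2 : ∀ (k : ℕ) (i : Fin N) (g : Euc N → Euc n),
      (List.replicate k i).foldr partialDeriv g = (partialDeriv i)^[k] g := by
    intro k i g
    induction k with
    | zero => rfl
    | succ k ih => rw [List.replicate_succ, List.foldr_cons, ih, Function.iterate_succ_apply']
  have h1 : ∀ l : List (Fin N), l.foldr (fun i g => (partialDeriv i)^[α i] g) f =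
      (l.flatMap fun i => List.replicate (α i) i).foldr partialDeriv f := by
    intro l
    induction l with
    | nil => rfl
    | cons i l ih => rw [List.foldr_cons, ih, List.flatMap_cons, List.foldr_append, h2]
  exact h1 _

theorem foldr_partialDeriv_eq {W : Euc N × Euc n → Euc n} {r : ℝ}
    (hW : ContDiffOn ℝ ∞ W (cyl N n r)) (L : List (Fin N)) {p : Euc N × Euc n}
    (hp : p ∈ cyl N n r) : L.foldr partialDeriv (fun t => W (t, p.2)) p.1 = listPartial L W p := by
  obtain ⟨t, x⟩ := p
  induction L generalizing t with
  | nil => rfl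
  | cons i L ih =>
    change lineDeriv ℝ (L.foldr partialDeriv fun t => W (t, x)) t _ = _
    have heq : L.foldr partialDeriv (fun t => W (t, x)) =ᶠ[𝓝 t] fun t =>
        listPartial L W (t, x) := by
      filter_upwards [Metric.isOpen_ball.mem_nhds hp.1] with t' ht' using ih t' ⟨ht', hp.2⟩
    rw [heq.lineDeriv_eq]
    exact (hasDerivAt_partial (contDiffOn_listPartial hW L) i hp).deriv

theorem taylorField_eq {W : Euc N × Euc n → Euc n} {r : ℝ} (hr : 0 < r)
    (hW : ContDiffOn ℝ ∞ W (cyl N n r)) (α : Fin N → ℕ) {x : Euc n} (hx : x ∈ Metric.ball 0 r) :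
    taylorField W α x =
      (∏ i, ((α i).factorial : ℝ))⁻¹ • listPartial (indexList α) W (0, x) := by
  rw [taylorField, iterPartial_eq_foldr,
    foldr_partialDeriv_eq hW (indexList α) (p := (0, x)) ⟨Metric.mem_ball_self hr, hx⟩]

theorem contDiffOn_taylorField {W : Euc N × Euc n → Euc n} {r : ℝ} (hr : 0 < r)
    (hW : ContDiffOn ℝ ∞ W (cyl N n r)) (α : Fin N → ℕ) :
    ContDiffOn ℝ ∞ (taylorField W α) (Metric.ball 0 r) := by
  have h1 : ContDiffOn ℝ ∞ (fun x : Euc n => (∏ i, ((α i).factorial : ℝ))⁻¹ •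
      listPartial (indexList α) W (0, x)) (Metric.ball 0 r) :=
    ((contDiffOn_listPartial hW (indexList α)).comp (contDiff_prodMk_right 0).contDiffOn
      fun x hx => ⟨Metric.mem_ball_self hr, hx⟩).const_smul _
  exact h1.congr fun x hx => taylorField_eq hr hW α hx

/-- The Taylor coefficients of a controlled family are controlled. -/
theorem MCtl.ctl_taylorField {e : Fin N → Fin ν → ℕ} {W : Euc N × Euc n → Euc n} {r : ℝ}
    (hr : 0 < r) (hW : ContDiffOn ℝ ∞ W (cyl N n r)) (h : MCtl X r (dilFam e W)) (α : Fin N → ℕ) :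
    Ctl X r (fam N (taylorField W α, degree e α)) := by
  refine (((h.listPartial (indexList α)).ctl.freeze hr).smul
    (∏ i, ((α i).factorial : ℝ))⁻¹).congr fun δ hδ p hp => ?_
  have h0 : ((0 : Euc N), p.2) ∈ cyl N n r := ⟨Metric.mem_ball_self hr, hp.2⟩
  have hd : dilate e δ 0 = 0 := (dilateL e δ).map_zero
  simp only [fam, taylorField_eq hr hW α hp.2, listPartial_dilFam e hW _ hδ h0, hd,
    sum_map_indexList, degree]
  exact smul_comm _ _ _

end Extract

/-! ### Transport of covectors along the flow of a field -/

/-- The integral curve of `f` starts at a point of the ball of half the radius and, as `f` is small,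
exists and stays in the ball for unit time. The bound on the derivative makes `f` Lipschitz. -/
theorem exists_integralCurve {E : Type*} [NormedAddCommGroup E] [NormedSpace ℝ E] [CompleteSpace E]
    {f : E → E} {r K : ℝ} (hf : DifferentiableOn ℝ f (Metric.ball 0 r))
    (hK : ∀ x ∈ Metric.ball (0 : E) r, ‖fderiv ℝ f x‖ ≤ K)
    (hL : ∀ x ∈ Metric.ball (0 : E) r, ‖f x‖ ≤ r / 4) {x : E}
    (hx : x ∈ Metric.ball (0 : E) (r / 2)) :
    ∃ c : ℝ → E, c 0 = x ∧ ∀ s ∈ Icc (0 : ℝ) 1, c s ∈ Metric.ball (0 : E) r ∧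
      HasDerivWithinAt c (f (c s)) (Icc 0 1) s := by
  have hr2 : ‖x‖ < r / 2 := mem_ball_zero_iff.1 hx
  have hr0 : 0 ≤ r / 4 := by linarith [norm_nonneg x]
  have hsub : Metric.closedBall x (r / 4) ⊆ Metric.ball 0 r := fun y hy => by
    rw [mem_ball_zero_iff]
    have := norm_le_norm_add_norm_sub' y x
    rw [mem_closedBall_iff_norm] at hy
    linarith
  have hlip : LipschitzOnWith (Real.toNNReal K) f (Metric.closedBall x (r / 4)) := by
    refine (convex_closedBall x _).lipschitzOnWith_of_nnnorm_fderiv_le (𝕜 := ℝ)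
      (fun y hy => hf.differentiableAt (Metric.isOpen_ball.mem_nhds (hsub hy))) fun y hy => ?_
    rw [← NNReal.coe_le_coe, coe_nnnorm]
    exact (hK y (hsub hy)).trans (Real.le_coe_toNNReal K)
  set a : NNReal := ⟨r / 4, hr0⟩
  have hP : IsPicardLindelof (fun _ => f) (⟨0, by simp⟩ : Icc (0 : ℝ) 1) x a 0 a
      (Real.toNNReal K) :=
    .of_time_independent (fun y hy => hL y (hsub hy)) hlip (by simp)
  obtain ⟨α, hα⟩ := ODE.FunSpace.exists_isFixedPt_next hP (Metric.mem_closedBall_self le_rfl)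
  have hmem : ∀ s, α.compProj s ∈ Metric.closedBall x (r / 4) := fun s =>
    α.compProj_mem_closedBall hP.mul_max_le
  have heq : ∀ s ∈ Icc (0 : ℝ) 1,
      α.compProj s = ODE.picard (fun _ => f) (0 : ℝ) x α.compProj s := by
    intro s hs
    conv_lhs => rw [← hα]
    rw [ODE.FunSpace.compProj_apply, ODE.FunSpace.next_apply, projIcc_of_mem _ hs]
  refine ⟨α.compProj, ?_, fun s hs => ⟨hsub (hmem s), ?_⟩⟩
  · rw [heq 0 (by simp)]
    simp [ODE.picard]
  · have hc : ContinuousOn (Function.uncurry fun _ : ℝ => f)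
        (Icc (0 : ℝ) 1 ×ˢ Metric.closedBall x (r / 4)) :=
      hlip.continuousOn.comp continuousOn_snd fun p hp => hp.2
    have := ODE.hasDerivWithinAt_picard_Icc (t₀ := 0) (by simp) hc
      α.continuous_compProj.continuousOn (fun t _ => hmem t) x hs
    exact this.congr heq (heq s hs)

/-- The field `δ^d Z`. -/
def atScale {n ν : ℕ} (δ : Fin ν → ℝ) (Z : FormalVF n ν) : Euc n → Euc n :=
  fun x => mpow δ Z.2 • Z.1 x

section Transport

variable {n ν : ℕ} {Ω : Set (Euc n)} {V Z : FormalVF n ν} {δ : Fin ν → ℝ}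

theorem contDiffOn_atScale (hZ : ContDiffOn ℝ ∞ Z.1 Ω) : ContDiffOn ℝ ∞ (atScale δ Z) Ω :=
  hZ.const_smul _

theorem contDiffOn_bracket (hΩ : IsOpen Ω) (hV : ContDiffOn ℝ ∞ V.1 Ω)
    (hZ : ContDiffOn ℝ ∞ Z.1 Ω) : ContDiffOn ℝ ∞ (bracket V Z).1 Ω :=
  ((hZ.fderiv_of_isOpen hΩ (by simp)).clm_apply hV).sub
    ((hV.fderiv_of_isOpen hΩ (by simp)).clm_apply hZ)

theorem lieBracket_atScale {x : Euc n} (hV : DifferentiableAt ℝ V.1 x)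
    (hZ : DifferentiableAt ℝ Z.1 x) :
    VectorField.lieBracket ℝ (atScale δ V) (atScale δ Z) x = atScale δ (bracket V Z) x := by
  change VectorField.lieBracket ℝ (mpow δ V.2 • V.1) (mpow δ Z.2 • Z.1) x = _
  rw [VectorField.lieBracket_const_smul_left hV,
    VectorField.lieBracket_const_smul_right hZ, smul_smul, ← mpow_add]
  rfl

/-- The covectors `ξ s` at the points `c s`, for `s ∈ [0,1]`, are transported by the flow of the
field `σ δ^d V`. -/
structure IsTransport (Ω : Set (Euc n)) (V : FormalVF n ν) (δ : Fin ν → ℝ) (σ : ℝ)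
    (c : ℝ → Euc n) (ξ : ℝ → Euc n →L[ℝ] ℝ) : Prop where
  mem : ∀ s ∈ Icc (0 : ℝ) 1, c s ∈ Ω
  lipschitz : ∀ Z : FormalVF n ν, ContDiffOn ℝ ∞ Z.1 Ω →
    ∃ L : NNReal, LipschitzOnWith L (fun s => ξ s (atScale δ Z (c s))) (Icc 0 1)
  deriv : ∀ Z : FormalVF n ν, ContDiffOn ℝ ∞ Z.1 Ω → ∀ᵐ s, s ∈ Icc (0 : ℝ) 1 →
    HasDerivAt (fun s => ξ s (atScale δ Z (c s)))
      (σ * ξ s (atScale δ (bracket V Z) (c s))) s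

/-- Flow out along `σ δ^d V`, viewed as a subunit curve of a list with one entry, and transport the
covector `η` along it. -/
theorem exists_isTransport {r K : ℝ} (hV : ContDiffOn ℝ ∞ V.1 (Metric.ball 0 r))
    (hK : ∀ x ∈ Metric.ball (0 : Euc n) r, ‖V.1 x‖ ≤ K)
    (hK' : ∀ x ∈ Metric.ball (0 : Euc n) r, ‖fderiv ℝ V.1 x‖ ≤ K)
    (hδ : δ ∈ Icc (0 : Fin ν → ℝ) 1) {σ : ℝ} (hσ : 0 ≤ σ) (hσr : σ * K ≤ r / 4)
    (hσ1 : σ * K < 1) {x : Euc n} (hx : x ∈ Metric.ball (0 : Euc n) (r / 2))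
    (η : Euc n →L[ℝ] ℝ) :
    ∃ c ξ, c 0 = x ∧ ξ 0 = η ∧ IsTransport (Metric.ball 0 r) V δ σ c ξ := by
  have hr : 0 < r := by linarith [(norm_nonneg x).trans_lt (mem_ball_zero_iff.1 hx)]
  have hK0 : 0 ≤ K := (norm_nonneg _).trans (hK 0 (Metric.mem_ball_self hr))
  have hm0 := mpow_nonneg hδ V.2
  have hm1 := mpow_le_one hδ V.2
  have hmK : ∀ {u : ℝ}, 0 ≤ u → u ≤ K → ‖σ‖ * (‖mpow δ V.2‖ * u) ≤ σ * K := by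
    intro u hu0 hu
    rw [Real.norm_of_nonneg hσ, Real.norm_of_nonneg hm0]
    exact mul_le_mul_of_nonneg_left ((mul_le_of_le_one_left hu0 hm1).trans hu) hσ
  let f : Euc n → Euc n := fun x => σ • atScale δ V x
  have hf : ContDiffOn ℝ ∞ f (Metric.ball 0 r) := (contDiffOn_atScale hV).const_smul σ
  have hVd : ∀ y ∈ Metric.ball (0 : Euc n) r, DifferentiableAt ℝ V.1 y := fun y hy =>
    (hV.contDiffAt (Metric.isOpen_ball.mem_nhds hy)).differentiableAt (by simp)
  have hfd : ∀ y ∈ Metric.ball (0 : Euc n) r,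
      fderiv ℝ f y = σ • mpow δ V.2 • fderiv ℝ V.1 y := fun y hy =>
    (((hVd y hy).hasFDerivAt.const_smul (mpow δ V.2)).const_smul σ).fderiv
  have hfK : ∀ y ∈ Metric.ball (0 : Euc n) r, ‖f y‖ ≤ σ * K := fun y hy => by
    simp only [f, atScale, norm_smul]
    exact hmK (norm_nonneg _) (hK y hy)
  have hfK' : ∀ y ∈ Metric.ball (0 : Euc n) r, ‖fderiv ℝ f y‖ ≤ σ * K := fun y hy => by
    rw [hfd y hy, norm_smul, norm_smul]
    exact hmK (norm_nonneg _) (hK' y hy)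
  obtain ⟨c, hc0, hc⟩ := exists_integralCurve (hf.differentiableOn (by simp)) hfK'
    (fun y hy => (hfK y hy).trans hσr) hx
  have hcc : ContinuousOn c (Icc 0 1) := fun s hs => (hc s hs).2.continuousWithinAt
  have hS : IsSubunit (Metric.ball 0 r) (fun _ : Fin 1 => f) c
      (fun _ => EuclideanSpace.single 0 1) := by
    refine ⟨hcc, fun s hs => (hc s hs).1, measurable_const, by simp, fun s hs => ?_⟩
    have hI : ∫ t in (0 : ℝ)..s, f (c t) = c s - c 0 := by
      refine intervalIntegral.integral_eq_sub_of_hasDerivAt_of_le hs.1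
        (hcc.mono (Icc_subset_Icc_right hs.2)) (fun t ht => ?_) ?_
      · exact (hc t ⟨ht.1.le, ht.2.le.trans hs.2⟩).2.hasDerivAt
          (Icc_mem_nhds ht.1 (ht.2.trans_le hs.2))
      · refine ContinuousOn.intervalIntegrable ?_
        rw [uIcc_of_le hs.1]
        exact (hf.continuousOn.comp hcc fun t ht => (hc t ht).1).mono (Icc_subset_Icc_right hs.2)
    simp [hI]
  obtain ⟨ξ, -, hξ0, hξ⟩ := hS.exists_transport Metric.isOpen_ball (fun _ => hf)
    (mul_nonneg hσ hK0) (by simpa using hσ1) (fun _ => hfK) (fun _ => hfK')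
    (σ := 0) (by simp) η
  refine ⟨c, ξ, hc0, hξ0, fun s hs => (hc s hs).1, fun Z hZ => (hξ _ (contDiffOn_atScale hZ)).1,
    fun Z hZ => ?_⟩
  filter_upwards [(hξ _ (contDiffOn_atScale (δ := δ) hZ)).2] with s hs hmem
  refine (hs hmem).congr_deriv ?_
  have hy := (hc s hmem).1
  have hZd : DifferentiableAt ℝ Z.1 (c s) :=
    (hZ.contDiffAt (Metric.isOpen_ball.mem_nhds hy)).differentiableAt (by simp)
  have : VectorField.lieBracket ℝ f (atScale δ Z) (c s) = σ • atScale δ (bracket V Z) (c s) := by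
    change VectorField.lieBracket ℝ (σ • atScale δ V) (atScale δ Z) (c s) = _
    rw [VectorField.lieBracket_const_smul_left (V := atScale δ V)
        ((hVd _ hy).const_smul (mpow δ V.2)),
      lieBracket_atScale (hVd _ hy) hZd]
  simp [this]

namespace IsTransport

variable {σ : ℝ} {c : ℝ → Euc n} {ξ : ℝ → Euc n →L[ℝ] ℝ}

theorem abs_sub_le (h : IsTransport Ω V δ σ c ξ) (hσ : 0 ≤ σ) (hZ : ContDiffOn ℝ ∞ Z.1 Ω) {K : ℝ}
    (hK : ∀ s ∈ Icc (0 : ℝ) 1, |ξ s (atScale δ (bracket V Z) (c s))| ≤ K) {s : ℝ}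
    (hs : s ∈ Icc (0 : ℝ) 1) :
    |ξ s (atScale δ Z (c s)) - ξ 0 (atScale δ Z (c 0))| ≤ σ * K := by
  obtain ⟨L, hL⟩ := h.lipschitz Z hZ
  have hK0 : 0 ≤ K := (abs_nonneg _).trans (hK 0 (by simp))
  refine (abs_sub_le_of_ae_deriv_le hL (h.deriv Z hZ) (a := 0) (by simp) hs (K := σ * K)
    fun t ht => ?_).trans ?_
  · rw [abs_mul, abs_of_nonneg hσ]
    exact mul_le_mul_of_nonneg_left (hK t ht) hσ
  · refine mul_le_of_le_one_right (by positivity) ?_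
    rw [sub_zero, _root_.abs_le]; constructor <;> linarith [hs.1, hs.2]

/-- Taylor expansion of a pairing along the flow; its derivatives are pairings with iterated
brackets. -/
theorem taylor_le (h : IsTransport Ω V δ σ c ξ) (hΩ : IsOpen Ω) (hσ : 0 ≤ σ)
    (hV : ContDiffOn ℝ ∞ V.1 Ω) (hZ : ContDiffOn ℝ ∞ Z.1 Ω) {K : ℝ} (M : ℕ)
    (hK : ∀ s ∈ Icc (0 : ℝ) 1, |ξ s (atScale δ ((bracket V)^[M] Z) (c s))| ≤ K) {s : ℝ}
    (hs : s ∈ Icc (0 : ℝ) 1) :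
    |ξ s (atScale δ Z (c s))| ≤
      ∑ j ∈ Finset.range M, σ ^ j * |ξ 0 (atScale δ ((bracket V)^[j] Z) (c 0))| + K * σ ^ M := by
  induction M generalizing Z s with
  | zero => simpa using hK s hs
  | succ M ih =>
    have h1 := h.abs_sub_le hσ hZ (fun t ht => ih (contDiffOn_bracket hΩ hV hZ) hK ht) hs
    have h2 := abs_sub_abs_le_abs_sub (ξ s (atScale δ Z (c s))) (ξ 0 (atScale δ Z (c 0)))
    rw [Finset.sum_range_succ']
    have h3 : σ * (∑ j ∈ Finset.range M, σ ^ j *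
        |ξ 0 (atScale δ ((bracket V)^[j] (bracket V Z)) (c 0))| + K * σ ^ M) =
        ∑ j ∈ Finset.range M, σ ^ (j + 1) *
        |ξ 0 (atScale δ ((bracket V)^[j + 1] Z) (c 0))| + K * σ ^ (M + 1) := by
      rw [mul_add, Finset.mul_sum]
      congr 1
      · refine Finset.sum_congr rfl fun j _ => ?_
        rw [Function.iterate_succ_apply]; ring
      · ring
    rw [h3] at h1
    simp only [pow_zero, one_mul, Function.iterate_zero, id_eq]
    linarith

/-- An interpolation inequality: a bracket is controlled by the values of `Z` at both ends of the
flow. -/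
theorem mul_abs_bracket_le (h : IsTransport Ω V δ σ c ξ) (hΩ : IsOpen Ω) (hσ : 0 ≤ σ)
    (hV : ContDiffOn ℝ ∞ V.1 Ω) (hZ : ContDiffOn ℝ ∞ Z.1 Ω) {K : ℝ}
    (hK : ∀ s ∈ Icc (0 : ℝ) 1, |ξ s (atScale δ ((bracket V)^[2] Z) (c s))| ≤ K) :
    σ * |ξ 0 (atScale δ (bracket V Z) (c 0))| ≤
      |ξ 1 (atScale δ Z (c 1))| + |ξ 0 (atScale δ Z (c 0))| + K * σ ^ 2 := by
  have hK0 : 0 ≤ K := (abs_nonneg _).trans (hK 0 (by simp))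
  set b := ξ 0 (atScale δ (bracket V Z) (c 0)) with hb
  obtain ⟨L, hL⟩ := h.lipschitz Z hZ
  have hlin : LipschitzOnWith (Real.toNNReal |σ * b|) (fun s : ℝ => s * (σ * b)) (Icc 0 1) := by
    refine LipschitzOnWith.of_dist_le_mul fun s _ t _ => ?_
    rw [Real.dist_eq, Real.dist_eq, ← sub_mul, abs_mul, mul_comm,
      Real.coe_toNNReal _ (abs_nonneg _)]
  have hd : ∀ᵐ s, s ∈ Icc (0 : ℝ) 1 → HasDerivAt
      (fun s => ξ s (atScale δ Z (c s)) - s * (σ * b))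
      (σ * (ξ s (atScale δ (bracket V Z) (c s)) - b)) s := by
    filter_upwards [h.deriv Z hZ] with s hs hmem
    refine ((hs hmem).sub ((hasDerivAt_id s).mul_const (σ * b))).congr_deriv ?_
    ring
  have h1 := abs_sub_le_of_ae_deriv_le (hL.sub hlin) hd (a := 0) (b := 1) (by simp) (by simp)
    (K := σ * (σ * K)) fun t ht => by
      rw [abs_mul, abs_of_nonneg hσ]
      exact mul_le_mul_of_nonneg_left
        (h.abs_sub_le hσ (contDiffOn_bracket hΩ hV hZ) hK ht) hσ
  simp only [one_mul, zero_mul, sub_zero, abs_one, mul_one] at h1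
  have h2 : σ * |b| = |σ * b| := by rw [abs_mul, abs_of_nonneg hσ]
  rw [h2]
  have h3 := abs_le.1 h1
  have h4 := abs_le.1 (le_refl |ξ 1 (atScale δ Z (c 1))|)
  have h5 := abs_le.1 (le_refl |ξ 0 (atScale δ Z (c 0))|)
  rw [_root_.abs_le]
  constructor <;> nlinarith

/-- A finite family of fields that dominates its brackets with `V` changes at most by a factor two
in short time. -/
theorem abs_le_two {q : ℕ} {X : Fin q → FormalVF n ν} (h : IsTransport Ω V δ σ c ξ) (hσ : 0 ≤ σ)
    (hX : ∀ j, ContDiffOn ℝ ∞ (X j).1 Ω) {C : ℝ} (hσC : σ * C ≤ 1 / 2)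
    (hdom : ∀ s ∈ Icc (0 : ℝ) 1, ∀ M : ℝ, 0 ≤ M → (∀ j, |ξ s (atScale δ (X j) (c s))| ≤ M) →
      ∀ j, |ξ s (atScale δ (bracket V (X j)) (c s))| ≤ C * M)
    (h0 : ∀ j, |ξ 0 (atScale δ (X j) (c 0))| ≤ 1) {s : ℝ} (hs : s ∈ Icc (0 : ℝ) 1) (j : Fin q) :
    |ξ s (atScale δ (X j) (c s))| ≤ 2 := by
  have hbd : ∀ j, ∃ B : ℝ, ∀ s ∈ Icc (0 : ℝ) 1, |ξ s (atScale δ (X j) (c s))| ≤ B := by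
    intro j
    obtain ⟨L, hL⟩ := h.lipschitz _ (hX j)
    exact isCompact_Icc.exists_bound_of_continuousOn hL.continuousOn
  choose B hB using hbd
  obtain ⟨B', hB'⟩ : ∃ B', ∀ j, B j ≤ B' :=
    ⟨∑ j, |B j|, fun j => (le_abs_self _).trans
      (Finset.single_le_sum (f := fun j => |B j|) (fun _ _ => abs_nonneg _) (Finset.mem_univ j))⟩
  have hall : ∀ k : ℕ, ∀ s ∈ Icc (0 : ℝ) 1, ∀ j,
      |ξ s (atScale δ (X j) (c s))| ≤ 2 + (1 / 2) ^ k * |B'| := by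
    intro k
    induction k with
    | zero =>
      intro s hs j
      linarith [hB j s hs, hB' j, le_abs_self B', pow_zero (1 / 2 : ℝ)]
    | succ k ih =>
      intro s hs j
      have hM : 0 ≤ 2 + (1 / 2 : ℝ) ^ k * |B'| := by positivity
      have h1 := h.abs_sub_le hσ (hX j) (fun t ht => hdom t ht _ hM (ih t ht) j) hs
      have h2 := abs_sub_abs_le_abs_sub (ξ s (atScale δ (X j) (c s))) (ξ 0 (atScale δ (X j) (c 0)))
      have h3 : σ * (C * (2 + (1 / 2 : ℝ) ^ k * |B'|)) ≤ 1 / 2 * (2 + (1 / 2 : ℝ) ^ k * |B'|) := by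
        rw [← mul_assoc]
        exact mul_le_mul_of_nonneg_right hσC hM
      rw [pow_succ]
      linarith [h0 j]
  have hlim : Tendsto (fun k : ℕ => 2 + (1 / 2 : ℝ) ^ k * |B'|) atTop (𝓝 (2 + 0 * |B'|)) :=
    ((tendsto_pow_atTop_nhds_zero_of_lt_one (by norm_num) (by norm_num)).mul_const _).const_add _
  have := ge_of_tendsto' hlim fun k => hall k s hs j
  simpa using this

end IsTransport

end Transport

/-! ### Pointwise domination and its improvement by transport -/

section Dominates

variable {n ν q : ℕ}

/-- Near `0` and uniformly in the scale, a covector that is small on the fields of `S` is small on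
`Z`; that is, `Z` is a combination of fields of `S` with bounded coefficients. -/
def Dominates (S : Set (FormalVF n ν)) (Z : FormalVF n ν) : Prop :=
  ∃ C : ℝ, 0 ≤ C ∧ ∀ᶠ x in 𝓝 (0 : Euc n), ∀ δ ∈ Icc (0 : Fin ν → ℝ) 1, ∀ (ξ : Euc n →L[ℝ] ℝ)
    (M : ℝ), 0 ≤ M → (∀ Y ∈ S, |ξ (atScale δ Y x)| ≤ M) → |ξ (atScale δ Z x)| ≤ C * M

theorem Dominates.mono {S S' : Set (FormalVF n ν)} {Z : FormalVF n ν} (hS : S ⊆ S')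
    (h : Dominates S Z) : Dominates S' Z := by
  obtain ⟨C, hC, H⟩ := h
  refine ⟨C, hC, ?_⟩
  filter_upwards [H] with x hx δ hδ ξ M hM hY
  exact hx δ hδ ξ M hM fun Y hYS => hY Y (hS hYS)

theorem Dominates.of_mem {S : Set (FormalVF n ν)} {Z : FormalVF n ν} (hZ : Z ∈ S) :
    Dominates S Z :=
  ⟨1, zero_le_one, Eventually.of_forall fun x δ _ ξ M _ h => by simpa using h Z hZ⟩

theorem Set.Finite.exists_uniform_const {α : Type*} {s : Set α} (hs : s.Finite) {P : α → ℝ → Prop}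
    (hP : ∀ a ∈ s, ∀ C C', C ≤ C' → P a C → P a C') (h : ∀ a ∈ s, ∃ C, P a C) :
    ∃ C, 0 ≤ C ∧ ∀ a ∈ s, P a C := by
  choose! C hC using h
  obtain ⟨B, hB⟩ := (hs.image C).bddAbove
  exact ⟨max B 0, le_max_right _ _, fun a ha =>
    hP a ha _ _ ((hB (mem_image_of_mem C ha)).trans (le_max_left _ _)) (hC a ha)⟩

theorem Dominates.trans {S T : Set (FormalVF n ν)} {Z : FormalVF n ν} (hT : T.Finite)
    (hZ : Dominates T Z) (h : ∀ Y ∈ T, Dominates S Y) : Dominates S Z := by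
  obtain ⟨K, hK, HK⟩ := hT.exists_uniform_const
    (P := fun Y C => ∀ᶠ x in 𝓝 (0 : Euc n), ∀ δ ∈ Icc (0 : Fin ν → ℝ) 1,
      ∀ (ξ : Euc n →L[ℝ] ℝ) (M : ℝ), 0 ≤ M → (∀ Y ∈ S, |ξ (atScale δ Y x)| ≤ M) →
        |ξ (atScale δ Y x)| ≤ C * M)
    (fun Y _ C C' hC H => by
      filter_upwards [H] with x hx δ hδ ξ M hM hY
      exact (hx δ hδ ξ M hM hY).trans (mul_le_mul_of_nonneg_right hC hM))
    (fun Y hY => by obtain ⟨C, -, H⟩ := h Y hY; exact ⟨C, H⟩)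
  obtain ⟨C, hC, HC⟩ := hZ
  refine ⟨C * K, by positivity, ?_⟩
  filter_upwards [HC, (Filter.eventually_all_finite hT).2 HK] with x hx hxK δ hδ ξ M hM hY
  rw [mul_assoc]
  exact hx δ hδ ξ (K * M) (by positivity) fun Y' hY' => hxK Y' hY' δ hδ ξ M hM hY

/-- A class of smooth germs that is closed under brackets and dominated by the list `X`. -/
structure IsDominatedClass (X : Fin q → FormalVF n ν) (A : Set (FormalVF n ν)) : Prop where
  bracket : ∀ {V Z}, V ∈ A → Z ∈ A → bracket V Z ∈ A
  smooth : ∀ {Z}, Z ∈ A → ∀ᶠ x in 𝓝 (0 : Euc n), ContDiffAt ℝ ∞ Z.1 x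
  dom : ∀ {Z}, Z ∈ A → Dominates (range X) Z

theorem IsDominatedClass.iterate_mem {X : Fin q → FormalVF n ν} {A : Set (FormalVF n ν)}
    (hA : IsDominatedClass X A) {V Z : FormalVF n ν} (hV : V ∈ A) (hZ : Z ∈ A) (m : ℕ) :
    (RadonControl.bracket V)^[m] Z ∈ A := by
  induction m with
  | zero => exact hZ
  | succ m ih => rw [Function.iterate_succ_apply']; exact hA.bracket hV ih

/-- Short-time transport along the flow of `V`, with estimates for finitely many fields `Z`. -/
theorem IsDominatedClass.exists_transport {X : Fin q → FormalVF n ν} {A : Set (FormalVF n ν)}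
    (hA : IsDominatedClass X A) (hX : ∀ j, X j ∈ A) {V : FormalVF n ν} (hV : V ∈ A)
    {T : Set (FormalVF n ν)} (hT : T.Finite) (hTA : T ⊆ A) (m : ℕ) {P : Euc n → Prop}
    (hP : ∀ᶠ x in 𝓝 (0 : Euc n), P x) :
    ∃ K σ₀ : ℝ, 0 ≤ K ∧ 0 < σ₀ ∧ ∀ᶠ x in 𝓝 (0 : Euc n), ∀ δ ∈ Icc (0 : Fin ν → ℝ) 1,
      ∀ ξ : Euc n →L[ℝ] ℝ, (∀ j, |ξ (atScale δ (X j) x)| ≤ 1) → ∀ σ ∈ Icc (0 : ℝ) σ₀,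
      ∃ (x' : Euc n) (ξ' : Euc n →L[ℝ] ℝ), P x' ∧ (∀ j, |ξ' (atScale δ (X j) x')| ≤ 2) ∧
        ∀ Z ∈ T, |ξ' (atScale δ Z x')| ≤ ∑ j ∈ Finset.range m,
            σ ^ j * |ξ (atScale δ ((RadonControl.bracket V)^[j] Z) x)| + K * σ ^ m ∧
          σ * |ξ (atScale δ (RadonControl.bracket V Z) x)| ≤
            |ξ' (atScale δ Z x')| + |ξ (atScale δ Z x)| + K * σ ^ 2 := by
  -- bounds for `V` and its derivative
  obtain ⟨L, hL0, hL⟩ : ∃ L : ℝ, 0 ≤ L ∧ ∀ᶠ x in 𝓝 (0 : Euc n), ‖V.1 x‖ ≤ L ∧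
      ‖fderiv ℝ V.1 x‖ ≤ L := by
    have h0 := (hA.smooth hV).self_of_nhds
    have h1 := h0.continuousAt.norm.eventually_le_const (lt_add_one ‖V.1 0‖)
    have h2 := ((h0.fderiv_right (m := ∞) (by simp)).continuousAt).norm.eventually_le_const
      (lt_add_one ‖fderiv ℝ V.1 0‖)
    refine ⟨max (‖V.1 0‖ + 1) (‖fderiv ℝ V.1 0‖ + 1), by positivity, ?_⟩
    filter_upwards [h1, h2] with x hx1 hx2
    exact ⟨hx1.trans (le_max_left _ _), hx2.trans (le_max_right _ _)⟩
  obtain ⟨C, hC, HC⟩ := (finite_range X).exists_uniform_const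
    (P := fun Y C => ∀ᶠ x in 𝓝 (0 : Euc n), ∀ δ ∈ Icc (0 : Fin ν → ℝ) 1,
      ∀ (ξ : Euc n →L[ℝ] ℝ) (M : ℝ), 0 ≤ M → (∀ Y ∈ range X, |ξ (atScale δ Y x)| ≤ M) →
        |ξ (atScale δ (RadonControl.bracket V Y) x)| ≤ C * M)
    (fun Y _ C C' hC H => by
      filter_upwards [H] with x hx δ hδ ξ M hM hY
      exact (hx δ hδ ξ M hM hY).trans (mul_le_mul_of_nonneg_right hC hM))
    (by
      rintro _ ⟨j, rfl⟩
      obtain ⟨C, -, H⟩ := hA.dom (hA.bracket hV (hX j)); exact ⟨C, H⟩)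
  have key : ∀ k : ℕ, ∃ K, 0 ≤ K ∧ ∀ Z ∈ T, ∀ᶠ x in 𝓝 (0 : Euc n), ∀ δ ∈ Icc (0 : Fin ν → ℝ) 1,
      ∀ (ξ : Euc n →L[ℝ] ℝ) (M : ℝ), 0 ≤ M → (∀ Y ∈ range X, |ξ (atScale δ Y x)| ≤ M) →
        |ξ (atScale δ ((RadonControl.bracket V)^[k] Z) x)| ≤ K * M := fun k =>
    hT.exists_uniform_const
      (fun Y _ C C' hC H => by
        filter_upwards [H] with x hx δ hδ ξ M hM hY
        exact (hx δ hδ ξ M hM hY).trans (mul_le_mul_of_nonneg_right hC hM))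
      (fun Z hZ => by
        obtain ⟨C, -, H⟩ := hA.dom (hA.iterate_mem hV (hTA hZ) k); exact ⟨C, H⟩)
  obtain ⟨K₁, hK₁, HK₁⟩ := key m
  obtain ⟨K₂, hK₂, HK₂⟩ := key 2
  have hsm : ∀ᶠ x in 𝓝 (0 : Euc n), ContDiffAt ℝ ∞ V.1 x ∧ (∀ j, ContDiffAt ℝ ∞ (X j).1 x) ∧
      ∀ Z ∈ T, ContDiffAt ℝ ∞ Z.1 x :=
    (hA.smooth hV).and ((eventually_all.2 fun j => hA.smooth (hX j)).and
      ((Filter.eventually_all_finite hT).2 fun Z hZ => hA.smooth (hTA hZ)))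
  obtain ⟨r, hr, hball⟩ := Metric.eventually_nhds_iff_ball.1 (hP.and (hL.and (hsm.and
    (((Filter.eventually_all_finite (finite_range X)).2 HC).and
    (((Filter.eventually_all_finite hT).2 HK₁).and ((Filter.eventually_all_finite hT).2 HK₂))))))
  set σ₀ : ℝ := min (r / (4 * (L + 1))) (min (1 / (2 * (L + 1))) (1 / (2 * (C + 1)))) with hσ₀
  refine ⟨2 * K₁ + 2 * K₂, σ₀, by positivity, by positivity, ?_⟩
  filter_upwards [Metric.ball_mem_nhds (0 : Euc n) (half_pos hr)] with x hx δ hδ ξ hξ σ hσ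
  have hs1 : σ * (L + 1) ≤ r / 4 := by
    have := hσ.2.trans (min_le_left _ _)
    rw [le_div_iff₀ (by positivity)] at this
    linarith
  have hs2 : σ * (L + 1) ≤ 1 / 2 := by
    have := hσ.2.trans ((min_le_right _ _).trans (min_le_left _ _))
    rw [le_div_iff₀ (by positivity)] at this
    linarith
  have hs3 : σ * (C + 1) ≤ 1 / 2 := by
    have := hσ.2.trans ((min_le_right _ _).trans (min_le_right _ _))
    rw [le_div_iff₀ (by positivity)] at this
    linarith
  have hVs : ContDiffOn ℝ ∞ V.1 (Metric.ball 0 r) := fun y hy =>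
    (hball y hy).2.2.1.1.contDiffWithinAt
  have hXs : ∀ j, ContDiffOn ℝ ∞ (X j).1 (Metric.ball 0 r) := fun j y hy =>
    ((hball y hy).2.2.1.2.1 j).contDiffWithinAt
  have hTs : ∀ Z ∈ T, ContDiffOn ℝ ∞ Z.1 (Metric.ball 0 r) := fun Z hZ y hy =>
    ((hball y hy).2.2.1.2.2 Z hZ).contDiffWithinAt
  obtain ⟨c, η, hc0, hη0, h⟩ := exists_isTransport hVs (fun y hy => (hball y hy).2.1.1)
    (fun y hy => (hball y hy).2.1.2) hδ hσ.1 (by nlinarith [hσ.1]) (by nlinarith [hσ.1]) hx ξ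
  have hb : ∀ s ∈ Icc (0 : ℝ) 1, ∀ Y ∈ range X, |η s (atScale δ Y (c s))| ≤ 2 := by
    rintro s hs _ ⟨j, rfl⟩
    refine h.abs_le_two hσ.1 hXs (C := C) (by nlinarith [hσ.1]) (fun s hs M hM hj i => ?_)
      (by rw [hc0, hη0]; exact hξ) hs j
    refine (hball _ (h.mem s hs)).2.2.2.1 _ (mem_range_self i) δ hδ _ M hM ?_
    rintro _ ⟨j, rfl⟩
    exact hj j
  refine ⟨c 1, η 1, (hball _ (h.mem 1 (by simp))).1,
    fun j => hb 1 (by simp) _ (mem_range_self j), fun Z hZ => ⟨?_, ?_⟩⟩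
  · have := h.taylor_le Metric.isOpen_ball hσ.1 hVs (hTs Z hZ) (K := 2 * K₁) m (fun s hs => by
      rw [mul_comm]
      exact (hball _ (h.mem s hs)).2.2.2.2.1 Z hZ δ hδ _ 2 (by norm_num) (hb s hs))
      (s := 1) (by simp)
    rw [hc0, hη0] at this
    have h2 : 0 ≤ σ ^ m := pow_nonneg hσ.1 m
    nlinarith
  · have := h.mul_abs_bracket_le Metric.isOpen_ball hσ.1 hVs (hTs Z hZ)
      (K := 2 * K₂) (fun s hs => by
      rw [mul_comm]
      exact (hball _ (h.mem s hs)).2.2.2.2.2 Z hZ δ hδ _ 2 (by norm_num) (hb s hs))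
    rw [hc0, hη0] at this
    have h2 : 0 ≤ σ ^ 2 := pow_nonneg hσ.1 2
    nlinarith

/-- A weak (Hölder) form of domination by finitely many fields of `𝓛`, for covectors that are
normalized on the list `X`. -/
def WeaklyDominates (X : Fin q → FormalVF n ν) (𝓛 : Set (FormalVF n ν)) (k : ℕ)
    (Z : FormalVF n ν) : Prop :=
  ∃ T : Set (FormalVF n ν), T.Finite ∧ T ⊆ 𝓛 ∧ ∃ C : ℝ, 0 ≤ C ∧ ∀ᶠ x in 𝓝 (0 : Euc n),
    ∀ δ ∈ Icc (0 : Fin ν → ℝ) 1, ∀ ξ : Euc n →L[ℝ] ℝ, (∀ j, |ξ (atScale δ (X j) x)| ≤ 1) →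
      ∀ M : ℝ, 0 ≤ M → (∀ Y ∈ T, |ξ (atScale δ Y x)| ≤ M) → |ξ (atScale δ Z x)| ^ k ≤ C * M

theorem add_pow_le_two_pow_mul {a b : ℝ} (ha : 0 ≤ a) (hb : 0 ≤ b) (k : ℕ) :
    (a + b) ^ k ≤ 2 ^ k * (a ^ k + b ^ k) := by
  refine (add_pow_le ha hb k).trans ?_
  gcongr
  · exact one_le_two
  · omega

/-- Bracketing on the left with a field of `𝓛` keeps weak domination, with twice the exponent:
transport the covector along `Y` for a time proportional to its value on `[Y, Z]`. -/
theorem WeaklyDominates.bracket_left {X : Fin q → FormalVF n ν} {A 𝓛 : Set (FormalVF n ν)}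
    (hA : IsDominatedClass X A) (hX : ∀ j, X j ∈ A) (h𝓛A : 𝓛 ⊆ A)
    (h𝓛 : ∀ V ∈ 𝓛, ∀ Z ∈ 𝓛, RadonControl.bracket V Z ∈ 𝓛) {Y Z : FormalVF n ν} (hY : Y ∈ 𝓛)
    (hZ : Z ∈ A) {k : ℕ} (hk : 1 ≤ k) (h : WeaklyDominates X 𝓛 k Z) :
    WeaklyDominates X 𝓛 (2 * k) (RadonControl.bracket Y Z) := by
  obtain ⟨T, hTf, hT, C, hC, H⟩ := h
  obtain ⟨K, σ₀, hK, hσ₀, HT⟩ := hA.exists_transport hX (h𝓛A hY) (hTf.insert Z)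
    (insert_subset hZ (hT.trans h𝓛A)) (2 * k) H
  obtain ⟨G, hG, HG⟩ := hA.dom (hA.bracket (h𝓛A hY) hZ)
  -- the ratio between the time of the flow and the value of the covector on `[Y, Z]`
  set κ : ℝ := min (min 1 σ₀ / (G + 1))
      (min (1 / (2 * K + 1)) (1 / (2 * 8 ^ k * C * K + 1))) with hκ
  have hκ0 : 0 < κ := by positivity
  have hκ1 : κ * G ≤ min 1 σ₀ := by
    have : κ * (G + 1) ≤ min 1 σ₀ := by
      rw [← le_div_iff₀ (by positivity)]; exact min_le_left _ _
    linarith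
  have hκ2 : κ * K ≤ 1 / 2 := by
    have : κ ≤ 1 / (2 * K + 1) := (min_le_right _ _).trans (min_le_left _ _)
    rw [le_div_iff₀ (by positivity)] at this
    linarith
  have hκ3 : 8 ^ k * C * K * κ ^ k ≤ 1 / 2 := by
    have h1 : κ ≤ 1 / (2 * 8 ^ k * C * K + 1) := (min_le_right _ _).trans (min_le_right _ _)
    have h2 : κ ≤ 1 := h1.trans ((div_le_one (by positivity)).2 (by
      have : 0 ≤ 2 * 8 ^ k * C * K := by positivity
      linarith))
    have h3 : κ ^ k ≤ κ := pow_le_of_le_one hκ0.le h2 (by omega)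
    rw [le_div_iff₀ (by positivity)] at h1
    have h4 : 8 ^ k * C * K * κ ^ k ≤ 8 ^ k * C * K * κ := by gcongr
    linarith
  refine ⟨⋃ j ∈ Finset.range (2 * k), (RadonControl.bracket Y)^[j] '' T,
    (Finset.range (2 * k)).finite_toSet.biUnion fun j _ => hTf.image _, ?_,
    2 * (2 / κ) ^ k * (2 ^ k * (2 ^ k * C * (2 * k) + C)), by positivity, ?_⟩
  · have : ∀ j, ∀ Y' ∈ T, (RadonControl.bracket Y)^[j] Y' ∈ 𝓛 := by
      intro j Y' hY'
      induction j with
      | zero => exact hT hY'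
      | succ j ih => rw [Function.iterate_succ_apply']; exact h𝓛 _ hY _ ih
    refine iUnion₂_subset fun j _ => ?_
    rintro _ ⟨Y', hY', rfl⟩
    exact this j Y' hY'
  filter_upwards [H, HT, HG] with x hx hxT hxG δ hδ ξ hξ M hM hMY
  have hMY' : ∀ j < 2 * k, ∀ Y' ∈ T, |ξ (atScale δ ((RadonControl.bracket Y)^[j] Y') x)| ≤ M :=
    fun j hj Y' hY' => hMY _ (mem_iUnion₂.2 ⟨j, Finset.mem_range.2 hj, mem_image_of_mem _ hY'⟩)
  set g := |ξ (atScale δ (RadonControl.bracket Y Z) x)| with hg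
  have hg0 : 0 ≤ g := abs_nonneg _
  have hgG : g ≤ G := by
    have := hxG δ hδ ξ 1 zero_le_one (by rintro _ ⟨j, rfl⟩; exact hξ j)
    rwa [mul_one] at this
  have hσ0 : 0 ≤ κ * g := by positivity
  have hσ' : κ * g ≤ min 1 σ₀ := (mul_le_mul_of_nonneg_left hgG hκ0.le).trans hκ1
  have hσ1 : κ * g ≤ 1 := hσ'.trans (min_le_left _ _)
  obtain ⟨x', ξ', hx', hξ', hT'⟩ := hxT δ hδ ξ hξ (κ * g) ⟨hσ0, hσ'.trans (min_le_right _ _)⟩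
  set a := |ξ' (atScale δ Z x')| with ha
  set b := |ξ (atScale δ Z x)| with hb
  have ha0 : 0 ≤ a := abs_nonneg _
  have hb0 : 0 ≤ b := abs_nonneg _
  have hbk : b ^ k ≤ C * M := hx δ hδ ξ hξ M hM fun Y' hY' => hMY' 0 (by omega) Y' hY'
  have hhalf : ∀ v, |((1 / 2 : ℝ) • ξ') v| = 1 / 2 * |ξ' v| := fun v => by
    rw [_root_.smul_apply, smul_eq_mul, abs_mul]; norm_num
  have hak : (1 / 2 * a) ^ k ≤ C * (2 * k * M + K * (κ * g) ^ (2 * k)) := by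
    have := hx' δ hδ ((1 / 2 : ℝ) • ξ') (fun j => by rw [hhalf]; linarith [hξ' j])
      (2 * k * M + K * (κ * g) ^ (2 * k)) (by positivity) fun Y' hY' => ?_
    · rwa [hhalf] at this
    · rw [hhalf]
      have h1 := (hT' Y' (mem_insert_of_mem _ hY')).1
      have h2 : ∑ j ∈ Finset.range (2 * k), (κ * g) ^ j *
          |ξ (atScale δ ((RadonControl.bracket Y)^[j] Y') x)| ≤ ∑ j ∈ Finset.range (2 * k), M :=
        Finset.sum_le_sum fun j hj => (mul_le_of_le_one_left (abs_nonneg _)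
          (pow_le_one₀ hσ0 hσ1)).trans (hMY' j (Finset.mem_range.1 hj) Y' hY')
      simp only [Finset.sum_const, Finset.card_range, nsmul_eq_mul, Nat.cast_mul,
        Nat.cast_ofNat] at h2
      have h3 := abs_nonneg (ξ' (atScale δ Y' x'))
      linarith
  have hmain := (hT' Z (mem_insert _ _)).2
  have h1 : κ / 2 * g ^ 2 ≤ a + b := by
    have h2 : K * (κ * g) ^ 2 ≤ 1 / 2 * (κ * g ^ 2) := by
      have : K * (κ * g) ^ 2 = κ * K * (κ * g ^ 2) := by ring
      rw [this]
      exact mul_le_mul_of_nonneg_right hκ2 (by positivity)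
    have h3 : κ * g * g = κ * g ^ 2 := by ring
    rw [h3] at hmain
    linarith
  have h2 : (κ / 2) ^ k * g ^ (2 * k) ≤ 2 ^ k * (a ^ k + b ^ k) := by
    rw [pow_mul, ← mul_pow]
    exact (pow_le_pow_left₀ (by positivity) h1 k).trans (add_pow_le_two_pow_mul ha0 hb0 k)
  have h3 : a ^ k = 2 ^ k * (1 / 2 * a) ^ k := by rw [← mul_pow]; congr 1; ring
  have h4 : 2 ^ k * (2 ^ k * (C * (K * (κ * g) ^ (2 * k)))) ≤
      1 / 2 * ((κ / 2) ^ k * g ^ (2 * k)) := by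
    have e : (2 : ℝ) ^ k * (2 ^ k * (C * (K * (κ * g) ^ (2 * k)))) =
        (8 ^ k * C * K * κ ^ k) * ((κ / 2) ^ k * g ^ (2 * k)) := by
      rw [div_pow, mul_pow, pow_mul κ, show (8 : ℝ) = 2 * 2 * 2 by norm_num, mul_pow, mul_pow,
        ← pow_mul, mul_comm 2 k, pow_mul κ k 2]
      field_simp
    rw [e]
    exact mul_le_mul_of_nonneg_right hκ3 (by positivity)
  have h5 : (κ / 2) ^ k * g ^ (2 * k) ≤ 2 * (2 ^ k * (2 ^ k * C * (2 * k) + C)) * M := by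
    have h6 : (2 : ℝ) ^ k * (a ^ k + b ^ k) ≤
        2 ^ k * (2 ^ k * (C * (2 * k * M + K * (κ * g) ^ (2 * k))) + C * M) := by
      rw [h3]; gcongr
    nlinarith
  have h7 : g ^ (2 * k) = (2 / κ) ^ k * ((κ / 2) ^ k * g ^ (2 * k)) := by
    rw [← mul_assoc, ← mul_pow]
    have : 2 / κ * (κ / 2) = 1 := by field_simp
    rw [this, one_pow, one_mul]
  rw [h7]
  calc (2 / κ) ^ k * ((κ / 2) ^ k * g ^ (2 * k))
      ≤ (2 / κ) ^ k * (2 * (2 ^ k * (2 ^ k * C * (2 * k) + C)) * M) := by gcongr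
    _ = _ := by ring

/-- Bracketing on the left with a field `F` that is dominated by finitely many fields `Y` of `𝓛`
keeps weak domination, provided that the `[Y, Z]` are weakly dominated: transport along `Z`. -/
theorem WeaklyDominates.bracket_of_dominates {X : Fin q → FormalVF n ν} {A 𝓛 : Set (FormalVF n ν)}
    (hA : IsDominatedClass X A) (hX : ∀ j, X j ∈ A) (h𝓛A : 𝓛 ⊆ A) {F Z : FormalVF n ν}
    (hF : F ∈ A) (hZ : Z ∈ A) {S : Set (FormalVF n ν)} (hSf : S.Finite) (hS : S ⊆ 𝓛)
    (hSF : Dominates S F) {k : ℕ} (hk : 1 ≤ k)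
    (h : ∀ Y ∈ S, WeaklyDominates X 𝓛 k (RadonControl.bracket Y Z)) :
    WeaklyDominates X 𝓛 (2 * k) (RadonControl.bracket F Z) := by
  choose! T hTf hT H using h
  obtain ⟨C, hC, HC⟩ := hSf.exists_uniform_const
    (P := fun Y C => ∀ᶠ x in 𝓝 (0 : Euc n),
      ∀ δ ∈ Icc (0 : Fin ν → ℝ) 1, ∀ ξ : Euc n →L[ℝ] ℝ, (∀ j, |ξ (atScale δ (X j) x)| ≤ 1) →
      ∀ M : ℝ, 0 ≤ M → (∀ Y' ∈ T Y, |ξ (atScale δ Y' x)| ≤ M) →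
        |ξ (atScale δ (RadonControl.bracket Y Z) x)| ^ k ≤ C * M)
    (fun Y _ C C' hC H => by
      filter_upwards [H] with x hx δ hδ ξ hξ M hM hY
      exact (hx δ hδ ξ hξ M hM hY).trans (mul_le_mul_of_nonneg_right hC hM))
    (fun Y hY => by obtain ⟨C, -, HC⟩ := H Y hY; exact ⟨C, HC⟩)
  obtain ⟨D, hD, HD⟩ := hSF
  obtain ⟨K, σ₀, hK, hσ₀, HT⟩ := hA.exists_transport hX hZ (hSf.insert F)
    (insert_subset hF (hS.trans h𝓛A)) 2 HD
  obtain ⟨G, hG, HG⟩ := hA.dom (hA.bracket hF hZ)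
  -- as above, the time of the flow is `κ g`, with `g` the value of the covector on `[F, Z]`
  set κ : ℝ := min (σ₀ / (G + 1)) (1 / (2 * (D * K + K) + 1)) with hκ
  have hκ0 : 0 < κ := by positivity
  have hκ1 : κ * G ≤ σ₀ := by
    have : κ * (G + 1) ≤ σ₀ := by
      rw [← le_div_iff₀ (by positivity)]; exact min_le_left _ _
    linarith
  have hκ2 : κ * (D * K + K) ≤ 1 / 2 := by
    have : κ ≤ 1 / (2 * (D * K + K) + 1) := min_le_right _ _
    rw [le_div_iff₀ (by positivity)] at this
    linarith
  refine ⟨S ∪ ⋃ Y ∈ S, T Y, hSf.union (hSf.biUnion fun Y hY => hTf Y hY),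
    union_subset hS (iUnion₂_subset fun Y hY => hT Y hY),
    G ^ (2 * k) + 2 ^ k * ((8 * D / κ) ^ k + (4 * D ^ 2) ^ k * C ^ 2), by positivity, ?_⟩
  filter_upwards [HD, HT, HG, (Filter.eventually_all_finite hSf).2 HC, hA.smooth hF, hA.smooth hZ]
    with x hx hxT hxG hxC hFs hZs δ hδ ξ hξ M hM hMY
  have hswap : |ξ (atScale δ (RadonControl.bracket F Z) x)| =
      |ξ (atScale δ (RadonControl.bracket Z F) x)| := by
    have : atScale δ (RadonControl.bracket F Z) x = -atScale δ (RadonControl.bracket Z F) x := by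
      change mpow δ (F.2 + Z.2) • VectorField.lieBracket ℝ F.1 Z.1 x =
        -(mpow δ (Z.2 + F.2) • VectorField.lieBracket ℝ Z.1 F.1 x)
      rw [VectorField.lieBracket_swap, add_comm F.2]
      simp
    rw [this, map_neg, abs_neg]
  set g := |ξ (atScale δ (RadonControl.bracket F Z) x)| with hg
  have hg0 : 0 ≤ g := abs_nonneg _
  have hgG : g ≤ G := by
    have := hxG δ hδ ξ 1 zero_le_one (by rintro _ ⟨j, rfl⟩; exact hξ j)
    rwa [mul_one] at this
  -- for `M ≤ 1` all powers of `M` that occur are at most `M`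
  rcases lt_or_ge 1 M with hM1 | hM1
  · calc g ^ (2 * k) ≤ G ^ (2 * k) * 1 := by rw [mul_one]; gcongr
      _ ≤ _ := by
        gcongr
        have : 0 ≤ 2 ^ k * ((8 * D / κ) ^ k + (4 * D ^ 2) ^ k * C ^ 2) := by positivity
        linarith
  -- a bound for the values on the brackets `[Y, Z]`
  set η : ℝ := (C * M) ^ ((k : ℝ)⁻¹) with hη
  have hη0 : 0 ≤ η := by positivity
  have hηk : η ^ k = C * M := Real.rpow_inv_natCast_pow (by positivity) (by omega)
  have hbr : ∀ Y ∈ S, |ξ (atScale δ (RadonControl.bracket Z Y) x)| ≤ η := by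
    intro Y hY
    have h1 := hxC Y hY δ hδ ξ hξ M hM fun Y' hY' => hMY Y' (Or.inr (mem_iUnion₂.2 ⟨Y, hY, hY'⟩))
    rw [← hηk] at h1
    have h2 := le_of_pow_le_pow_left₀ (by omega) hη0 h1
    have : atScale δ (RadonControl.bracket Z Y) x = -atScale δ (RadonControl.bracket Y Z) x := by
      change mpow δ (Z.2 + Y.2) • VectorField.lieBracket ℝ Z.1 Y.1 x =
        -(mpow δ (Y.2 + Z.2) • VectorField.lieBracket ℝ Y.1 Z.1 x)
      rw [VectorField.lieBracket_swap, add_comm Z.2]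
      simp
    rwa [this, map_neg, abs_neg]
  have hσ0 : 0 ≤ κ * g := by positivity
  obtain ⟨x', ξ', hx', -, hT'⟩ := hxT δ hδ ξ hξ (κ * g)
    ⟨hσ0, (mul_le_mul_of_nonneg_left hgG hκ0.le).trans hκ1⟩
  have hF' : |ξ' (atScale δ F x')| ≤ D * (M + κ * g * η + K * (κ * g) ^ 2) := by
    refine hx' δ hδ ξ' _ (by positivity) fun Y hY => ?_
    have h1 := (hT' Y (mem_insert_of_mem _ hY)).1
    simp only [Finset.sum_range_succ, Finset.sum_range_zero, pow_zero, one_mul, zero_add, pow_one,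
      Function.iterate_zero, id_eq, Function.iterate_one] at h1
    have h2 := hMY Y (Or.inl hY)
    have h3 := mul_le_mul_of_nonneg_left (hbr Y hY) hσ0
    linarith
  have hFx : |ξ (atScale δ F x)| ≤ D * M := hx δ hδ ξ M hM fun Y hY => hMY Y (Or.inl hY)
  have hmain := (hT' F (mem_insert _ _)).2
  rw [← hswap] at hmain
  have h1 : g ^ 2 ≤ 8 * D / κ * M + 4 * D ^ 2 * η ^ 2 := by
    have h2 : (D * K + K) * (κ * g) ^ 2 ≤ 1 / 2 * (κ * g ^ 2) := by
      have : (D * K + K) * (κ * g) ^ 2 = κ * (D * K + K) * (κ * g ^ 2) := by ring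
      rw [this]
      exact mul_le_mul_of_nonneg_right hκ2 (by positivity)
    have h3 : κ * (g * (D * η)) ≤ κ * (g ^ 2 / 4 + (D * η) ^ 2) := by
      gcongr
      nlinarith [sq_nonneg (g / 2 - D * η)]
    have h4 : κ * g ^ 2 ≤ 8 * D * M + 4 * κ * (D * η) ^ 2 := by nlinarith
    have h5 : κ * (8 * D / κ * M + 4 * D ^ 2 * η ^ 2) = 8 * D * M + 4 * κ * (D * η) ^ 2 := by
      field_simp
    rw [← h5] at h4
    exact le_of_mul_le_mul_left h4 hκ0
  calc g ^ (2 * k) = (g ^ 2) ^ k := by rw [pow_mul]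
    _ ≤ (8 * D / κ * M + 4 * D ^ 2 * η ^ 2) ^ k := pow_le_pow_left₀ (by positivity) h1 k
    _ ≤ 2 ^ k * ((8 * D / κ * M) ^ k + (4 * D ^ 2 * η ^ 2) ^ k) :=
      add_pow_le_two_pow_mul (by positivity) (by positivity) k
    _ = 2 ^ k * ((8 * D / κ) ^ k * M ^ k + (4 * D ^ 2) ^ k * (C ^ 2 * M ^ 2)) := by
      rw [mul_pow, mul_pow (4 * D ^ 2), ← pow_mul η, mul_comm 2 k, pow_mul η, hηk, mul_pow C]
    _ ≤ 2 ^ k * ((8 * D / κ) ^ k * M + (4 * D ^ 2) ^ k * (C ^ 2 * M)) := by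
      gcongr
      · exact pow_le_of_le_one hM hM1 (by omega)
      · exact pow_le_of_le_one hM hM1 (by omega)
    _ = 2 ^ k * ((8 * D / κ) ^ k + (4 * D ^ 2) ^ k * C ^ 2) * M := by ring
    _ ≤ _ := by
      gcongr
      have : 0 ≤ G ^ (2 * k) := by positivity
      linarith

/-- If the fields of `S` are dominated by a finite set `𝒴`, then a list `X` of iterated brackets of
the fields of `S` is dominated by finitely many iterated brackets of the fields of `𝒴`, as long as
all these fields are dominated by `X`. -/
theorem IsDominatedClass.exists_dominates {X : Fin q → FormalVF n ν} {A S 𝒴 : Set (FormalVF n ν)}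
    (hA : IsDominatedClass X A) (hS : S ⊆ A) (hX : ∀ j, LieGen₀ S (X j)) (h𝒴f : 𝒴.Finite)
    (h𝒴 : 𝒴 ⊆ A) (hdom : ∀ F ∈ S, Dominates 𝒴 F) :
    ∃ T : Set (FormalVF n ν), T.Finite ∧ T ⊆ {Z | LieGen 𝒴 Z} ∧ ∀ j, Dominates T (X j) := by
  have hSA : ∀ Z, LieGen₀ S Z → Z ∈ A := by
    intro Z hZ
    induction hZ with
    | of Z hZ => exact hS hZ
    | bracket V Z hV _ ih => exact hA.bracket (hS hV) ih
  have h𝓛A : {Z | LieGen 𝒴 Z} ⊆ A := by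
    intro Z hZ
    induction hZ with
    | of Z hZ => exact h𝒴 hZ
    | bracket V Z _ _ ihV ihZ => exact hA.bracket ihV ihZ
  have hXA : ∀ j, X j ∈ A := fun j => hSA _ (hX j)
  have hweak : ∀ Z, LieGen₀ S Z → ∃ k, 1 ≤ k ∧ WeaklyDominates X {Z | LieGen 𝒴 Z} k Z := by
    intro Z hZ
    induction hZ with
    | of Z hZ =>
      obtain ⟨C, hC, H⟩ := hdom Z hZ
      refine ⟨1, le_rfl, 𝒴, h𝒴f, fun Y hY => LieGen.of Y hY, C, hC, ?_⟩
      filter_upwards [H] with x hx δ hδ ξ _ M hM hY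
      rw [pow_one]
      exact hx δ hδ ξ M hM hY
    | bracket V Z hV hZ ih =>
      obtain ⟨k, hk, h⟩ := ih
      refine ⟨2 * (2 * k), by omega, WeaklyDominates.bracket_of_dominates hA hXA h𝓛A (hS hV)
        (hSA Z hZ) h𝒴f (fun Y hY => LieGen.of Y hY) (hdom V hV) (by omega) fun Y hY => ?_⟩
      exact h.bracket_left hA hXA h𝓛A (fun V hV Z hZ => LieGen.bracket V Z hV hZ)
        (LieGen.of Y hY) (hSA Z hZ) hk
  choose k hk T hTf hT C hC H using fun j => hweak (X j) (hX j)
  refine ⟨⋃ j, T j, finite_iUnion hTf, iUnion_subset hT, fun j₀ => ?_⟩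
  refine ⟨∑ j, C j, Finset.sum_nonneg fun j _ => hC j, ?_⟩
  filter_upwards [eventually_all.2 H] with x hx δ hδ ξ M hM hY
  -- normalize the covector by its largest value on the list `X`
  obtain ⟨j₁, -, hj₁⟩ := Finset.exists_max_image Finset.univ
    (fun j => |ξ (atScale δ (X j) x)|) ⟨j₀, Finset.mem_univ _⟩
  set t := |ξ (atScale δ (X j₁) x)| with ht
  refine (hj₁ j₀ (Finset.mem_univ _)).trans ?_
  rcases (abs_nonneg (ξ (atScale δ (X j₁) x))).eq_or_lt with h0 | hpos
  · rw [ht, ← h0]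
    exact mul_nonneg (Finset.sum_nonneg fun j _ => hC j) hM
  have happ : ∀ v, |(t⁻¹ • ξ) v| = t⁻¹ * |ξ v| := fun v => by
    rw [_root_.smul_apply, smul_eq_mul, abs_mul, abs_of_pos (inv_pos.2 hpos)]
  have h1 := hx j₁ δ hδ (t⁻¹ • ξ) (fun j => by
    rw [happ, inv_mul_le_one₀ hpos]; exact hj₁ j (Finset.mem_univ _)) (t⁻¹ * M) (by positivity)
    fun Y hYT => by
      rw [happ]
      exact mul_le_mul_of_nonneg_left (hY Y (mem_iUnion.2 ⟨j₁, hYT⟩)) (inv_pos.2 hpos).le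
  rw [happ, ← ht, inv_mul_cancel₀ hpos.ne', one_pow] at h1
  have h2 : t ≤ C j₁ * M := by
    have h3 : t * 1 ≤ t * (C j₁ * (t⁻¹ * M)) := mul_le_mul_of_nonneg_left h1 hpos.le
    have h4 : t * (C j₁ * (t⁻¹ * M)) = C j₁ * M := by
      rw [mul_left_comm, ← mul_assoc t, mul_inv_cancel₀ hpos.ne', one_mul]
    rwa [h4, mul_one] at h3
  refine h2.trans (mul_le_mul_of_nonneg_right ?_ hM)
  exact Finset.single_le_sum (f := C) (fun j _ => hC j) (Finset.mem_univ j₁)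

end Dominates

/-! ### Frames on multi-parameter balls -/

theorem abs_le_two_mul_of_forall {α : Type*} {E : α → ℝ} {m : ℝ} (hb : ∃ B, ∀ a, |E a| ≤ B)
    (h : ∀ S, 0 ≤ S → (∀ a, |E a| ≤ S) → ∀ a, |E a| ≤ m + S / 2) (a : α) : |E a| ≤ 2 * m := by
  obtain ⟨B, hB⟩ := hb
  have hbdd : BddAbove (range fun a => |E a|) := ⟨B, by rintro _ ⟨a, rfl⟩; exact hB a⟩
  have : Nonempty α := ⟨a⟩
  have h1 : ⨆ a, |E a| ≤ m + (⨆ a, |E a|) / 2 :=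
    ciSup_le fun a => h _ ((abs_nonneg _).trans (le_ciSup hbdd a)) (fun a => le_ciSup hbdd a) a
  exact (le_ciSup hbdd a).trans (by linarith)

/-- A linearly independent finite family has a dual family of functionals. -/
theorem LinearIndependent.exists_dual {E ι : Type*} [NormedAddCommGroup E] [NormedSpace ℝ E]
    [FiniteDimensional ℝ E] [Fintype ι] [DecidableEq ι] {v : ι → E} (hv : LinearIndependent ℝ v) :
    ∃ θ : ι → E →L[ℝ] ℝ, ∀ i j, θ i (v j) = if i = j then 1 else 0 := by
  obtain ⟨g, hg⟩ := LinearMap.exists_leftInverse_of_injective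
    (Fintype.linearCombination ℝ v) (LinearMap.ker_eq_bot.2 hv.fintypeLinearCombination_injective)
  refine ⟨fun i => LinearMap.toContinuousLinearMap ((LinearMap.proj i).comp g), fun i j => ?_⟩
  have h1 : g (v j) = Pi.single j 1 := by
    have := LinearMap.congr_fun hg (Pi.single j 1)
    simpa using this
  simp [h1, Pi.single_apply]

/-- A finite family has a linearly independent subfamily in which all the members have coordinates
of absolute value at most one: maximize the determinant. -/
theorem exists_frame_of_finite {E : Type*} [NormedAddCommGroup E] [NormedSpace ℝ E]
    [FiniteDimensional ℝ E] {q : ℕ} (v : Fin q → E) :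
    ∃ (k : ℕ) (f : Fin k → Fin q), LinearIndependent ℝ (fun i => v (f i)) ∧
      ∀ l, ∃ a : Fin k → ℝ, (∀ i, |a i| ≤ 1) ∧ v l = ∑ i, a i • v (f i) := by
  set S := Submodule.span ℝ (range v) with hS
  set k := Module.finrank ℝ S with hk
  let b : Module.Basis (Fin k) ℝ S := Module.finBasis ℝ S
  let u : Fin q → S := fun l => ⟨v l, Submodule.subset_span (mem_range_self l)⟩
  have hu : ⊤ ≤ Submodule.span ℝ (range u) := by
    rintro ⟨x, hx⟩ -
    have : (Submodule.span ℝ (range u)).map S.subtype = S := by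
      rw [Submodule.map_span, ← range_comp]; rfl
    rw [← this] at hx
    obtain ⟨y, hy, hyx⟩ := hx
    have : y = ⟨x, by assumption⟩ := Subtype.ext hyx
    rwa [← this]
  -- some subfamily is a basis of the span
  obtain ⟨f₀, hf₀⟩ : ∃ f : Fin k → Fin q, b.det (fun i => u (f i)) ≠ 0 := by
    by_contra hcon
    push Not at hcon
    have : b.det = 0 := by
      refine Module.Basis.ext_alternating b fun w hw => ?_
      have : ∀ w : Fin k → S, b.det w = 0 := by
        have key : ∀ s : Finset (Fin k), ∀ w : Fin k → S, (∀ i ∉ s, ∃ l, w i = u l) →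
            b.det w = 0 := by
          intro s
          induction s using Finset.induction_on with
          | empty =>
            intro w hw
            choose f hf using fun i => hw i (by simp)
            rw [show w = fun i => u (f i) from funext hf]
            exact hcon f
          | insert a s ha ih =>
            intro w hw
            have hmem : w a ∈ Submodule.span ℝ (range u) := hu trivial
            rw [← Function.update_eq_self a w]
            generalize w a = x at hmem
            induction hmem using Submodule.span_induction with
            | mem x hx =>
              obtain ⟨l, rfl⟩ := hx
              refine ih _ fun i hi => ?_
              by_cases hia : i = a
              · subst hia; exact ⟨l, by simp⟩
              · rw [Function.update_of_ne hia]
                exact hw i (by simp [hia, hi])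
            | zero => exact b.det.map_update_zero w a
            | add x y _ _ hx hy => rw [b.det.map_update_add, hx, hy, add_zero]
            | smul c x _ hx => rw [b.det.map_update_smul, hx, smul_zero]
        exact fun w => key Finset.univ w (by simp)
      simpa using this _
    have h1 := b.det_self
    rw [this] at h1
    simp at h1
  obtain ⟨f, -, hf⟩ := Finset.exists_max_image (Finset.univ : Finset (Fin k → Fin q))
    (fun f => |b.det (fun i => u (f i))|) ⟨f₀, Finset.mem_univ _⟩
  have hpos : 0 < |b.det (fun i => u (f i))| :=
    (abs_pos.2 hf₀).trans_le (hf f₀ (Finset.mem_univ _))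
  obtain ⟨hli, hsp⟩ := (b.is_basis_iff_det (v := fun i => u (f i))).2
    (isUnit_iff_ne_zero.2 (abs_pos.1 hpos))
  refine ⟨k, f, ?_, fun l => ?_⟩
  · exact hli.map' S.subtype (Submodule.ker_subtype S)
  · let b' := Module.Basis.mk hli hsp.ge
    refine ⟨fun i => b'.repr (u l) i, fun i => ?_, ?_⟩
    · have hsum : u l = ∑ j, b'.repr (u l) j • u (f j) := by
        conv_lhs => rw [← b'.sum_repr (u l)]
        simp [b']
      have h1 : b.det (Function.update (fun i => u (f i)) i (u l)) =
          b'.repr (u l) i * b.det (fun i => u (f i)) := by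
        conv_lhs => rw [hsum]
        rw [b.det.map_update_sum]
        rw [Finset.sum_eq_single i]
        · rw [b.det.map_update_smul, Function.update_eq_self_iff.2 rfl, smul_eq_mul]
        · intro j _ hj
          rw [b.det.map_update_smul, b.det.map_eq_zero_of_eq _ _ hj.symm, smul_zero]
          simp [Function.update_of_ne hj]
        · simp
      have h2 := hf (Function.update f i l) (Finset.mem_univ _)
      have h3 : (fun j => u (Function.update f i l j)) =
          Function.update (fun i => u (f i)) i (u l) := by
        ext j
        by_cases hj : j = i
        · subst hj; simp
        · simp [Function.update_of_ne hj]
      rw [h3, h1, abs_mul] at h2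
      exact le_of_mul_le_mul_right (by rwa [one_mul]) hpos
    · have hsum : u l = ∑ j, b'.repr (u l) j • u (f j) := by
        conv_lhs => rw [← b'.sum_repr (u l)]
        simp [b']
      have := congrArg (fun x : S => (x : E)) hsum
      simpa [u] using this

/-- The hypotheses on a list `Y` of fields of nonzero degrees under which there are frames on the
balls of `Y`: the fields and their first derivatives are bounded, and the brackets are dominated
pointwise by the fields. -/
structure IsFrameList {n ν q : ℕ} (Y : Fin q → FormalVF n ν) (r : ℝ) : Prop where
  pos : 0 < r
  degree_ne : ∀ l, (Y l).2 ≠ 0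
  smooth : ∀ l, ContDiffOn ℝ ∞ (Y l).1 (Metric.ball 0 r)
  bdd : ∃ K : ℝ, ∀ l, ∀ x ∈ Metric.ball (0 : Euc n) r, ‖(Y l).1 x‖ ≤ K ∧ ‖fderiv ℝ (Y l).1 x‖ ≤ K
  dom : ∀ l i, ∃ C : ℝ, 0 ≤ C ∧ ∀ δ ∈ Icc (0 : Fin ν → ℝ) 1, ∀ x ∈ Metric.ball (0 : Euc n) r,
    ∀ (ξ : Euc n →L[ℝ] ℝ) (M : ℝ), 0 ≤ M → (∀ j, |ξ (atScale δ (Y j) x)| ≤ M) →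
      |ξ (atScale δ (bracket (Y l) (Y i)) x)| ≤ C * M

section Frame

variable {n ν q : ℕ} {Y : Fin q → FormalVF n ν} {r : ℝ}

/-- Transport along the subunit curves of a small multiple of the scale: the pairings with the
fields of the list change little. -/
theorem IsFrameList.exists_transport (h : IsFrameList Y r) {ε : ℝ} (hε : 0 < ε) :
    ∃ τ : ℝ, 0 < τ ∧ ∀ δ ∈ Icc (0 : Fin ν → ℝ) 1, ∀ (c : ℝ → Euc n) (a : ℝ → Euc q),
      IsSubunit (Metric.ball 0 r) (scaled Y (τ • δ)) c a → ∀ σ ∈ Icc (0 : ℝ) 1,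
      ∀ η : Euc n →L[ℝ] ℝ, ∃ ξ : ℝ → Euc n →L[ℝ] ℝ, ξ σ = η ∧
        (∃ B, ∀ s ∈ Icc (0 : ℝ) 1, ∀ l, |ξ s (atScale δ (Y l) (c s))| ≤ B) ∧
        ∀ S, 0 ≤ S → (∀ s ∈ Icc (0 : ℝ) 1, ∀ l, |ξ s (atScale δ (Y l) (c s))| ≤ S) →
          ∀ s ∈ Icc (0 : ℝ) 1, ∀ s' ∈ Icc (0 : ℝ) 1, ∀ l,
            |ξ s (atScale δ (Y l) (c s)) - ξ s' (atScale δ (Y l) (c s'))| ≤ ε * S := by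
  obtain ⟨K₀, hK₀⟩ := h.bdd
  choose C hC HC using h.dom
  set K := max K₀ 0
  have hK0 : 0 ≤ K := le_max_right _ _
  obtain ⟨D, hD0, hD⟩ : ∃ D, 0 ≤ D ∧ ∀ l i, C l i ≤ D :=
    ⟨∑ l, ∑ i, C l i, Finset.sum_nonneg fun l _ => Finset.sum_nonneg fun i _ => hC l i,
      fun l i => (Finset.single_le_sum (f := fun i => C l i) (fun i _ => hC l i)
        (Finset.mem_univ i)).trans (Finset.single_le_sum (f := fun l => ∑ i, C l i)
          (fun l _ => Finset.sum_nonneg fun i _ => hC l i) (Finset.mem_univ l))⟩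
  set τ : ℝ := min 1 (min (1 / (q * K + 1) / 2) (ε / (q * D + 1))) with hτ
  have hτ0 : 0 < τ := by positivity
  have hτ1 : τ ≤ 1 := min_le_left _ _
  have hτK : q * (τ * K) < 1 := by
    have : τ ≤ 1 / (q * K + 1) / 2 := (min_le_right _ _).trans (min_le_left _ _)
    rw [div_div, le_div_iff₀ (by positivity)] at this
    have h2 : 0 ≤ q * (τ * K) := by positivity
    nlinarith
  have hτD : q * (τ * D) ≤ ε := by
    have : τ ≤ ε / (q * D + 1) := (min_le_right _ _).trans (min_le_right _ _)
    rw [le_div_iff₀ (by positivity)] at this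
    nlinarith
  have hτd : ∀ l, τ ^ (∑ μ, (Y l).2 μ) ≤ τ := by
    intro l
    refine pow_le_of_le_one hτ0.le hτ1 fun h0 => h.degree_ne l (funext fun μ => ?_)
    exact (Finset.sum_eq_zero_iff.1 h0) μ (Finset.mem_univ μ)
  refine ⟨τ, hτ0, fun δ hδ c a hca σ hσ η => ?_⟩
  have hdiff : ∀ l, ∀ x ∈ Metric.ball (0 : Euc n) r, DifferentiableAt ℝ (Y l).1 x := fun l x hx =>
    ((h.smooth l).contDiffAt (Metric.isOpen_ball.mem_nhds hx)).differentiableAt (by simp)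
  have hsc : ∀ l x, scaled Y (τ • δ) l x = τ ^ (∑ μ, (Y l).2 μ) • atScale δ (Y l) x :=
    fun l x => scaled_smul Y τ δ l x
  have hcoef : ∀ l, ‖τ ^ (∑ μ, (Y l).2 μ) * mpow δ (Y l).2‖ ≤ τ := by
    intro l
    rw [Real.norm_of_nonneg (mul_nonneg (by positivity) (mpow_nonneg hδ _))]
    exact (mul_le_of_le_one_right (by positivity) (mpow_le_one hδ _)).trans (hτd l)
  have hb1 : ∀ l, ∀ x ∈ Metric.ball (0 : Euc n) r, ‖scaled Y (τ • δ) l x‖ ≤ τ * K := by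
    intro l x hx
    rw [hsc, atScale, smul_smul, norm_smul]
    exact mul_le_mul (hcoef l) ((hK₀ l x hx).1.trans (le_max_left _ _)) (norm_nonneg _) hτ0.le
  have hb2 : ∀ l, ∀ x ∈ Metric.ball (0 : Euc n) r, ‖fderiv ℝ (scaled Y (τ • δ) l) x‖ ≤ τ * K := by
    intro l x hx
    have : fderiv ℝ (scaled Y (τ • δ) l) x =
        (τ ^ (∑ μ, (Y l).2 μ) * mpow δ (Y l).2) • fderiv ℝ (Y l).1 x := by
      rw [← mpow_smul]
      exact ((hdiff l x hx).hasFDerivAt.const_smul (mpow (τ • δ) (Y l).2)).fderiv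
    rw [this, norm_smul]
    exact mul_le_mul (hcoef l) ((hK₀ l x hx).2.trans (le_max_left _ _)) (norm_nonneg _) hτ0.le
  obtain ⟨ξ, -, hξσ, hξ⟩ := hca.exists_transport Metric.isOpen_ball
    (contDiffOn_scaled h.smooth _) (by positivity) hτK hb1 hb2 hσ η
  have hξl := fun l => hξ _ (contDiffOn_atScale (δ := δ) (h.smooth l))
  refine ⟨ξ, hξσ, ?_, fun S hS0 hS s hs s' hs' l => ?_⟩
  · choose L hL using fun l => (hξl l).1
    choose B hB using fun l => isCompact_Icc.exists_bound_of_continuousOn (hL l).continuousOn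
    refine ⟨∑ l, |B l|, fun s hs l => (hB l s hs).trans ((le_abs_self _).trans ?_)⟩
    exact Finset.single_le_sum (f := fun l => |B l|) (fun _ _ => abs_nonneg _) (Finset.mem_univ l)
  · obtain ⟨L, hL⟩ := (hξl l).1
    refine (abs_sub_le_of_ae_deriv_le hL (hξl l).2 hs' hs (K := ε * S) fun t ht => ?_).trans ?_
    · have hx := hca.mem t ht
      have hterm : ∀ j : Fin q, ‖ξ t (VectorField.lieBracket ℝ (scaled Y (τ • δ) j)
          (atScale δ (Y l)) (c t))‖ ≤ τ * (D * S) := by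
        intro j
        have : VectorField.lieBracket ℝ (scaled Y (τ • δ) j) (atScale δ (Y l)) (c t) =
            τ ^ (∑ μ, (Y j).2 μ) • atScale δ (bracket (Y j) (Y l)) (c t) := by
          rw [show scaled Y (τ • δ) j = τ ^ (∑ μ, (Y j).2 μ) • atScale δ (Y j) from
            funext (hsc j)]
          rw [VectorField.lieBracket_const_smul_left (V := atScale δ (Y j))
            ((hdiff j _ hx).const_smul (mpow δ (Y j).2)),
            lieBracket_atScale (hdiff j _ hx) (hdiff l _ hx)]
        rw [this, map_smul, norm_smul, Real.norm_of_nonneg (by positivity)]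
        have h1 := HC j l δ hδ (c t) hx (ξ t) S hS0 (hS t ht)
        exact mul_le_mul (hτd j) (h1.trans (mul_le_mul_of_nonneg_right (hD j l) hS0))
          (norm_nonneg _) hτ0.le
      have h2 := hca.norm_sum_le t _ hterm
      simp only [smul_eq_mul, Real.norm_eq_abs] at h2
      refine h2.trans ?_
      calc (q : ℝ) * (τ * (D * S)) = q * (τ * D) * S := by ring
        _ ≤ ε * S := mul_le_mul_of_nonneg_right hτD hS0
    · refine mul_le_of_le_one_right (by positivity) ?_
      rw [abs_le]; constructor <;> linarith [hs.1, hs.2, hs'.1, hs'.2]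

/-- A frame chosen at the center of a small ball remains one on the whole ball: by
`IsFrameList.exists_transport`, neither its dual family nor the coordinates of the other fields
change much along subunit curves. The number of frame fields depends on the center and on the
scale. -/
theorem IsFrameList.exists_frame (h : IsFrameList Y r) : ∃ τ : ℝ, 0 < τ ∧
    ∀ δ ∈ Icc (0 : Fin ν → ℝ) 1, ∀ x₀ : Euc n, ∃ (k : ℕ) (f : Fin k → Fin q), Function.Injective f ∧
      ∀ x ∈ ccBall (Metric.ball 0 r) Y x₀ (τ • δ),
        LinearIndependent ℝ (fun i => atScale δ (Y (f i)) x) ∧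
        ∀ (η : Euc n →L[ℝ] ℝ) (M : ℝ), 0 ≤ M → (∀ i, |η (atScale δ (Y (f i)) x)| ≤ M) →
          ∀ l, |η (atScale δ (Y l) x)| ≤ 2 * q * M := by
  -- so small that `q` error terms, each multiplied by a bound `2 q`, can be absorbed
  set ε : ℝ := 1 / (2 * (q + 1) ^ 2) with hε
  have hε0 : 0 < ε := by positivity
  have hq0 : (0 : ℝ) ≤ q := by positivity
  have hε1 : ε * (q + 1) ^ 2 = 1 / 2 := by rw [hε]; field_simp
  have hε2 : (q + 1) * ε ≤ 1 / 2 := by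
    rw [← hε1, mul_comm]
    exact mul_le_mul_of_nonneg_left (le_self_pow₀ (by linarith) (by norm_num)) hε0.le
  have hε3 : ε ≤ 1 / 2 := by nlinarith
  have hε4 : q * (ε * (2 * q)) < 1 := by nlinarith
  obtain ⟨τ, hτ, H⟩ := h.exists_transport hε0
  refine ⟨τ, hτ, fun δ hδ x₀ => ?_⟩
  obtain ⟨k, f, hli, hco⟩ := exists_frame_of_finite fun l => atScale δ (Y l) x₀
  have hinj : Function.Injective f := fun i j hij => hli.injective (by simp only [hij])
  have hk : k ≤ q := by simpa using Fintype.card_le_of_injective f hinj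
  have hkq : (k : ℝ) ≤ q := by exact_mod_cast hk
  have hdom : ∀ (η : Euc n →L[ℝ] ℝ) (M : ℝ), 0 ≤ M → (∀ i, |η (atScale δ (Y (f i)) x₀)| ≤ M) →
      ∀ l, |η (atScale δ (Y l) x₀)| ≤ q * M := by
    intro η M hM hη l
    obtain ⟨a, ha, hl⟩ := hco l
    rw [hl, map_sum]
    calc |∑ i, η (a i • atScale δ (Y (f i)) x₀)| ≤ ∑ i : Fin k, M := by
          refine (Finset.abs_sum_le_sum_abs _ _).trans (Finset.sum_le_sum fun i _ => ?_)
          rw [map_smul, smul_eq_mul, abs_mul]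
          exact (mul_le_of_le_one_left (abs_nonneg _) (ha i)).trans (hη i)
      _ = k * M := by simp
      _ ≤ q * M := by gcongr
  refine ⟨k, f, hinj, fun x hx => ⟨?_, fun η M hM hη l => ?_⟩⟩
  · obtain ⟨c, a, -, -, hca, rfl, rfl, -⟩ := mem_unitBall_iff.1 hx
    obtain ⟨θ, hθ⟩ := hli.exists_dual
    have h1 : ∀ i, ∃ ξ : Euc n →L[ℝ] ℝ, ∀ j,
        |ξ (atScale δ (Y (f j)) (c 1)) - if i = j then 1 else 0| ≤ ε * (2 * q) := by
      intro i
      obtain ⟨ξ, hξ0, ⟨B, hB⟩, hξ⟩ := H δ hδ c a hca 0 (by simp) (θ i)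
      have hθq : ∀ l, |θ i (atScale δ (Y l) (c 0))| ≤ q := by
        intro l
        have := hdom (θ i) 1 zero_le_one (fun j => by rw [hθ]; split_ifs <;> simp) l
        rwa [mul_one] at this
      have hS : ∀ p : Icc (0 : ℝ) 1 × Fin q, |ξ p.1 (atScale δ (Y p.2) (c p.1))| ≤ 2 * q := by
        refine abs_le_two_mul_of_forall ⟨B, fun p => hB p.1 p.1.2 p.2⟩ fun S hS0 hS p => ?_
        have h2 := hξ S hS0 (fun s hs l => hS (⟨s, hs⟩, l)) p.1 p.1.2 0 (by simp) p.2
        rw [hξ0] at h2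
        have h3 := abs_sub_abs_le_abs_sub (ξ p.1 (atScale δ (Y p.2) (c p.1)))
          (θ i (atScale δ (Y p.2) (c 0)))
        have h4 := hθq p.2
        have h5 : ε * S ≤ 1 / 2 * S := mul_le_mul_of_nonneg_right hε3 hS0
        linarith
      refine ⟨ξ 1, fun j => ?_⟩
      have h2 := hξ (2 * q) (by positivity) (fun s hs l => hS (⟨s, hs⟩, l)) 1 (by simp) 0 (by simp)
        (f j)
      rwa [hξ0, hθ] at h2
    -- the transported dual family pairs with the frame as a nearly diagonal matrix
    choose ξ hξ using h1
    rw [Fintype.linearIndependent_iff]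
    intro g hg
    by_contra hcon
    push Not at hcon
    obtain ⟨i₀, hi₀⟩ := hcon
    obtain ⟨i, -, hi⟩ := Finset.exists_max_image Finset.univ (fun i => |g i|)
      ⟨i₀, Finset.mem_univ _⟩
    have hpos : 0 < |g i| := (abs_pos.2 hi₀).trans_le (hi i₀ (Finset.mem_univ _))
    have h2 := congrArg (ξ i) hg
    rw [map_sum, map_zero] at h2
    have h3 : g i = -∑ j, g j * (ξ i (atScale δ (Y (f j)) (c 1)) - if i = j then 1 else 0) := by
      simp only [mul_sub, Finset.sum_sub_distrib, mul_ite, mul_one, mul_zero, Finset.sum_ite_eq,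
        Finset.mem_univ, if_true]
      simp only [map_smul, smul_eq_mul] at h2
      rw [h2]; ring
    have h4 : |g i| ≤ k * (|g i| * (ε * (2 * q))) := by
      conv_lhs => rw [h3, abs_neg]
      calc |∑ j, g j * (ξ i (atScale δ (Y (f j)) (c 1)) - if i = j then 1 else 0)|
          ≤ ∑ j : Fin k, |g i| * (ε * (2 * q)) := by
            refine (Finset.abs_sum_le_sum_abs _ _).trans (Finset.sum_le_sum fun j _ => ?_)
            rw [abs_mul]
            exact mul_le_mul (hi j (Finset.mem_univ _)) (hξ i j) (abs_nonneg _) (abs_nonneg _)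
        _ = k * (|g i| * (ε * (2 * q))) := by simp
    have h5 : (k : ℝ) * (ε * (2 * q)) < 1 := by
      have : (k : ℝ) * (ε * (2 * q)) ≤ q * (ε * (2 * q)) := by gcongr
      linarith
    nlinarith
  · obtain ⟨c, a, -, -, hca, rfl, rfl, -⟩ := mem_unitBall_iff.1 hx
    obtain ⟨ξ, hξ1, ⟨B, hB⟩, hξ⟩ := H δ hδ c a hca 1 (by simp) η
    have hS : ∀ p : Icc (0 : ℝ) 1 × Fin q, |ξ p.1 (atScale δ (Y p.2) (c p.1))| ≤ 2 * (q * M) := by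
      refine abs_le_two_mul_of_forall ⟨B, fun p => hB p.1 p.1.2 p.2⟩ fun S hS0 hS p => ?_
      have hS' := fun s hs l => hS (⟨s, hs⟩, l)
      have h2 : ∀ i, |ξ 0 (atScale δ (Y (f i)) (c 0))| ≤ M + ε * S := by
        intro i
        have h3 := hξ S hS0 hS' 0 (by simp) 1 (by simp) (f i)
        have h4 := abs_sub_abs_le_abs_sub (ξ 0 (atScale δ (Y (f i)) (c 0)))
          (ξ 1 (atScale δ (Y (f i)) (c 1)))
        rw [hξ1] at h3 h4
        linarith [hη i]
      have h3 := hdom (ξ 0) (M + ε * S) (by positivity) h2 p.2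
      have h4 := hξ S hS0 hS' p.1 p.1.2 0 (by simp) p.2
      have h5 := abs_sub_abs_le_abs_sub (ξ p.1 (atScale δ (Y p.2) (c p.1)))
        (ξ 0 (atScale δ (Y p.2) (c 0)))
      have h6 : (q + 1) * ε * S ≤ 1 / 2 * S := mul_le_mul_of_nonneg_right hε2 hS0
      nlinarith
    have := hS (⟨1, by simp⟩, l)
    simp only [hξ1] at this
    linarith

end Frame

/-! ### Coordinates with respect to a frame -/

/-- A family of functionals that is dual to `v` if `v` is linearly independent. -/
noncomputable def dualFamily {n k : ℕ} (v : Fin k → Euc n) : Fin k → Euc n →L[ℝ] ℝ :=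
  open Classical in if h : LinearIndependent ℝ v then h.exists_dual.choose else 0

theorem dualFamily_apply {n k : ℕ} {v : Fin k → Euc n} (h : LinearIndependent ℝ v) (i j : Fin k) :
    dualFamily v i (v j) = if i = j then 1 else 0 := by
  rw [dualFamily, dif_pos h]
  convert h.exists_dual.choose_spec i j

/-- Smooth fields that are linearly independent at a point have a smooth dual coframe near it. -/
theorem exists_smooth_coframe {n k : ℕ} {Z : Fin k → Euc n → Euc n} {y : Euc n}
    (hZ : ∀ i, ContDiffAt ℝ ∞ (Z i) y) (hli : LinearIndependent ℝ fun i => Z i y) :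
    ∃ θ : Fin k → Euc n → Euc n →L[ℝ] ℝ, (∀ i, ContDiffAt ℝ ∞ (θ i) y) ∧
      ∀ᶠ x in 𝓝 y, ∀ i j, θ i x (Z j x) = if i = j then 1 else 0 := by
  obtain ⟨η, hη⟩ := hli.exists_dual
  let P : Euc n →L[ℝ] (Fin k → ℝ) := ContinuousLinearMap.pi η
  let G : (Fin k → Euc n) →L[ℝ] ((Fin k → ℝ) →L[ℝ] (Fin k → ℝ)) :=
    ∑ j, ((ContinuousLinearMap.smulRightL ℝ (Fin k → ℝ) (Fin k → ℝ)
      (ContinuousLinearMap.proj j)).comp (P.comp (ContinuousLinearMap.proj j)))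
  let T : Euc n → (Fin k → ℝ) →L[ℝ] (Fin k → ℝ) := fun x => G fun j => Z j x
  have hTj : ∀ x j, T x (Pi.single j 1) = P (Z j x) := by
    intro x j
    simp [T, G, Pi.single_apply]
  have hTy : T y = 1 := by
    refine ContinuousLinearMap.coe_injective (LinearMap.pi_ext' fun j => LinearMap.ext_ring ?_)
    change T y (Pi.single j 1) = Pi.single j 1
    ext i
    simp [hTj, P, hη, Pi.single_apply]
  have hTs : ContDiffAt ℝ ∞ T y := G.contDiff.contDiffAt.comp y (contDiffAt_pi.2 hZ)
  have hRs : ContDiffAt ℝ ∞ (fun x => Ring.inverse (T x)) y := by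
    have h1 := contDiffAt_ringInverse ℝ (n := ∞) (1 : ((Fin k → ℝ) →L[ℝ] (Fin k → ℝ))ˣ)
    rw [Units.val_one, ← hTy] at h1
    exact h1.comp y hTs
  refine ⟨fun i x => ((ContinuousLinearMap.proj i).comp (Ring.inverse (T x))).comp P, fun i => ?_,
    ?_⟩
  · exact (contDiffAt_const.clm_comp hRs).clm_comp contDiffAt_const
  · have hu : ∀ᶠ x in 𝓝 y, IsUnit (T x) := by
      refine hTs.continuousAt.eventually (Units.isOpen.mem_nhds ?_)
      rw [hTy]; exact isUnit_one
    filter_upwards [hu] with x hx i j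
    simp only [ContinuousLinearMap.comp_apply, ← hTj]
    have : Ring.inverse (T x) (T x (Pi.single j 1)) = Pi.single j 1 := by
      have := congrArg (fun L : (Fin k → ℝ) →L[ℝ] (Fin k → ℝ) => L (Pi.single j 1))
        (Ring.inverse_mul_cancel _ hx)
      exact this
    rw [this]
    simp [Pi.single_apply]

/-- A class of families that contains the fields of the list `Y`, is closed under brackets with
them, and consists of families that are dominated pointwise by `Y`. -/
structure IsFrameClass {ν N n q : ℕ} (Y : Fin q → FormalVF n ν) (r : ℝ)
    (𝒬 : Set (Family ν N n)) : Prop where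
  self_mem : ∀ l, fam N (Y l) ∈ 𝒬
  bracket_mem : ∀ {Q}, Q ∈ 𝒬 → ∀ l, (fam N (Y l)).bracket Q ∈ 𝒬
  smooth : ∀ {Q}, Q ∈ 𝒬 → SmoothFam r Q
  dom : ∀ {Q}, Q ∈ 𝒬 → ∃ C : ℝ, 0 ≤ C ∧ ∀ δ ∈ Icc (0 : Fin ν → ℝ) 1, ∀ p ∈ cyl N n r,
    ∀ (ξ : Euc n →L[ℝ] ℝ) (M : ℝ), 0 ≤ M → (∀ j, |ξ (atScale δ (Y j) p.2)| ≤ M) →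
      |ξ (Q δ p)| ≤ C * M

theorem IsFrameClass.isFrameList {ν N n q : ℕ} {Y : Fin q → FormalVF n ν} {r : ℝ}
    {𝒬 : Set (Family ν N n)} (h : IsFrameClass Y r 𝒬) (hr : 0 < r) (hdeg : ∀ l, (Y l).2 ≠ 0)
    (hY : ∀ l, ContDiffOn ℝ ∞ (Y l).1 (Metric.ball 0 r))
    (hb : ∃ K : ℝ, ∀ l, ∀ x ∈ Metric.ball (0 : Euc n) r, ‖(Y l).1 x‖ ≤ K ∧
      ‖fderiv ℝ (Y l).1 x‖ ≤ K) : IsFrameList Y r := by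
  refine ⟨hr, hdeg, hY, hb, fun l i => ?_⟩
  obtain ⟨C, hC, H⟩ := h.dom (h.bracket_mem (h.self_mem i) l)
  refine ⟨C, hC, fun δ hδ x hx ξ M hM hj => ?_⟩
  have hp : ((0 : Euc N), x) ∈ cyl N n r := ⟨Metric.mem_ball_self hr, hx⟩
  have := H δ hδ (0, x) hp ξ M hM hj
  rw [← fam_bracket (hY l) (hY i) δ hp] at this
  exact this

/-- The subfamily `Y ∘ f` is a frame on `B` at the scale `δ`, with bounds that depend only on the
length of the list. -/
def IsFrameOn {n ν q k : ℕ} (Y : Fin q → FormalVF n ν) (δ : Fin ν → ℝ) (B : Set (Euc n))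
    (f : Fin k → Fin q) : Prop :=
  ∀ x ∈ B, LinearIndependent ℝ (fun i => atScale δ (Y (f i)) x) ∧
    ∀ (η : Euc n →L[ℝ] ℝ) (M : ℝ), 0 ≤ M → (∀ i, |η (atScale δ (Y (f i)) x)| ≤ M) →
      ∀ l, |η (atScale δ (Y l) x)| ≤ 2 * q * M

/-- The coordinates of the family `Q` with respect to the frame `Y ∘ f`. -/
noncomputable def frameCoord {ν N n q k : ℕ} (Y : Fin q → FormalVF n ν) (δ : Fin ν → ℝ)
    (f : Fin k → Fin q) (Q : Family ν N n) (i : Fin k) (p : Euc N × Euc n) : ℝ :=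
  dualFamily (fun i => atScale δ (Y (f i)) p.2) i (Q δ p)

section Coordinates

variable {ν N n q k : ℕ} {Y : Fin q → FormalVF n ν} {r : ℝ} {𝒬 : Set (Family ν N n)}
  {δ : Fin ν → ℝ} {B : Set (Euc n)} {f : Fin k → Fin q} {Q : Family ν N n}

/-- The frame spans all values of a family of the class, because a covector that vanishes on the
frame vanishes on these values. -/
theorem sum_frameCoord (h : IsFrameClass Y r 𝒬) (hQ : Q ∈ 𝒬) (hδ : δ ∈ Icc (0 : Fin ν → ℝ) 1)
    (hf : IsFrameOn Y δ B f) {p : Euc N × Euc n} (hp : p ∈ cyl N n r) (hpB : p.2 ∈ B) :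
    Q δ p = ∑ i, frameCoord Y δ f Q i p • atScale δ (Y (f i)) p.2 := by
  obtain ⟨hli, hb⟩ := hf p.2 hpB
  set Z : Fin k → Euc n := fun i => atScale δ (Y (f i)) p.2 with hZ
  set v : Euc n := Q δ p - ∑ i, frameCoord Y δ f Q i p • Z i with hv
  have hDv : ∀ i, dualFamily Z i v = 0 := by
    intro i
    rw [hv, map_sub, map_sum]
    simp only [map_smul, dualFamily_apply hli, smul_eq_mul, mul_ite, mul_one, mul_zero,
      Finset.sum_ite_eq, Finset.mem_univ, if_true]
    exact sub_self _
  -- the functional `⟨v, ·⟩`, corrected so that it vanishes on the frame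
  let η : Euc n →L[ℝ] ℝ := innerSL ℝ v - ∑ i, inner ℝ v (Z i) • dualFamily Z i
  have hηZ : ∀ i, η (Z i) = 0 := by
    intro i
    simp [η, _root_.sum_apply, dualFamily_apply hli]
  have hηl : ∀ l, |η (atScale δ (Y l) p.2)| ≤ 0 := by
    intro l
    simpa using hb η 0 le_rfl (fun i => by
      rw [show η (atScale δ (Y (f i)) p.2) = 0 from hηZ i]; simp) l
  obtain ⟨C, hC, H⟩ := h.dom hQ
  have hηQ : η (Q δ p) = 0 := by
    have := H δ hδ p hp η 0 le_rfl hηl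
    rw [mul_zero] at this
    exact abs_eq_zero.1 (le_antisymm this (abs_nonneg _))
  have h1 : η v = 0 := by
    rw [hv, map_sub, map_sum, hηQ]
    simp [hηZ]
  have h2 : η v = inner ℝ v v := by
    simp [η, _root_.sum_apply, hDv]
  have h3 : v = 0 := by
    rw [h1] at h2
    exact inner_self_eq_zero.1 h2.symm
  rw [hv, sub_eq_zero] at h3
  exact h3

theorem frameCoord_eq (h : IsFrameClass Y r 𝒬) (hQ : Q ∈ 𝒬) (hδ : δ ∈ Icc (0 : Fin ν → ℝ) 1)
    (hf : IsFrameOn Y δ B f) {p : Euc N × Euc n} (hp : p ∈ cyl N n r) (hpB : p.2 ∈ B)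
    {θ : Fin k → Euc n →L[ℝ] ℝ}
    (hθ : ∀ i j, θ i (atScale δ (Y (f j)) p.2) = if i = j then 1 else 0) (i : Fin k) :
    frameCoord Y δ f Q i p = θ i (Q δ p) := by
  conv_rhs => rw [sum_frameCoord h hQ hδ hf hp hpB]
  simp [hθ]

theorem abs_frameCoord_le (h : IsFrameClass Y r 𝒬) (hQ : Q ∈ 𝒬) : ∃ C : ℝ, 0 ≤ C ∧
    ∀ (k : ℕ) (f : Fin k → Fin q), ∀ δ ∈ Icc (0 : Fin ν → ℝ) 1, ∀ B : Set (Euc n),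
      IsFrameOn Y δ B f → ∀ p ∈ cyl N n r, p.2 ∈ B → ∀ i, |frameCoord Y δ f Q i p| ≤ C := by
  obtain ⟨C, hC, H⟩ := h.dom hQ
  refine ⟨C * (2 * q), by positivity, fun k f δ hδ B hf p hp hpB i => ?_⟩
  obtain ⟨hli, hb⟩ := hf p.2 hpB
  refine H δ hδ p hp _ (2 * q) (by positivity) fun l => ?_
  have := hb (dualFamily (fun i => atScale δ (Y (f i)) p.2) i) 1 zero_le_one
    (fun j => by
      rw [dualFamily_apply hli i j]; split_ifs <;> simp) l
  rwa [mul_one] at this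

/-- Near a point of `B`, the coordinates are restrictions to `B` of smooth functions. -/
theorem exists_smooth_frameCoord (h : IsFrameClass Y r 𝒬)
    (hY : ∀ l, ContDiffOn ℝ ∞ (Y l).1 (Metric.ball 0 r)) (hQ : Q ∈ 𝒬)
    (hδ : δ ∈ Icc (0 : Fin ν → ℝ) 1) (hf : IsFrameOn Y δ B f) {p : Euc N × Euc n}
    (hp : p ∈ cyl N n r) (hpB : p.2 ∈ B) (i : Fin k) :
    ∃ w : Euc N × Euc n → ℝ, ContDiffAt ℝ ∞ w p ∧
      ∀ᶠ p' in 𝓝 p, p'.2 ∈ B → frameCoord Y δ f Q i p' = w p' := by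
  obtain ⟨θ, hθs, hθ⟩ := exists_smooth_coframe (Z := fun i => atScale δ (Y (f i))) (y := p.2)
    (fun i => (contDiffOn_atScale (hY (f i))).contDiffAt (Metric.isOpen_ball.mem_nhds hp.2))
    (hf p.2 hpB).1
  refine ⟨fun p => θ i p.2 (Q δ p), ?_, ?_⟩
  · exact ((hθs i).comp p contDiffAt_snd).clm_apply
      ((h.smooth hQ δ hδ).contDiffAt (isOpen_cyl.mem_nhds hp))
  · filter_upwards [(continuous_snd.tendsto p).eventually hθ, isOpen_cyl.mem_nhds hp]
      with p' hθ' hp' hpB'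
    exact frameCoord_eq h hQ hδ hf hp' hpB' (θ := fun i => θ i p'.2) hθ' i

theorem boundedCont_frameCoord (h : IsFrameClass Y r 𝒬)
    (hY : ∀ l, ContDiffOn ℝ ∞ (Y l).1 (Metric.ball 0 r)) (hQ : Q ∈ 𝒬) : ∃ C : ℝ, 0 ≤ C ∧
    ∀ (k : ℕ) (f : Fin k → Fin q), ∀ δ ∈ Icc (0 : Fin ν → ℝ) 1, ∀ B ⊆ Metric.ball (0 : Euc n) r,
      IsFrameOn Y δ B f → ∀ i,
        BoundedCont (Metric.ball (0 : Euc N) r ×ˢ B) C (frameCoord Y δ f Q i) := by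
  obtain ⟨C, hC, H⟩ := abs_frameCoord_le h hQ
  refine ⟨C, hC, fun k f δ hδ B hB hf i => ⟨fun p hp => ?_, fun p hp =>
    H k f δ hδ B hf p ⟨hp.1, hB hp.2⟩ hp.2 i⟩⟩
  obtain ⟨w, hw, hev⟩ := exists_smooth_frameCoord h hY hQ hδ hf ⟨hp.1, hB hp.2⟩ hp.2 i
  refine hw.continuousAt.continuousWithinAt.congr_of_eventuallyEq ?_ (hev.self_of_nhds hp.2)
  filter_upwards [nhdsWithin_le_nhds hev, self_mem_nhdsWithin] with p' h1 h2 using h1 h2.2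

end Coordinates

section Derivatives

variable {ν N n q k : ℕ} {Y : Fin q → FormalVF n ν} {r τ : ℝ} {𝒬 : Set (Family ν N n)}
  {δ : Fin ν → ℝ} {x₀ : Euc n} {f : Fin k → Fin q} {Q : Family ν N n}

theorem isPartialFst_frameCoord {B : Set (Euc n)} (hB : B ⊆ Metric.ball (0 : Euc n) r)
    (hQ : SmoothFam r Q) (hδ : δ ∈ Icc (0 : Fin ν → ℝ) 1) (i : Fin k) (m : Fin N) :
    IsPartialFst m (Metric.ball (0 : Euc N) r) B (frameCoord Y δ f Q i)
      (frameCoord Y δ f (Q.partialFst m) i) := fun t ht x hx =>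
  (dualFamily (fun i => atScale δ (Y (f i)) x) i).hasFDerivAt.comp_hasDerivAt (0 : ℝ)
    (hasDerivAt_partial (hQ δ hδ) m (p := (t, x)) ⟨ht, hB hx⟩)

/-- The derivative of the coordinates of `Q` along a field `Y_l` of the list: the coordinates of
`[Y_l, Q]`, corrected by those of the brackets of `Y_l` with the frame. -/
theorem isDerivAlongSnd_frameCoord (h : IsFrameClass Y r 𝒬)
    (hY : ∀ l, ContDiffOn ℝ ∞ (Y l).1 (Metric.ball 0 r)) (hτ : 0 < τ) (hQ : Q ∈ 𝒬)
    (hδ : δ ∈ Icc (0 : Fin ν → ℝ) 1)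
    (hf : IsFrameOn Y δ (ccBall (Metric.ball 0 r) Y x₀ (τ • δ)) f) (i : Fin k) (l : Fin q) :
    IsDerivAlongSnd (scaled Y δ l) (Metric.ball (0 : Euc N) r)
      (ccBall (Metric.ball 0 r) Y x₀ (τ • δ)) (frameCoord Y δ f Q i)
      (fun p => frameCoord Y δ f ((fam N (Y l)).bracket Q) i p + ∑ m, (-1) *
        (frameCoord Y δ f Q m p *
          frameCoord Y δ f ((fam N (Y l)).bracket (fam N (Y (f m)))) i p)) := by
  intro t ht x hx φ hφ0 hφ
  set B := ccBall (Metric.ball 0 r) Y x₀ (τ • δ) with hB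
  have hxr : x ∈ Metric.ball 0 r := ccBall_subset hx
  have hmem := eventually_mem_ccBall Metric.isOpen_ball hY hτ hx l hφ0 hφ
  have hd0 : HasDerivAt φ (scaled Y δ l x) 0 := by
    have := hφ.self_of_nhds
    rwa [hφ0] at this
  -- the coordinates are differentiable along the curve
  have hdiff : ∀ m, ∃ g, HasDerivAt (fun s => frameCoord Y δ f Q m (t, φ s)) g 0 := by
    intro m
    obtain ⟨w, hw, hev⟩ := exists_smooth_frameCoord h hY hQ hδ hf (p := (t, x)) ⟨ht, hxr⟩ hx m
    have hc : HasDerivAt (fun s => (t, φ s)) ((0 : Euc N), scaled Y δ l x) 0 :=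
      (hasDerivAt_const _ _).prodMk hd0
    have hw' : HasFDerivAt w (fderiv ℝ w (t, x)) (t, φ 0) := by
      rw [hφ0]
      exact (hw.differentiableAt (by simp)).hasFDerivAt
    refine ⟨_, (hw'.comp_hasDerivAt (0 : ℝ) hc).congr_of_eventuallyEq ?_⟩
    have hcont : Tendsto (fun s => (t, φ s)) (𝓝 0) (𝓝 (t, x)) := by
      have := hc.continuousAt.tendsto
      rwa [hφ0] at this
    filter_upwards [hcont.eventually hev, hmem] with s h1 h2 using h1 h2
  choose g hg using hdiff
  have hsl : ∀ {P : Family ν N n}, P ∈ 𝒬 →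
      HasDerivAt (fun s => P δ (t, φ s)) (fderiv ℝ (fun x => P δ (t, x)) x (scaled Y δ l x)) 0 := by
    intro P hP
    have h1 : HasFDerivAt (fun x => P δ (t, x)) (fderiv ℝ (fun x => P δ (t, x)) x) (φ 0) := by
      rw [hφ0]
      exact ((((h.smooth hP).slice hδ ht).contDiffAt
        (Metric.isOpen_ball.mem_nhds hxr)).differentiableAt (by simp)).hasFDerivAt
    exact h1.comp_hasDerivAt (0 : ℝ) hd0
  have h1 : fderiv ℝ (fun x => Q δ (t, x)) x (scaled Y δ l x) =
      ∑ m, (g m • atScale δ (Y (f m)) x +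
        frameCoord Y δ f Q m (t, x) • fderiv ℝ (atScale δ (Y (f m))) x (scaled Y δ l x)) := by
    have h2 : HasDerivAt (fun s => ∑ m, frameCoord Y δ f Q m (t, φ s) • atScale δ (Y (f m)) (φ s))
        (∑ m, (g m • atScale δ (Y (f m)) x +
          frameCoord Y δ f Q m (t, x) • fderiv ℝ (atScale δ (Y (f m))) x (scaled Y δ l x))) 0 := by
      refine HasDerivAt.fun_sum fun m _ => ?_
      have := (hg m).smul (hsl (h.self_mem (f m)))
      rw [hφ0] at this
      rw [add_comm]
      exact this
    refine (hsl hQ).unique (h2.congr_of_eventuallyEq ?_)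
    filter_upwards [hmem] with s hs
    exact sum_frameCoord h hQ hδ hf (p := (t, φ s)) ⟨ht, ccBall_subset hs⟩ hs
  have h2 : (fam N (Y l)).bracket Q δ (t, x) = ∑ m, (g m • atScale δ (Y (f m)) x +
      frameCoord Y δ f Q m (t, x) • (fam N (Y l)).bracket (fam N (Y (f m))) δ (t, x)) := by
    change fderiv ℝ (fun x => Q δ (t, x)) x (scaled Y δ l x) -
      fderiv ℝ (scaled Y δ l) x (Q δ (t, x)) = ∑ m, (_ + _ • (fderiv ℝ (atScale δ (Y (f m))) x
        (scaled Y δ l x) - fderiv ℝ (scaled Y δ l) x (atScale δ (Y (f m)) x)))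
    rw [h1]
    conv_lhs => rw [sum_frameCoord h hQ hδ hf (p := (t, x)) ⟨ht, hxr⟩ hx]
    rw [map_sum, ← Finset.sum_sub_distrib]
    refine Finset.sum_congr rfl fun m _ => ?_
    rw [map_smul, smul_sub, add_sub_assoc]
  have h3 : g i = frameCoord Y δ f ((fam N (Y l)).bracket Q) i (t, x) + ∑ m, (-1) *
      (frameCoord Y δ f Q m (t, x) *
        frameCoord Y δ f ((fam N (Y l)).bracket (fam N (Y (f m)))) i (t, x)) := by
    have h4 : frameCoord Y δ f ((fam N (Y l)).bracket Q) i (t, x) = ∑ m,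
        (g m * (if i = m then 1 else 0) + frameCoord Y δ f Q m (t, x) *
          frameCoord Y δ f ((fam N (Y l)).bracket (fam N (Y (f m)))) i (t, x)) := by
      rw [frameCoord, h2, map_sum]
      refine Finset.sum_congr rfl fun m _ => ?_
      rw [map_add, map_smul, map_smul, smul_eq_mul, smul_eq_mul]
      have := dualFamily_apply (hf x hx).1 i m
      rw [this]
      rfl
    rw [h4, Finset.sum_add_distrib]
    simp
  exact (hg i).congr_deriv h3

/-- The derivative of a coordinate along a field of the list is a coordinate of a bracket minus a
sum of products of coordinates, so that induction on the order of the derivatives applies. -/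
theorem wordBound_frameCoord (h : IsFrameClass Y r 𝒬)
    (hY : ∀ l, ContDiffOn ℝ ∞ (Y l).1 (Metric.ball 0 r)) (hτ : 0 < τ) (m : ℕ) (hQ : Q ∈ 𝒬) :
    ∃ C : ℝ, 0 ≤ C ∧ ∀ δ ∈ Icc (0 : Fin ν → ℝ) 1, ∀ (x₀ : Euc n) (k : ℕ) (f : Fin k → Fin q),
      k ≤ q → IsFrameOn Y δ (ccBall (Metric.ball 0 r) Y x₀ (τ • δ)) f → ∀ i,
        WordBound (fun l => IsDerivAlongSnd (scaled Y δ l) (Metric.ball (0 : Euc N) r)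
          (ccBall (Metric.ball 0 r) Y x₀ (τ • δ)))
          (Metric.ball (0 : Euc N) r ×ˢ ccBall (Metric.ball 0 r) Y x₀ (τ • δ)) C m
          (frameCoord Y δ f Q i) := by
  induction m generalizing Q with
  | zero =>
    obtain ⟨C, hC, H⟩ := boundedCont_frameCoord h hY hQ
    exact ⟨C, hC, fun δ hδ x₀ k f _ hf i => H k f δ hδ _ ccBall_subset hf i⟩
  | succ m ih =>
    obtain ⟨C, hC, H⟩ := boundedCont_frameCoord h hY hQ
    obtain ⟨C₁, hC₁, H₁⟩ := ih hQ
    choose C₂ hC₂ H₂ using fun l => ih (h.bracket_mem hQ l)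
    choose C₃ hC₃ H₃ using fun l j => ih (h.bracket_mem (h.self_mem j) l)
    obtain ⟨D₂, hD₂0, hD₂⟩ : ∃ D, 0 ≤ D ∧ ∀ l, C₂ l ≤ D :=
      ⟨∑ l, C₂ l, Finset.sum_nonneg fun l _ => hC₂ l, fun l =>
        Finset.single_le_sum (f := C₂) (fun l _ => hC₂ l) (Finset.mem_univ l)⟩
    obtain ⟨D₃, hD₃0, hD₃⟩ : ∃ D, 0 ≤ D ∧ ∀ l i, C₃ l i ≤ D :=
      ⟨∑ l, ∑ i, C₃ l i, Finset.sum_nonneg fun l _ => Finset.sum_nonneg fun i _ => hC₃ l i,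
        fun l i => (Finset.single_le_sum (f := fun i => C₃ l i) (fun i _ => hC₃ l i)
          (Finset.mem_univ i)).trans (Finset.single_le_sum (f := fun l => ∑ i, C₃ l i)
            (fun l _ => Finset.sum_nonneg fun i _ => hC₃ l i) (Finset.mem_univ l))⟩
    set E : ℝ := D₂ + q * (2 ^ m * (1 * (2 ^ m * (C₁ * D₃)))) with hE
    have hE0 : 0 ≤ E := by positivity
    refine ⟨max C E, le_max_of_le_left hC, fun δ hδ x₀ k f hkq hf i => ⟨?_, fun l =>
      ⟨_, isDerivAlongSnd_frameCoord h hY hτ hQ hδ hf i l, ?_⟩⟩⟩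
    · have := H k f δ hδ _ ccBall_subset hf i
      exact ⟨this.1, fun y hy => (this.2 y hy).trans (le_max_left _ _)⟩
    · have hD := isDerivationRel_isDerivAlongSnd (scaled Y δ) (Metric.ball (0 : Euc N) r)
        (ccBall (Metric.ball 0 r) Y x₀ (τ • δ))
      have hsum := WordBound.sum hD Finset.univ fun j _ =>
        (WordBound.const (C := 1) (k := -1) hD (by simp)).mul hD zero_le_one (by positivity)
          ((H₁ δ hδ x₀ k f hkq hf j).mul hD hC₁ hD₃0
            ((H₃ l (f j) δ hδ x₀ k f hkq hf i).mono_const (hD₃ l (f j))))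
      refine (((H₂ l δ hδ x₀ k f hkq hf i).mono_const (hD₂ l)).add hD hsum).mono_const ?_
      refine le_trans ?_ (le_max_right C E)
      rw [hE, Finset.card_univ, Fintype.card_fin]
      gcongr

/-- The frame does not depend on `t`, so that derivatives in `t` of coordinates are coordinates of
derivatives. -/
theorem mixedBound_frameCoord (h : IsFrameClass Y r 𝒬)
    (hY : ∀ l, ContDiffOn ℝ ∞ (Y l).1 (Metric.ball 0 r)) (hτ : 0 < τ) {𝒲 : Set (Family ν N n)}
    (h𝒲 : 𝒲 ⊆ 𝒬) (hpart : ∀ Q ∈ 𝒲, ∀ i, Q.partialFst i ∈ 𝒲) (m : ℕ) (hQ : Q ∈ 𝒲) :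
    ∃ C : ℝ, 0 ≤ C ∧ ∀ δ ∈ Icc (0 : Fin ν → ℝ) 1, ∀ (x₀ : Euc n) (k : ℕ) (f : Fin k → Fin q),
      k ≤ q → IsFrameOn Y δ (ccBall (Metric.ball 0 r) Y x₀ (τ • δ)) f → ∀ i,
        MixedBound (scaled Y δ) (Metric.ball (0 : Euc N) r)
          (ccBall (Metric.ball 0 r) Y x₀ (τ • δ)) C m (frameCoord Y δ f Q i) := by
  induction m generalizing Q with
  | zero =>
    obtain ⟨C, hC, H⟩ := wordBound_frameCoord h hY hτ 0 (h𝒲 hQ)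
    exact ⟨C, hC, H⟩
  | succ m ih =>
    obtain ⟨C, hC, H⟩ := wordBound_frameCoord h hY hτ (m + 1) (h𝒲 hQ)
    choose C₁ hC₁ H₁ using fun i => ih (hpart Q hQ i)
    have hle : ∀ i, C₁ i ≤ C + ∑ i, C₁ i := fun i => by
      have := Finset.single_le_sum (f := C₁) (fun l _ => hC₁ l) (Finset.mem_univ i)
      linarith
    have hle' : C ≤ C + ∑ i, C₁ i := by
      have : 0 ≤ ∑ i, C₁ i := Finset.sum_nonneg fun i _ => hC₁ i
      linarith
    refine ⟨C + ∑ i, C₁ i, hC.trans hle', fun δ hδ x₀ k f hkq hf i => ?_⟩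
    have hw := (H δ hδ x₀ k f hkq hf i).mono_const hle'
    refine ⟨hw.1, fun j => ⟨_, isPartialFst_frameCoord ccBall_subset (h.smooth (h𝒲 hQ)) hδ i j, ?_⟩,
      hw.2⟩
    exact (H₁ j δ hδ x₀ k f hkq hf i).mono subset_rfl subset_rfl (hle j)

end Derivatives

section Control

variable {ν N n q : ℕ} {Y : Fin q → FormalVF n ν} {r : ℝ} {𝒬 : Set (Family ν N n)}

theorem RadonControl.MixedBound.zero {Z : Fin q → Euc n → Euc n} {A : Set (Euc N)}
    {B : Set (Euc n)} {C : ℝ} (hC : 0 ≤ C) (m : ℕ) : MixedBound Z A B C m 0 := by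
  have hb : BoundedCont (A ×ˢ B) C (0 : Euc N × Euc n → ℝ) :=
    ⟨continuousOn_const, fun y _ => by simpa using hC⟩
  induction m with
  | zero => exact hb
  | succ m ih =>
    refine ⟨hb, fun i => ⟨0, fun t _ x _ => hasDerivAt_const _ _, ih⟩, fun j => ⟨0, ?_, ?_⟩⟩
    · intro t _ y _ φ _ _
      exact hasDerivAt_const _ _
    · exact WordBound.const (k := 0) (isDerivationRel_isDerivAlongSnd _ _ _) (by simpa using hC)

/-- A list that dominates pointwise a class of families closed under brackets with its fields
controls these families, with derivatives in the parameter as far as the class allows. -/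
theorem IsFrameClass.exists_coeff (h : IsFrameClass Y r 𝒬) (hL : IsFrameList Y r) :
    ∃ τ : ℝ, 0 < τ ∧ ∀ Q ∈ 𝒬, ∃ c : Euc n → (Fin ν → ℝ) → Fin q → Euc N × Euc n → ℝ,
      (∀ x₀, ∀ δ ∈ Icc (0 : Fin ν → ℝ) 1, ∀ t ∈ Metric.ball (0 : Euc N) r,
        ∀ x ∈ ccBall (Metric.ball 0 r) Y x₀ (τ • δ),
        Q δ (t, x) = ∑ l, c x₀ δ l (t, x) • scaled Y δ l x) ∧
      (∀ m, ∃ C : ℝ, ∀ x₀, ∀ δ ∈ Icc (0 : Fin ν → ℝ) 1, ∀ l,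
        WordBound (fun k => IsDerivAlongSnd (scaled Y δ k) (Metric.ball (0 : Euc N) r)
          (ccBall (Metric.ball 0 r) Y x₀ (τ • δ)))
          (Metric.ball (0 : Euc N) r ×ˢ ccBall (Metric.ball 0 r) Y x₀ (τ • δ)) C m (c x₀ δ l)) ∧
      ∀ 𝒲 ⊆ 𝒬, (∀ Q ∈ 𝒲, ∀ i, Q.partialFst i ∈ 𝒲) → Q ∈ 𝒲 → ∀ m, ∃ C : ℝ, ∀ x₀,
        ∀ δ ∈ Icc (0 : Fin ν → ℝ) 1, ∀ l, MixedBound (scaled Y δ) (Metric.ball (0 : Euc N) r)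
          (ccBall (Metric.ball 0 r) Y x₀ (τ • δ)) C m (c x₀ δ l) := by
  obtain ⟨τ, hτ, H⟩ := hL.exists_frame
  choose k f hinj hf using H
  classical
  refine ⟨τ, hτ, fun Q hQ => ⟨fun x₀ δ => if hδ : δ ∈ Icc (0 : Fin ν → ℝ) 1 then
    Function.extend (f δ hδ x₀) (frameCoord Y δ (f δ hδ x₀) Q) 0 else 0, ?_, ?_, ?_⟩⟩
  · intro x₀ δ hδ t ht x hx
    rw [sum_frameCoord h hQ hδ (hf δ hδ x₀) (p := (t, x)) ⟨ht, ccBall_subset hx⟩ hx]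
    simp only [dif_pos hδ]
    refine Fintype.sum_of_injective (f δ hδ x₀) (hinj δ hδ x₀) _ _ (fun l hl => ?_) fun i => ?_
    · rw [Function.extend_apply' _ _ _ (by simpa using hl)]
      simp
    · rw [(hinj δ hδ x₀).extend_apply]
      rfl
  · intro m
    obtain ⟨C, hC, HC⟩ := wordBound_frameCoord h hL.smooth hτ m hQ
    refine ⟨C, fun x₀ δ hδ l => ?_⟩
    simp only [dif_pos hδ]
    by_cases hl : ∃ i, f δ hδ x₀ i = l
    · obtain ⟨i, rfl⟩ := hl
      rw [(hinj δ hδ x₀).extend_apply]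
      exact HC δ hδ x₀ _ _ (by simpa using Fintype.card_le_of_injective _ (hinj δ hδ x₀))
        (hf δ hδ x₀) i
    · rw [Function.extend_apply' _ _ _ hl]
      exact WordBound.const (k := 0) (isDerivationRel_isDerivAlongSnd _ _ _) (by simpa using hC)
  · intro 𝒲 h𝒲 hpart hQ𝒲 m
    obtain ⟨C, hC, HC⟩ := mixedBound_frameCoord h hL.smooth hτ h𝒲 hpart m hQ𝒲
    refine ⟨C, fun x₀ δ hδ l => ?_⟩
    simp only [dif_pos hδ]
    by_cases hl : ∃ i, f δ hδ x₀ i = l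
    · obtain ⟨i, rfl⟩ := hl
      rw [(hinj δ hδ x₀).extend_apply]
      exact HC δ hδ x₀ _ _ (by simpa using Fintype.card_le_of_injective _ (hinj δ hδ x₀))
        (hf δ hδ x₀) i
    · rw [Function.extend_apply' _ _ _ hl]
      exact MixedBound.zero hC m

theorem IsFrameClass.controls (h : IsFrameClass Y r 𝒬) (hL : IsFrameList Y r) {Z : FormalVF n ν}
    (hZ : fam N Z ∈ 𝒬) : Controls Y Z := by
  obtain ⟨τ, hτ, H⟩ := h.exists_coeff hL
  obtain ⟨c, hc, hw, -⟩ := H _ hZ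
  have h0 : (0 : Euc N) ∈ Metric.ball (0 : Euc N) r := Metric.mem_ball_self hL.pos
  refine ⟨Metric.ball 0 r, Metric.isOpen_ball, hL.smooth, Metric.ball 0 r, Metric.isOpen_ball,
    Metric.mem_ball_self hL.pos, subset_rfl, τ, hτ, fun x₀ δ l x => c x₀ δ l (0, x),
    fun x₀ _ δ hδ x hx => hc x₀ δ hδ 0 h0 x hx, fun m => ?_⟩
  obtain ⟨C, hC⟩ := hw m
  exact ⟨C, fun x₀ _ δ hδ l => (hC x₀ δ hδ l).slice h0⟩

theorem IsFrameClass.controlsFamily (h : IsFrameClass Y r 𝒬) (hL : IsFrameList Y r)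
    {e : Fin N → Fin ν → ℕ} {W : Euc N × Euc n → Euc n} {𝒲 : Set (Family ν N n)} (h𝒲 : 𝒲 ⊆ 𝒬)
    (hpart : ∀ Q ∈ 𝒲, ∀ i, Q.partialFst i ∈ 𝒲) (hW : dilFam e W ∈ 𝒲) : ControlsFamily e Y W := by
  obtain ⟨τ, hτ, H⟩ := h.exists_coeff hL
  obtain ⟨c, hc, -, hm⟩ := H _ (h𝒲 hW)
  refine ⟨Metric.ball 0 r, Metric.isOpen_ball, hL.smooth, Metric.ball 0 r, Metric.isOpen_ball,
    Metric.mem_ball_self hL.pos, subset_rfl, τ, hτ, r, hL.pos, c,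
    fun x₀ _ δ hδ t ht x hx => hc x₀ δ hδ t ht x hx, fun m => ?_⟩
  obtain ⟨C, hC⟩ := hm 𝒲 h𝒲 hpart hW m
  exact ⟨C, fun x₀ _ δ hδ l => hC x₀ δ hδ l⟩

end Control

/-! ### Graded Lie algebras of germs -/

/-- The germ of `Z` at `0` is smooth. -/
def IsSmoothGerm {n : ℕ} (Z : Euc n → Euc n) : Prop := ∀ᶠ x in 𝓝 (0 : Euc n), ContDiffAt ℝ ∞ Z x

namespace IsSmoothGerm

variable {n : ℕ} {U V Z : Euc n → Euc n}

theorem zero : IsSmoothGerm (0 : Euc n → Euc n) := Eventually.of_forall fun _ => contDiffAt_const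

theorem add (hV : IsSmoothGerm V) (hZ : IsSmoothGerm Z) : IsSmoothGerm (V + Z) := by
  filter_upwards [hV, hZ] with x h1 h2 using h1.add h2

theorem smul (c : ℝ) (hZ : IsSmoothGerm Z) : IsSmoothGerm (c • Z) := by
  filter_upwards [hZ] with x h using contDiffAt_const.smul h

theorem bracket (hV : IsSmoothGerm V) (hZ : IsSmoothGerm Z) :
    IsSmoothGerm (VectorField.lieBracket ℝ V Z) := by
  filter_upwards [hV, hZ] with x h1 h2 using h1.lieBracket_vectorField h2 (by simp)

theorem congr (h : V =ᶠ[𝓝 0] Z) (hV : IsSmoothGerm V) : IsSmoothGerm Z := by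
  filter_upwards [hV, h.eventuallyEq_nhds] with x h1 h2 using h1.congr_of_eventuallyEq h2.symm

theorem eventually_differentiableAt (hV : IsSmoothGerm V) :
    ∀ᶠ x in 𝓝 (0 : Euc n), DifferentiableAt ℝ V x := by
  filter_upwards [hV] with x h using h.differentiableAt (by simp)

theorem lieBracket_add_right (hV : IsSmoothGerm V) (hZ : IsSmoothGerm Z) :
    VectorField.lieBracket ℝ U (V + Z) =ᶠ[𝓝 0]
      VectorField.lieBracket ℝ U V + VectorField.lieBracket ℝ U Z := by
  filter_upwards [hV.eventually_differentiableAt, hZ.eventually_differentiableAt] with x h1 h2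
  exact VectorField.lieBracket_add_right h1 h2

theorem lieBracket_add_left (hV : IsSmoothGerm V) (hZ : IsSmoothGerm Z) :
    VectorField.lieBracket ℝ (V + Z) U =ᶠ[𝓝 0]
      VectorField.lieBracket ℝ V U + VectorField.lieBracket ℝ Z U := by
  filter_upwards [hV.eventually_differentiableAt, hZ.eventually_differentiableAt] with x h1 h2
  exact VectorField.lieBracket_add_left h1 h2

theorem lieBracket_smul_right (c : ℝ) (hV : IsSmoothGerm V) :
    VectorField.lieBracket ℝ U (c • V) =ᶠ[𝓝 0] c • VectorField.lieBracket ℝ U V := by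
  filter_upwards [hV.eventually_differentiableAt] with x h1
  exact VectorField.lieBracket_const_smul_right h1

theorem lieBracket_smul_left (c : ℝ) (hV : IsSmoothGerm V) :
    VectorField.lieBracket ℝ (c • V) U =ᶠ[𝓝 0] c • VectorField.lieBracket ℝ V U := by
  filter_upwards [hV.eventually_differentiableAt] with x h1
  exact VectorField.lieBracket_const_smul_left h1

theorem lieBracket_lieBracket_left (hU : IsSmoothGerm U) (hV : IsSmoothGerm V)
    (hZ : IsSmoothGerm Z) :
    VectorField.lieBracket ℝ U (VectorField.lieBracket ℝ V Z) +
      (-1 : ℝ) • VectorField.lieBracket ℝ V (VectorField.lieBracket ℝ U Z) =ᶠ[𝓝 0]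
    VectorField.lieBracket ℝ (VectorField.lieBracket ℝ U V) Z := by
  filter_upwards [hU, hV, hZ] with x h1 h2 h3
  have h2' : minSmoothness ℝ 2 ≤ (∞ : WithTop ℕ∞) := by
    rw [minSmoothness_of_isRCLikeNormedField]
    exact WithTop.coe_le_coe.2 (le_top : (2 : ℕ∞) ≤ ⊤)
  simp [VectorField.leibniz_identity_lieBracket h2' h1 h2 h3]

end IsSmoothGerm

section LieSpan

variable {n ν : ℕ}

/-- The graded Lie algebra of germs that is generated by a set of fields with degrees:
`LieSpan S Z d` says that `Z` is a germ of degree `d` in it. -/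
inductive LieSpan (S : Set (FormalVF n ν)) : (Euc n → Euc n) → (Fin ν → ℕ) → Prop
  | of (Z : Euc n → Euc n) (d : Fin ν → ℕ) : (Z, d) ∈ S → LieSpan S Z d
  | zero (d : Fin ν → ℕ) : d ≠ 0 → LieSpan S 0 d
  | add (V Z : Euc n → Euc n) (d : Fin ν → ℕ) :
    LieSpan S V d → LieSpan S Z d → LieSpan S (V + Z) d
  | smul (c : ℝ) (Z : Euc n → Euc n) (d : Fin ν → ℕ) : LieSpan S Z d → LieSpan S (c • Z) d
  | bracket (V Z : Euc n → Euc n) (d d' : Fin ν → ℕ) : LieSpan S V d → LieSpan S Z d' →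
    LieSpan S (VectorField.lieBracket ℝ V Z) (d + d')
  | congr (V Z : Euc n → Euc n) (d : Fin ν → ℕ) : V =ᶠ[𝓝 0] Z → LieSpan S V d → LieSpan S Z d

/-- The graded linear span of the iterated brackets in `ℒ₀(S)`. -/
inductive LieGen₀Span (S : Set (FormalVF n ν)) : (Euc n → Euc n) → (Fin ν → ℕ) → Prop
  | of (Z : Euc n → Euc n) (d : Fin ν → ℕ) : LieGen₀ S (Z, d) → LieGen₀Span S Z d
  | zero (d : Fin ν → ℕ) : LieGen₀Span S 0 d
  | add (V Z : Euc n → Euc n) (d : Fin ν → ℕ) :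
    LieGen₀Span S V d → LieGen₀Span S Z d → LieGen₀Span S (V + Z) d
  | smul (c : ℝ) (Z : Euc n → Euc n) (d : Fin ν → ℕ) : LieGen₀Span S Z d → LieGen₀Span S (c • Z) d
  | congr (V Z : Euc n → Euc n) (d : Fin ν → ℕ) :
    V =ᶠ[𝓝 0] Z → LieGen₀Span S V d → LieGen₀Span S Z d

variable {S S' : Set (FormalVF n ν)} {V Z : Euc n → Euc n} {d d' : Fin ν → ℕ}

theorem LieSpan.trans (h : LieSpan S Z d) (hS : ∀ Y ∈ S, LieSpan S' Y.1 Y.2) : LieSpan S' Z d := by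
  induction h with
  | of Z d hZ => exact hS _ hZ
  | zero d hd => exact LieSpan.zero d hd
  | add V Z d _ _ h1 h2 => exact LieSpan.add _ _ _ h1 h2
  | smul c Z d _ h1 => exact LieSpan.smul _ _ _ h1
  | bracket V Z d d' _ _ h1 h2 => exact LieSpan.bracket _ _ _ _ h1 h2
  | congr V Z d h _ h1 => exact LieSpan.congr _ _ _ h h1

theorem LieSpan.isSmoothGerm (hS : ∀ Y ∈ S, IsSmoothGerm Y.1) (h : LieSpan S Z d) :
    IsSmoothGerm Z := by
  induction h with
  | of Z d hZ => exact hS _ hZ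
  | zero d hd => exact .zero
  | add V Z d _ _ h1 h2 => exact h1.add h2
  | smul c Z d _ h1 => exact h1.smul c
  | bracket V Z d d' _ _ h1 h2 => exact h1.bracket h2
  | congr V Z d h _ h1 => exact h1.congr h

theorem LieSpan.degree_ne_zero (hS : ∀ Y ∈ S, Y.2 ≠ 0) (h : LieSpan S Z d) : d ≠ 0 := by
  induction h with
  | of Z d hZ => exact hS _ hZ
  | zero d hd => exact hd
  | add V Z d _ _ h1 h2 => exact h1
  | smul c Z d _ h1 => exact h1
  | bracket V Z d d' _ _ h1 h2 =>
    intro h0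
    exact h1 (funext fun μ => by
      have := congrFun h0 μ
      simp only [Pi.add_apply, Pi.zero_apply] at this
      simp only [Pi.zero_apply]
      omega)
  | congr V Z d h _ h1 => exact h1

theorem RadonControl.LieGen.lieSpan {Y : FormalVF n ν} (h : LieGen S Y) : LieSpan S Y.1 Y.2 := by
  induction h with
  | of Y hY => exact LieSpan.of _ _ hY
  | bracket V Z _ _ h1 h2 => exact LieSpan.bracket _ _ _ _ h1 h2

theorem RadonControl.LieGen₀.lieGen {Y : FormalVF n ν} (h : LieGen₀ S Y) : LieGen S Y := by
  induction h with
  | of Y hY => exact LieGen.of _ hY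
  | bracket V Z hV _ h2 => exact LieGen.bracket _ _ (LieGen.of _ hV) h2

theorem RadonControl.LieGen₀.mono (hS : S ⊆ S') {Y : FormalVF n ν} (h : LieGen₀ S Y) :
    LieGen₀ S' Y := by
  induction h with
  | of Y hY => exact LieGen₀.of _ (hS hY)
  | bracket V Z hV _ h2 => exact LieGen₀.bracket _ _ (hS hV) h2

theorem RadonControl.LieGen₀.isSmoothGerm (hS : ∀ Y ∈ S, IsSmoothGerm Y.1) {Y : FormalVF n ν}
    (h : LieGen₀ S Y) : IsSmoothGerm Y.1 :=
  h.lieGen.lieSpan.isSmoothGerm hS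

theorem LieGen₀Span.isSmoothGerm (hS : ∀ Y ∈ S, IsSmoothGerm Y.1) (h : LieGen₀Span S Z d) :
    IsSmoothGerm Z := by
  induction h with
  | of Z d hZ => exact hZ.isSmoothGerm hS
  | zero d => exact .zero
  | add V Z d _ _ h1 h2 => exact h1.add h2
  | smul c Z d _ h1 => exact h1.smul c
  | congr V Z d h _ h1 => exact h1.congr h

/-- If bracketing with `V` maps `ℒ₀(S)` to its span, it maps the span to itself. -/
theorem LieGen₀Span.bracket_of (hS : ∀ Y ∈ S, IsSmoothGerm Y.1)
    (hV : ∀ Z d', LieGen₀ S (Z, d') → LieGen₀Span S (VectorField.lieBracket ℝ V Z) (d + d'))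
    (h : LieGen₀Span S Z d') : LieGen₀Span S (VectorField.lieBracket ℝ V Z) (d + d') := by
  induction h with
  | of Z d' hZ => exact hV Z d' hZ
  | zero d' => rw [VectorField.lieBracket_zero_right]; exact .zero _
  | add Z Z' d' hZ hZ' h1 h2 =>
    exact .congr _ _ _ ((hZ.isSmoothGerm hS).lieBracket_add_right (hZ'.isSmoothGerm hS)).symm
      (.add _ _ _ h1 h2)
  | smul c Z d' hZ h1 =>
    exact .congr _ _ _ ((hZ.isSmoothGerm hS).lieBracket_smul_right c).symm (.smul _ _ _ h1)
  | congr Z Z' d' h hZ h1 =>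
    exact .congr _ _ _ (EventuallyEq.rfl.lieBracket_vectorField h) h1

theorem LieGen₀Span.bracket_lieGen₀ (hS : ∀ Y ∈ S, IsSmoothGerm Y.1) {U : FormalVF n ν}
    (hU : LieGen₀ S U) (h : LieGen₀Span S Z d') :
    LieGen₀Span S (VectorField.lieBracket ℝ U.1 Z) (U.2 + d') := by
  induction hU generalizing Z d' with
  | of U hU =>
    exact LieGen₀Span.bracket_of hS (fun Z d' hZ => .of _ _ (LieGen₀.bracket _ _ hU hZ)) h
  | bracket U U' hU hU' ih =>
    have h0 : ∀ {Z d'}, LieGen₀Span S Z d' →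
        LieGen₀Span S (VectorField.lieBracket ℝ U.1 Z) (U.2 + d') := fun h =>
      LieGen₀Span.bracket_of hS (fun Z d' hZ => .of _ _ (LieGen₀.bracket _ _ hU hZ)) h
    have hZ := h.isSmoothGerm hS
    refine .congr _ _ _
      ((hS U hU).lieBracket_lieBracket_left (hU'.isSmoothGerm hS) hZ) ?_
    refine .add _ _ _ ?_ (.smul _ _ _ ?_)
    · have := h0 (ih h)
      rwa [← add_assoc] at this
    · have := ih (h0 h)
      rwa [← add_assoc, add_comm U'.2] at this

theorem LieGen₀Span.bracket (hS : ∀ Y ∈ S, IsSmoothGerm Y.1) (hV : LieGen₀Span S V d)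
    (h : LieGen₀Span S Z d') : LieGen₀Span S (VectorField.lieBracket ℝ V Z) (d + d') := by
  induction hV with
  | of V d hV => exact LieGen₀Span.bracket_lieGen₀ hS hV h
  | zero d => rw [VectorField.lieBracket_zero_left]; exact .zero _
  | add V V' d hV hV' h1 h2 =>
    exact .congr _ _ _ ((hV.isSmoothGerm hS).lieBracket_add_left (hV'.isSmoothGerm hS)).symm
      (.add _ _ _ h1 h2)
  | smul c V d hV h1 =>
    exact .congr _ _ _ ((hV.isSmoothGerm hS).lieBracket_smul_left c).symm (.smul _ _ _ h1)
  | congr V V' d h0 hV h1 =>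
    exact .congr _ _ _ (h0.lieBracket_vectorField EventuallyEq.rfl) h1

/-- By the Jacobi identity, the brackets in `ℒ₀(S)` span the Lie algebra generated by `S`. -/
theorem LieSpan.lieGen₀Span (hS : ∀ Y ∈ S, IsSmoothGerm Y.1) (h : LieSpan S Z d) :
    LieGen₀Span S Z d := by
  induction h with
  | of Z d hZ => exact .of _ _ (.of _ hZ)
  | zero d hd => exact .zero d
  | add V Z d _ _ h1 h2 => exact .add _ _ _ h1 h2
  | smul c Z d _ h1 => exact .smul _ _ _ h1
  | bracket V Z d d' _ _ h1 h2 => exact h1.bracket hS h2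
  | congr V Z d h _ h1 => exact .congr _ _ _ h h1

theorem Dominates.add {T : Set (FormalVF n ν)} (hV : Dominates T (V, d)) (hZ : Dominates T (Z, d)) :
    Dominates T (V + Z, d) := by
  obtain ⟨C, hC, H⟩ := hV
  obtain ⟨C', hC', H'⟩ := hZ
  refine ⟨C + C', by positivity, ?_⟩
  filter_upwards [H, H'] with x h1 h2 δ hδ ξ M hM hY
  have : atScale δ (V + Z, d) x = atScale δ (V, d) x + atScale δ (Z, d) x := smul_add _ _ _
  rw [this, map_add, add_mul]
  exact (abs_add_le _ _).trans (add_le_add (h1 δ hδ ξ M hM hY) (h2 δ hδ ξ M hM hY))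

theorem Dominates.smul {T : Set (FormalVF n ν)} (c : ℝ) (hZ : Dominates T (Z, d)) :
    Dominates T (c • Z, d) := by
  obtain ⟨C, hC, H⟩ := hZ
  refine ⟨|c| * C, by positivity, ?_⟩
  filter_upwards [H] with x h1 δ hδ ξ M hM hY
  have : atScale δ (c • Z, d) x = c • atScale δ (Z, d) x := smul_comm (mpow δ d) c (Z x)
  rw [this, map_smul, smul_eq_mul, abs_mul, mul_assoc]
  exact mul_le_mul_of_nonneg_left (h1 δ hδ ξ M hM hY) (abs_nonneg _)

theorem Dominates.congr {T : Set (FormalVF n ν)} (h : V =ᶠ[𝓝 0] Z) (hV : Dominates T (V, d)) :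
    Dominates T (Z, d) := by
  obtain ⟨C, hC, H⟩ := hV
  refine ⟨C, hC, ?_⟩
  filter_upwards [H, h] with x h1 h2 δ hδ ξ M hM hY
  have : atScale δ (Z, d) x = atScale δ (V, d) x := by simp [atScale, h2]
  rw [this]
  exact h1 δ hδ ξ M hM hY

theorem LieGen₀Span.exists_dominates (h : LieGen₀Span S Z d) :
    ∃ T : Set (FormalVF n ν), T.Finite ∧ T ⊆ {Y | LieGen₀ S Y} ∧ Dominates T (Z, d) := by
  induction h with
  | of Z d hZ => exact ⟨{(Z, d)}, finite_singleton _, by simpa using hZ, Dominates.of_mem rfl⟩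
  | zero d =>
    refine ⟨∅, finite_empty, empty_subset _, 0, le_rfl, Eventually.of_forall ?_⟩
    intro x δ _ ξ M _ _
    simp [atScale]
  | add V Z d _ _ h1 h2 =>
    obtain ⟨T, hTf, hT, h⟩ := h1
    obtain ⟨T', hTf', hT', h'⟩ := h2
    exact ⟨T ∪ T', hTf.union hTf', union_subset hT hT',
      (h.mono subset_union_left).add (h'.mono subset_union_right)⟩
  | smul c Z d _ h1 =>
    obtain ⟨T, hTf, hT, h⟩ := h1
    exact ⟨T, hTf, hT, h.smul c⟩
  | congr V Z d h0 _ h1 =>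
    obtain ⟨T, hTf, hT, h⟩ := h1
    exact ⟨T, hTf, hT, h.congr h0⟩

/-- Finitely many elements of the Lie algebra generated by `S` are dominated by a finite subset of
`ℒ₀(S)`. -/
theorem exists_dominates_of_lieSpan (hS : ∀ Y ∈ S, IsSmoothGerm Y.1) {𝒳 : Set (FormalVF n ν)}
    (h𝒳f : 𝒳.Finite) (h𝒳 : ∀ Z ∈ 𝒳, LieSpan S Z.1 Z.2) :
    ∃ T : Set (FormalVF n ν), T.Finite ∧ T ⊆ {Y | LieGen₀ S Y} ∧ ∀ Z ∈ 𝒳, Dominates T Z := by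
  choose! T hTf hT hd using fun Z (hZ : Z ∈ 𝒳) => ((h𝒳 Z hZ).lieGen₀Span hS).exists_dominates
  exact ⟨⋃ Z ∈ 𝒳, T Z, h𝒳f.biUnion hTf, iUnion₂_subset hT, fun Z hZ =>
    (hd Z hZ).mono (subset_biUnion_of_mem (u := T) hZ)⟩

/-- An element of `ℒ₀(S)` is a bracket of finitely many elements of `S`. -/
theorem exists_finite_lieGen₀ {T : Set (FormalVF n ν)} (hTf : T.Finite)
    (hT : T ⊆ {Y | LieGen₀ S Y}) :
    ∃ F : Set (FormalVF n ν), F.Finite ∧ F ⊆ S ∧ T ⊆ {Y | LieGen₀ F Y} := by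
  have key : ∀ Y, LieGen₀ S Y → ∃ F : Set (FormalVF n ν), F.Finite ∧ F ⊆ S ∧ LieGen₀ F Y := by
    intro Y hY
    induction hY with
    | of Y hY => exact ⟨{Y}, finite_singleton _, by simpa using hY, .of _ rfl⟩
    | bracket V Z hV _ ih =>
      obtain ⟨F, hFf, hF, h⟩ := ih
      exact ⟨insert V F, hFf.insert V, insert_subset hV hF,
        .bracket _ _ (mem_insert _ _) (h.mono (subset_insert _ _))⟩
  choose! F hFf hF hY using key
  exact ⟨⋃ Y ∈ T, F Y, hTf.biUnion fun Y hYT => hFf Y (hT hYT),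
    iUnion₂_subset fun Y hYT => hF Y (hT hYT),
    fun Y hYT => (hY Y (hT hYT)).mono (subset_biUnion_of_mem (u := F) hYT)⟩

end LieSpan

/-! ### Finite lists inside the Lie algebra generated by the pure powers -/

section Generates

variable {n ν N q : ℕ}

theorem mpow_one (d : Fin ν → ℕ) : mpow (1 : Fin ν → ℝ) d = 1 := by simp [mpow]

theorem contDiffOn_of_smoothFam {r : ℝ} (hr : 0 < r) {Z : FormalVF n ν}
    (h : SmoothFam r (fam N Z)) : ContDiffOn ℝ ∞ Z.1 (Metric.ball 0 r) := by
  have := h.slice (δ := 1) ⟨zero_le_one, le_rfl⟩ (Metric.mem_ball_self hr)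
  simpa [fam, mpow_one] using this

/-- The germs that are controlled by the list `X` on all small balls. -/
def ctlClass (N : ℕ) (X : Fin q → FormalVF n ν) : Set (FormalVF n ν) :=
  {Z | ∀ᶠ r in 𝓝[>] (0 : ℝ), Ctl X r (fam N Z)}

theorem ctlClass_iff {X : Fin q → FormalVF n ν} {Z : FormalVF n ν} :
    Z ∈ ctlClass N X ↔ ∀ᶠ r in 𝓝[>] (0 : ℝ), Ctl X r (fam N Z) := Iff.rfl

theorem dominates_of_mem_ctlClass {X : Fin q → FormalVF n ν} {Z : FormalVF n ν}
    (hZ : Z ∈ ctlClass N X) : Dominates (range X) Z := by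
  obtain ⟨r, h, hr⟩ := ((ctlClass_iff.1 hZ).and self_mem_nhdsWithin).exists
  obtain ⟨C, hC, H⟩ := h.dom
  refine ⟨C, hC, ?_⟩
  filter_upwards [Metric.ball_mem_nhds (0 : Euc n) hr] with x hx δ hδ ξ M _ hM
  exact H δ hδ (0, x) ⟨Metric.mem_ball_self hr, hx⟩ ξ M fun j => hM _ (mem_range_self j)

theorem isSmoothGerm_of_mem_ctlClass {X : Fin q → FormalVF n ν} {Z : FormalVF n ν}
    (hZ : Z ∈ ctlClass N X) : IsSmoothGerm Z.1 := by
  obtain ⟨r, h, hr⟩ := ((ctlClass_iff.1 hZ).and self_mem_nhdsWithin).exists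
  filter_upwards [Metric.ball_mem_nhds (0 : Euc n) hr] with x hx
  exact (contDiffOn_of_smoothFam hr h.smooth).contDiffAt (Metric.isOpen_ball.mem_nhds hx)

theorem bracket_mem_ctlClass {X : Fin q → FormalVF n ν}
    (hX : ∀ᶠ r in 𝓝[>] (0 : ℝ), IsClosedList N X r) {V Z : FormalVF n ν}
    (hV : V ∈ ctlClass N X) (hZ : Z ∈ ctlClass N X) : bracket V Z ∈ ctlClass N X := by
  rw [ctlClass_iff] at hV hZ ⊢
  filter_upwards [hX, hV, hZ] with r h hV hZ
  exact (hV.bracket h hZ).congr fun δ _ p hp =>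
    fam_bracket (contDiffOn_of_smoothFam h.pos hV.smooth)
      (contDiffOn_of_smoothFam h.pos hZ.smooth) δ hp

theorem isDominatedClass_ctlClass {X : Fin q → FormalVF n ν}
    (hX : ∀ᶠ r in 𝓝[>] (0 : ℝ), IsClosedList N X r) : IsDominatedClass X (ctlClass N X) :=
  ⟨fun hV hZ => bracket_mem_ctlClass hX hV hZ, isSmoothGerm_of_mem_ctlClass,
    dominates_of_mem_ctlClass⟩

theorem LieSpan.mem_ctlClass {X : Fin q → FormalVF n ν}
    (hX : ∀ᶠ r in 𝓝[>] (0 : ℝ), IsClosedList N X r) {S : Set (FormalVF n ν)}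
    (hS : S ⊆ ctlClass N X) {Z : Euc n → Euc n} {d : Fin ν → ℕ} (h : LieSpan S Z d) :
    (Z, d) ∈ ctlClass N X := by
  induction h with
  | of Z d hZ => exact hS hZ
  | zero d hd =>
    refine ctlClass_iff.2 <| Eventually.of_forall fun r => Ctl.zero.congr fun δ _ p _ => ?_
    simp [fam]
  | add V Z d _ _ h1 h2 =>
    rw [ctlClass_iff] at h1 h2 ⊢
    filter_upwards [h1, h2] with r h1 h2
    exact (h1.add h2).congr fun δ _ p _ => by simp [fam]
  | smul c Z d _ h1 =>
    rw [ctlClass_iff] at h1 ⊢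
    filter_upwards [h1] with r h1
    exact (h1.smul c).congr fun δ _ p _ => smul_comm (mpow δ d) c (Z p.2)
  | bracket V Z d d' _ _ h1 h2 => exact bracket_mem_ctlClass hX (V := (V, d)) (Z := (Z, d')) h1 h2
  | congr V Z d h _ h1 =>
    rw [ctlClass_iff] at h1 ⊢
    filter_upwards [h1, eventually_ball h] with r h1 h
    exact h1.congr fun δ _ p hp => by simp [fam, h p.2 hp.2]

/-- The data of a finite list that is closed under brackets, up to control, and controls `W`. -/
structure IsControlList (e : Fin N → Fin ν → ℕ) (X : Fin q → FormalVF n ν)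
    (W : Euc N × Euc n → Euc n) : Prop where
  closed : ∀ᶠ r in 𝓝[>] (0 : ℝ), IsClosedList N X r
  mctl : ∀ᶠ r in 𝓝[>] (0 : ℝ), MCtl X r (dilFam e W)

/-- A generated list that controls `W` is closed under brackets up to control, by the definition of
`Generates`. -/
theorem isControlList_append {e : Fin N → Fin ν → ℕ} {W : Euc N × Euc n → Euc n}
    (hW : ∀ᶠ p in 𝓝 (0 : Euc N × Euc n), ContDiffAt ℝ ∞ W p) {r p : ℕ} {F : Fin r → FormalVF n ν}
    {G : Fin p → FormalVF n ν} (h : Generates F G) (hc : ControlsFamily e (Fin.append F G) W)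
    (hF : ∀ i, IsSmoothGerm (F i).1) : IsControlList e (Fin.append F G) W := by
  have hsm : ∀ j, IsSmoothGerm (Fin.append F G j).1 := by
    intro j
    refine Fin.addCases (fun i => ?_) (fun k => ?_) j
    · rw [Fin.append_left]; exact hF i
    · rw [Fin.append_right]
      exact (h.1 k).isSmoothGerm (by rintro _ ⟨i, rfl⟩; exact hF i)
  refine ⟨?_, hc.eventually_mctl hW⟩
  have h1 : ∀ᶠ r in 𝓝[>] (0 : ℝ), ∀ j, ∀ x ∈ Metric.ball (0 : Euc n) r,
      ContDiffAt ℝ ∞ (Fin.append F G j).1 x := eventually_all.2 fun j => eventually_ball (hsm j)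
  have h2 : ∀ᶠ r in 𝓝[>] (0 : ℝ), ∀ j k,
      Ctl (Fin.append F G) r (fam N (bracket (Fin.append F G j) (Fin.append F G k))) :=
    eventually_all.2 fun j => eventually_all.2 fun k =>
      (h.2 j k).eventually_ctl ((hsm j).bracket (hsm k))
  filter_upwards [h1, h2, self_mem_nhdsWithin] with ρ h1 h2 hρ
  exact ⟨hρ, fun j x hx => (h1 j x hx).contDiffWithinAt, h2⟩

theorem IsControlList.taylorField_mem {e : Fin N → Fin ν → ℕ} {W : Euc N × Euc n → Euc n}
    (hW : ∀ᶠ p in 𝓝 (0 : Euc N × Euc n), ContDiffAt ℝ ∞ W p) {X : Fin q → FormalVF n ν}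
    (hX : IsControlList e X W) (α : Fin N → ℕ) : (taylorField W α, degree e α) ∈ ctlClass N X := by
  rw [ctlClass_iff]
  filter_upwards [hX.mctl, eventually_cyl hW, self_mem_nhdsWithin] with r h hs hr
  exact h.ctl_taylorField hr (fun p hp => (hs p hp).contDiffWithinAt) α

/-- If a list with the properties required by `GeneratesControl` is dominated by finitely many
brackets of fields of `S`, then `S` itself generates such a list. -/
theorem IsControlList.generatesControl {e : Fin N → Fin ν → ℕ} {W : Euc N × Euc n → Euc n}
    {X : Fin q → FormalVF n ν} (hX : IsControlList e X W) {S : Set (FormalVF n ν)}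
    (hS : S ⊆ ctlClass N X) (hdeg : ∀ Y ∈ S, Y.2 ≠ 0) {T : Set (FormalVF n ν)} (hTf : T.Finite)
    (hT : T ⊆ {Y | LieGen₀ S Y}) (hdom : ∀ j, Dominates T (X j)) :
    GeneratesControl e S W ∧
      ∀ Z ∈ ctlClass N X, SetControls {Y | LieGen S Y} Z := by
  obtain ⟨F, hFf, hFS, hTF⟩ := exists_finite_lieGen₀ hTf hT
  obtain ⟨a, f, -, hf⟩ := hFf.fin_param
  obtain ⟨b, g, -, hg⟩ := hTf.fin_param
  set Y : Fin (a + b) → FormalVF n ν := Fin.append f g with hY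
  have hYgen : ∀ l, LieGen S (Y l) := by
    intro l
    refine Fin.addCases (fun i => ?_) (fun k => ?_) l
    · rw [hY, Fin.append_left]
      exact LieGen.of _ (hFS (hf ▸ mem_range_self i))
    · rw [hY, Fin.append_right]
      exact LieGen₀.lieGen (hT (hg ▸ mem_range_self k))
  have hYA : ∀ l, Y l ∈ ctlClass N X := fun l => (hYgen l).lieSpan.mem_ctlClass hX.closed hS
  have hYdeg : ∀ l, (Y l).2 ≠ 0 := fun l => (hYgen l).lieSpan.degree_ne_zero hdeg
  have hTY : T ⊆ range Y := by
    rw [← hg]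
    rintro _ ⟨k, rfl⟩
    exact ⟨Fin.natAdd a k, by rw [hY, Fin.append_right]⟩
  -- a common radius
  have hbdd : ∃ K, 0 ≤ K ∧ ∀ l ∈ (univ : Set (Fin (a + b))), ∀ᶠ x in 𝓝 (0 : Euc n),
      ‖(Y l).1 x‖ ≤ K ∧ ‖fderiv ℝ (Y l).1 x‖ ≤ K := by
    refine finite_univ.exists_uniform_const (fun l _ C C' hC h => ?_) fun l _ => ?_
    · filter_upwards [h] with x hx using ⟨hx.1.trans hC, hx.2.trans hC⟩
    · have h0 := (isSmoothGerm_of_mem_ctlClass (hYA l)).self_of_nhds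
      have h1 := h0.continuousAt.norm.eventually_le_const (lt_add_one ‖(Y l).1 0‖)
      have h2 := ((h0.fderiv_right (m := ∞) (by simp)).continuousAt).norm.eventually_le_const
        (lt_add_one ‖fderiv ℝ (Y l).1 0‖)
      refine ⟨max (‖(Y l).1 0‖ + 1) (‖fderiv ℝ (Y l).1 0‖ + 1), ?_⟩
      filter_upwards [h1, h2] with x hx1 hx2
      exact ⟨hx1.trans (le_max_left _ _), hx2.trans (le_max_right _ _)⟩
  obtain ⟨K, -, hK⟩ := hbdd
  have hK' : ∀ᶠ x in 𝓝 (0 : Euc n), ∀ l, ‖(Y l).1 x‖ ≤ K ∧ ‖fderiv ℝ (Y l).1 x‖ ≤ K :=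
    eventually_all.2 fun l => hK l (mem_univ l)
  obtain ⟨D, hD, HD⟩ := (finite_univ (α := Fin q)).exists_uniform_const
    (P := fun j C => ∀ᶠ x in 𝓝 (0 : Euc n), ∀ δ ∈ Icc (0 : Fin ν → ℝ) 1,
      ∀ (ξ : Euc n →L[ℝ] ℝ) (M : ℝ), 0 ≤ M → (∀ Y ∈ T, |ξ (atScale δ Y x)| ≤ M) →
        |ξ (atScale δ (X j) x)| ≤ C * M)
    (fun Y _ C C' hC H => by
      filter_upwards [H] with x hx δ hδ ξ M hM hY
      exact (hx δ hδ ξ M hM hY).trans (mul_le_mul_of_nonneg_right hC hM))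
    (fun j _ => by obtain ⟨C, -, H⟩ := hdom j; exact ⟨C, H⟩)
  have HD' : ∀ᶠ x in 𝓝 (0 : Euc n), ∀ j, ∀ δ ∈ Icc (0 : Fin ν → ℝ) 1,
      ∀ (ξ : Euc n →L[ℝ] ℝ) (M : ℝ), 0 ≤ M → (∀ Y ∈ T, |ξ (atScale δ Y x)| ≤ M) →
        |ξ (atScale δ (X j) x)| ≤ D * M := eventually_all.2 fun j => HD j (mem_univ j)
  have hgood : ∀ᶠ r in 𝓝[>] (0 : ℝ), IsClosedList N X r ∧ MCtl X r (dilFam e W) ∧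
      (∀ l, Ctl X r (fam N (Y l))) ∧ IsFrameClass Y r {Q : Family ν N n | Ctl X r Q} ∧
      IsFrameList Y r := by
    filter_upwards [hX.closed, hX.mctl, eventually_all.2 fun l => ctlClass_iff.1 (hYA l),
      eventually_ball HD',
      eventually_ball hK'] with r h1 h2 h3 h4 h5
    have h6 : IsFrameClass Y r {Q : Family ν N n | Ctl X r Q} := by
      refine ⟨h3, fun hQ l => (h3 l).bracket h1 hQ, fun hQ => Ctl.smooth hQ, fun hQ => ?_⟩
      obtain ⟨C, hC, H⟩ := Ctl.dom hQ
      refine ⟨C * D, by positivity, fun δ hδ p hp ξ M hM hj => ?_⟩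
      rw [mul_assoc]
      refine H δ hδ p hp ξ (D * M) fun j => h4 p.2 hp.2 j δ hδ ξ M hM fun Z hZ => ?_
      obtain ⟨l, rfl⟩ := hTY hZ
      exact hj l
    exact ⟨h1, h2, h3, h6, h6.isFrameList h1.pos hYdeg
      (fun l => contDiffOn_of_smoothFam h1.pos (h3 l).smooth) ⟨K, fun l x hx => h5 x hx l⟩⟩
  refine ⟨⟨a, b, f, g, fun i => hFS (hf ▸ mem_range_self i), ⟨fun k => ?_, ?_⟩, ?_⟩, fun Z hZ => ?_⟩
  · rw [hf]
    exact hTF (hg ▸ mem_range_self k)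
  · intro j k
    obtain ⟨r, h1, -, h3, h4, h5⟩ := hgood.exists
    refine h4.controls h5 (?_ : Ctl X r (fam N (bracket (Y j) (Y k))))
    exact ((h3 j).bracket h1 (h3 k)).congr fun δ _ p hp =>
      fam_bracket (h5.smooth j) (h5.smooth k) δ hp
  · obtain ⟨r, -, h2, -, h4, h5⟩ := hgood.exists
    exact h4.controlsFamily h5 (𝒲 := {Q | MCtl X r Q}) (fun Q hQ => MCtl.ctl hQ)
      (fun Q hQ i => MCtl.partialFst hQ i) h2
  · obtain ⟨r, hZr, -, -, -, h4, h5⟩ := ((ctlClass_iff.1 hZ).and hgood).exists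
    exact ⟨a + b, Y, hYgen, h4.controls h5 hZr⟩

end Generates

section Conditions

variable {n ν N : ℕ} {e : Fin N → Fin ν → ℕ}

theorem degree_pos (he : ∀ j, e j ≠ 0) {α : Fin N → ℕ} (hα : α ≠ 0) : degree e α ≠ 0 := by
  obtain ⟨j, hj⟩ := Function.ne_iff.1 hα
  obtain ⟨μ, hμ⟩ := Function.ne_iff.1 (he j)
  intro h
  have h1 := congrFun h μ
  simp only [degree, Finset.sum_apply, Pi.smul_apply, smul_eq_mul, Pi.zero_apply,
    Finset.sum_eq_zero_iff, Finset.mem_univ, true_implies] at h1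
  exact (mul_ne_zero hj hμ) (h1 j)

theorem degree_add (α β : Fin N → ℕ) : degree e (α + β) = degree e α + degree e β := by
  simp [degree, add_smul, Finset.sum_add_distrib]

theorem IsPurePower.ne_zero {α : Fin N → ℕ} (h : IsPurePower e α) : α ≠ 0 := by
  rintro rfl
  obtain ⟨μ, hμ, -⟩ := h
  exact hμ (by simp [degree])

theorem IsPurePower.of_add_left (he : ∀ j, e j ≠ 0) {α β : Fin N → ℕ} (hα : α ≠ 0)
    (h : IsPurePower e (α + β)) : IsPurePower e α := by
  obtain ⟨μ, hμ⟩ := Function.ne_iff.1 (degree_pos he hα)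
  obtain ⟨μ₀, -, h2⟩ := h
  have key : ∀ μ, degree e α μ ≠ 0 → μ = μ₀ := fun μ hμ => h2 μ (by
    simp only [degree_add, Pi.add_apply]; omega)
  exact ⟨μ, hμ, fun μ' hμ' => (key μ' hμ').trans (key μ hμ).symm⟩

/-- The fields of the family `E`, with multi-indices as degrees. -/
def multiIndexed (E : (Fin N → ℕ) → Euc n → Euc n) : Set (FormalVF n N) :=
  {Y | ∃ α, α ≠ 0 ∧ Y = (E α, α)}

theorem degree_ne_zero_of_mem_multiIndexed {E : (Fin N → ℕ) → Euc n → Euc n} :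
    ∀ Y ∈ multiIndexed E, Y.2 ≠ 0 := by
  rintro _ ⟨α, hα, rfl⟩; exact hα

variable {E E' : (Fin N → ℕ) → Euc n → Euc n}

theorem LieSpan.map_allPowers {Z : Euc n → Euc n} {α : Fin N → ℕ} (he : ∀ j, e j ≠ 0)
    (h : LieSpan (multiIndexed E) Z α) : LieSpan (allPowers e E) Z (degree e α) := by
  induction h with
  | of Z α hZ =>
    obtain ⟨β, hβ, h⟩ := hZ
    obtain ⟨rfl, rfl⟩ := Prod.mk.inj h
    exact .of _ _ ⟨α, hβ, rfl⟩
  | zero α hα => exact .zero _ (degree_pos he hα)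
  | add V Z d _ _ h1 h2 => exact .add _ _ _ h1 h2
  | smul c Z d _ h1 => exact .smul _ _ _ h1
  | bracket V Z d d' _ _ h1 h2 =>
    rw [degree_add]; exact .bracket _ _ _ _ h1 h2
  | congr V Z d h _ h1 => exact .congr _ _ _ h h1

/-- A bracket whose multi-index is a pure power involves only pure powers. -/
theorem LieSpan.map_purePowers {Z : Euc n → Euc n} {α : Fin N → ℕ} (he : ∀ j, e j ≠ 0)
    (h : LieSpan (multiIndexed E) Z α) (hα : IsPurePower e α) :
    LieSpan (purePowers e E) Z (degree e α) := by
  induction h with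
  | of Z α hZ =>
    obtain ⟨β, hβ, h⟩ := hZ
    obtain ⟨rfl, rfl⟩ := Prod.mk.inj h
    exact .of _ _ ⟨α, hα, rfl⟩
  | zero α hα' => exact .zero _ (degree_pos he hα')
  | add V Z d _ _ h1 h2 => exact .add _ _ _ (h1 hα) (h2 hα)
  | smul c Z d _ h1 => exact .smul _ _ _ (h1 hα)
  | bracket V Z d d' hV hZ h1 h2 =>
    rw [degree_add]
    have hd := hV.degree_ne_zero degree_ne_zero_of_mem_multiIndexed
    have hd' := hZ.degree_ne_zero degree_ne_zero_of_mem_multiIndexed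
    exact .bracket _ _ _ _ (h1 (IsPurePower.of_add_left he hd hα))
      (h2 (IsPurePower.of_add_left he hd' (by rwa [add_comm])))
  | congr V Z d h _ h1 => exact .congr _ _ _ h (h1 hα)

theorem purePowers_subset : purePowers e E ⊆ allPowers e E := by
  rintro _ ⟨α, hα, rfl⟩
  exact ⟨α, IsPurePower.ne_zero hα, rfl⟩

theorem LieSpan.purePowers_trans (he : ∀ j, e j ≠ 0)
    (hE : ∀ α, α ≠ 0 → LieSpan (multiIndexed E') (E α) α) {Z : Euc n → Euc n} {d : Fin ν → ℕ}
    (h : LieSpan (purePowers e E) Z d) : LieSpan (purePowers e E') Z d :=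
  h.trans (by
    rintro _ ⟨α, hα, rfl⟩
    exact (hE α (IsPurePower.ne_zero hα)).map_purePowers he hα)

theorem RadonControl.GeneratesControl.mono {S S' : Set (FormalVF n ν)} (h : S ⊆ S')
    {W : Euc N × Euc n → Euc n} (hS : GeneratesControl e S W) : GeneratesControl e S' W := by
  obtain ⟨r, p, F, G, hF, hG⟩ := hS
  exact ⟨r, p, F, G, fun i => h (hF i), hG⟩

/-- The pure powers of the Taylor coefficients generate a list that controls `W` if and only if
finiteness and the algebraic condition hold for a family `E` that generates the same graded Lie
algebra as the Taylor coefficients. -/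
theorem generatesControl_purePowers_iff (he : ∀ j, e j ≠ 0) {W : Euc N × Euc n → Euc n}
    (hW : ∀ᶠ p in 𝓝 (0 : Euc N × Euc n), ContDiffAt ℝ ∞ W p)
    (hE : ∀ α, α ≠ 0 → LieSpan (multiIndexed (taylorField W)) (E α) α)
    (hE' : ∀ α, α ≠ 0 → LieSpan (multiIndexed E) (taylorField W α) α) :
    GeneratesControl e (purePowers e (taylorField W)) W ↔
      GeneratesControl e (allPowers e E) W ∧ AlgebraicCondition e E := by
  have hTs : ∀ Y ∈ multiIndexed (taylorField W), IsSmoothGerm Y.1 := by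
    rintro _ ⟨α, -, rfl⟩
    obtain ⟨r, hs, hr⟩ := ((eventually_cyl hW).and self_mem_nhdsWithin).exists
    filter_upwards [Metric.ball_mem_nhds (0 : Euc n) hr] with x hx
    exact (contDiffOn_taylorField hr (fun p hp => (hs p hp).contDiffWithinAt) α).contDiffAt
      (Metric.isOpen_ball.mem_nhds hx)
  have hEs : ∀ α, α ≠ 0 → IsSmoothGerm (E α) := fun α hα => (hE α hα).isSmoothGerm hTs
  have hpureE : ∀ Y ∈ purePowers e E, IsSmoothGerm Y.1 := by
    rintro _ ⟨α, hα, rfl⟩; exact hEs α (IsPurePower.ne_zero hα)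
  have hpureT : ∀ Y ∈ purePowers e (taylorField W), IsSmoothGerm Y.1 := by
    rintro _ ⟨α, hα, rfl⟩; exact hTs _ ⟨α, IsPurePower.ne_zero hα, rfl⟩
  have hdegP : ∀ {E : (Fin N → ℕ) → Euc n → Euc n}, ∀ Y ∈ purePowers e E, Y.2 ≠ 0 := by
    rintro E _ ⟨α, hα, rfl⟩; exact degree_pos he (IsPurePower.ne_zero hα)
  -- the fields of both families are controlled by every list as in `GeneratesControl`
  have hmemT : ∀ {q : ℕ} {X : Fin q → FormalVF n ν}, IsControlList e X W →
      allPowers e (taylorField W) ⊆ ctlClass N X := by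
    rintro q X hX _ ⟨α, -, rfl⟩
    exact hX.taylorField_mem hW α
  have hmemE : ∀ {q : ℕ} {X : Fin q → FormalVF n ν}, IsControlList e X W →
      allPowers e E ⊆ ctlClass N X := by
    rintro q X hX _ ⟨α, hα, rfl⟩
    exact ((hE α hα).map_allPowers he).mem_ctlClass hX.closed (hmemT hX)
  constructor
  · rintro ⟨r, p, F, G, hF, hG, hc⟩
    have hX := isControlList_append hW hG hc fun i => hpureT _ (hF i)
    have hgen : ∀ j, LieSpan (purePowers e E) (Fin.append F G j).1 (Fin.append F G j).2 := by
      intro j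
      refine LieSpan.purePowers_trans he hE' ?_
      refine Fin.addCases (fun i => ?_) (fun k => ?_) j
      · rw [Fin.append_left]; exact .of _ _ (hF i)
      · rw [Fin.append_right]
        exact ((hG.1 k).mono (by rintro _ ⟨i, rfl⟩; exact hF i)).lieGen.lieSpan
    -- the list lies in the Lie algebra generated by the pure powers of `E`
    obtain ⟨T, hTf, hT, hd⟩ := exists_dominates_of_lieSpan hpureE (finite_range (Fin.append F G))
      (by rintro _ ⟨j, rfl⟩; exact hgen j)
    obtain ⟨h1, h2⟩ := hX.generatesControl (purePowers_subset.trans (hmemE hX)) hdegP hTf hT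
      fun j => hd _ (mem_range_self j)
    exact ⟨h1.mono purePowers_subset, fun α hα _ => h2 _ (hmemE hX ⟨α, hα, rfl⟩)⟩
  · rintro ⟨⟨r, p, F, G, hF, hG, hc⟩, halg⟩
    have hFs : ∀ i, IsSmoothGerm (F i).1 := by
      intro i
      obtain ⟨α, hα, h⟩ := hF i
      rw [h]; exact hEs α hα
    have hX := isControlList_append hW hG hc hFs
    -- by the algebraic condition, the generators are dominated by brackets of pure powers
    have hFgen : ∀ i, ∃ 𝒴 : Set (FormalVF n ν), 𝒴.Finite ∧
        𝒴 ⊆ {Y | LieGen (purePowers e E) Y} ∧ Dominates 𝒴 (F i) := by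
      intro i
      obtain ⟨α, hα, h⟩ := hF i
      by_cases hp : IsPurePower e α
      · exact ⟨{F i}, finite_singleton _, by
          rw [h]; exact singleton_subset_iff.2 (LieGen.of (S := purePowers e E) _ ⟨α, hp, rfl⟩),
            Dominates.of_mem rfl⟩
      · obtain ⟨q, Z, hZ, hcon⟩ := halg α hα hp
        refine ⟨range Z, finite_range Z, by rintro _ ⟨j, rfl⟩; exact hZ j, ?_⟩
        rw [h]
        exact dominates_of_mem_ctlClass (N := N) <| ctlClass_iff.2 (hcon.eventually_ctl (hEs α hα))
    choose 𝒴 h𝒴f h𝒴 h𝒴d using hFgen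
    have hUgen : (⋃ i, 𝒴 i) ⊆ {Y | LieGen (purePowers e E) Y} := iUnion_subset h𝒴
    have hpE := purePowers_subset.trans (hmemE hX)
    obtain ⟨T, hTf, hT, hd⟩ := (isDominatedClass_ctlClass hX.closed).exists_dominates
      (X := Fin.append F G) (S := range F) (𝒴 := ⋃ i, 𝒴 i)
      (by rintro _ ⟨i, rfl⟩; exact hmemE hX (hF i))
      (fun j => by
        refine Fin.addCases (fun i => ?_) (fun k => ?_) j
        · rw [Fin.append_left]; exact .of _ (mem_range_self i)
        · rw [Fin.append_right]; exact hG.1 k)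
      (finite_iUnion h𝒴f)
      (fun Y hY => (hUgen hY : LieGen _ _).lieSpan.mem_ctlClass hX.closed hpE)
      (by rintro _ ⟨i, rfl⟩; exact (h𝒴d i).mono (subset_iUnion 𝒴 i))
    have hTspan : ∀ Z ∈ T, LieSpan (purePowers e (taylorField W)) Z.1 Z.2 := fun Z hZ =>
      LieSpan.purePowers_trans he hE
        ((hT hZ : LieGen _ _).lieSpan.trans fun Y hY => (hUgen hY : LieGen _ _).lieSpan)
    obtain ⟨T', hTf', hT', hd'⟩ := exists_dominates_of_lieSpan hpureT hTf hTspan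
    exact (hX.generatesControl (purePowers_subset.trans (hmemT hX)) hdegP hTf' hT'
      fun j => (hd j).trans hTf hd').1

end Conditions

/-! ### The logarithmic derivative of an exponential with non-commuting coefficients -/

section Formal

open Finset in
/-- For a derivation `D`, with `ad_V B = V B - B V`:
`D(V^n) = ∑_k (-1)^k C(n,k+1) V^{n-1-k} ad_V^k(D V)`. -/
theorem derivation_pow {A : Type*} [Ring A] [Algebra ℝ A] (D : A →+ A)
    (hD : ∀ a b, D (a * b) = D a * b + a * D b) (V : A) (n : ℕ) :
    D (V ^ n) = ∑ k ∈ range n, (((-1) ^ k * (n.choose (k + 1) : ℝ)) : ℝ) •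
      (V ^ (n - 1 - k) * (fun B => V * B - B * V)^[k] (D V)) := by
  have h1 : D 1 = 0 := by simpa using hD 1 1
  induction n with
  | zero => simpa using h1
  | succ n ih =>
    set B : ℕ → A := fun k => (fun B => V * B - B * V)^[k] (D V) with hB
    have hBs : ∀ k, B k * V = V * B k - B (k + 1) := fun k => by
      simp only [hB, Function.iterate_succ_apply']; abel
    have hB0 : D V = B 0 := rfl
    rw [pow_succ, hD, ih, sum_mul]
    have h2 : ∀ k ∈ range n, ((((-1) ^ k * (n.choose (k + 1) : ℝ)) : ℝ) •
        (V ^ (n - 1 - k) * B k)) * V =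
        (((-1) ^ k * (n.choose (k + 1) : ℝ)) : ℝ) • (V ^ (n - k) * B k) +
        (((-1) ^ (k + 1) * (n.choose (k + 1) : ℝ)) : ℝ) • (V ^ (n - (k + 1)) * B (k + 1)) := by
      intro k hk
      have hk := mem_range.1 hk
      rw [smul_mul_assoc, mul_assoc, hBs, mul_sub, ← mul_assoc, ← pow_succ,
        show n - 1 - k + 1 = n - k by omega, show n - 1 - k = n - (k + 1) by omega, smul_sub,
        pow_succ, mul_neg_one, neg_mul, neg_smul, sub_eq_add_neg]
    rw [sum_congr rfl h2, sum_add_distrib]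
    have h3 : ∀ k ∈ range (n + 1), (((-1) ^ k * ((n + 1).choose (k + 1) : ℝ)) : ℝ) •
        (V ^ (n + 1 - 1 - k) * B k) =
        (((-1) ^ k * (n.choose (k + 1) : ℝ)) : ℝ) • (V ^ (n - k) * B k) +
        (((-1) ^ k * (n.choose k : ℝ)) : ℝ) • (V ^ (n - k) * B k) := by
      intro k _
      rw [← add_smul, Nat.choose_succ_succ, Nat.add_sub_cancel]
      push_cast
      congr 1
      ring
    rw [sum_congr rfl h3, sum_add_distrib, sum_range_succ (fun k => (((-1) ^ k *
      (n.choose (k + 1) : ℝ)) : ℝ) • (V ^ (n - k) * B k)) n, sum_range_succ' (fun k => (((-1) ^ k *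
      (n.choose k : ℝ)) : ℝ) • (V ^ (n - k) * B k)) n]
    simp [hB0, add_assoc]

variable {N : ℕ} {R : Type*} [Ring R]

/-- Polynomials in `N` central variables with coefficients in the ring `R`. -/
abbrev CPoly (N : ℕ) (R : Type*) [Ring R] : Type _ := AddMonoidAlgebra R (Fin N → ℕ)

/-- The pairs of multi-indices with sum `α`. -/
def splittings (α : Fin N → ℕ) : Finset ((Fin N → ℕ) × (Fin N → ℕ)) :=
  (Finset.Iic α ×ˢ Finset.Iic α).filter fun p => p.1 + p.2 = α

theorem mem_splittings {α : Fin N → ℕ} {p : (Fin N → ℕ) × (Fin N → ℕ)} :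
    p ∈ splittings α ↔ p.1 + p.2 = α := by
  simp only [splittings, Finset.mem_filter, Finset.mem_product, Finset.mem_Iic,
    and_iff_right_iff_imp]
  rintro rfl
  exact ⟨le_self_add, le_add_self⟩

theorem CPoly.coeff_mul (P Q : CPoly N R) (α : Fin N → ℕ) :
    (P * Q).coeff α = ∑ p ∈ splittings α, P.coeff p.1 * Q.coeff p.2 :=
  AddMonoidAlgebra.coeff_mul_antidiag P Q α _ mem_splittings

theorem CPoly.coeff_commutator (P Q : CPoly N R) (α : Fin N → ℕ) :
    (P * Q - Q * P).coeff α =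
      ∑ p ∈ splittings α, (P.coeff p.1 * Q.coeff p.2 - Q.coeff p.2 * P.coeff p.1) := by
  have h1 : (Q * P).coeff α = ∑ p ∈ splittings α, Q.coeff p.2 * P.coeff p.1 := by
    rw [CPoly.coeff_mul]
    refine Finset.sum_nbij' Prod.swap Prod.swap ?_ ?_ ?_ ?_ ?_ <;>
      simp [mem_splittings, add_comm]
  change (P * Q).coeff α - (Q * P).coeff α = _
  rw [h1, CPoly.coeff_mul, Finset.sum_sub_distrib]

theorem sum_index_add (α β : Fin N → ℕ) : ∑ i, (α + β) i = ∑ i, α i + ∑ i, β i :=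
  Finset.sum_add_distrib

theorem sum_index_eq_zero {α : Fin N → ℕ} : ∑ i, α i = 0 ↔ α = 0 := by
  simp [Finset.sum_eq_zero_iff, funext_iff]

theorem sum_index_pos {α : Fin N → ℕ} : 0 < ∑ i, α i ↔ α ≠ 0 := by
  rw [Nat.pos_iff_ne_zero, Ne, sum_index_eq_zero]

/-- All terms of `P` have degree at least `k`. -/
def VanishBelow (k : ℕ) (P : CPoly N R) : Prop := ∀ α, ∑ i, α i < k → P.coeff α = 0

namespace VanishBelow

variable {k l : ℕ} {P Q : CPoly N R}

theorem mono (h : VanishBelow k P) (hl : l ≤ k) : VanishBelow l P := fun α hα =>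
  h α (hα.trans_le hl)

theorem zero : VanishBelow k (0 : CPoly N R) := fun _ _ => rfl

theorem of_zero : VanishBelow 0 P := fun _ h => absurd h (by simp)

theorem add (hP : VanishBelow k P) (hQ : VanishBelow k Q) : VanishBelow k (P + Q) := fun α hα => by
  simp [hP α hα, hQ α hα]

theorem sub (hP : VanishBelow k P) (hQ : VanishBelow k Q) : VanishBelow k (P - Q) := fun α hα => by
  simp [AddMonoidAlgebra.coeff_sub, hP α hα, hQ α hα]

theorem coeff_eq (h : VanishBelow k (P - Q)) {α : Fin N → ℕ} (hα : ∑ i, α i < k) :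
    P.coeff α = Q.coeff α := sub_eq_zero.1 (h α hα)

theorem of_coeff_eq (h : ∀ α, ∑ i, α i < k → P.coeff α = Q.coeff α) : VanishBelow k (P - Q) :=
  fun α hα => sub_eq_zero.2 (h α hα)

theorem smul [Algebra ℝ R] (c : ℝ) (hP : VanishBelow k P) : VanishBelow k (c • P) := fun α hα => by
  simp [hP α hα]

theorem sum {ι : Type*} {s : Finset ι} {f : ι → CPoly N R} (h : ∀ i ∈ s, VanishBelow k (f i)) :
    VanishBelow k (∑ i ∈ s, f i) := by
  classical
  induction s using Finset.induction_on with
  | empty => simpa using zero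
  | insert i s hi ih =>
    rw [Finset.sum_insert hi]
    exact (h i (Finset.mem_insert_self i s)).add (ih fun j hj => h j (Finset.mem_insert_of_mem hj))

theorem mul (hP : VanishBelow k P) (hQ : VanishBelow l Q) : VanishBelow (k + l) (P * Q) := by
  intro α hα
  rw [CPoly.coeff_mul]
  refine Finset.sum_eq_zero fun p hp => ?_
  rw [← mem_splittings.1 hp, sum_index_add] at hα
  rcases lt_or_ge (∑ i, p.1 i) k with h | h
  · rw [hP _ h, zero_mul]
  · rw [hQ _ (by omega), mul_zero]

theorem pow (hP : VanishBelow 1 P) (m : ℕ) : VanishBelow m (P ^ m) := by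
  induction m with
  | zero => exact of_zero
  | succ m ih => rw [pow_succ]; exact ih.mul hP

theorem iterate_ad (hP : VanishBelow 1 P) (hQ : VanishBelow 1 Q) (m : ℕ) :
    VanishBelow (m + 1) ((fun B => P * B - B * P)^[m] Q) := by
  induction m with
  | zero => exact hQ
  | succ m ih =>
    rw [Function.iterate_succ_apply']
    exact ((hP.mul ih).mono (by omega)).sub (ih.mul hP)

/-- The terms of degree at most `m` of `P ^ k`, `k ≥ 2`, depend only on the terms of degree less
than `m` of `P`. -/
theorem pow_sub_pow {m : ℕ} (hP : VanishBelow 1 P) (hQ : VanishBelow 1 Q)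
    (h : VanishBelow m (P - Q)) : VanishBelow (m + k) (P ^ (k + 1) - Q ^ (k + 1)) := by
  induction k with
  | zero => simpa using h
  | succ k ih =>
    have : P ^ (k + 1 + 1) - Q ^ (k + 1 + 1) =
        (P ^ (k + 1) - Q ^ (k + 1)) * P + Q ^ (k + 1) * (P - Q) := by
      rw [pow_succ P, pow_succ Q]; noncomm_ring
    rw [this]
    exact ((ih.mul hP).mono (by omega)).add (((hQ.pow (k + 1)).mul h).mono (by omega))

/-- A polynomial with constant term `1` can be cancelled on the left. -/
theorem of_mul_left (hP : VanishBelow 1 (P - 1)) (h : VanishBelow k (P * Q)) :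
    VanishBelow k Q := by
  have key : ∀ l ≤ k, VanishBelow l Q := by
    intro l
    induction l with
    | zero => exact fun _ => of_zero
    | succ l ih =>
      intro hl
      have h2 : Q = P * Q - (P - 1) * Q := by noncomm_ring
      rw [h2]
      exact (h.mono hl).sub ((hP.mul (ih (by omega))).mono (by omega))
  exact key k le_rfl

end VanishBelow

/-- The Euler operator `∑_i t_i ∂_i`. -/
noncomputable def euler : CPoly N R →+ CPoly N R where
  toFun P := .ofCoeff (Finsupp.onFinset P.coeff.support (fun α => (∑ i, α i) • P.coeff α) fun α h =>
    Finsupp.mem_support_iff.2 fun h' => h (by rw [h', smul_zero]))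
  map_zero' := by ext α; simp
  map_add' P Q := by ext α; simp

@[simp]
theorem coeff_euler (P : CPoly N R) (α : Fin N → ℕ) :
    (euler P).coeff α = (∑ i, α i) • P.coeff α := rfl

theorem euler_mul (P Q : CPoly N R) : euler (P * Q) = euler P * Q + P * euler Q := by
  ext α
  rw [AddMonoidAlgebra.coeff_add, Finsupp.add_apply, coeff_euler, CPoly.coeff_mul, CPoly.coeff_mul,
    CPoly.coeff_mul, Finset.smul_sum, ← Finset.sum_add_distrib]
  refine Finset.sum_congr rfl fun p hp => ?_
  rw [← mem_splittings.1 hp, sum_index_add, coeff_euler, coeff_euler, add_smul, smul_mul_assoc,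
    mul_smul_comm]

theorem VanishBelow.euler {k : ℕ} {P : CPoly N R} (h : VanishBelow k P) :
    VanishBelow k (euler P) := fun α hα => by rw [coeff_euler, h α hα, smul_zero]

/-- The partial sum `∑_{k<M} V^k / k!` of the exponential. -/
noncomputable def truncExp {A : Type*} [Ring A] [Algebra ℝ A] (M : ℕ) (V : A) : A :=
  ∑ k ∈ Finset.range M, ((k.factorial : ℝ)⁻¹) • V ^ k

/-- The partial sum `∑_{k<M} (-1)^k/(k+1)! ad_V^k(B)` of `(1 - e^{-ad V})/(ad V) B`. -/
noncomputable def truncDexp {A : Type*} [Ring A] [Algebra ℝ A] (M : ℕ) (V B : A) : A :=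
  ∑ k ∈ Finset.range M, ((-1) ^ k * ((k + 1).factorial : ℝ)⁻¹ : ℝ) •
    (fun B => V * B - B * V)^[k] B

/-- `E(e^V) = e^V · (1 - e^{-ad V})/(ad V) (E V)` for the Euler operator `E`, up to terms of degree
at least `M`. -/
theorem vanishBelow_euler_truncExp [Algebra ℝ R] {V : CPoly N R} (hV : VanishBelow 1 V) (M : ℕ) :
    VanishBelow M (euler (truncExp M V) - truncExp M V * truncDexp M V (euler V)) := by
  set f : ℕ → ℕ → CPoly N R := fun a k => ((a.factorial : ℝ)⁻¹ *
    ((-1) ^ k * ((k + 1).factorial : ℝ)⁻¹) : ℝ) •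
      (V ^ a * (fun B => V * B - B * V)^[k] (euler V)) with hf
  have h1 : truncExp M V * truncDexp M V (euler V) =
      ∑ p ∈ Finset.range M ×ˢ Finset.range M, f p.1 p.2 := by
    rw [truncExp, truncDexp, Finset.sum_mul_sum, Finset.sum_product]
    simp only [hf, smul_mul_smul_comm]
  have hsm : ∀ (c : ℝ) (P : CPoly N R), euler (c • P) = c • euler P := by
    intro c P
    ext α
    rw [coeff_euler, AddMonoidAlgebra.coeff_smul_apply, AddMonoidAlgebra.coeff_smul_apply,
      coeff_euler, smul_comm]
  have h2 : euler (truncExp M V) = ∑ p ∈ (Finset.range M ×ˢ Finset.range M).filter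
      (fun p => p.1 + p.2 + 1 < M), f p.1 p.2 := by
    have h3 : ∀ m ∈ Finset.range M, euler (((m.factorial : ℝ)⁻¹) • V ^ m) =
        ∑ k ∈ Finset.range m, f (m - 1 - k) k := by
      intro m _
      rw [hsm, derivation_pow euler euler_mul, Finset.smul_sum]
      refine Finset.sum_congr rfl fun k hk => ?_
      have hk := Finset.mem_range.1 hk
      rw [smul_smul]
      congr 1
      have h4 : ((m.choose (k + 1) : ℝ)) * (k + 1).factorial * (m - 1 - k).factorial =
          m.factorial := by
        rw [show m - 1 - k = m - (k + 1) by omega]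
        exact_mod_cast Nat.choose_mul_factorial_mul_factorial (by omega : k + 1 ≤ m)
      have := Nat.factorial_ne_zero m
      have := Nat.factorial_ne_zero (k + 1)
      have := Nat.factorial_ne_zero (m - 1 - k)
      rw [← h4]
      have : (m.choose (k + 1) : ℝ) ≠ 0 := by
        exact_mod_cast (Nat.choose_pos (by omega : k + 1 ≤ m)).ne'
      field_simp
    rw [truncExp, map_sum, Finset.sum_congr rfl h3, Finset.sum_sigma']
    refine Finset.sum_nbij' (fun x => (x.1 - 1 - x.2, x.2)) (fun p => ⟨p.1 + p.2 + 1, p.2⟩)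
      ?_ ?_ ?_ ?_ ?_
    · rintro ⟨m, k⟩ h
      simp only [Finset.mem_sigma, Finset.mem_range, Finset.mem_filter, Finset.mem_product] at h ⊢
      omega
    · rintro ⟨a, k⟩ h
      simp only [Finset.mem_sigma, Finset.mem_range, Finset.mem_filter, Finset.mem_product] at h ⊢
      omega
    · rintro ⟨m, k⟩ h
      simp only [Finset.mem_sigma, Finset.mem_range] at h
      simp only [Sigma.mk.injEq, heq_eq_eq, and_true]
      omega
    · rintro ⟨a, k⟩ h
      simp only [Prod.mk.injEq, and_true]
      omega
    · intros; rfl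
  rw [h1, h2, ← Finset.sum_filter_add_sum_filter_not (Finset.range M ×ˢ Finset.range M)
    (fun p => p.1 + p.2 + 1 < M), sub_add_cancel_left, ← neg_one_smul ℝ]
  refine (VanishBelow.sum fun p hp => ?_).smul _
  exact (((hV.pow p.1).mul (hV.iterate_ad hV.euler p.2)).smul _).mono
    (by have := (Finset.mem_filter.1 hp).2; omega)

theorem vanishBelow_truncExp_sub_one [Algebra ℝ R] {V : CPoly N R} (hV : VanishBelow 1 V) {M : ℕ}
    (hM : 0 < M) :
    VanishBelow 1 (truncExp M V - 1) := by
  obtain ⟨m, rfl⟩ := Nat.exists_eq_add_of_lt hM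
  rw [truncExp, zero_add, Finset.sum_range_succ']
  simp only [Nat.factorial_zero, Nat.cast_one, inv_one, pow_zero, one_smul, add_sub_cancel_right]
  exact VanishBelow.sum fun k _ => ((hV.pow (k + 1)).smul _).mono (by omega)

end Formal

/-! ### Smooth maps on a ball and the differential operators of vector fields -/

section Operators

variable {n N : ℕ} {r : ℝ}

/-- The smooth maps from the ball of radius `r` to `ℝ^n`, extended by zero. They serve both as
vector fields and as the vector valued functions on which vector fields act. -/
def smoothMaps (n : ℕ) (r : ℝ) : Submodule ℝ (Euc n → Euc n) where
  carrier := {h | ContDiffOn ℝ ∞ h (Metric.ball 0 r) ∧ ∀ x ∉ Metric.ball (0 : Euc n) r, h x = 0}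
  zero_mem' := ⟨contDiffOn_const, fun _ _ => rfl⟩
  add_mem' hf hg := ⟨hf.1.add hg.1, fun x hx => by simp [hf.2 x hx, hg.2 x hx]⟩
  smul_mem' c f hf := ⟨hf.1.const_smul c, fun x hx => by simp [hf.2 x hx]⟩

/-- The restriction of a map that is smooth on the ball, extended by zero. -/
noncomputable def restrictBall (h : Euc n → Euc n) (hh : ContDiffOn ℝ ∞ h (Metric.ball 0 r)) :
    smoothMaps n r :=
  ⟨(Metric.ball 0 r).indicator h, hh.congr fun _ hx => indicator_of_mem hx _,
    fun _ hx => indicator_of_notMem hx _⟩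

theorem restrictBall_apply {h : Euc n → Euc n} (hh : ContDiffOn ℝ ∞ h (Metric.ball 0 r)) {x : Euc n}
    (hx : x ∈ Metric.ball 0 r) : (restrictBall h hh).1 x = h x := indicator_of_mem hx _

theorem smoothMaps_ext {f g : smoothMaps n r} (h : ∀ x ∈ Metric.ball (0 : Euc n) r, f.1 x = g.1 x) :
    f = g := by
  refine Subtype.ext (funext fun x => ?_)
  by_cases hx : x ∈ Metric.ball (0 : Euc n) r
  · exact h x hx
  · rw [f.2.2 x hx, g.2.2 x hx]

theorem smoothMaps_contDiffAt (f : smoothMaps n r) {x : Euc n} (hx : x ∈ Metric.ball 0 r) :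
    ContDiffAt ℝ ∞ f.1 x := f.2.1.contDiffAt (Metric.isOpen_ball.mem_nhds hx)

theorem smoothMaps_hasFDerivAt (f : smoothMaps n r) {x : Euc n} (hx : x ∈ Metric.ball 0 r) :
    HasFDerivAt f.1 (fderiv ℝ f.1 x) x :=
  ((smoothMaps_contDiffAt f hx).differentiableAt (by simp)).hasFDerivAt

theorem contDiffOn_fderiv_apply (f X : smoothMaps n r) :
    ContDiffOn ℝ ∞ (fun x => fderiv ℝ f.1 x (X.1 x)) (Metric.ball 0 r) :=
  (f.2.1.fderiv_of_isOpen Metric.isOpen_ball (by simp)).clm_apply X.2.1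

/-- The derivative in the direction of the vector field `X`, as an operator on smooth maps. -/
noncomputable def lieDer : smoothMaps n r →ₗ[ℝ] Module.End ℝ (smoothMaps n r) where
  toFun X :=
    { toFun := fun f => restrictBall _ (contDiffOn_fderiv_apply f X)
      map_add' := fun f g => smoothMaps_ext fun x hx => by
        change _ = (restrictBall _ _).1 x + (restrictBall _ _).1 x
        rw [restrictBall_apply _ hx, restrictBall_apply _ hx, restrictBall_apply _ hx]
        exact congrArg (fun L : Euc n →L[ℝ] Euc n => L (X.1 x))
          ((smoothMaps_hasFDerivAt f hx).add (smoothMaps_hasFDerivAt g hx)).fderiv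
      map_smul' := fun c f => smoothMaps_ext fun x hx => by
        change _ = c • (restrictBall _ _).1 x
        rw [restrictBall_apply _ hx, restrictBall_apply _ hx]
        exact congrArg (fun L : Euc n →L[ℝ] Euc n => L (X.1 x))
          ((smoothMaps_hasFDerivAt f hx).const_smul c).fderiv }
  map_add' X Y := LinearMap.ext fun f => smoothMaps_ext fun x hx => by
    change (restrictBall _ (contDiffOn_fderiv_apply f (X + Y))).1 x =
      (restrictBall _ (contDiffOn_fderiv_apply f X)).1 x +
        (restrictBall _ (contDiffOn_fderiv_apply f Y)).1 x
    rw [restrictBall_apply _ hx, restrictBall_apply _ hx, restrictBall_apply _ hx]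
    exact map_add _ _ _
  map_smul' c X := LinearMap.ext fun f => smoothMaps_ext fun x hx => by
    change (restrictBall _ (contDiffOn_fderiv_apply f (c • X))).1 x =
      c • (restrictBall _ (contDiffOn_fderiv_apply f X)).1 x
    rw [restrictBall_apply _ hx, restrictBall_apply _ hx]
    exact (fderiv ℝ f.1 x).map_smul c (X.1 x)

theorem lieDer_apply (X f : smoothMaps n r) {x : Euc n} (hx : x ∈ Metric.ball 0 r) :
    (lieDer X f).1 x = fderiv ℝ f.1 x (X.1 x) :=
  restrictBall_apply (contDiffOn_fderiv_apply f X) hx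

/-- The identity map of the ball. -/
noncomputable def idMap (n : ℕ) (r : ℝ) : smoothMaps n r := restrictBall id contDiffOn_id

theorem idMap_apply {x : Euc n} (hx : x ∈ Metric.ball 0 r) : (idMap n r).1 x = x :=
  restrictBall_apply _ hx

theorem lieDer_idMap (X : smoothMaps n r) : lieDer X (idMap n r) = X := by
  refine smoothMaps_ext fun x hx => ?_
  have : (idMap n r).1 =ᶠ[𝓝 x] id := by
    filter_upwards [Metric.isOpen_ball.mem_nhds hx] with y hy using idMap_apply hy
  rw [lieDer_apply X _ hx, this.fderiv_eq, fderiv_id]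
  rfl

theorem lieDer_injective : Function.Injective (lieDer (n := n) (r := r)) := fun X Y h => by
  rw [← lieDer_idMap X, h, lieDer_idMap]

theorem contDiffOn_lieBracket (X Y : smoothMaps n r) :
    ContDiffOn ℝ ∞ (VectorField.lieBracket ℝ X.1 Y.1) (Metric.ball 0 r) :=
  (contDiffOn_fderiv_apply Y X).sub (contDiffOn_fderiv_apply X Y)

theorem lieDer_mul_sub_mul (X Y : smoothMaps n r) :
    lieDer X * lieDer Y - lieDer Y * lieDer X =
      lieDer (restrictBall _ (contDiffOn_lieBracket X Y)) := by
  refine LinearMap.ext fun f => smoothMaps_ext fun x hx => ?_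
  have key : ∀ X Y : smoothMaps n r, (lieDer X (lieDer Y f)).1 x =
      fderiv ℝ (fderiv ℝ f.1) x (X.1 x) (Y.1 x) + fderiv ℝ f.1 x (fderiv ℝ Y.1 x (X.1 x)) := by
    intro X Y
    have h1 : (lieDer Y f).1 =ᶠ[𝓝 x] fun x => fderiv ℝ f.1 x (Y.1 x) := by
      filter_upwards [Metric.isOpen_ball.mem_nhds hx] with y hy using lieDer_apply Y f hy
    have h2 : HasFDerivAt (fderiv ℝ f.1) (fderiv ℝ (fderiv ℝ f.1) x) x :=
      (((smoothMaps_contDiffAt f hx).fderiv_right (m := ∞) (by simp)).differentiableAt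
        (by simp)).hasFDerivAt
    rw [lieDer_apply _ _ hx, h1.fderiv_eq, (h2.clm_apply (smoothMaps_hasFDerivAt Y hx)).fderiv]
    simp [add_comm]
  change (lieDer X (lieDer Y f)).1 x - (lieDer Y (lieDer X f)).1 x = _
  have hsymm : fderiv ℝ (fderiv ℝ f.1) x (X.1 x) (Y.1 x) =
      fderiv ℝ (fderiv ℝ f.1) x (Y.1 x) (X.1 x) :=
    (((smoothMaps_contDiffAt f hx).isSymmSndFDerivAt (by
      rw [minSmoothness_of_isRCLikeNormedField]; exact WithTop.coe_le_coe.2 le_top)) _ _)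
  rw [key, key, lieDer_apply _ _ hx, restrictBall_apply _ hx, hsymm, VectorField.lieBracket,
    map_sub]
  abel

/-- The operators at multi-index `α` that are given by vector fields in the graded Lie algebra
generated by `S`. -/
def lieOperators (S : Set (FormalVF n N)) (r : ℝ) (α : Fin N → ℕ) :
    Submodule ℝ (Module.End ℝ (smoothMaps n r)) where
  carrier := {T | ∃ Y, T = lieDer Y ∧ (α ≠ 0 → LieSpan S Y.1 α)}
  zero_mem' := ⟨0, by simp, fun h => .zero α h⟩
  add_mem' := by
    rintro _ _ ⟨X, rfl, hX⟩ ⟨Y, rfl, hY⟩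
    exact ⟨X + Y, by simp, fun h => .add _ _ _ (hX h) (hY h)⟩
  smul_mem' := by
    rintro c _ ⟨X, rfl, hX⟩
    exact ⟨c • X, by simp, fun h => .smul _ _ _ (hX h)⟩

theorem sub_mem_lieOperators {S : Set (FormalVF n N)} {α : Fin N → ℕ}
    {T T' : Module.End ℝ (smoothMaps n r)} (hT : T ∈ lieOperators S r α)
    (hT' : T' ∈ lieOperators S r α) : T - T' ∈ lieOperators S r α := by
  obtain ⟨X, rfl, hX⟩ := hT
  obtain ⟨Y, rfl, hY⟩ := hT'
  refine ⟨X - Y, (map_sub lieDer X Y).symm, fun h => ?_⟩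
  rw [sub_eq_add_neg, ← neg_one_smul ℝ Y]
  exact .add _ _ _ (hX h) (.smul (-1) _ _ (hY h))

theorem mul_sub_mul_mem_lieOperators (hr : 0 < r) {S : Set (FormalVF n N)} {α β : Fin N → ℕ}
    (hα : α ≠ 0) (hβ : β ≠ 0) {T T' : Module.End ℝ (smoothMaps n r)} (hT : T ∈ lieOperators S r α)
    (hT' : T' ∈ lieOperators S r β) : T * T' - T' * T ∈ lieOperators S r (α + β) := by
  obtain ⟨X, rfl, hX⟩ := hT
  obtain ⟨Y, rfl, hY⟩ := hT'
  refine ⟨_, lieDer_mul_sub_mul X Y, fun _ => .congr _ _ _ ?_ (.bracket _ _ _ _ (hX hα) (hY hβ))⟩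
  filter_upwards [Metric.ball_mem_nhds (0 : Euc n) hr] with x hx
  exact (restrictBall_apply _ hx).symm

/-- A commutator of polynomials without constant term involves only coefficients of strictly lower
degree. -/
theorem commutator_coeff_mem (hr : 0 < r) {S : Set (FormalVF n N)} {m : ℕ}
    {P Q : CPoly N (Module.End ℝ (smoothMaps n r))} (hP : VanishBelow 1 P) (hQ : VanishBelow 1 Q)
    (hPm : ∀ α, ∑ i, α i < m → P.coeff α ∈ lieOperators S r α)
    (hQm : ∀ α, ∑ i, α i < m → Q.coeff α ∈ lieOperators S r α) (α : Fin N → ℕ)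
    (hα : ∑ i, α i < m + 1) : (P * Q - Q * P).coeff α ∈ lieOperators S r α := by
  rw [CPoly.coeff_commutator]
  refine Submodule.sum_mem _ fun p hp => ?_
  rw [← mem_splittings.1 hp] at hα ⊢
  rw [sum_index_add] at hα
  by_cases h1 : p.1 = 0
  · rw [hP p.1 (by simp [h1])]; simp
  by_cases h2 : p.2 = 0
  · rw [hQ p.2 (by simp [h2])]; simp
  have h1' := sum_index_pos.2 h1
  have h2' := sum_index_pos.2 h2
  exact mul_sub_mul_mem_lieOperators hr h1 h2 (hPm _ (by omega)) (hQm _ (by omega))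

/-- In `(1 - e^{-ad V})/(ad V) (E V)` the coefficients of degree at most `m` are those of `E V` up
to commutators of the coefficients of degree less than `m` of `V`. -/
theorem truncDexp_sub_coeff_mem (hr : 0 < r) {S : Set (FormalVF n N)} {m : ℕ}
    {V : CPoly N (Module.End ℝ (smoothMaps n r))} (hV : VanishBelow 1 V)
    (hVm : ∀ α, ∑ i, α i < m → V.coeff α ∈ lieOperators S r α) (M : ℕ) {α : Fin N → ℕ}
    (hα : ∑ i, α i < m + 1) :
    (truncDexp (M + 1) V (euler V) - euler V).coeff α ∈ lieOperators S r α := by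
  have hE : ∀ α, ∑ i, α i < m → (euler V).coeff α ∈ lieOperators S r α := fun α h => by
    rw [coeff_euler, ← Nat.cast_smul_eq_nsmul ℝ]
    exact Submodule.smul_mem _ _ (hVm α h)
  have had : ∀ k : ℕ, ∀ α, ∑ i, α i < m →
      ((fun B => V * B - B * V)^[k] (euler V)).coeff α ∈ lieOperators S r α := by
    intro k
    induction k with
    | zero => exact hE
    | succ k ih =>
      intro α h
      rw [Function.iterate_succ_apply']
      exact commutator_coeff_mem hr hV ((hV.iterate_ad hV.euler k).mono (by omega)) hVm ih α
        (by omega)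
  rw [truncDexp, Finset.sum_range_succ']
  simp only [pow_zero, zero_add, Nat.factorial_one, Nat.cast_one, inv_one, mul_one, one_smul,
    Function.iterate_zero, id_eq, add_sub_cancel_right]
  rw [AddMonoidAlgebra.coeff_sum, Finsupp.finsetSum_apply]
  refine Submodule.sum_mem _ fun k _ => ?_
  rw [AddMonoidAlgebra.coeff_smul_apply, Function.iterate_succ_apply']
  exact Submodule.smul_mem _ _ (commutator_coeff_mem hr hV
    ((hV.iterate_ad hV.euler k).mono (by omega)) hVm (had k) α hα)

end Operators

/-! ### Asymptotic expansions in powers of `t` -/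

section Expansions

variable {N n : ℕ} {r : ℝ}

/-- The monomial `t^α`. -/
def monomialAt (t : Euc N) (α : Fin N → ℕ) : ℝ := ∏ i, t i ^ α i

theorem monomialAt_add (t : Euc N) (α β : Fin N → ℕ) :
    monomialAt t (α + β) = monomialAt t α * monomialAt t β := by
  simp [monomialAt, pow_add, Finset.prod_mul_distrib]

theorem monomialAt_zero (t : Euc N) : monomialAt t 0 = 1 := by simp [monomialAt]

theorem monomialAt_smul (c : ℝ) (t : Euc N) (α : Fin N → ℕ) :
    monomialAt (c • t) α = c ^ (∑ i, α i) * monomialAt t α := by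
  simp [monomialAt, mul_pow, Finset.prod_mul_distrib, Finset.prod_pow_eq_pow_sum]

theorem abs_monomialAt_le (t : Euc N) (α : Fin N → ℕ) : |monomialAt t α| ≤ ‖t‖ ^ ∑ i, α i := by
  rw [monomialAt, Finset.abs_prod, ← Finset.prod_pow_eq_pow_sum]
  refine Finset.prod_le_prod (fun i _ => abs_nonneg _) fun i _ => ?_
  rw [abs_pow]
  exact pow_le_pow_left₀ (abs_nonneg _) (PiLp.norm_apply_le t i) _

/-- The multi-indices of order less than `M`. -/
def indexBelow (N M : ℕ) : Finset (Fin N → ℕ) :=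
  (Fintype.piFinset fun _ : Fin N => Finset.range M).filter fun α => ∑ i, α i < M

theorem mem_indexBelow {M : ℕ} {α : Fin N → ℕ} : α ∈ indexBelow N M ↔ ∑ i, α i < M := by
  simp only [indexBelow, Finset.mem_filter, Fintype.mem_piFinset, Finset.mem_range,
    and_iff_right_iff_imp]
  exact fun h i => (Finset.single_le_sum (fun _ _ => Nat.zero_le _) (Finset.mem_univ i)).trans_lt h

section Uniqueness

variable {E : Type*} [NormedAddCommGroup E] [NormedSpace ℝ E]

/-- In one variable, and with one-sided estimates only: divide by the lowest power that occurs. -/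
theorem coeff_eq_zero_of_isBigO_pow {K M : ℕ} {a : ℕ → E} {C : ℝ}
    (h : ∀ᶠ s in 𝓝[>] (0 : ℝ), ‖∑ k ∈ Finset.range K, s ^ k • a k‖ ≤ C * s ^ M) {k : ℕ}
    (hk : k < M) (hK : k < K) : a k = 0 := by
  induction k using Nat.strong_induction_on with
  | _ k ih =>
    set g : ℝ → E := fun s => ∑ j ∈ Finset.range (K - k), s ^ j • a (k + j) with hg
    have h1 : ∀ s : ℝ, ∑ j ∈ Finset.range K, s ^ j • a j = s ^ k • g s := by
      intro s
      rw [← Finset.sum_range_add_sum_Ico _ hK.le, Finset.sum_eq_zero, zero_add,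
        Finset.sum_Ico_eq_sum_range, hg, Finset.smul_sum]
      · simp only [pow_add, mul_smul]
      · intro j hj
        have hj := Finset.mem_range.1 hj
        rw [ih j hj (hj.trans hk) (hj.trans hK), smul_zero]
    have hgc : Continuous g := by fun_prop
    have hg0 : g 0 = a k := by
      rw [hg]
      obtain ⟨m, hm⟩ : ∃ m, K - k = m + 1 := ⟨K - k - 1, by omega⟩
      simp [hm, Finset.sum_range_succ']
    have h2 : ∀ᶠ s in 𝓝[>] (0 : ℝ), ‖g s‖ ≤ C * s ^ (M - k) := by
      filter_upwards [h, self_mem_nhdsWithin] with s hs hs0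
      have hs0 : 0 < s := hs0
      rw [h1, norm_smul, norm_pow, Real.norm_of_nonneg hs0.le] at hs
      have h3 : C * s ^ M = s ^ k * (C * s ^ (M - k)) := by
        rw [show M = k + (M - k) by omega, pow_add, show k + (M - k) - k = M - k by omega]; ring
      rw [h3] at hs
      exact le_of_mul_le_mul_left hs (pow_pos hs0 k)
    have h3 : Tendsto (fun s : ℝ => C * s ^ (M - k)) (𝓝[>] 0) (𝓝 0) := by
      have : Continuous fun s : ℝ => C * s ^ (M - k) := by fun_prop
      have h4 := this.tendsto 0
      rw [zero_pow (by omega), mul_zero] at h4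
      exact h4.mono_left nhdsWithin_le_nhds
    have h4 := le_of_tendsto_of_tendsto (hgc.norm.tendsto 0 |>.mono_left nhdsWithin_le_nhds) h3 h2
    rw [hg0] at h4
    exact norm_le_zero_iff.1 h4

/-- The coefficients of a polynomial that is `O(|t|^M)` vanish up to degree `M`. -/
theorem coeff_eq_zero_of_isBigO {M : ℕ} {s : Finset (Fin N → ℕ)} {u : (Fin N → ℕ) → Euc n} {C : ℝ}
    (h : ∀ᶠ t in 𝓝 (0 : Euc N), ‖∑ α ∈ s, monomialAt t α • u α‖ ≤ C * ‖t‖ ^ M) {α : Fin N → ℕ}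
    (hα : α ∈ s) (hM : ∑ i, α i < M) : u α = 0 := by
  have h1 : ∀ t : Euc N, ∑ β ∈ s.filter (fun β => ∑ i, β i = ∑ i, α i),
      monomialAt t β • u β = 0 := by
    intro t
    set K := (s.sup fun β => ∑ i, β i) + 1 with hK
    refine coeff_eq_zero_of_isBigO_pow (K := K) (M := M) (C := C * ‖t‖ ^ M)
      (a := fun k => ∑ β ∈ s.filter (fun β => ∑ i, β i = k), monomialAt t β • u β) ?_ hM
      (Nat.lt_succ_of_le (Finset.le_sup (f := fun β => ∑ i, β i) hα))
    have h2 : Tendsto (fun c : ℝ => c • t) (𝓝[>] 0) (𝓝 0) := by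
      have : Continuous fun c : ℝ => c • t := by fun_prop
      simpa using (this.tendsto 0).mono_left nhdsWithin_le_nhds
    filter_upwards [h2.eventually h, self_mem_nhdsWithin] with c hc hc0
    have hc0 : 0 < c := hc0
    have h3 : ∑ β ∈ s, monomialAt (c • t) β • u β = ∑ k ∈ Finset.range K, c ^ k •
        ∑ β ∈ s.filter (fun β => ∑ i, β i = k), monomialAt t β • u β := by
      rw [← Finset.sum_fiberwise_of_maps_to (t := Finset.range K) (g := fun β => ∑ i, β i)]
      · refine Finset.sum_congr rfl fun k _ => ?_
        rw [Finset.smul_sum]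
        refine Finset.sum_congr rfl fun β hβ => ?_
        rw [monomialAt_smul, (Finset.mem_filter.1 hβ).2, mul_smul]
      · exact fun β hβ => Finset.mem_range.2
          (Nat.lt_succ_of_le (Finset.le_sup (f := fun β => ∑ i, β i) hβ))
    rw [h3, norm_smul, mul_pow, Real.norm_of_nonneg hc0.le] at hc
    linarith
  have hinj : Function.Injective (Finsupp.equivFunOnFinite (α := Fin N) (M := ℕ)).symm :=
    Equiv.injective _
  ext j
  set q : MvPolynomial (Fin N) ℝ := ∑ β ∈ s.filter (fun β => ∑ i, β i = ∑ i, α i),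
    MvPolynomial.monomial (Finsupp.equivFunOnFinite.symm β) (u β j) with hq
  have h2 : q = 0 := by
    refine MvPolynomial.funext fun t => ?_
    have h3 := congrArg (fun v : Euc n => v j) (h1 (WithLp.toLp 2 t))
    simp only [hq, map_sum, MvPolynomial.eval_monomial, map_zero]
    simp only [WithLp.ofLp_sum, Finset.sum_apply, PiLp.smul_apply, smul_eq_mul,
      PiLp.zero_apply] at h3
    rw [← h3]
    refine Finset.sum_congr rfl fun β _ => ?_
    rw [mul_comm, monomialAt, Finsupp.prod_fintype _ _ (by simp)]
    rfl
  have h3 := congrArg (MvPolynomial.coeff (Finsupp.equivFunOnFinite.symm α)) h2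
  simp only [hq, MvPolynomial.coeff_sum, MvPolynomial.coeff_monomial, hinj.eq_iff,
    MvPolynomial.coeff_zero] at h3
  have hm : α ∈ s.filter (fun β => ∑ i, β i = ∑ i, α i) := Finset.mem_filter.2 ⟨hα, rfl⟩
  rw [Finset.sum_ite_eq', if_pos hm] at h3
  exact h3

end Uniqueness

/-- Taylor's formula at the endpoint of `[0,1]`, for a chain of successive derivatives. -/
theorem norm_sub_taylor_le {E : Type*} [NormedAddCommGroup E] [NormedSpace ℝ E] {M : ℕ}
    {f : ℕ → ℝ → E} {C : ℝ}
    (hf : ∀ k < M, ∀ s ∈ Icc (0 : ℝ) 1, HasDerivWithinAt (f k) (f (k + 1) s) (Icc 0 1) s)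
    (hC : ∀ s ∈ Icc (0 : ℝ) 1, ‖f M s‖ ≤ C) :
    ‖f 0 1 - ∑ k ∈ Finset.range M, ((k.factorial : ℝ)⁻¹) • f k 0‖ ≤ C := by
  have hC0 : 0 ≤ C := (norm_nonneg _).trans (hC 0 (by simp))
  have key : ∀ (M : ℕ) (f : ℕ → ℝ → E),
      (∀ k < M, ∀ s ∈ Icc (0 : ℝ) 1, HasDerivWithinAt (f k) (f (k + 1) s) (Icc 0 1) s) →
      (∀ s ∈ Icc (0 : ℝ) 1, ‖f M s‖ ≤ C) → ∀ s ∈ Icc (0 : ℝ) 1,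
      ‖f 0 s - ∑ k ∈ Finset.range M, (s ^ k * (k.factorial : ℝ)⁻¹) • f k 0‖ ≤ C := by
    intro M
    induction M with
    | zero => intro f _ h s hs; simpa using h s hs
    | succ M ih =>
      intro f hf hC s hs
      have h1 := ih (fun k => f (k + 1)) (fun k hk => hf (k + 1) (by omega)) hC
      set g : ℝ → E := fun s => f 0 s -
        ∑ k ∈ Finset.range (M + 1), (s ^ k * (k.factorial : ℝ)⁻¹) • f k 0 with hg
      have hd : ∀ s ∈ Icc (0 : ℝ) 1, HasDerivWithinAt g (f 1 s -
          ∑ k ∈ Finset.range M, (s ^ k * (k.factorial : ℝ)⁻¹) • f (k + 1) 0) (Icc 0 1) s := by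
        intro s hs
        refine (hf 0 (by omega) s hs).sub ?_
        have h2 : ∀ k ∈ Finset.range (M + 1), HasDerivWithinAt
            (fun s : ℝ => (s ^ k * (k.factorial : ℝ)⁻¹) • f k 0)
            ((k * s ^ (k - 1) * (k.factorial : ℝ)⁻¹) • f k 0) (Icc 0 1) s := fun k _ =>
          (((hasDerivAt_pow k s).mul_const _).smul_const _).hasDerivWithinAt
        refine (HasDerivWithinAt.fun_sum h2).congr_deriv ?_
        rw [Finset.sum_range_succ']
        simp only [Nat.cast_zero, zero_mul, zero_smul, add_zero, Nat.add_sub_cancel]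
        refine Finset.sum_congr rfl fun k _ => ?_
        congr 1
        rw [Nat.factorial_succ]
        have := Nat.factorial_ne_zero k
        push_cast
        field_simp
      have h3 := (convex_Icc (0 : ℝ) 1).norm_image_sub_le_of_norm_hasDerivWithin_le hd h1
        (left_mem_Icc.2 zero_le_one) hs
      have h4 : g 0 = 0 := by
        simp [hg, Finset.sum_range_succ']
      rw [h4, sub_zero, sub_zero, Real.norm_of_nonneg hs.1] at h3
      exact h3.trans (mul_le_of_le_one_right hC0 hs.2)
  simpa using key M f hf hC 1 (by simp)

/-- Evaluation of a polynomial at `t`. -/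
noncomputable def evalAt {R : Type*} [Ring R] [Algebra ℝ R] (t : Euc N) : CPoly N R →ₐ[ℝ] R :=
  AddMonoidAlgebra.liftNCAlgHom (AlgHom.id ℝ R)
    { toFun := fun α => algebraMap ℝ R (monomialAt t α.toAdd)
      map_one' := by simp [monomialAt_zero]
      map_mul' := fun α β => by simp [monomialAt_add] }
    fun x _ => (Algebra.commutes (R := ℝ) _ x).symm

theorem evalAt_single {R : Type*} [Ring R] [Algebra ℝ R] (t : Euc N) (α : Fin N → ℕ) (T : R) :
    evalAt t (AddMonoidAlgebra.single α T : CPoly N R) = monomialAt t α • T := by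
  rw [Algebra.smul_def, Algebra.commutes]
  exact AddMonoidAlgebra.liftNC_single _ _ α T

theorem evalAt_eq_sum {R : Type*} [Ring R] [Algebra ℝ R] (t : Euc N) (P : CPoly N R) :
    evalAt t P = ∑ α ∈ P.coeff.support, monomialAt t α • P.coeff α := by
  conv_lhs => rw [← AddMonoidAlgebra.sum_coeff_single P, Finsupp.sum, map_sum]
  exact Finset.sum_congr rfl fun α _ => evalAt_single t α _

theorem evalAt_apply (t : Euc N) (P : CPoly N (Module.End ℝ (smoothMaps n r)))
    (f : smoothMaps n r) (x : Euc n) :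
    (evalAt t P f).1 x = ∑ α ∈ P.coeff.support, monomialAt t α • (P.coeff α f).1 x := by
  rw [evalAt_eq_sum, LinearMap.sum_apply, Submodule.coe_sum, Finset.sum_apply]
  rfl

theorem exists_evalAt_le {M : ℕ} {P : CPoly N (Module.End ℝ (smoothMaps n r))}
    (hP : VanishBelow M P) (f : smoothMaps n r) {x₀ : Euc n} (hx₀ : x₀ ∈ Metric.ball 0 r) :
    ∃ C, 0 ≤ C ∧ ∀ᶠ x in 𝓝 x₀, ∀ t : Euc N, ‖t‖ ≤ 1 → ‖(evalAt t P f).1 x‖ ≤ C * ‖t‖ ^ M := by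
  refine ⟨∑ α ∈ P.coeff.support, (‖(P.coeff α f).1 x₀‖ + 1),
    Finset.sum_nonneg fun α _ => by positivity, ?_⟩
  have h : ∀ᶠ x in 𝓝 x₀, ∀ α ∈ P.coeff.support, ‖(P.coeff α f).1 x‖ ≤ ‖(P.coeff α f).1 x₀‖ + 1 :=
    (Filter.eventually_all_finset _).2 fun α _ =>
      (smoothMaps_contDiffAt (P.coeff α f) hx₀).continuousAt.norm.eventually_le_const (lt_add_one _)
  filter_upwards [h] with x hx t ht
  rw [evalAt_apply, Finset.sum_mul]
  refine (norm_sum_le _ _).trans (Finset.sum_le_sum fun α hα => ?_)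
  have h1 : M ≤ ∑ i, α i := by
    by_contra h
    exact Finsupp.mem_support_iff.1 hα (hP α (not_le.1 h))
  rw [norm_smul, mul_comm]
  exact mul_le_mul (hx α hα) ((abs_monomialAt_le t α).trans
    (pow_le_pow_of_le_one (norm_nonneg t) ht h1)) (abs_nonneg _) (by positivity)

/-- The polynomial `∑_{0<|α|<M} t^α X_α` with differential operators as coefficients. -/
noncomputable def fieldPoly (X : (Fin N → ℕ) → smoothMaps n r) (M : ℕ) :
    CPoly N (Module.End ℝ (smoothMaps n r)) :=
  ∑ α ∈ (indexBelow N M).filter (fun α => α ≠ 0), AddMonoidAlgebra.single α (lieDer (X α))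

theorem coeff_fieldPoly (X : (Fin N → ℕ) → smoothMaps n r) (M : ℕ) (α : Fin N → ℕ) :
    (fieldPoly X M).coeff α = if ∑ i, α i < M ∧ α ≠ 0 then lieDer (X α) else 0 := by
  rw [fieldPoly, AddMonoidAlgebra.coeff_sum, Finsupp.finsetSum_apply]
  simp only [AddMonoidAlgebra.coeff_single, Finsupp.single_apply]
  rw [Finset.sum_ite_eq']
  simp [mem_indexBelow]

theorem vanishBelow_fieldPoly (X : (Fin N → ℕ) → smoothMaps n r) (M : ℕ) :
    VanishBelow 1 (fieldPoly X M) := fun α hα => by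
  rw [coeff_fieldPoly, if_neg]
  rintro ⟨-, h⟩
  exact absurd (sum_index_pos.2 h) (by omega)

theorem evalAt_fieldPoly (X : (Fin N → ℕ) → smoothMaps n r) (M : ℕ) (t : Euc N) :
    evalAt t (fieldPoly X M) =
      lieDer (∑ α ∈ (indexBelow N M).filter (fun α => α ≠ 0), monomialAt t α • X α) := by
  rw [fieldPoly, map_sum, map_sum]
  exact Finset.sum_congr rfl fun α _ => by rw [evalAt_single, map_smul]

theorem truncField_eq {X : (Fin N → ℕ) → smoothMaps n r} {Y : (Fin N → ℕ) → Euc n → Euc n} {M : ℕ}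
    {x : Euc n} (h : ∀ α, α ≠ 0 → ∑ i, α i < M → Y α x = (X α).1 x) (t : Euc N) :
    truncField Y M t x = (∑ α ∈ (indexBelow N M).filter (fun α => α ≠ 0), monomialAt t α • X α :
      smoothMaps n r).1 x := by
  rw [truncField, Submodule.coe_sum, Finset.sum_apply]
  refine Finset.sum_congr ?_ fun α hα => ?_
  · ext α
    simp only [Finset.mem_filter, mem_indexBelow, Fintype.mem_piFinset, Finset.mem_range,
      sum_index_pos]
    constructor
    · rintro ⟨-, h1, h2⟩; exact ⟨h2, h1⟩
    · rintro ⟨h1, h2⟩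
      exact ⟨fun i => (Finset.single_le_sum (fun _ _ => Nat.zero_le _) (Finset.mem_univ i)).trans_lt
        h1, h2, h1⟩
  · obtain ⟨h1, h2⟩ := Finset.mem_filter.1 hα
    rw [h α h2 (mem_indexBelow.1 h1)]
    rfl

end Expansions

/-! ### Exponentials of small vector fields -/

section Exponentials

variable {N n : ℕ} {r : ℝ}

theorem exists_ball_of_eventually {x₀ : Euc n} {p : Euc n → Prop} (h : ∀ᶠ x in 𝓝 x₀, p x) {ε : ℝ}
    (hε : 0 < ε) : ∃ ε' > 0, ε' ≤ ε ∧ ∀ x ∈ Metric.ball x₀ ε', p x := by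
  obtain ⟨ε', h1, h2⟩ := Metric.eventually_nhds_iff_ball.1 h
  exact ⟨min ε ε', lt_min hε h1, min_le_left _ _, fun x hx =>
    h2 x (Metric.ball_subset_ball (min_le_right _ _) hx)⟩

/-- The integral curves of `∑ t^α X_α` during the time interval `[0,1]` stay near their starting
point if `t` is small. -/
theorem eventually_curve_mem_ball (X : (Fin N → ℕ) → smoothMaps n r)
    {Y : (Fin N → ℕ) → Euc n → Euc n} {M : ℕ}
    (hY : ∀ α, α ≠ 0 → ∑ i, α i < M → ∀ x ∈ Metric.ball (0 : Euc n) r, Y α x = (X α).1 x)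
    {x₀ : Euc n} (hx₀ : x₀ ∈ Metric.ball 0 r) {ε : ℝ} (hε : 0 < ε) :
    ∀ᶠ p in 𝓝 ((0, x₀) : Euc N × Euc n), ∀ c : ℝ → Euc n, c 0 = p.2 →
      (∀ s ∈ Icc (0 : ℝ) 1, HasDerivWithinAt c (truncField Y M p.1 (c s)) (Icc 0 1) s) →
      ∀ s ∈ Icc (0 : ℝ) 1, c s ∈ Metric.ball x₀ ε := by
  obtain ⟨C, hC0, hC⟩ := exists_evalAt_le (vanishBelow_fieldPoly X M) (idMap n r) hx₀
  obtain ⟨ε', hε', hεε, H⟩ := exists_ball_of_eventually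
    (hC.and (Metric.isOpen_ball.mem_nhds hx₀)) hε
  have h1 : ∀ᶠ p in 𝓝 ((0, x₀) : Euc N × Euc n), ‖p.1‖ ≤ 1 := by
    have : ContinuousAt (fun p : Euc N × Euc n => ‖p.1‖) (0, x₀) := by fun_prop
    exact this.eventually_le_const (by simp)
  have h2 : ∀ᶠ p in 𝓝 ((0, x₀) : Euc N × Euc n), C * ‖p.1‖ < ε' / 4 := by
    have : ContinuousAt (fun p : Euc N × Euc n => C * ‖p.1‖) (0, x₀) := by fun_prop
    exact this.eventually_lt_const (by simpa using hε')
  have h3 : ∀ᶠ p in 𝓝 ((0, x₀) : Euc N × Euc n), ‖p.2 - x₀‖ < ε' / 4 := by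
    have : ContinuousAt (fun p : Euc N × Euc n => ‖p.2 - x₀‖) (0, x₀) := by fun_prop
    exact this.eventually_lt_const (by simpa using hε')
  filter_upwards [h1, h2, h3] with p h1 h2 h3 c hc0 hc
  have key : ∀ s ∈ Icc (0 : ℝ) 1, ‖c s - p.2‖ ≤ ε' / 4 * s := by
    refine image_norm_le_of_norm_deriv_right_lt_deriv_boundary
      (f' := fun s => truncField Y M p.1 (c s)) (B' := fun _ => ε' / 4)
      (fun s hs => (hc s hs).continuousWithinAt.sub continuousWithinAt_const)
      (fun s hs => ?_) (by simp [hc0])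
      (fun s => by simpa using (hasDerivAt_id s).const_mul (ε' / 4)) fun s hs hB => ?_
    · exact (((hc s (Ico_subset_Icc_self hs)).sub_const _).mono_of_mem_nhdsWithin
        (Icc_mem_nhdsGE_of_mem hs))
    · have hB : ‖c s - p.2‖ = ε' / 4 * s := hB
      have h4 : c s ∈ Metric.ball x₀ ε' := by
        rw [mem_ball_iff_norm]
        have h5 := norm_add_le (c s - p.2) (p.2 - x₀)
        rw [sub_add_sub_cancel, hB] at h5
        nlinarith [hs.2]
      obtain ⟨h5, h6⟩ := H _ h4
      have h7 := h5 p.1 h1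
      rw [evalAt_fieldPoly, lieDer_idMap, pow_one, ← truncField_eq
        (fun α h h' => hY α h h' _ h6)] at h7
      exact h7.trans_lt h2
  intro s hs
  refine Metric.ball_subset_ball hεε ?_
  rw [mem_ball_iff_norm]
  have h5 := norm_add_le (c s - p.2) (p.2 - x₀)
  rw [sub_add_sub_cancel] at h5
  nlinarith [hs.2, key s hs]

/-- Expansion of a function along the exponential: `f(exp(V_t) x) = ∑_{k<M} V_t^k f(x) / k! +
O(|t|^M)`. -/
theorem exists_exp_estimate (X : (Fin N → ℕ) → smoothMaps n r)
    {Y : (Fin N → ℕ) → Euc n → Euc n} {M : ℕ}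
    (hY : ∀ α, α ≠ 0 → ∑ i, α i < M → ∀ x ∈ Metric.ball (0 : Euc n) r, Y α x = (X α).1 x)
    (f : smoothMaps n r) {x₀ : Euc n} (hx₀ : x₀ ∈ Metric.ball 0 r) :
    ∃ C, ∀ᶠ p in 𝓝 ((0, x₀) : Euc N × Euc n), ∀ c : ℝ → Euc n, c 0 = p.2 →
      (∀ s ∈ Icc (0 : ℝ) 1, HasDerivWithinAt c (truncField Y M p.1 (c s)) (Icc 0 1) s) →
      ‖f.1 (c 1) - (evalAt p.1 (truncExp M (fieldPoly X M)) f).1 p.2‖ ≤ C * ‖p.1‖ ^ M := by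
  obtain ⟨C, hC0, hC⟩ := exists_evalAt_le ((vanishBelow_fieldPoly X M).pow M) f hx₀
  obtain ⟨ε, hε, -, H⟩ := exists_ball_of_eventually
    (hC.and (Metric.isOpen_ball.mem_nhds hx₀)) one_pos
  have h1 : ∀ᶠ p in 𝓝 ((0, x₀) : Euc N × Euc n), ‖p.1‖ ≤ 1 := by
    have : ContinuousAt (fun p : Euc N × Euc n => ‖p.1‖) (0, x₀) := by fun_prop
    exact this.eventually_le_const (by simp)
  refine ⟨C, ?_⟩
  filter_upwards [h1, eventually_curve_mem_ball X hY hx₀ hε] with p h1 h2 c hc0 hc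
  have hmem := h2 c hc0 hc
  have h3 := norm_sub_taylor_le (M := M) (f := fun k s =>
      ((evalAt p.1 (fieldPoly X M) ^ k) f).1 (c s))
    (C := C * ‖p.1‖ ^ M) (fun k _ s hs => ?_) fun s hs => ?_
  · have h4 : (evalAt p.1 (truncExp M (fieldPoly X M)) f).1 p.2 = ∑ k ∈ Finset.range M,
        ((k.factorial : ℝ)⁻¹) • ((evalAt p.1 (fieldPoly X M) ^ k) f).1 (c 0) := by
      rw [truncExp, map_sum, LinearMap.sum_apply, Submodule.coe_sum, Finset.sum_apply, hc0]
      refine Finset.sum_congr rfl fun k _ => ?_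
      rw [map_smul, map_pow]
      rfl
    rw [h4]
    simpa using h3
  · have h6 := (H _ (hmem s hs)).2
    set g := (evalAt p.1 (fieldPoly X M) ^ k) f with hg
    have h5 := (smoothMaps_hasFDerivAt g h6).comp_hasDerivWithinAt s (hc s hs)
    refine h5.congr_deriv ?_
    rw [pow_succ', Module.End.mul_apply, ← hg, evalAt_fieldPoly, lieDer_apply _ _ h6,
      truncField_eq (fun α h h' => hY α h h' _ h6)]
  · change ‖((evalAt p.1 (fieldPoly X M) ^ M) f).1 (c s)‖ ≤ _
    rw [← map_pow]
    exact (H _ (hmem s hs)).1 p.1 h1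

end Exponentials

/-! ### Taylor expansions in the parameter -/

section Taylor

variable {N n : ℕ} {Ω : Set (Euc N × Euc n)} {F : Euc N × Euc n → Euc n}

theorem contDiffOn_listPartial_of_isOpen (hΩ : IsOpen Ω) (hF : ContDiffOn ℝ ∞ F Ω)
    (L : List (Fin N)) : ContDiffOn ℝ ∞ (listPartial L F) Ω := by
  induction L with
  | nil => exact hF
  | cons i L ih => exact (ih.fderiv_of_isOpen hΩ (by simp)).clm_apply contDiffOn_const

/-- Partial derivatives in the parameter commute. -/
theorem listPartial_perm (hΩ : IsOpen Ω) (hF : ContDiffOn ℝ ∞ F Ω) {L L' : List (Fin N)}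
    (h : L.Perm L') : EqOn (listPartial L F) (listPartial L' F) Ω := by
  induction h with
  | nil => exact fun _ _ => rfl
  | cons i _ ih =>
    intro p hp
    have := Filter.eventuallyEq_of_mem (hΩ.mem_nhds hp) ih
    exact congrArg (fun A : (Euc N × Euc n) →L[ℝ] Euc n => A (EuclideanSpace.single i 1, 0))
      this.fderiv_eq
  | swap i j L =>
    intro p hp
    have hs := (contDiffOn_listPartial_of_isOpen hΩ hF L).contDiffAt (hΩ.mem_nhds hp)
    have hd : DifferentiableAt ℝ (fderiv ℝ (listPartial L F)) p :=
      (hs.fderiv_right (m := ∞) (by simp)).differentiableAt (by simp)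
    have key : ∀ v w : Euc N × Euc n,
        fderiv ℝ (fun p => fderiv ℝ (listPartial L F) p v) p w =
          fderiv ℝ (fderiv ℝ (listPartial L F)) p w v := fun v w => by
      rw [(hd.hasFDerivAt.clm_apply (hasFDerivAt_const v p)).fderiv]
      simp
    change fderiv ℝ (fun p => fderiv ℝ (listPartial L F) p _) p _ =
      fderiv ℝ (fun p => fderiv ℝ (listPartial L F) p _) p _
    rw [key, key]
    exact hs.isSymmSndFDerivAt (by
      rw [minSmoothness_of_isRCLikeNormedField]; exact WithTop.coe_le_coe.2 le_top) _ _
  | trans _ _ ih1 ih2 => exact ih1.trans ih2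

/-- The Taylor coefficient `∂_t^α F / α!` as a function on the whole space. -/
noncomputable def taylorCoeff (F : Euc N × Euc n → Euc n) (α : Fin N → ℕ) (p : Euc N × Euc n) :
    Euc n :=
  (∏ i, ((α i).factorial : ℝ))⁻¹ • listPartial (indexList α) F p

theorem taylorCoeff_zero (p : Euc N × Euc n) : taylorCoeff F 0 p = F p := by
  have : indexList (0 : Fin N → ℕ) = [] := by simp [indexList]
  rw [taylorCoeff, this]
  simp [listPartial]

theorem contDiffOn_taylorCoeff (hΩ : IsOpen Ω) (hF : ContDiffOn ℝ ∞ F Ω) (α : Fin N → ℕ) :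
    ContDiffOn ℝ ∞ (taylorCoeff F α) Ω :=
  (contDiffOn_listPartial_of_isOpen hΩ hF _).const_smul _

theorem count_indexList (α : Fin N → ℕ) (i : Fin N) : (indexList α).count i = α i := by
  have h1 := sum_map_indexList (fun j => Pi.single j 1 : Fin N → Fin N → ℕ) α
  have h2 : ∀ L : List (Fin N), (L.map (fun j => Pi.single j 1 : Fin N → Fin N → ℕ)).sum i =
      L.count i := by
    intro L
    induction L with
    | nil => rfl
    | cons j L ih =>
      rw [List.map_cons, List.sum_cons, Pi.add_apply, ih, List.count_cons, add_comm]
      congr 1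
      by_cases h : j = i
      · subst h; simp
      · simp [h, Ne.symm h]
  rw [← h2, h1]
  simp [Finset.sum_apply, Pi.single_apply]

/-- `∂_i (∂^α F / α!) = (α_i + 1) ∂^(α + e_i) F / (α + e_i)!`. -/
theorem fderiv_taylorCoeff (hΩ : IsOpen Ω) (hF : ContDiffOn ℝ ∞ F Ω) (α : Fin N → ℕ) (i : Fin N)
    {p : Euc N × Euc n} (hp : p ∈ Ω) :
    fderiv ℝ (taylorCoeff F α) p (EuclideanSpace.single i 1, 0) =
      ((α i + 1 : ℕ) : ℝ) • taylorCoeff F (α + Pi.single i 1) p := by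
  have h1 : (i :: indexList α).Perm (indexList (α + Pi.single i 1)) := by
    refine List.perm_iff_count.2 fun j => ?_
    rw [List.count_cons, count_indexList, count_indexList, Pi.add_apply]
    by_cases h : i = j
    · subst h; simp
    · simp [h, Ne.symm h]
  have h2 := (contDiffOn_listPartial_of_isOpen hΩ hF (indexList α)).contDiffAt (hΩ.mem_nhds hp)
  have h3 : fderiv ℝ (taylorCoeff F α) p = (∏ i, ((α i).factorial : ℝ))⁻¹ •
      fderiv ℝ (listPartial (indexList α) F) p :=
    ((h2.differentiableAt (by simp)).hasFDerivAt.const_smul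
      (∏ i, ((α i).factorial : ℝ))⁻¹).fderiv
  have h4 : ∏ j, (((α + Pi.single i 1 : Fin N → ℕ) j).factorial : ℝ) =
      (α i + 1) * ∏ j, ((α j).factorial : ℝ) := by
    rw [← Finset.mul_prod_erase _ _ (Finset.mem_univ i),
      ← Finset.mul_prod_erase _ (fun j => ((α j).factorial : ℝ)) (Finset.mem_univ i),
      ← mul_assoc]
    congr 1
    · simp [Nat.factorial_succ]
    · refine Finset.prod_congr rfl fun j hj => ?_
      simp [Finset.ne_of_mem_erase hj]
  rw [taylorCoeff, ← listPartial_perm hΩ hF h1 hp, h3, h4, smul_smul]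
  have h5 : ((α i + 1 : ℕ) : ℝ) * ((α i + 1) * ∏ j, ((α j).factorial : ℝ))⁻¹ =
      (∏ j, ((α j).factorial : ℝ))⁻¹ := by
    have h6 : (∏ j, ((α j).factorial : ℝ)) ≠ 0 :=
      Finset.prod_ne_zero_iff.2 fun j _ => by exact_mod_cast Nat.factorial_ne_zero _
    have h7 : ((α i : ℝ) + 1) ≠ 0 := by positivity
    push_cast
    field_simp
  rw [h5]
  rfl

/-- The homogeneous part of degree `k` of the Taylor expansion of `F` in `t`, at the point `p`. -/
noncomputable def taylorHomog (F : Euc N × Euc n → Euc n) (k : ℕ) (t : Euc N) (p : Euc N × Euc n) :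
    Euc n :=
  ∑ α ∈ Finset.piAntidiag Finset.univ k, monomialAt t α • taylorCoeff F α p

/-- Reindexing by `α ↦ α + e_i`: the index `β` of order `k + 1` is reached with total weight
`∑ β_i = k + 1`. -/
theorem sum_piAntidiag_succ {E : Type*} [AddCommGroup E] [Module ℝ E] (k : ℕ)
    (g : (Fin N → ℕ) → E) :
    ∑ α ∈ Finset.piAntidiag Finset.univ k, ∑ i, ((α i + 1 : ℕ) : ℝ) • g (α + Pi.single i 1) =
      ((k + 1 : ℕ) : ℝ) • ∑ α ∈ Finset.piAntidiag Finset.univ (k + 1), g α := by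
  have h1 : ∀ i : Fin N, ∑ α ∈ Finset.piAntidiag Finset.univ k,
      ((α i + 1 : ℕ) : ℝ) • g (α + Pi.single i 1) =
      ∑ α ∈ Finset.piAntidiag Finset.univ (k + 1), ((α i : ℕ) : ℝ) • g α := by
    intro i
    have h2 : ∑ α ∈ Finset.piAntidiag Finset.univ (k + 1), ((α i : ℕ) : ℝ) • g α =
        ∑ α ∈ (Finset.piAntidiag Finset.univ (k + 1)).filter (fun α => α i ≠ 0),
          ((α i : ℕ) : ℝ) • g α := by
      refine (Finset.sum_filter_of_ne (p := fun α : Fin N → ℕ => α i ≠ 0) fun α _ h h' => h ?_).symm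
      rw [h', Nat.cast_zero, zero_smul]
    have hs : ∑ j, (Pi.single i 1 : Fin N → ℕ) j = 1 := by simp
    rw [h2]
    refine Finset.sum_nbij' (fun α => α + Pi.single i 1) (fun α => α - Pi.single i 1) ?_ ?_ ?_ ?_ ?_
    · intro α hα
      simp only [Finset.mem_piAntidiag, Finset.mem_filter, Finset.mem_univ, implies_true,
        and_true] at hα ⊢
      exact ⟨by rw [sum_index_add, hα, hs], by simp⟩
    · intro α hα
      simp only [Finset.mem_piAntidiag, Finset.mem_filter, Finset.mem_univ, implies_true,
        and_true] at hα ⊢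
      have h3 : α - Pi.single i 1 + Pi.single i 1 = α := tsub_add_cancel_of_le (by
        intro j
        by_cases h : j = i
        · subst h; simpa using Nat.one_le_iff_ne_zero.2 hα.2
        · simp [h])
      have h4 := sum_index_add (α - Pi.single i 1) (Pi.single i 1)
      rw [h3, hs, hα.1] at h4
      exact (Nat.add_right_cancel h4).symm
    · intro α _
      exact add_tsub_cancel_right α _
    · intro α hα
      refine tsub_add_cancel_of_le fun j => ?_
      by_cases h : j = i
      · subst h; simpa using Nat.one_le_iff_ne_zero.2 (Finset.mem_filter.1 hα).2
      · simp [h]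
    · intro α _; simp
  rw [Finset.sum_comm, Finset.sum_congr rfl fun i _ => h1 i, Finset.sum_comm, Finset.smul_sum]
  refine Finset.sum_congr rfl fun α hα => ?_
  rw [← Finset.sum_smul, ← Nat.cast_sum, (Finset.mem_piAntidiag.1 hα).1]

theorem euclidean_eq_sum (t : Euc N) : t = ∑ i, t i • EuclideanSpace.single i (1 : ℝ) := by
  ext j
  simp [WithLp.ofLp_sum, Finset.sum_apply, Pi.single_apply]

theorem hasDerivAt_taylorHomog (hΩ : IsOpen Ω) (hF : ContDiffOn ℝ ∞ F Ω) (k : ℕ) {t : Euc N}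
    {x : Euc n} {s : ℝ} (h : (s • t, x) ∈ Ω) :
    HasDerivAt (fun s => taylorHomog F k t (s • t, x))
      (((k + 1 : ℕ) : ℝ) • taylorHomog F (k + 1) t (s • t, x)) s := by
  have h1 : HasDerivAt (fun s : ℝ => (s • t, x)) (t, (0 : Euc n)) s := by
    simpa using ((hasDerivAt_id s).smul_const t).prodMk (hasDerivAt_const s x)
  have h2 : ∀ α ∈ Finset.piAntidiag Finset.univ k, HasDerivAt
      (fun s : ℝ => monomialAt t α • taylorCoeff F α (s • t, x))
      (∑ i, ((α i + 1 : ℕ) : ℝ) • (monomialAt t (α + Pi.single i 1) •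
        taylorCoeff F (α + Pi.single i 1) (s • t, x))) s := by
    intro α _
    have h3 := (((contDiffOn_taylorCoeff hΩ hF α).contDiffAt (hΩ.mem_nhds h)).differentiableAt
      (by simp)).hasFDerivAt.comp_hasDerivAt s h1
    refine (h3.const_smul (monomialAt t α)).congr_deriv ?_
    have h4 : (t, (0 : Euc n)) = ∑ i, t i • (EuclideanSpace.single i (1 : ℝ), (0 : Euc n)) := by
      refine Prod.ext ?_ ?_
      · rw [Prod.fst_sum]; exact euclidean_eq_sum t
      · rw [Prod.snd_sum]; simp
    rw [h4, map_sum, Finset.smul_sum]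
    refine Finset.sum_congr rfl fun i _ => ?_
    rw [map_smul, fderiv_taylorCoeff hΩ hF α i h, monomialAt_add, smul_smul, smul_smul, smul_smul]
    have h5 : monomialAt t (Pi.single i 1) = t i := by
      rw [monomialAt, Finset.prod_eq_single i]
      · simp
      · intro j _ hj; simp [hj]
      · simp
    rw [h5]
    congr 1
    ring
  refine (HasDerivAt.fun_sum h2).congr_deriv ?_
  rw [sum_piAntidiag_succ k fun α => monomialAt t α • taylorCoeff F α (s • t, x)]
  rfl

theorem sum_range_piAntidiag {E : Type*} [AddCommMonoid E] (M : ℕ) (g : (Fin N → ℕ) → E) :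
    ∑ k ∈ Finset.range M, ∑ α ∈ Finset.piAntidiag Finset.univ k, g α =
      ∑ α ∈ indexBelow N M, g α := by
  rw [← Finset.sum_fiberwise_of_maps_to (s := indexBelow N M) (t := Finset.range M)
    (g := fun α => ∑ i, α i) fun α hα => Finset.mem_range.2 (mem_indexBelow.1 hα)]
  refine Finset.sum_congr rfl fun k hk => Finset.sum_congr ?_ fun _ _ => rfl
  ext α
  have := Finset.mem_range.1 hk
  simp only [Finset.mem_piAntidiag, Finset.mem_univ, implies_true, and_true, Finset.mem_filter,
    mem_indexBelow]
  constructor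
  · intro h; exact ⟨h.trans_lt this, h⟩
  · exact fun h => h.2

/-- The Taylor expansions in `t` of a smooth map and of its radial derivative, with remainders that
are uniform in `x`. -/
theorem exists_taylor_estimate {x₀ : Euc n}
    (hF : ∀ᶠ p in 𝓝 ((0, x₀) : Euc N × Euc n), ContDiffAt ℝ ∞ F p) (M : ℕ) :
    ∃ C, ∀ᶠ p in 𝓝 ((0, x₀) : Euc N × Euc n),
      ‖F p - ∑ α ∈ indexBelow N (M + 1), monomialAt p.1 α • taylorCoeff F α (0, p.2)‖ ≤
        C * ‖p.1‖ ^ (M + 1) ∧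
      ‖fderiv ℝ F p (p.1, 0) - ∑ α ∈ indexBelow N (M + 1),
        (∑ i, α i) • monomialAt p.1 α • taylorCoeff F α (0, p.2)‖ ≤ C * ‖p.1‖ ^ (M + 1) := by
  obtain ⟨U, hU, hUo, h0U⟩ := eventually_nhds_iff.1 hF
  have hFU : ContDiffOn ℝ ∞ F U := fun p hp => (hU p hp).contDiffWithinAt
  set I : Finset (Fin N → ℕ) := Finset.piAntidiag Finset.univ (M + 1) with hI
  set K : ℝ := ∑ α ∈ I, (‖taylorCoeff F α (0, x₀)‖ + 1) with hK
  have hK0 : 0 ≤ K := Finset.sum_nonneg fun α _ => by positivity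
  have h1 : ∀ᶠ p in 𝓝 ((0, x₀) : Euc N × Euc n), ∀ α ∈ I,
      ‖taylorCoeff F α p‖ ≤ ‖taylorCoeff F α (0, x₀)‖ + 1 :=
    (Filter.eventually_all_finset _).2 fun α _ => ((contDiffOn_taylorCoeff hUo hFU α).contDiffAt
      (hUo.mem_nhds h0U)).continuousAt.norm.eventually_le_const (lt_add_one _)
  obtain ⟨ε, hε, H⟩ := Metric.eventually_nhds_iff_ball.1 (h1.and (hUo.mem_nhds h0U))
  refine ⟨(M + 1).factorial * K, ?_⟩
  filter_upwards [Metric.ball_mem_nhds _ hε] with p hp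
  obtain ⟨t, x⟩ := p
  have hp' : ∀ s ∈ Icc (0 : ℝ) 1, (s • t, x) ∈ Metric.ball ((0, x₀) : Euc N × Euc n) ε := by
    intro s hs
    rw [Metric.mem_ball, Prod.dist_eq, max_lt_iff] at hp ⊢
    refine ⟨lt_of_le_of_lt ?_ hp.1, hp.2⟩
    simp only [dist_zero_right, norm_smul, Real.norm_of_nonneg hs.1]
    exact mul_le_of_le_one_left (norm_nonneg t) hs.2
  set f : ℕ → ℝ → Euc n := fun k s => (k.factorial : ℝ) • taylorHomog F k t (s • t, x) with hf
  have hd : ∀ k, ∀ s ∈ Icc (0 : ℝ) 1, HasDerivAt (f k) (f (k + 1) s) s := by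
    intro k s hs
    refine ((hasDerivAt_taylorHomog hUo hFU k (H _ (hp' s hs)).2).const_smul
      (k.factorial : ℝ)).congr_deriv ?_
    rw [smul_smul, hf]
    simp only
    rw [Nat.factorial_succ, mul_comm, Nat.cast_mul]
  have hb : ∀ s ∈ Icc (0 : ℝ) 1, ‖f (M + 1) s‖ ≤ (M + 1).factorial * K * ‖t‖ ^ (M + 1) := by
    intro s hs
    rw [hf]
    simp only
    rw [norm_smul, Real.norm_of_nonneg (Nat.cast_nonneg _), mul_assoc]
    refine mul_le_mul_of_nonneg_left ?_ (Nat.cast_nonneg _)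
    rw [taylorHomog, hK, Finset.sum_mul]
    refine (norm_sum_le _ _).trans (Finset.sum_le_sum fun α hα => ?_)
    rw [norm_smul, mul_comm]
    refine mul_le_mul ((H _ (hp' s hs)).1 α hα) ?_ (norm_nonneg _) (by positivity)
    have := abs_monomialAt_le t α
    rwa [(Finset.mem_piAntidiag.1 hα).1] at this
  have hfk : ∀ k : ℕ, ((k.factorial : ℝ)⁻¹) • f k 0 = taylorHomog F k t (0, x) := by
    intro k
    rw [hf]
    simp only
    rw [smul_smul, inv_mul_cancel₀ (by exact_mod_cast Nat.factorial_ne_zero k), one_smul, zero_smul]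
  have hf0 : ∀ s, f 0 s = F (s • t, x) := by
    intro s
    simp only [hf, taylorHomog, Finset.piAntidiag_zero, Finset.sum_singleton]
    rw [taylorCoeff_zero, monomialAt_zero]
    simp
  constructor
  · have h2 := norm_sub_taylor_le (f := f) (M := M + 1)
      (fun k _ s hs => (hd k s hs).hasDerivWithinAt) hb
    rw [hf0, one_smul, Finset.sum_congr rfl fun k _ => hfk k] at h2
    simp only [taylorHomog] at h2
    rwa [sum_range_piAntidiag] at h2
  · have h2 := norm_sub_taylor_le (f := fun k => f (k + 1)) (M := M)
      (fun k _ s hs => (hd (k + 1) s hs).hasDerivWithinAt) hb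
    have h3 : f 1 1 = fderiv ℝ F (t, x) (t, 0) := by
      have h4 : HasDerivAt (fun s : ℝ => (s • t, x)) (t, (0 : Euc n)) 1 := by
        simpa using ((hasDerivAt_id (1 : ℝ)).smul_const t).prodMk (hasDerivAt_const 1 x)
      have h5 : HasFDerivAt F (fderiv ℝ F (t, x)) ((1 : ℝ) • t, x) := by
        rw [one_smul]
        exact ((hU _ (H _ hp).2).differentiableAt (by simp)).hasFDerivAt
      have h6 := h5.comp_hasDerivAt (1 : ℝ) h4
      have h7 := hd 0 1 (by simp)
      rw [funext hf0] at h7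
      exact h7.unique h6
    have h4 : ∑ k ∈ Finset.range M, ((k.factorial : ℝ)⁻¹) • f (k + 1) 0 =
        ∑ α ∈ indexBelow N (M + 1), (∑ i, α i) • monomialAt t α • taylorCoeff F α (0, x) := by
      rw [← sum_range_piAntidiag, Finset.sum_range_succ']
      simp only [Finset.piAntidiag_zero, Finset.sum_singleton, Pi.zero_apply, Finset.sum_const_zero,
        zero_smul, add_zero]
      refine Finset.sum_congr rfl fun k _ => ?_
      have h5 : ((k.factorial : ℝ)⁻¹) • f (k + 1) 0 =
          (k + 1) • taylorHomog F (k + 1) t (0, x) := by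
        have h6 : (k.factorial : ℝ)⁻¹ = ((k + 1 : ℕ) : ℝ) * ((k + 1).factorial : ℝ)⁻¹ := by
          rw [Nat.factorial_succ]
          have := Nat.factorial_ne_zero k
          push_cast
          field_simp
        rw [h6, mul_smul, hfk, Nat.cast_smul_eq_nsmul]
      rw [h5, taylorHomog, Finset.smul_sum]
      refine Finset.sum_congr rfl fun α hα => ?_
      rw [(Finset.mem_piAntidiag.1 hα).1]
    rw [h4] at h2
    simpa [h3] using h2

end Taylor

/-! ### The field `W` -/

section FieldW

variable {N n : ℕ} {γ : Euc N × Euc n → Euc n}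

theorem isLocalInverse_gammaInv (hγ : ∀ᶠ p in 𝓝 (0 : Euc N × Euc n), ContDiffAt ℝ ∞ γ p)
    (hγ0 : ∀ᶠ x in 𝓝 (0 : Euc n), γ (0, x) = x) : IsLocalInverse γ (gammaInv γ) :=
  Classical.epsilon_spec (exists_isLocalInverse γ hγ hγ0)

theorem fderiv_inr_eq (hγ : ContDiffAt ℝ ∞ γ 0) (hγ0 : ∀ᶠ x in 𝓝 (0 : Euc n), γ (0, x) = x)
    (x : Euc n) : fderiv ℝ γ 0 (0, x) = x := by
  have h1 : HasFDerivAt γ (fderiv ℝ γ 0) (ContinuousLinearMap.inr ℝ (Euc N) (Euc n) 0) := by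
    rw [map_zero]
    exact (hγ.differentiableAt (by simp)).hasFDerivAt
  have h2 := h1.comp (0 : Euc n) (ContinuousLinearMap.inr ℝ (Euc N) (Euc n)).hasFDerivAt
  have h3 : HasFDerivAt (γ ∘ ContinuousLinearMap.inr ℝ (Euc N) (Euc n))
      (ContinuousLinearMap.id ℝ (Euc n)) 0 :=
    (hasFDerivAt_id (0 : Euc n)).congr_of_eventuallyEq hγ0
  simpa using congrArg (fun L => L x) (h2.unique h3)

theorem tendsto_graph {g : Euc N × Euc n → Euc n} (hg : ContinuousAt g 0) (h0 : g 0 = 0) :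
    Tendsto (fun p : Euc N × Euc n => (p.1, g p)) (𝓝 0) (𝓝 0) := by
  have : ContinuousAt (fun p : Euc N × Euc n => (p.1, g p)) 0 := continuousAt_fst.prodMk hg
  rw [ContinuousAt, h0] at this
  exact this

/-- The local inverse is smooth near `0`. Its continuity is known only at `0`, so that smoothness
at nearby points is obtained by comparison with the inverse function given by the inverse function
theorem. -/
theorem eventually_contDiffAt_gammaInv
    (hγ : ∀ᶠ p in 𝓝 (0 : Euc N × Euc n), ContDiffAt ℝ ∞ γ p)
    (hγ0 : ∀ᶠ x in 𝓝 (0 : Euc n), γ (0, x) = x) :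
    ∀ᶠ p in 𝓝 (0 : Euc N × Euc n), ContDiffAt ℝ ∞ (gammaInv γ) p := by
  obtain ⟨hc, h0, hright, hleft⟩ := isLocalInverse_gammaInv hγ hγ0
  set Φ : Euc N × Euc n → Euc N × Euc n := fun p => (p.1, γ p) with hΦ
  set G : Euc N × Euc n → Euc N × Euc n := fun p => (p.1, gammaInv γ p) with hG
  have hΦs : ∀ p, ContDiffAt ℝ ∞ γ p → ContDiffAt ℝ ∞ Φ p := fun p hp => contDiffAt_fst.prodMk hp
  have hGc : Tendsto G (𝓝 0) (𝓝 0) := tendsto_graph hc h0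
  obtain ⟨e, he⟩ : ∃ e : (Euc N × Euc n) ≃L[ℝ] (Euc N × Euc n),
      (e : (Euc N × Euc n) →L[ℝ] (Euc N × Euc n)) = fderiv ℝ Φ 0 := by
    have h1 : fderiv ℝ Φ 0 = (ContinuousLinearMap.fst ℝ _ _).prod (fderiv ℝ γ 0) :=
      (hasFDerivAt_fst.prodMk (hγ.self_of_nhds.differentiableAt (by simp)).hasFDerivAt).fderiv
    have hinj : Function.Injective (fderiv ℝ Φ 0) := by
      rw [injective_iff_map_eq_zero]
      rintro ⟨t, x⟩ h
      rw [h1] at h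
      obtain ⟨h2, h3⟩ := Prod.ext_iff.1 h
      change t = 0 at h2
      subst h2
      change fderiv ℝ γ 0 (0, x) = 0 at h3
      rw [fderiv_inr_eq hγ.self_of_nhds hγ0] at h3
      rw [h3]; rfl
    refine ⟨(LinearEquiv.ofInjectiveEndo (fderiv ℝ Φ 0 : (Euc N × Euc n) →ₗ[ℝ] (Euc N × Euc n))
      hinj).toContinuousLinearEquiv, ?_⟩
    exact ContinuousLinearMap.ext fun p => rfl
  have hinv : ∀ᶠ p in 𝓝 (0 : Euc N × Euc n), ∃ e : (Euc N × Euc n) ≃L[ℝ] (Euc N × Euc n),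
      (e : (Euc N × Euc n) →L[ℝ] (Euc N × Euc n)) = fderiv ℝ Φ p := by
    have h1 : ContinuousAt (fderiv ℝ Φ) 0 :=
      ((hΦs 0 hγ.self_of_nhds).fderiv_right (m := ∞) (by simp)).continuousAt
    have h2 := e.nhds
    rw [he] at h2
    exact h1 h2
  obtain ⟨A, hA, hAo, h0A⟩ := eventually_nhds_iff.1 ((hγ.and hinv).and hleft)
  filter_upwards [hright, hGc (hAo.mem_nhds h0A)] with p hp1 hp2
  obtain ⟨⟨h1, e', he'⟩, h2⟩ := hA _ hp2
  have hGp : Φ (G p) = p := Prod.ext rfl hp1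
  have hd : HasFDerivAt Φ (e' : (Euc N × Euc n) →L[ℝ] (Euc N × Euc n)) (G p) := by
    rw [he']
    exact ((hΦs _ h1).differentiableAt (by simp)).hasFDerivAt
  have hL := (hΦs _ h1).to_localInverse hd (by simp)
  have hst := (hΦs _ h1).hasStrictFDerivAt' hd (by simp)
  set L := (hΦs _ h1).localInverse hd (by simp) with hLdef
  have hLp : L (Φ (G p)) = G p := (hΦs _ h1).localInverse_apply_image hd (by simp)
  have hr : ∀ᶠ q in 𝓝 (Φ (G p)), Φ (L q) = q := hst.eventually_right_inverse
  rw [hGp] at hL hLp hr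
  have hLA : ∀ᶠ q in 𝓝 p, L q ∈ A := by
    have := hL.continuousAt
    exact this (by rw [hLp]; exact hAo.mem_nhds hp2)
  have heq : gammaInv γ =ᶠ[𝓝 p] fun q => (L q).2 := by
    filter_upwards [hr, hLA] with q hq1 hq2
    have h3 := (hA _ hq2).2
    have h4 : ((L q).1, γ (L q)) = q := hq1
    rwa [h4] at h3
  exact hL.snd.congr_of_eventuallyEq heq

theorem fieldW_eq {p : Euc N × Euc n} (h : DifferentiableAt ℝ γ (p.1, gammaInv γ p)) :
    fieldW γ p = fderiv ℝ γ (p.1, gammaInv γ p) (p.1, 0) := by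
  have h1 : HasDerivAt (fun s : ℝ => (s • p.1, gammaInv γ p)) (p.1, (0 : Euc n)) 1 := by
    simpa using ((hasDerivAt_id (1 : ℝ)).smul_const p.1).prodMk
      (hasDerivAt_const (1 : ℝ) (gammaInv γ p))
  have h2 : HasFDerivAt γ (fderiv ℝ γ (p.1, gammaInv γ p)) ((1 : ℝ) • p.1, gammaInv γ p) := by
    rw [one_smul]; exact h.hasFDerivAt
  exact (h2.comp_hasDerivAt (1 : ℝ) h1).deriv

theorem eventually_contDiffAt_fieldW (hγ : ∀ᶠ p in 𝓝 (0 : Euc N × Euc n), ContDiffAt ℝ ∞ γ p)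
    (hγ0 : ∀ᶠ x in 𝓝 (0 : Euc n), γ (0, x) = x) :
    ∀ᶠ p in 𝓝 (0 : Euc N × Euc n), ContDiffAt ℝ ∞ (fieldW γ) p := by
  obtain ⟨hc, h0, -, -⟩ := isLocalInverse_gammaInv hγ hγ0
  have h1 := (tendsto_graph hc h0).eventually hγ
  filter_upwards [eventually_contDiffAt_gammaInv hγ hγ0, h1.eventually_nhds] with p hp1 hp2
  have heq : fieldW γ =ᶠ[𝓝 p] fun p => fderiv ℝ γ (p.1, gammaInv γ p) (p.1, 0) := by
    filter_upwards [hp2] with q hq using fieldW_eq (hq.differentiableAt (by simp))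
  refine ContDiffAt.congr_of_eventuallyEq ?_ heq
  have h2 : ContDiffAt ℝ ∞ (fderiv ℝ γ) (p.1, gammaInv γ p) :=
    hp2.self_of_nhds.fderiv_right (by simp)
  exact (h2.comp p (contDiffAt_fst.prodMk hp1)).clm_apply (contDiffAt_fst.prodMk contDiffAt_const)

/-- `W(t, γ_t(x))` is the radial derivative of `γ`. -/
theorem eventually_fieldW_apply (hγ : ∀ᶠ p in 𝓝 (0 : Euc N × Euc n), ContDiffAt ℝ ∞ γ p)
    (hγ0 : ∀ᶠ x in 𝓝 (0 : Euc n), γ (0, x) = x) :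
    ∀ᶠ p in 𝓝 (0 : Euc N × Euc n), fieldW γ (p.1, γ p) = fderiv ℝ γ p (p.1, 0) := by
  obtain ⟨-, -, -, hleft⟩ := isLocalInverse_gammaInv hγ hγ0
  filter_upwards [hleft, hγ] with p hp1 hp2
  rw [fieldW_eq (by rw [hp1]; exact hp2.differentiableAt (by simp)), hp1]

end FieldW

/-! ### Exponential expansions and the Taylor coefficients of `W` -/

section Relation

variable {N n : ℕ} {γ : Euc N × Euc n → Euc n} {r : ℝ}

theorem taylorField_eq_taylorCoeff {W : Euc N × Euc n → Euc n} (hr : 0 < r)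
    (hW : ContDiffOn ℝ ∞ W (cyl N n r)) (α : Fin N → ℕ) {x : Euc n} (hx : x ∈ Metric.ball 0 r) :
    taylorField W α x = taylorCoeff W α (0, x) := taylorField_eq hr hW α hx

/-- Two asymptotic expansions of the same order have the same coefficients. -/
theorem eq_coeff_apply {M : ℕ} {P : CPoly N (Module.End ℝ (smoothMaps n r))} {f : smoothMaps n r}
    {x : Euc n} {a : (Fin N → ℕ) → Euc n} {C : ℝ}
    (h : ∀ᶠ t in 𝓝 (0 : Euc N),
      ‖∑ α ∈ indexBelow N M, monomialAt t α • a α - (evalAt t P f).1 x‖ ≤ C * ‖t‖ ^ M)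
    {α : Fin N → ℕ} (hα : ∑ i, α i < M) : a α = (P.coeff α f).1 x := by
  classical
  set s := indexBelow N M ∪ P.coeff.support with hs
  set u : (Fin N → ℕ) → Euc n := fun β =>
    (if β ∈ indexBelow N M then a β else 0) - (P.coeff β f).1 x with hu
  have h1 : ∀ t : Euc N, ∑ β ∈ s, monomialAt t β • u β =
      ∑ β ∈ indexBelow N M, monomialAt t β • a β - (evalAt t P f).1 x := by
    intro t
    simp only [hu, smul_sub, Finset.sum_sub_distrib]
    congr 1
    · rw [← Finset.sum_subset (Finset.subset_union_left : indexBelow N M ⊆ s)]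
      · exact Finset.sum_congr rfl fun β hβ => by rw [if_pos hβ]
      · intro β _ hβ; rw [if_neg hβ, smul_zero]
    · rw [evalAt_apply, ← Finset.sum_subset (Finset.subset_union_right : P.coeff.support ⊆ s)]
      intro β _ hβ
      rw [Finsupp.notMem_support_iff.1 hβ]
      exact smul_zero _
  have hm : α ∈ indexBelow N M := mem_indexBelow.2 hα
  have h2 := coeff_eq_zero_of_isBigO (s := s) (u := u) (M := M) (C := C)
    (by simpa only [h1] using h) (Finset.mem_union_left _ hm) hα
  rw [hu] at h2
  simp only [if_pos hm] at h2
  exact sub_eq_zero.1 h2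

/-- The expansion of `f ∘ γ_t` that follows from an exponential expansion of order `M` of `γ`. -/
theorem exists_comp_estimate (X : (Fin N → ℕ) → smoothMaps n r)
    {Y : (Fin N → ℕ) → Euc n → Euc n} {M : ℕ}
    (hY : ∀ α, α ≠ 0 → ∑ i, α i < M → ∀ x ∈ Metric.ball (0 : Euc n) r, Y α x = (X α).1 x)
    {Ω : Set (Euc n)} {x₀ : Euc n} (hx₀ : x₀ ∈ Metric.ball 0 r) (hγc : ContinuousAt γ (0, x₀))
    (hγ0 : γ (0, x₀) = x₀) {C : ℝ}
    (hC : ∀ᶠ p in 𝓝 ((0, x₀) : Euc N × Euc n), ∃ y, IsExp Ω (truncField Y M p.1) p.2 y ∧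
      ‖γ p - y‖ ≤ C * ‖p.1‖ ^ M) (f : smoothMaps n r) :
    ∃ C, ∀ᶠ p in 𝓝 ((0, x₀) : Euc N × Euc n),
      ‖f.1 (γ p) - (evalAt p.1 (truncExp M (fieldPoly X M)) f).1 p.2‖ ≤ C * ‖p.1‖ ^ M := by
  obtain ⟨K, s, hs, hK⟩ := ((smoothMaps_contDiffAt f hx₀).of_le
    (by exact_mod_cast le_top : (1 : WithTop ℕ∞) ≤ ∞)).exists_lipschitzOnWith
  obtain ⟨ε, hε, hεs⟩ := Metric.mem_nhds_iff.1 hs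
  obtain ⟨C', hC'⟩ := exists_exp_estimate X hY f hx₀
  have h1 : ∀ᶠ p in 𝓝 ((0, x₀) : Euc N × Euc n), γ p ∈ s := hγc (by rwa [hγ0])
  refine ⟨K * C + C', ?_⟩
  filter_upwards [hC, hC', h1, eventually_curve_mem_ball X hY hx₀ hε] with p h2 h3 h4 h5
  obtain ⟨y, ⟨c, hc0, rfl, hc⟩, hy⟩ := h2
  have hcd := fun s hs => (hc s hs).2
  have h6 := hK.norm_sub_le h4 (hεs (h5 c hc0 hcd 1 (by simp)))
  have h7 := h3 c hc0 hcd
  have h8 := norm_add_le (f.1 (γ p) - f.1 (c 1))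
    (f.1 (c 1) - (evalAt p.1 (truncExp M (fieldPoly X M)) f).1 p.2)
  rw [sub_add_sub_cancel] at h8
  have h9 : (K : ℝ) * ‖γ p - c 1‖ ≤ K * (C * ‖p.1‖ ^ M) := mul_le_mul_of_nonneg_left hy K.2
  rw [add_mul]
  linarith

/-- The Taylor coefficients of `W` are the coefficients of `(1 - e^{-ad V})/(ad V) (E V)`, where
`V = ∑ t^α X_α` and `E` is the Euler operator. This follows from the two expansions of
`E (f ∘ γ_t) = (W_t f) ∘ γ_t`. -/
theorem exists_lieDer_eq_truncDexp (hγ : ∀ᶠ p in 𝓝 (0 : Euc N × Euc n), ContDiffAt ℝ ∞ γ p)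
    (hγ0 : ∀ᶠ x in 𝓝 (0 : Euc n), γ (0, x) = x) {Y : (Fin N → ℕ) → Euc n → Euc n}
    (hY : IsExpExpansion γ Y) (M : ℕ) :
    ∃ r > 0, ∃ X W : (Fin N → ℕ) → smoothMaps n r,
      (∀ α, α ≠ 0 → ∑ i, α i < M + 1 → Y α =ᶠ[𝓝 0] (X α).1) ∧
      (∀ α, taylorField (fieldW γ) α =ᶠ[𝓝 0] (W α).1) ∧
      ∀ α, ∑ i, α i < M + 1 → lieDer (W α) =
        (truncDexp (M + 1) (fieldPoly X (M + 1)) (euler (fieldPoly X (M + 1)))).coeff α := by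
  obtain ⟨Ω, hΩ, h0Ω, hYs, C, hC⟩ := hY (M + 1)
  have hWs := eventually_contDiffAt_fieldW hγ hγ0
  obtain ⟨r, ⟨⟨h1, h2⟩, h3⟩, hr⟩ := ((((eventually_cyl (((hγ.and hWs).and
    (eventually_fieldW_apply hγ hγ0)).and hC).eventually_nhds).and (eventually_ball hγ0)).and
    (eventually_ball (hΩ.mem_nhds h0Ω))).and self_mem_nhdsWithin).exists
  have hr : 0 < r := hr
  have hcyl : ∀ x ∈ Metric.ball (0 : Euc n) r, ((0, x) : Euc N × Euc n) ∈ cyl N n r :=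
    fun x hx => ⟨Metric.mem_ball_self hr, hx⟩
  have hball : Metric.ball (0 : Euc n) r ⊆ Ω := fun x hx => h3 x hx
  have hWcyl : ContDiffOn ℝ ∞ (fieldW γ) (cyl N n r) := fun p hp =>
    (h1 p hp).self_of_nhds.1.1.2.contDiffWithinAt
  have hex : ∀ α, ∃ X : smoothMaps n r, α ≠ 0 → ∑ i, α i < M + 1 →
      ∀ x ∈ Metric.ball (0 : Euc n) r, Y α x = X.1 x := by
    intro α
    by_cases h : α ≠ 0 ∧ ∑ i, α i < M + 1
    · exact ⟨restrictBall (Y α) ((hYs α (sum_index_pos.2 h.1) h.2).mono hball), fun _ _ x hx =>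
        (restrictBall_apply _ hx).symm⟩
    · exact ⟨0, fun h1 h2 => absurd ⟨h1, h2⟩ h⟩
  choose X hX using hex
  set W : (Fin N → ℕ) → smoothMaps n r := fun α =>
    restrictBall (taylorField (fieldW γ) α) (contDiffOn_taylorField hr hWcyl α) with hW
  have hWeq : ∀ α, ∀ x ∈ Metric.ball (0 : Euc n) r, (W α).1 x = taylorCoeff (fieldW γ) α (0, x) :=
    fun α x hx => by rw [hW, restrictBall_apply _ hx, taylorField_eq_taylorCoeff hr hWcyl α hx]
  refine ⟨r, hr, X, W, fun α h h' => ?_, fun α => ?_, ?_⟩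
  · filter_upwards [Metric.ball_mem_nhds (0 : Euc n) hr] with x hx using hX α h h' x hx
  · filter_upwards [Metric.ball_mem_nhds (0 : Euc n) hr] with x hx
    exact (restrictBall_apply _ hx).symm
  set V := fieldPoly X (M + 1) with hV
  set A := truncExp (M + 1) V with hA
  set Wp : CPoly N (Module.End ℝ (smoothMaps n r)) :=
    ∑ α ∈ indexBelow N (M + 1), AddMonoidAlgebra.single α (lieDer (W α)) with hWp
  have hWpc : ∀ α, ∑ i, α i < M + 1 → Wp.coeff α = lieDer (W α) := by
    intro α hα
    rw [hWp, AddMonoidAlgebra.coeff_sum, Finsupp.finsetSum_apply]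
    simp only [AddMonoidAlgebra.coeff_single, Finsupp.single_apply]
    rw [Finset.sum_ite_eq', if_pos (mem_indexBelow.2 hα)]
  have key : VanishBelow (M + 1) (euler A - A * Wp) := by
    intro α hα
    refine LinearMap.ext fun f => smoothMaps_ext fun x₀ hx₀ => ?_
    have hloc := h1 _ (hcyl x₀ hx₀)
    have hγx : γ (0, x₀) = x₀ := h2 x₀ hx₀
    have hγc : ContinuousAt γ (0, x₀) := hloc.self_of_nhds.1.1.1.continuousAt
    have hcomp := fun f => exists_comp_estimate X hX hx₀ hγc hγx (hloc.mono fun _ h => h.2) f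
    set F : Euc N × Euc n → Euc n := fun p => f.1 (γ p) with hF
    have hγb : ∀ᶠ p in 𝓝 ((0, x₀) : Euc N × Euc n), γ p ∈ Metric.ball (0 : Euc n) r :=
      hγc (by rw [hγx]; exact Metric.isOpen_ball.mem_nhds hx₀)
    have hFs : ∀ᶠ p in 𝓝 ((0, x₀) : Euc N × Euc n), ContDiffAt ℝ ∞ F p := by
      filter_upwards [hγb, hloc] with p hp hp'
      exact (smoothMaps_contDiffAt f hp).comp p hp'.1.1.1
    obtain ⟨C₁, hC₁⟩ := exists_taylor_estimate hFs M
    obtain ⟨C₂, hC₂⟩ := hcomp f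
    have hslice : Tendsto (fun t : Euc N => (t, x₀)) (𝓝 0) (𝓝 (0, x₀)) :=
      (Continuous.prodMk_left x₀).tendsto 0
    -- the Taylor coefficients of `f ∘ γ`
    have hcoef : ∀ α, ∑ i, α i < M + 1 → taylorCoeff F α (0, x₀) = (A.coeff α f).1 x₀ := by
      intro α hα
      refine eq_coeff_apply (M := M + 1) (C := C₁ + C₂) (a := fun α => taylorCoeff F α (0, x₀)) ?_
        hα
      filter_upwards [hslice.eventually hC₁, hslice.eventually hC₂] with t ht1 ht2
      have h4 := norm_sub_le (F (t, x₀) - (evalAt t A f).1 x₀) (F (t, x₀) -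
        ∑ α ∈ indexBelow N (M + 1), monomialAt t α • taylorCoeff F α (0, x₀))
      rw [sub_sub_sub_cancel_left] at h4
      have h5 := ht1.1
      rw [add_mul]
      refine h4.trans ?_
      rw [add_comm]
      exact add_le_add h5 ht2
    -- the Taylor coefficients of the radial derivative of `f ∘ γ`
    have hcoef' : (∑ i, α i) • taylorCoeff F α (0, x₀) = ((A * Wp).coeff α f).1 x₀ := by
      have hWloc : ∀ᶠ p in 𝓝 ((0, x₀) : Euc N × Euc n), ContDiffAt ℝ ∞ (fieldW γ) p :=
        hloc.mono fun p hp => hp.1.1.2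
      obtain ⟨C₃, hC₃⟩ := exists_taylor_estimate hWloc M
      have hgr : Tendsto (fun p : Euc N × Euc n => (p.1, γ p)) (𝓝 (0, x₀)) (𝓝 (0, x₀)) := by
        have : ContinuousAt (fun p : Euc N × Euc n => (p.1, γ p)) (0, x₀) :=
          continuousAt_fst.prodMk hγc
        rw [ContinuousAt, hγx] at this
        exact this
      choose C₄ hC₄ using fun α => hcomp (lieDer (W α) f)
      have hC₄' : ∀ᶠ p in 𝓝 ((0, x₀) : Euc N × Euc n), ∀ α ∈ indexBelow N (M + 1),
          ‖(lieDer (W α) f).1 (γ p) - (evalAt p.1 A (lieDer (W α) f)).1 p.2‖ ≤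
            C₄ α * ‖p.1‖ ^ (M + 1) :=
        (Filter.eventually_all_finset _).2 fun α _ => hC₄ α
      have hfd : ∀ᶠ p in 𝓝 ((0, x₀) : Euc N × Euc n),
          ‖fderiv ℝ f.1 (γ p)‖ ≤ ‖fderiv ℝ f.1 x₀‖ + 1 := by
        have h4 : ContinuousAt (fderiv ℝ f.1) (γ (0, x₀)) := by
          rw [hγx]
          exact ((smoothMaps_contDiffAt f hx₀).fderiv_right (m := ∞) (by simp)).continuousAt
        have h5 : ContinuousAt (fun p => ‖fderiv ℝ f.1 (γ p)‖) (0, x₀) := (h4.comp hγc).norm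
        exact h5.eventually_le_const (by simp only [hγx]; exact lt_add_one _)
      have hsmall : ∀ᶠ p in 𝓝 ((0, x₀) : Euc N × Euc n), ‖p.1‖ ≤ 1 := by
        have : ContinuousAt (fun p : Euc N × Euc n => ‖p.1‖) (0, x₀) := by fun_prop
        exact this.eventually_le_const (by simp)
      refine eq_coeff_apply (M := M + 1) (P := A * Wp)
        (C := C₁ + ((‖fderiv ℝ f.1 x₀‖ + 1) * C₃ + ∑ α ∈ indexBelow N (M + 1), C₄ α))
        (a := fun α => (∑ i, α i) • taylorCoeff F α (0, x₀)) ?_ hα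
      filter_upwards [hslice.eventually hC₁, hslice.eventually hC₄', hslice.eventually hfd,
        hslice.eventually hγb, hslice.eventually hloc, hslice.eventually (hgr.eventually hC₃),
        hslice.eventually hsmall] with t ht1 ht2 ht3 ht4 ht5 ht6 ht7
      set y := γ (t, x₀) with hy
      set T := ∑ α ∈ indexBelow N (M + 1), monomialAt t α • taylorCoeff (fieldW γ) α (0, y) with hT
      have e1 : fderiv ℝ F (t, x₀) (t, 0) = fderiv ℝ f.1 y (fieldW γ (t, y)) := by
        have h4 := (smoothMaps_hasFDerivAt f ht4).comp (t, x₀)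
          (ht5.1.1.1.differentiableAt (by simp)).hasFDerivAt
        rw [show F = f.1 ∘ γ from rfl, h4.fderiv, ContinuousLinearMap.comp_apply, ← ht5.1.2]
      have e2 : fderiv ℝ f.1 y T =
          ∑ α ∈ indexBelow N (M + 1), monomialAt t α • (lieDer (W α) f).1 y := by
        rw [hT, map_sum]
        refine Finset.sum_congr rfl fun α _ => ?_
        rw [map_smul, lieDer_apply _ _ ht4, hWeq α y ht4]
      have e3 : (evalAt t (A * Wp) f).1 x₀ = ∑ α ∈ indexBelow N (M + 1),
          monomialAt t α • (evalAt t A (lieDer (W α) f)).1 x₀ := by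
        rw [map_mul, Module.End.mul_apply, hWp, map_sum, LinearMap.sum_apply, map_sum,
          Submodule.coe_sum, Finset.sum_apply]
        refine Finset.sum_congr rfl fun α _ => ?_
        rw [evalAt_single, LinearMap.smul_apply, map_smul]
        rfl
      have b1 : ‖∑ α ∈ indexBelow N (M + 1), monomialAt t α • (∑ i, α i) • taylorCoeff F α (0, x₀) -
          fderiv ℝ F (t, x₀) (t, 0)‖ ≤ C₁ * ‖t‖ ^ (M + 1) := by
        rw [norm_sub_rev]
        simpa only [smul_comm (monomialAt t _) (∑ i, _)] using ht1.2
      have b2 : ‖fderiv ℝ F (t, x₀) (t, 0) - fderiv ℝ f.1 y T‖ ≤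
          (‖fderiv ℝ f.1 x₀‖ + 1) * C₃ * ‖t‖ ^ (M + 1) := by
        rw [e1, ← map_sub, mul_assoc]
        exact ((fderiv ℝ f.1 y).le_opNorm _).trans
          (mul_le_mul ht3 ht6.1 (norm_nonneg _) (by positivity))
      have b3 : ‖fderiv ℝ f.1 y T - (evalAt t (A * Wp) f).1 x₀‖ ≤
          (∑ α ∈ indexBelow N (M + 1), C₄ α) * ‖t‖ ^ (M + 1) := by
        rw [e2, e3, ← Finset.sum_sub_distrib, Finset.sum_mul]
        refine (norm_sum_le _ _).trans (Finset.sum_le_sum fun α hα => ?_)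
        rw [← smul_sub, norm_smul]
        have h4 : ‖monomialAt t α‖ ≤ 1 :=
          (abs_monomialAt_le t α).trans (pow_le_one₀ (norm_nonneg t) ht7)
        exact (mul_le_of_le_one_left (norm_nonneg _) h4).trans (ht2 α hα)
      have h4 := norm_sub_le_norm_sub_add_norm_sub
        (∑ α ∈ indexBelow N (M + 1), monomialAt t α • (∑ i, α i) • taylorCoeff F α (0, x₀))
        (fderiv ℝ F (t, x₀) (t, 0)) ((evalAt t (A * Wp) f).1 x₀)
      have h5 := norm_sub_le_norm_sub_add_norm_sub (fderiv ℝ F (t, x₀) (t, 0))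
        (fderiv ℝ f.1 y T) ((evalAt t (A * Wp) f).1 x₀)
      rw [add_mul, add_mul]
      linarith
    rw [hcoef α hα] at hcoef'
    change (∑ i, α i) • (A.coeff α f).1 x₀ - ((A * Wp).coeff α f).1 x₀ = 0
    rw [hcoef', sub_self]
  have hV1 : VanishBelow 1 V := vanishBelow_fieldPoly X (M + 1)
  have hfin : VanishBelow (M + 1) (Wp - truncDexp (M + 1) V (euler V)) := by
    refine VanishBelow.of_mul_left (vanishBelow_truncExp_sub_one hV1 (Nat.succ_pos M))
      (P := A) ?_
    have h4 : A * (Wp - truncDexp (M + 1) V (euler V)) =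
        (euler A - A * truncDexp (M + 1) V (euler V)) - (euler A - A * Wp) := by noncomm_ring
    rw [h4]
    exact (vanishBelow_euler_truncExp hV1 (M + 1)).sub key
  intro α hα
  rw [← hWpc α hα]
  exact hfin.coeff_eq hα

/-- The Taylor coefficients of `W` lie in the graded Lie algebra generated by the fields of an
exponential expansion. -/
theorem lieSpan_taylorField (hγ : ∀ᶠ p in 𝓝 (0 : Euc N × Euc n), ContDiffAt ℝ ∞ γ p)
    (hγ0 : ∀ᶠ x in 𝓝 (0 : Euc n), γ (0, x) = x) {Y : (Fin N → ℕ) → Euc n → Euc n}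
    (hY : IsExpExpansion γ Y) {α : Fin N → ℕ} (hα : α ≠ 0) :
    LieSpan (multiIndexed Y) (taylorField (fieldW γ) α) α := by
  obtain ⟨r, hr, X, W, hX, hW, h⟩ := exists_lieDer_eq_truncDexp hγ hγ0 hY (∑ i, α i)
  set V := fieldPoly X (∑ i, α i + 1) with hV
  have hVm : ∀ β, ∑ i, β i < ∑ i, α i + 1 → V.coeff β ∈ lieOperators (multiIndexed Y) r β := by
    intro β hβ
    rw [hV, coeff_fieldPoly]
    split_ifs with h1
    · exact ⟨X β, rfl, fun h2 => .congr _ _ _ (hX β h2 hβ) (.of _ _ ⟨β, h2, rfl⟩)⟩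
    · exact Submodule.zero_mem _
  have h1 := truncDexp_sub_coeff_mem hr (vanishBelow_fieldPoly X _) hVm (∑ i, α i) (α := α)
    (by omega)
  have h2 : (euler V).coeff α ∈ lieOperators (multiIndexed Y) r α := by
    rw [coeff_euler, ← Nat.cast_smul_eq_nsmul ℝ]
    exact Submodule.smul_mem _ _ (hVm α (Nat.lt_succ_self _))
  obtain ⟨Z, hZ, hZ'⟩ := Submodule.add_mem _ h1 h2
  have h3 : lieDer (W α) = lieDer Z := by
    rw [h α (Nat.lt_succ_self _), ← hZ]
    exact (sub_add_cancel _ _).symm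
  rw [← lieDer_injective h3] at hZ'
  exact .congr _ _ _ (hW α).symm (hZ' hα)

/-- The fields of an exponential expansion lie in the graded Lie algebra generated by the Taylor
coefficients of `W`: the coefficient of `W` at `α` is `|α| X_α` up to commutators of fields `X_β`
with `|β| < |α|`. -/
theorem lieSpan_of_isExpExpansion (hγ : ∀ᶠ p in 𝓝 (0 : Euc N × Euc n), ContDiffAt ℝ ∞ γ p)
    (hγ0 : ∀ᶠ x in 𝓝 (0 : Euc n), γ (0, x) = x) {Y : (Fin N → ℕ) → Euc n → Euc n}
    (hY : IsExpExpansion γ Y) {α : Fin N → ℕ} (hα : α ≠ 0) :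
    LieSpan (multiIndexed (taylorField (fieldW γ))) (Y α) α := by
  induction hm : ∑ i, α i using Nat.strong_induction_on generalizing α with
  | _ m ih =>
    set S := multiIndexed (taylorField (fieldW γ)) with hS
    obtain ⟨r, hr, X, W, hX, hW, h⟩ := exists_lieDer_eq_truncDexp hγ hγ0 hY m
    set V := fieldPoly X (m + 1) with hV
    have hVm : ∀ β, ∑ i, β i < m → V.coeff β ∈ lieOperators S r β := by
      intro β hβ
      rw [hV, coeff_fieldPoly]
      split_ifs with h1
      · exact ⟨X β, rfl, fun h2 => .congr _ _ _ (hX β h2 (by omega)) (ih _ hβ h2 rfl)⟩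
      · exact Submodule.zero_mem _
    have h1 := truncDexp_sub_coeff_mem hr (vanishBelow_fieldPoly X _) hVm m (α := α) (by omega)
    have h2 : lieDer (W α) ∈ lieOperators S r α :=
      ⟨W α, rfl, fun _ => .congr _ _ _ (hW α) (.of _ _ ⟨α, hα, rfl⟩)⟩
    rw [h α (by omega)] at h2
    have h3 : (euler V).coeff α ∈ lieOperators S r α := by
      have h4 := sub_mem_lieOperators h2 h1
      have h5 : (truncDexp (m + 1) V (euler V)).coeff α -
          (truncDexp (m + 1) V (euler V) - euler V).coeff α = (euler V).coeff α :=
        sub_sub_cancel _ _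
      rwa [h5] at h4
    have h4 : V.coeff α = lieDer (X α) := by rw [hV, coeff_fieldPoly, if_pos ⟨by omega, hα⟩]
    rw [coeff_euler, hm, h4, ← Nat.cast_smul_eq_nsmul ℝ] at h3
    have hm0 : (m : ℝ) ≠ 0 := by
      have := sum_index_pos.2 hα
      exact_mod_cast (by omega : m ≠ 0)
    obtain ⟨Z, hZ, hZ'⟩ := Submodule.smul_mem (lieOperators S r α) (m : ℝ)⁻¹ h3
    rw [smul_smul, inv_mul_cancel₀ hm0, one_smul] at hZ
    rw [← lieDer_injective hZ] at hZ'
    exact .congr _ _ _ (hX α hα (by omega)).symm (hZ' hα)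

end Relation

/-! ### Existence of exponential expansions -/

section Existence

variable {N n : ℕ} {r : ℝ}

/-- The fields `X_α` with `(e^V)_α id = g_α`, where `V = ∑ t^α X_α`: since `(e^V)_α` equals `X_α` up
to products of `X_β` with `|β| < |α|`, the equations can be solved recursively. -/
noncomputable def logFields (g : (Fin N → ℕ) → smoothMaps n r) (α : Fin N → ℕ) : smoothMaps n r :=
  g α - (truncExp (∑ i, α i + 1) (fieldPoly (fun β =>
    if ∑ i, β i < ∑ i, α i then logFields g β else 0) (∑ i, α i))).coeff α (idMap n r)
termination_by ∑ i, α i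

theorem fieldPoly_congr {X Y : (Fin N → ℕ) → smoothMaps n r} {M : ℕ}
    (h : ∀ α, ∑ i, α i < M → X α = Y α) : fieldPoly X M = fieldPoly Y M :=
  Finset.sum_congr rfl fun α hα => by rw [h α (mem_indexBelow.1 (Finset.mem_filter.1 hα).1)]

theorem logFields_eq (g : (Fin N → ℕ) → smoothMaps n r) (α : Fin N → ℕ) :
    logFields g α = g α -
      (truncExp (∑ i, α i + 1) (fieldPoly (logFields g) (∑ i, α i))).coeff α (idMap n r) := by
  rw [logFields, fieldPoly_congr (Y := logFields g) fun β hβ => if_pos hβ]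

theorem vanishBelow_truncExp_sub {R : Type*} [Ring R] [Algebra ℝ R] {V : CPoly N R}
    (hV : VanishBelow 1 V) {m M : ℕ} (h : m ≤ M) :
    VanishBelow m (truncExp M V - truncExp m V) := by
  rw [truncExp, truncExp, ← Finset.sum_range_add_sum_Ico _ h, add_sub_cancel_left]
  exact VanishBelow.sum fun k hk => ((hV.pow k).smul _).mono (Finset.mem_Ico.1 hk).1

/-- The top degree coefficient of `e^V` depends linearly on the top degree coefficient of `V`. -/
theorem vanishBelow_truncExp_sub_truncExp {R : Type*} [Ring R] [Algebra ℝ R] {V V' : CPoly N R}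
    (hV : VanishBelow 1 V) (hV' : VanishBelow 1 V') {m : ℕ} (hm : 0 < m)
    (h : VanishBelow m (V - V')) :
    VanishBelow (m + 1) (truncExp (m + 1) V + V' - (truncExp (m + 1) V' + V)) := by
  obtain ⟨m, rfl⟩ := Nat.exists_eq_add_of_lt hm
  have h1 : truncExp (0 + m + 1 + 1) V + V' - (truncExp (0 + m + 1 + 1) V' + V) =
      ∑ k ∈ Finset.range m, (((k + 1 + 1).factorial : ℝ)⁻¹) •
        (V ^ (k + 1 + 1) - V' ^ (k + 1 + 1)) := by
    rw [truncExp, truncExp, zero_add, Finset.sum_range_succ', Finset.sum_range_succ',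
      Finset.sum_range_succ', Finset.sum_range_succ']
    simp only [zero_add, Nat.factorial_one, Nat.factorial_zero, Nat.cast_one, inv_one, pow_one,
      pow_zero, one_smul, smul_sub, Finset.sum_sub_distrib]
    abel
  rw [h1]
  exact VanishBelow.sum fun k _ => ((VanishBelow.pow_sub_pow hV hV' h).smul _).mono (by omega)

/-- The recursion that defines `logFields` is solved in every order of truncation. -/
theorem coeff_truncExp_logFields (g : (Fin N → ℕ) → smoothMaps n r) {α : Fin N → ℕ} (hα : α ≠ 0)
    {M : ℕ} (hM : ∑ i, α i < M) :
    (truncExp M (fieldPoly (logFields g) M)).coeff α (idMap n r) = g α := by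
  set X := logFields g with hX
  set m := ∑ i, α i with hm
  have hm0 : 0 < m := sum_index_pos.2 hα
  have h1 := (vanishBelow_truncExp_sub (vanishBelow_fieldPoly X M) (Nat.succ_le_of_lt hM)).coeff_eq
    (α := α) (Nat.lt_succ_self _)
  have hsub : VanishBelow m (fieldPoly X M - fieldPoly X m) := by
    refine VanishBelow.of_coeff_eq fun β hβ => ?_
    rw [coeff_fieldPoly, coeff_fieldPoly]
    simp only [hβ, hβ.trans hM]
  have h2 := (vanishBelow_truncExp_sub_truncExp (vanishBelow_fieldPoly X M)
    (vanishBelow_fieldPoly X m) hm0 hsub).coeff_eq (α := α) (Nat.lt_succ_self _)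
  have h3 : (fieldPoly X M).coeff α = lieDer (X α) := by rw [coeff_fieldPoly, if_pos ⟨hM, hα⟩]
  have h4 : (fieldPoly X m).coeff α = 0 := by rw [coeff_fieldPoly, if_neg (by simp [hm])]
  have h5 : (truncExp (m + 1) (fieldPoly X M)).coeff α (idMap n r) +
      (fieldPoly X m).coeff α (idMap n r) = (truncExp (m + 1) (fieldPoly X m)).coeff α (idMap n r) +
        (fieldPoly X M).coeff α (idMap n r) := congrArg (fun T => T (idMap n r)) h2
  rw [h3, h4, lieDer_idMap, LinearMap.zero_apply, add_zero] at h5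
  rw [h1, h5, hX, logFields_eq g α]
  exact add_sub_cancel _ _

/-- The fields `logFields` of the Taylor coefficients of `γ` form an exponential expansion: the flow
of their truncated sum, which exists up to time one for small `t`, has the same Taylor polynomial
as `γ`. -/
theorem exists_isExpExpansion {γ : Euc N × Euc n → Euc n}
    (hγ : ∀ᶠ p in 𝓝 (0 : Euc N × Euc n), ContDiffAt ℝ ∞ γ p)
    (hγ0 : ∀ᶠ x in 𝓝 (0 : Euc n), γ (0, x) = x) : ∃ X, IsExpExpansion γ X := by
  obtain ⟨r, ⟨h1, h2⟩, hr⟩ := (((eventually_cyl hγ).and (eventually_ball hγ0)).and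
    self_mem_nhdsWithin).exists
  have hr : 0 < r := hr
  have h0 : (0 : Euc n) ∈ Metric.ball 0 r := Metric.mem_ball_self hr
  have hcyl : ContDiffOn ℝ ∞ γ (cyl N n r) := fun p hp => (h1 p hp).contDiffWithinAt
  have hg : ∀ α, ContDiffOn ℝ ∞ (fun x => taylorCoeff γ α (0, x)) (Metric.ball 0 r) := fun α =>
    (contDiffOn_taylorCoeff isOpen_cyl hcyl α).comp (contDiff_prodMk_right 0).contDiffOn
      fun x hx => ⟨Metric.mem_ball_self hr, hx⟩
  set X := logFields fun α => restrictBall _ (hg α) with hX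
  refine ⟨fun α => (X α).1, fun M => ⟨Metric.ball 0 r, Metric.isOpen_ball, h0,
    fun α _ _ => (X α).2.1, ?_⟩⟩
  -- for `M = 0` the truncated field vanishes and the estimate is mere boundedness
  rcases M with _ | M
  · have hb : ∀ᶠ p in 𝓝 (0 : Euc N × Euc n), ‖γ p - p.2‖ ≤ ‖γ 0‖ + 1 := by
      have h3 : ContinuousAt (fun p : Euc N × Euc n => ‖γ p - p.2‖) 0 :=
        (hγ.self_of_nhds.continuousAt.sub continuousAt_snd).norm
      exact h3.eventually_le_const (by simp)
    have hb' : ∀ᶠ p in 𝓝 (0 : Euc N × Euc n), p.2 ∈ Metric.ball (0 : Euc n) r :=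
      continuousAt_snd (Metric.isOpen_ball.mem_nhds h0)
    refine ⟨‖γ 0‖ + 1, ?_⟩
    filter_upwards [hb, hb'] with p hp hp'
    refine ⟨p.2, ⟨fun _ => p.2, rfl, rfl, fun s _ => ⟨hp', ?_⟩⟩, by simpa using hp⟩
    simpa [truncField] using hasDerivWithinAt_const s (Icc (0 : ℝ) 1) p.2
  set V := fieldPoly X (M + 1) with hV
  set A := truncExp (M + 1) V with hA
  have hcoef : ∀ α, ∑ i, α i < M + 1 → ∀ x ∈ Metric.ball (0 : Euc n) r,
      (A.coeff α (idMap n r)).1 x = taylorCoeff γ α (0, x) := by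
    intro α hα x hx
    by_cases h : α = 0
    · subst h
      have h3 := (vanishBelow_truncExp_sub_one (vanishBelow_fieldPoly X (M + 1))
        (Nat.succ_pos M)).coeff_eq (α := 0) (by simp)
      rw [AddMonoidAlgebra.coeff_one_zero] at h3
      rw [hA, hV, h3, taylorCoeff_zero, h2 x hx]
      exact idMap_apply hx
    · rw [hA, hV, hX, coeff_truncExp_logFields _ h hα, restrictBall_apply _ hx]
  -- the terms of degree greater than `M` of the exponential
  set P : CPoly N (Module.End ℝ (smoothMaps n r)) :=
    A - ∑ α ∈ indexBelow N (M + 1), AddMonoidAlgebra.single α (A.coeff α) with hP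
  have hPv : VanishBelow (M + 1) P := by
    refine VanishBelow.of_coeff_eq fun α hα => ?_
    rw [AddMonoidAlgebra.coeff_sum, Finsupp.finsetSum_apply]
    simp only [AddMonoidAlgebra.coeff_single, Finsupp.single_apply]
    rw [Finset.sum_ite_eq', if_pos (mem_indexBelow.2 hα)]
  have hPe : ∀ t : Euc N, ∀ x ∈ Metric.ball (0 : Euc n) r, (evalAt t A (idMap n r)).1 x =
      (evalAt t P (idMap n r)).1 x +
        ∑ α ∈ indexBelow N (M + 1), monomialAt t α • taylorCoeff γ α (0, x) := by
    intro t x hx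
    have h3 : evalAt t A = evalAt t P +
        ∑ α ∈ indexBelow N (M + 1), monomialAt t α • A.coeff α := by
      rw [hP, map_sub, map_sum]
      simp only [evalAt_single, sub_add_cancel]
    rw [h3, LinearMap.add_apply, LinearMap.sum_apply]
    change (evalAt t P (idMap n r)).1 x + _ = _
    rw [Submodule.coe_sum, Finset.sum_apply]
    congr 1
    refine Finset.sum_congr rfl fun α hα => ?_
    rw [← hcoef α (mem_indexBelow.1 hα) x hx]
    rfl
  obtain ⟨C₁, -, hC₁⟩ := exists_evalAt_le hPv (idMap n r) h0
  obtain ⟨C₂, hC₂⟩ := exists_taylor_estimate (x₀ := 0) hγ M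
  obtain ⟨C₃, hC₃⟩ := exists_exp_estimate X (Y := fun α => (X α).1) (M := M + 1)
    (fun _ _ _ _ _ => rfl) (idMap n r) h0
  -- a ball on which the exponentials exist
  obtain ⟨C₄, hC₄0, hC₄⟩ := exists_evalAt_le (vanishBelow_fieldPoly X (M + 1)) (idMap n r) h0
  obtain ⟨ρ, hρ, hρr, hC₄'⟩ := exists_ball_of_eventually hC₄ (half_pos hr)
  have hρsub : Metric.closedBall (0 : Euc n) ρ ⊆ Metric.ball 0 r :=
    Metric.closedBall_subset_ball (by linarith)
  have hsmall : ∀ᶠ p in 𝓝 (0 : Euc N × Euc n), ‖p.1‖ ≤ 1 ∧ C₄ * ‖p.1‖ ≤ ρ / 4 := by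
    have h3 : ContinuousAt (fun p : Euc N × Euc n => ‖p.1‖) 0 := by fun_prop
    have h4 : ContinuousAt (fun p : Euc N × Euc n => C₄ * ‖p.1‖) 0 := by fun_prop
    exact (h3.eventually_le_const (by simp)).and (h4.eventually_le_const (by simpa using hρ))
  have hx : ∀ᶠ p in 𝓝 (0 : Euc N × Euc n), p.2 ∈ Metric.ball (0 : Euc n) (ρ / 2) :=
    continuousAt_snd (Metric.ball_mem_nhds _ (half_pos hρ))
  have hx' : ∀ᶠ p in 𝓝 (0 : Euc N × Euc n), ∀ t : Euc N, ‖t‖ ≤ 1 →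
      ‖(evalAt t P (idMap n r)).1 p.2‖ ≤ C₁ * ‖t‖ ^ (M + 1) :=
    (continuousAt_snd (p := (0 : Euc N × Euc n))).eventually hC₁
  refine ⟨C₂ + C₁ + C₃, ?_⟩
  filter_upwards [hsmall, hx, hx', hC₂, hC₃] with p hp1 hp2 hp3 hp4 hp5
  set v : smoothMaps n r :=
    ∑ α ∈ (indexBelow N (M + 1)).filter (fun α => α ≠ 0), monomialAt p.1 α • X α with hv
  have hvt : truncField (fun α => (X α).1) (M + 1) p.1 = v.1 :=
    funext fun x => truncField_eq (fun _ _ _ => rfl) p.1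
  have hfd : ContinuousOn (fderiv ℝ v.1) (Metric.closedBall 0 ρ) :=
    ((v.2.1.fderiv_of_isOpen (m := ∞) Metric.isOpen_ball (by simp)).continuousOn).mono hρsub
  obtain ⟨K, hK⟩ := (isCompact_closedBall (0 : Euc n) ρ).exists_bound_of_continuousOn hfd
  have hsub := Metric.ball_subset_closedBall (x := (0 : Euc n)) (ε := ρ)
  obtain ⟨c, hc0, hc⟩ := exists_integralCurve (f := v.1) (r := ρ) (K := K) (x := p.2)
    (fun x hx => (smoothMaps_hasFDerivAt v
      (hρsub (hsub hx))).differentiableAt.differentiableWithinAt)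
    (fun x hx => hK x (hsub hx)) (fun x hx => by
      have h3 := hC₄' x hx p.1 hp1.1
      rw [evalAt_fieldPoly, lieDer_idMap, pow_one] at h3
      exact h3.trans hp1.2) hp2
  have hcr : ∀ s ∈ Icc (0 : ℝ) 1, c s ∈ Metric.ball (0 : Euc n) r := fun s hs =>
    hρsub (hsub (hc s hs).1)
  refine ⟨c 1, ⟨c, hc0, rfl, fun s hs => ⟨hcr s hs, by rw [hvt]; exact (hc s hs).2⟩⟩, ?_⟩
  have h3 := hp5 c hc0 fun s hs => by rw [hvt]; exact (hc s hs).2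
  have hpr : p.2 ∈ Metric.ball (0 : Euc n) r :=
    Metric.ball_subset_ball (by linarith) hp2
  rw [idMap_apply (hcr 1 (by simp)), hPe p.1 p.2 hpr] at h3
  have h4 := hp3 p.1 hp1.1
  have h5 := hp4.1
  set T := ∑ α ∈ indexBelow N (M + 1), monomialAt p.1 α • taylorCoeff γ α (0, p.2) with hT
  set Q := (evalAt p.1 P (idMap n r)).1 p.2 with hQ
  have h6 : γ p - c 1 = (γ p - T) - Q - (c 1 - (Q + T)) := by abel
  rw [h6, add_mul, add_mul]
  have h7 := norm_sub_le (γ p - T - Q) (c 1 - (Q + T))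
  have h8 := norm_sub_le (γ p - T) Q
  linarith

end Existence

theorem theorem8p7 (ν N n : ℕ) (e : Fin N → Fin ν → ℕ) (he : ∀ j, e j ≠ 0)
    (γ : Euc N × Euc n → Euc n)
    (hγ : ∀ᶠ p in 𝓝 (0 : Euc N × Euc n), ContDiffAt ℝ ∞ γ p)
    (hγ0 : ∀ᶠ x in 𝓝 (0 : Euc n), γ (0, x) = x) :
    (∃ X : (Fin N → ℕ) → Euc n → Euc n, IsExpExpansion γ X) ∧
    ∀ X : (Fin N → ℕ) → Euc n → Euc n, IsExpExpansion γ X →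
      List.TFAE [ConditionI e γ, ConditionII e γ, ConditionIII e γ X] := by
  refine ⟨exists_isExpExpansion hγ hγ0, fun X hX => ?_⟩
  have hW := eventually_contDiffAt_fieldW hγ hγ0
  have h12 : ConditionI e γ ↔ ConditionII e γ :=
    generatesControl_purePowers_iff he hW (fun α hα => .of _ _ ⟨α, hα, rfl⟩)
      fun α hα => .of _ _ ⟨α, hα, rfl⟩
  have h13 : ConditionI e γ ↔ ConditionIII e γ X :=
    generatesControl_purePowers_iff he hW (fun α hα => lieSpan_of_isExpExpansion hγ hγ0 hX hα)
      fun α hα => lieSpan_taylorField hγ hγ0 hX hα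
  tfae_have 1 ↔ 2 := h12
  tfae_have 1 ↔ 3 := h13
  tfae_finish
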